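/- Let $R$ be a positive division rig: a commutative semiring in which every non-zero element has a multiplicative inverse, and in which $x+y=0$ implies $x=y=0$. **The category.** $\mathsf{Resist}_R$ is the strict symmetric monoidal category with objects the natural numbers (tensor product $+$) generated by a special commutative Frobenius algebra $(\nabla,\eta,\Delta,\epsilon)$ on the object $1$ (whose composites are the junctions $\circ^a_b\colon a\to b$) and by conductances $y\colon 1\to 1$, $0\neq y\in R$, subject to the following identities (composition in diagrammatic order). * Self-adjointness: $(1\otimes\circ^0_2)(1\otimes y\otimes 1)(\circ^2_0\otimes 1)=y$. * Short circuit: $\Delta(y\otimes 1)\nabla=1$. * Parallel: $\Delta(y\otimes z)\nabla=y+z$. * Star–mesh, for every $n\ge 0$ and all non-zero $y_1,\dots,y_n$: the star $\circ^0_n(y_1\otimes\cdots\otimes y_n)\colon 0\to n$ equals the mesh $0\to n$, which has one node at each output and, between the nodes $i<j$, the conductance $y_iy_j/\sum_k y_k$. A *circuit* $n\to m$ is a well-formed expression built from these generators, identities, symmetries, composition and $\otimes$. A *diagram* is a circuit up to the hypergraph category laws (strict symmetric monoidal and Frobenius laws) and self-adjointness. Diagrams are rewritten by replacing, inside a diagram,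 the left-hand side of a short circuit, parallel or star–mesh identity by its right-hand side. A diagram is *normal* if no rewriting step applies to it. A *family of meshes* is a diagram given by a network of nodes and conductances in which every node carries at least one input or output (possibly several), there are no loops, and any two nodes are joined by at most one conductance. **Corollary.** Every diagram reduces to exactly one normal diagram, the normal diagrams are exactly the families of meshes, and two circuits $n\to m$ are equal as maps of $\mathsf{Resist}_R$ if and only if they have the same normal form. Moreover, suppose that equality in $R$ is decidable. That is, elements of $R$ are named by natural numbers so that sums and products can be computed on names, inverses of non-zero named elements are named, and it is decidable whether two names denote the same element. (Not every element of $R$ need be named.) Consider circuits whose conductances are given by names. Then there is a computable function $\mathrm{nf}$ that takes each such circuit to a circuit, of the same type, whose diagram is its normal form, in such a way that two circuits $s,t\colon n\to m$ are equal in $\mathsf{Resist}_R$ if and only if $\mathrm{nf}(s)$ and $\mathrm{nf}(t)$ are the same expression. In particular, equality of maps in $\mathsf{Resist}_R$ is decidable. -/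

import Mathlib

namespace ResistorCircuit

/-- A commutative rig `R` is a positive division rig if every non-zero element has a multiplicative
inverse and a sum is zero only if both summands are. -/
structure IsPositiveDivisionRig (R : Type*) [CommSemiring R] : Prop where
  exists_inv : ∀ x : R, x ≠ 0 → ∃ y : R, x * y = 1
  positive : ∀ x y : R, x + y = 0 → x = 0 ∧ y = 0

/-! ### Circuits: expressions built from conductances and junctions -/

/-- Raw expressions for circuits, with conductances labelled in `α`. Composition is in diagrammatic
order; `swap a b : a + b ⟶ b + a` is the symmetry. -/
inductive CircuitTerm (α : Type*) : Type _
  | id (n : ℕ)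
  | comp (f g : CircuitTerm α)
  | tensor (f g : CircuitTerm α)
  | swap (a b : ℕ)
  | mul
  | unit
  | comul
  | counit
  | cond (y : α)

namespace CircuitTerm

infixl:65 " ⨟ " => CircuitTerm.comp
infixr:75 " ⊠ " => CircuitTerm.tensor

/-- Relabelling of the conductances. -/
def map {α β : Type*} (φ : α → β) : CircuitTerm α → CircuitTerm β
  | id n => id n
  | comp f g => comp (f.map φ) (g.map φ)
  | tensor f g => tensor (f.map φ) (g.map φ)
  | swap a b => swap a b
  | mul => mul
  | unit => unit
  | comul => comul
  | counit => counit
  | cond y => cond (φ y)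

/-- The code of an expression whose labels are numbers: its reverse Polish notation. -/
def code : CircuitTerm ℕ → List (ℕ × ℕ × ℕ)
  | id n => [(0, n, 0)]
  | comp f g => f.code ++ g.code ++ [(1, 0, 0)]
  | tensor f g => f.code ++ g.code ++ [(2, 0, 0)]
  | swap a b => [(3, a, b)]
  | mul => [(4, 0, 0)]
  | unit => [(5, 0, 0)]
  | comul => [(6, 0, 0)]
  | counit => [(7, 0, 0)]
  | cond c => [(8, c, 0)]

section derived
variable {α : Type*}

/-- `merge a : a ⟶ 1` joins `a` wires. -/
def merge : ℕ → CircuitTerm α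
  | 0 => unit
  | a + 1 => id 1 ⊠ merge a ⨟ mul

/-- `split b : 1 ⟶ b` splits one wire into `b` wires. -/
def split : ℕ → CircuitTerm α
  | 0 => counit
  | b + 1 => comul ⨟ id 1 ⊠ split b

/-- The junction with `a` inputs and `b` outputs. -/
def spider (a b : ℕ) : CircuitTerm α := merge a ⨟ split b

/-- The cup `0 ⟶ 2`. -/
def cup : CircuitTerm α := spider 0 2

/-- The cap `2 ⟶ 0`. -/
def cap : CircuitTerm α := spider 2 0

/-- The parallel juxtaposition of conductances, one on each wire. -/
def conds : List α → CircuitTerm α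
  | [] => id 0
  | y :: ys => cond y ⊠ conds ys

/-- The star: one internal node joined to `ys.length` outer ends by the conductances `ys`. -/
def star (ys : List α) : CircuitTerm α := spider 0 ys.length ⨟ conds ys

/-- `k` disconnected nodes, as a map `0 ⟶ k`. -/
def units : ℕ → CircuitTerm α
  | 0 => id 0
  | k + 1 => unit ⊠ units k

/-- `k` disconnected nodes, as a map `k ⟶ 0`. -/
def counits : ℕ → CircuitTerm α
  | 0 => id 0
  | k + 1 => counit ⊠ counits k

/-- `join k i : 1 + k ⟶ k` merges the first wire into wire `i < k` of the other `k` wires. -/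
def join (k i : ℕ) : CircuitTerm α :=
  swap 1 i ⊠ id (k - i) ⨟ id i ⊠ mul ⊠ id (k - i - 1)

/-- `fork k i : k ⟶ 1 + k` makes a copy of wire `i < k` and puts it first. -/
def fork (k i : ℕ) : CircuitTerm α :=
  id i ⊠ comul ⊠ id (k - i - 1) ⨟ swap i 1 ⊠ id (k - i)

/-- `link k i j y : k ⟶ k` puts the conductance `y` between wires `i` and `j`. -/
def link (k i j : ℕ) (y : α) : CircuitTerm α :=
  fork k i ⨟ cond y ⊠ id k ⨟ join k j

/-- All the conductances of a list of edges `(i, j, y)`, put on `k` wires. -/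
def links (k : ℕ) : List (ℕ × ℕ × α) → CircuitTerm α
  | [] => id k
  | (i, j, y) :: es => link k i j y ⨟ links k es

/-- `legsIn k l : l.length ⟶ k` attaches its inputs to the listed nodes among `k` nodes. -/
def legsIn (k : ℕ) : List ℕ → CircuitTerm α
  | [] => units k
  | i :: l => id 1 ⊠ legsIn k l ⨟ join k i

/-- `legsOut k l : k ⟶ l.length` attaches its outputs to the listed nodes among `k` nodes. -/
def legsOut (k : ℕ) : List ℕ → CircuitTerm α
  | [] => counits k
  | i :: l => fork k i ⨟ id 1 ⊠ legsOut k l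

end derived

/-- Well-formed circuits `n ⟶ m`. Conductances are non-zero. -/
inductive Typed {R : Type*} [CommSemiring R] : ℕ → ℕ → CircuitTerm R → Prop
  | id (n : ℕ) : Typed n n (id n)
  | comp {n k m : ℕ} {f g : CircuitTerm R} : Typed n k f → Typed k m g → Typed n m (f ⨟ g)
  | tensor {a b c d : ℕ} {f g : CircuitTerm R} :
      Typed a b f → Typed c d g → Typed (a + c) (b + d) (f ⊠ g)
  | swap (a b : ℕ) : Typed (a + b) (b + a) (swap a b)
  | mul : Typed 2 1 mul
  | unit : Typed 0 1 unit
  | comul : Typed 1 2 comul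
  | counit : Typed 1 0 counit
  | cond {y : R} : y ≠ 0 → Typed 1 1 (cond y)

end CircuitTerm

open CircuitTerm

/-- An open network: `nodes` nodes `0, 1, …`, the nodes to which the inputs and the outputs are
attached, and a list of edges `(i, j, y)`, the conductance `y` lying between nodes `i` and `j`. -/
structure Network (α : Type*) where
  nodes : ℕ
  inputs : List ℕ
  outputs : List ℕ
  edges : List (ℕ × ℕ × α)

/-- The network as a circuit. -/
def Network.toTerm {α : Type*} (N : Network α) : CircuitTerm α :=
  legsIn N.nodes N.inputs ⨟ links N.nodes N.edges ⨟ legsOut N.nodes N.outputs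

section rig
variable {R : Type*} [CommSemiring R]

/-- The mesh of a star with conductances `y`: its `n` nodes are the outputs, and the conductance
between nodes `i < j` is `yᵢ yⱼ / ∑ₖ yₖ`. -/
noncomputable def mesh {n : ℕ} (y : Fin n → R) : CircuitTerm R :=
  Network.toTerm
    { nodes := n
      inputs := []
      outputs := List.range n
      edges := ((List.finRange n ×ˢ List.finRange n).filter fun p => p.1 < p.2).map fun p =>
        ((p.1 : ℕ), (p.2 : ℕ), y p.1 * y p.2 * Ring.inverse (∑ k, y k)) }

/-! ### The identities -/

/-- The laws of a strict symmetric monoidal category with objects the natural numbers (those beyond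
the congruence rules), and of a special commutative Frobenius algebra on the object `1`.
An instance is only used where both sides are well-formed and of the same type, see `Cong`. -/
inductive HypergraphLaw : CircuitTerm R → CircuitTerm R → Prop
  | id_comp (n : ℕ) (f : CircuitTerm R) : HypergraphLaw (id n ⨟ f) f
  | comp_id (n : ℕ) (f : CircuitTerm R) : HypergraphLaw (f ⨟ id n) f
  | comp_assoc (f g h : CircuitTerm R) : HypergraphLaw (f ⨟ g ⨟ h) (f ⨟ (g ⨟ h))
  | tensor_id (a b : ℕ) : HypergraphLaw (id a ⊠ id b) (id (a + b))
  | interchange (f g f' g' : CircuitTerm R) :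
      HypergraphLaw (f ⊠ g ⨟ f' ⊠ g') ((f ⨟ f') ⊠ (g ⨟ g'))
  | tensor_assoc (f g h : CircuitTerm R) : HypergraphLaw ((f ⊠ g) ⊠ h) (f ⊠ (g ⊠ h))
  | id_tensor (f : CircuitTerm R) : HypergraphLaw (id 0 ⊠ f) f
  | tensor_id_zero (f : CircuitTerm R) : HypergraphLaw (f ⊠ id 0) f
  | swap_natural {a b c d : ℕ} {f g : CircuitTerm R} (hf : Typed a b f) (hg : Typed c d g) :
      HypergraphLaw (f ⊠ g ⨟ swap b d) (swap a c ⨟ g ⊠ f)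
  | swap_swap (a b : ℕ) : HypergraphLaw (swap a b ⨟ swap b a) (id (a + b))
  | swap_zero (a : ℕ) : HypergraphLaw (swap a 0) (id a)
  | swap_add (a b c : ℕ) :
      HypergraphLaw (swap a (b + c)) (swap a b ⊠ id c ⨟ id b ⊠ swap a c)
  | mul_assoc : HypergraphLaw (mul ⊠ id 1 ⨟ mul) (id 1 ⊠ mul ⨟ mul)
  | unit_mul : HypergraphLaw (unit ⊠ id 1 ⨟ mul) (id 1)
  | mul_comm : HypergraphLaw (swap 1 1 ⨟ mul) mul
  | comul_assoc : HypergraphLaw (comul ⨟ comul ⊠ id 1) (comul ⨟ id 1 ⊠ comul)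
  | comul_counit : HypergraphLaw (comul ⨟ counit ⊠ id 1) (id 1)
  | comul_comm : HypergraphLaw (comul ⨟ swap 1 1) comul
  | frobenius_left : HypergraphLaw (comul ⊠ id 1 ⨟ id 1 ⊠ mul) (mul ⨟ comul)
  | frobenius_right : HypergraphLaw (id 1 ⊠ comul ⨟ mul ⊠ id 1) (mul ⨟ comul)
  | special : HypergraphLaw (comul ⨟ mul) (id 1)

/-- The identities that do not change the network drawn by a circuit: the laws of a hypergraph
category, and self-adjointness of conductances (a conductance bent around by a cup and a cap is
the same conductance). -/
inductive StructuralLaw : CircuitTerm R → CircuitTerm R → Prop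
  | hypergraph {s t : CircuitTerm R} : HypergraphLaw s t → StructuralLaw s t
  | self_adjoint (y : R) :
      StructuralLaw (id 1 ⊠ cup ⨟ id 1 ⊠ cond y ⊠ id 1 ⨟ cap ⊠ id 1) (cond y)

/-- The oriented identities: short circuit, parallel conductances, and star to mesh. -/
inductive Rule : CircuitTerm R → CircuitTerm R → Prop
  | short_circuit (y : R) : Rule (comul ⨟ cond y ⊠ id 1 ⨟ mul) (id 1)
  | parallel (y z : R) : Rule (comul ⨟ cond y ⊠ cond z ⨟ mul) (cond (y + z))
  | star_mesh {n : ℕ} (y : Fin n → R) (hy : ∀ i, y i ≠ 0) : Rule (star (List.ofFn y)) (mesh y)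

/-- The identities of the category of resistor circuits. -/
inductive ResistLaw : CircuitTerm R → CircuitTerm R → Prop
  | structural {s t : CircuitTerm R} : StructuralLaw s t → ResistLaw s t
  | rule {s t : CircuitTerm R} : Rule s t → ResistLaw s t

/-- Equality of circuits `n ⟶ m` generated by a set of laws: the smallest congruence for
composition and tensor product that contains all well-formed instances of the laws. -/
inductive Cong (A : CircuitTerm R → CircuitTerm R → Prop) :
    ℕ → ℕ → CircuitTerm R → CircuitTerm R → Prop
  | law {n m : ℕ} {s t : CircuitTerm R} : A s t → Typed n m s → Typed n m t → Cong A n m s t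
  | refl {n m : ℕ} {s : CircuitTerm R} : Typed n m s → Cong A n m s s
  | symm {n m : ℕ} {s t : CircuitTerm R} : Cong A n m s t → Cong A n m t s
  | trans {n m : ℕ} {s t u : CircuitTerm R} : Cong A n m s t → Cong A n m t u → Cong A n m s u
  | comp {n k m : ℕ} {s s' t t' : CircuitTerm R} :
      Cong A n k s s' → Cong A k m t t' → Cong A n m (s ⨟ t) (s' ⨟ t')
  | tensor {a b c d : ℕ} {s s' t t' : CircuitTerm R} :
      Cong A a b s s' → Cong A c d t t' → Cong A (a + c) (b + d) (s ⊠ t) (s' ⊠ t')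

/-- Circuits `n ⟶ m`. -/
abbrev Circuit (R : Type*) [CommSemiring R] (n m : ℕ) : Type _ :=
  {t : CircuitTerm R // Typed n m t}

/-- The equality of circuits generated by a set of laws, as a setoid. -/
def congSetoid (A : CircuitTerm R → CircuitTerm R → Prop) (n m : ℕ) : Setoid (Circuit R n m) where
  r s t := Cong A n m s.1 t.1
  iseqv := ⟨fun s => .refl s.2, .symm, .trans⟩

/-! ### The category of resistor circuits -/

/-- The category of resistor circuits over `R`; its objects are the natural numbers. -/
structure Resist (R : Type*) where
  of : ℕ

/-- The maps of the category of resistor circuits: circuits modulo all the identities. -/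
instance : CategoryTheory.Category (Resist R) where
  Hom n m := Quotient (congSetoid (ResistLaw (R := R)) n.of m.of)
  id n := Quotient.mk _ ⟨id n.of, .id _⟩
  comp := Quotient.map₂ (fun f g => ⟨f.1 ⨟ g.1, .comp f.2 g.2⟩) fun _ _ h _ _ h' => .comp h h'
  id_comp := by
    rintro n m ⟨f⟩
    exact Quotient.sound (.law (.structural (.hypergraph (.id_comp _ _))) (.comp (.id _) f.2) f.2)
  comp_id := by
    rintro n m ⟨f⟩
    exact Quotient.sound (.law (.structural (.hypergraph (.comp_id _ _))) (.comp f.2 (.id _)) f.2)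
  assoc := by
    rintro n m k l ⟨f⟩ ⟨g⟩ ⟨h⟩
    exact Quotient.sound (.law (.structural (.hypergraph (.comp_assoc _ _ _)))
      (.comp (.comp f.2 g.2) h.2) (.comp f.2 (.comp g.2 h.2)))

/-- The map of the category of resistor circuits given by a circuit. -/
def Circuit.toResist {n m : ℕ} (s : Circuit R n m) : (⟨n⟩ : Resist R) ⟶ ⟨m⟩ :=
  Quotient.mk _ s

/-! ### Rewriting -/

variable (R) in
/-- Diagrams: circuits up to the identities that do not change the network they draw. -/
def Diagram (n m : ℕ) : Type _ := Quotient (congSetoid (StructuralLaw (R := R)) n m)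

/-- The diagram of a circuit. -/
def Circuit.toDiagram {n m : ℕ} (s : Circuit R n m) : Diagram R n m := Quotient.mk _ s

/-- One rewriting step: some part of the diagram is the left-hand side of a rule and is replaced by
its right-hand side. -/
def Step {n m : ℕ} (d e : Diagram R n m) : Prop :=
  ∃ (p q : ℕ) (a b l r : CircuitTerm R) (_ : Rule l r)
    (hl : Typed n m (a ⨟ id p ⊠ l ⊠ id q ⨟ b)) (hr : Typed n m (a ⨟ id p ⊠ r ⊠ id q ⨟ b)),
    d = Circuit.toDiagram ⟨_, hl⟩ ∧ e = Circuit.toDiagram ⟨_, hr⟩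

/-- Reduction in finitely many steps. -/
def Reduces {n m : ℕ} (d e : Diagram R n m) : Prop := Relation.ReflTransGen Step d e

/-- A diagram is normal if no rewriting step applies to it. -/
def IsNormal {n m : ℕ} (d : Diagram R n m) : Prop := ∀ e, ¬ Step d e

/-- A network is a family of meshes if every node carries an input or an output (no internal
nodes; a node may carry several of them), no edge is a loop and no two edges are parallel. -/
structure Network.IsMeshFamily (N : Network R) : Prop where
  inputs_lt : ∀ i ∈ N.inputs, i < N.nodes
  outputs_lt : ∀ i ∈ N.outputs, i < N.nodes
  external : ∀ i < N.nodes, i ∈ N.inputs ∨ i ∈ N.outputs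
  edges_lt : ∀ e ∈ N.edges, e.1 < e.2.1 ∧ e.2.1 < N.nodes
  edges_ne : ∀ e ∈ N.edges, e.2.2 ≠ 0
  simple : N.edges.Pairwise fun e f => (e.1, e.2.1) ≠ (f.1, f.2.1)

/-- The diagrams drawn by families of meshes. -/
def IsMeshFamily {n m : ℕ} (d : Diagram R n m) : Prop :=
  ∃ (N : Network R) (_ : N.IsMeshFamily) (h : Typed n m N.toTerm), d = Circuit.toDiagram ⟨_, h⟩

end rig

/-- A system of names (natural numbers) for elements of the rig, in which sums and products can be
computed, inverses of named elements have names, and equality is decidable. If all elements of the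
rig have names, the rig is a computable rig; for an uncountable rig only some of them do. -/
structure DecidableNaming (R : Type*) [CommSemiring R] where
  val : ℕ → R
  add : ∃ f : ℕ → ℕ → ℕ, Computable₂ f ∧ ∀ a b, val (f a b) = val a + val b
  mul : ∃ f : ℕ → ℕ → ℕ, Computable₂ f ∧ ∀ a b, val (f a b) = val a * val b
  inv : ∀ a, val a ≠ 0 → ∃ b, val a * val b = 1
  decidable_eq : ComputablePred fun p : ℕ × ℕ => val p.1 = val p.2

end ResistorCircuit

open ResistorCircuit

/-! A diagram is the same thing as an open network: finitely many nodes, inputs and outputs attached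
to nodes, and a multiset of undirected edges labelled by conductances. In one direction, every
circuit is structurally equal to the circuit drawn by its network (`Net.ofTerm_spec`); this is shown
by feeding the outputs of a network into one generator after the other. In the other direction, the
labellings of the nodes of a circuit by natural numbers (`Lab`) are invariant under structural
equality (`lab_cong`), and a labelling with as many labels as possible gives different labels to
different nodes, so that it determines the network up to renaming.

Existence of normal forms: drop the loops and replace the star around a node without legs by a mesh,
until only nodes with legs are left; then drop loops and merge parallel edges
(`Net.normalize_spec`). Positivity keeps all sums of conductances non-zero.

Uniqueness: record a network by the matrix of total conductances between different nodes. The short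
circuit and parallel rules do not change it, and star to mesh is the elimination of one node, a
Schur complement (`elim_matOf_star`). Eliminations commute (`CondMat.elim_comm`, by the computation
`elim_symm`). Hence the matrix that is left after the elimination of all nodes without legs
(`reducedMat`) is invariant under rewriting (`Effect.reducedMat_eq`). A family of meshes has nothing
to eliminate, and its matrix determines its edges; so a diagram reduces to at most one family of
meshes (`IsMeshFamily.unique`). Neither termination nor local confluence has to be proved. A step
needs a loop, a pair of parallel edges or a node without legs, so families of meshes are normal; a
normal diagram is the family of meshes to which it reduces (`isNormal_iff`).

Equality of maps is the equivalence relation generated by the steps, as these are stable under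
composition and tensor product (`eqvGen_of_cong`). By uniqueness, equivalent diagrams reduce to the
same family of meshes (`toResist_eq_iff`).

Computability: the normalization is written for labels of any type with operations `Ops`, so that it
runs on names of conductances and commutes with their evaluation (`Ops.Hom.normalize`). Nodes are
numbered by their order among the legs, edges are listed in a fixed order, and each conductance gets
its least name; then the diagram determines the resulting expression (`Ops.Hom.normalize_eq`).
Expressions are read from their reverse Polish codes with a stack, and everything is a composite of
folds over lists. -/

namespace ResistorCircuit
open CircuitTerm

/-! ### Types and well-formedness of raw expressions -/

namespace CircuitTerm

/-- The number of inputs of an expression. -/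
def dom {α : Type*} : CircuitTerm α → ℕ
  | id n => n
  | comp f _ => f.dom
  | tensor f g => f.dom + g.dom
  | swap a b => a + b
  | mul => 2
  | unit => 0
  | comul => 1
  | counit => 1
  | cond _ => 1

/-- The number of outputs of an expression. -/
def cod {α : Type*} : CircuitTerm α → ℕ
  | id n => n
  | comp _ g => g.cod
  | tensor f g => f.cod + g.cod
  | swap a b => b + a
  | mul => 1
  | unit => 1
  | comul => 2
  | counit => 0
  | cond _ => 1

/-- Well-formedness of an expression, its type being given by `dom` and `cod`. -/
def WellFormed {R : Type*} [CommSemiring R] : CircuitTerm R → Prop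
  | comp f g => f.WellFormed ∧ g.WellFormed ∧ f.cod = g.dom
  | tensor f g => f.WellFormed ∧ g.WellFormed
  | cond y => y ≠ 0
  | _ => True

variable {R : Type*} [CommSemiring R]

theorem Typed.wellFormed {n m : ℕ} {t : CircuitTerm R} (h : Typed n m t) :
    t.WellFormed ∧ t.dom = n ∧ t.cod = m := by
  induction h <;> simp_all [WellFormed, dom, cod]

theorem WellFormed.typed {t : CircuitTerm R} (h : t.WellFormed) : Typed t.dom t.cod t := by
  induction t with
  | comp f g hf hg =>
    obtain ⟨h1, h2, h3⟩ := h
    have := hf h1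
    rw [h3] at this
    exact .comp this (hg h2)
  | tensor f g hf hg => exact .tensor (hf h.1) (hg h.2)
  | id n => exact .id n
  | swap a b => exact .swap a b
  | mul => exact .mul
  | unit => exact .unit
  | comul => exact .comul
  | counit => exact .counit
  | cond y => exact .cond h

theorem typed_iff {n m : ℕ} {t : CircuitTerm R} :
    Typed n m t ↔ t.WellFormed ∧ t.dom = n ∧ t.cod = m :=
  ⟨Typed.wellFormed, fun ⟨h, h1, h2⟩ => h1 ▸ h2 ▸ h.typed⟩

end CircuitTerm

variable {R : Type*} [CommSemiring R]

theorem Cong.typed {A : CircuitTerm R → CircuitTerm R → Prop} {n m : ℕ} {s t : CircuitTerm R}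
    (h : Cong A n m s t) : Typed n m s ∧ Typed n m t := by
  induction h with
  | law _ h1 h2 => exact ⟨h1, h2⟩
  | refl h => exact ⟨h, h⟩
  | symm _ ih => exact ih.symm
  | trans _ _ h1 h2 => exact ⟨h1.1, h2.2⟩
  | comp _ _ h1 h2 => exact ⟨.comp h1.1 h2.1, .comp h1.2 h2.2⟩
  | tensor _ _ h1 h2 => exact ⟨.tensor h1.1 h2.1, .tensor h1.2 h2.2⟩

/-! ### Circuits of all types modulo structural equality, as one algebra with total operations -/

/-- Structural equality of raw expressions; ill-formed expressions with the same numbers of inputs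
and outputs are identified. -/
def rawSetoid (R : Type*) [CommSemiring R] : Setoid (CircuitTerm R) where
  r s t := s.dom = t.dom ∧ s.cod = t.cod ∧
    -- Since `Cong` relates only well-formed circuits, the disjunction keeps well-formed and
    -- ill-formed expressions apart.
    (s.WellFormed ∨ t.WellFormed → Cong StructuralLaw s.dom s.cod s t)
  iseqv := by
    refine ⟨fun s => ⟨rfl, rfl, fun h => .refl (by tauto : s.WellFormed).typed⟩, ?_, ?_⟩
    · rintro s t ⟨h1, h2, h3⟩
      exact ⟨h1.symm, h2.symm, fun h => h1 ▸ h2 ▸ (h3 h.symm).symm⟩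
    · rintro s t u ⟨h1, h2, h3⟩ ⟨h4, h5, h6⟩
      refine ⟨h1.trans h4, h2.trans h5, fun h => ?_⟩
      rw [← h1, ← h2] at h6
      rcases h with h | h
      · have := h3 (.inl h)
        exact this.trans (h6 (.inl this.typed.2.wellFormed.1))
      · have := h6 (.inr h)
        exact (h3 (.inr this.typed.1.wellFormed.1)).trans this

/-- Raw expressions of all types modulo structural equality. -/
def Q (R : Type*) [CommSemiring R] : Type _ := Quotient (rawSetoid R)

namespace Q

/-- The class of an expression. -/
def mk (t : CircuitTerm R) : Q R := Quotient.mk (rawSetoid R) t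

theorem mk_eq_mk {s t : CircuitTerm R} : mk s = mk t ↔ s.dom = t.dom ∧ s.cod = t.cod ∧
    (s.WellFormed ∨ t.WellFormed → Cong StructuralLaw s.dom s.cod s t) :=
  Quotient.eq (r := rawSetoid R)

theorem cong_of_eq {n m : ℕ} {s t : CircuitTerm R} (h : mk s = mk t) (hs : Typed n m s) :
    Cong StructuralLaw n m s t := by
  obtain ⟨h1, rfl, rfl⟩ := hs.wellFormed
  exact (mk_eq_mk.1 h).2.2 (.inl h1)

theorem eq_of_cong {n m : ℕ} {s t : CircuitTerm R} (h : Cong StructuralLaw n m s t) :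
    mk s = mk t := by
  obtain ⟨h1, rfl, rfl⟩ := h.typed.1.wellFormed
  obtain ⟨h4, h5, h6⟩ := h.typed.2.wellFormed
  exact mk_eq_mk.2 ⟨h5.symm, h6.symm, fun _ => h⟩

/-- Makes a hypergraph law an equation for all raw expressions: the law is needed only if both sides
are well-formed, and otherwise both are ill-formed with the same numbers of wires, hence identified.
-/
theorem eq_of_law {s t : CircuitTerm R} (hd : s.dom = t.dom) (hc : s.cod = t.cod)
    (hw : s.WellFormed ↔ t.WellFormed) (h : s.WellFormed → HypergraphLaw s t) : mk s = mk t :=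
  mk_eq_mk.2 ⟨hd, hc, fun hs => .law (.hypergraph (h (by tauto)))
    (typed_iff.2 ⟨by tauto, rfl, rfl⟩) (typed_iff.2 ⟨by tauto, hd.symm, hc.symm⟩)⟩

/-- The number of inputs. -/
def dom : Q R → ℕ := Quotient.lift CircuitTerm.dom fun _ _ h => h.1

/-- The number of outputs. -/
def cod : Q R → ℕ := Quotient.lift CircuitTerm.cod fun _ _ h => h.2.1

/-- Composition. -/
instance : Mul (Q R) where
  mul := Quotient.map₂ (sa := rawSetoid R) (sb := rawSetoid R) (sc := rawSetoid R) comp (by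
    rintro s s' ⟨h1, h2, h3⟩ t t' ⟨h4, h5, h6⟩
    refine ⟨h1, h5, fun h => ?_⟩
    have h7 : s.cod = t.dom := by
      rcases h with ⟨-, -, h⟩ | ⟨-, -, h⟩
      · exact h
      · rw [h2, h4, h]
    refine .comp (h3 ?_) (h7 ▸ h6 ?_)
    · rcases h with h | h
      exacts [.inl h.1, .inr h.1]
    · rcases h with h | h
      exacts [.inl h.2.1, .inr h.2.1])

/-- The tensor product. -/
def tens : Q R → Q R → Q R :=
  Quotient.map₂ (sa := rawSetoid R) (sb := rawSetoid R) (sc := rawSetoid R) tensor (by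
    rintro s s' ⟨h1, h2, h3⟩ t t' ⟨h4, h5, h6⟩
    refine ⟨congrArg₂ _ h1 h4, congrArg₂ _ h2 h5, fun h => .tensor (h3 ?_) (h6 ?_)⟩
    · rcases h with h | h
      exacts [.inl h.1, .inr h.1]
    · rcases h with h | h
      exacts [.inl h.2, .inr h.2])

infixr:75 " ⊙ " => Q.tens

theorem mk_comp (s t : CircuitTerm R) : mk (s ⨟ t) = mk s * mk t := rfl
theorem mk_tensor (s t : CircuitTerm R) : mk (s ⊠ t) = mk s ⊙ mk t := rfl

/-- The identities, symmetries and generators. -/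
def one (n : ℕ) : Q R := mk (id n)
/-- The symmetry. -/
def sw (a b : ℕ) : Q R := mk (swap a b)
/-- The multiplication. -/
def mu : Q R := mk mul
/-- The unit. -/
def et : Q R := mk unit
/-- The comultiplication. -/
def de : Q R := mk comul
/-- The counit. -/
def ep : Q R := mk counit
/-- A conductance. -/
def cd (y : R) : Q R := mk (cond y)

@[simp] theorem dom_mk (t : CircuitTerm R) : (mk t).dom = t.dom := rfl
@[simp] theorem cod_mk (t : CircuitTerm R) : (mk t).cod = t.cod := rfl

theorem ind {p : Q R → Prop} (h : ∀ t, p (mk t)) (q : Q R) : p q :=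
  Quotient.ind h q

@[simp] theorem dom_mul (f g : Q R) : (f * g).dom = f.dom := by
  induction f using ind; induction g using ind; rfl
@[simp] theorem cod_mul (f g : Q R) : (f * g).cod = g.cod := by
  induction f using ind; induction g using ind; rfl
@[simp] theorem dom_tens (f g : Q R) : (f ⊙ g).dom = f.dom + g.dom := by
  induction f using ind; induction g using ind; rfl
@[simp] theorem cod_tens (f g : Q R) : (f ⊙ g).cod = f.cod + g.cod := by
  induction f using ind; induction g using ind; rfl
@[simp] theorem dom_one (n : ℕ) : (one n : Q R).dom = n := rfl
@[simp] theorem cod_one (n : ℕ) : (one n : Q R).cod = n := rfl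
@[simp] theorem dom_sw (a b : ℕ) : (sw a b : Q R).dom = a + b := rfl
@[simp] theorem cod_sw (a b : ℕ) : (sw a b : Q R).cod = b + a := rfl
@[simp] theorem dom_mu : (mu : Q R).dom = 2 := rfl
@[simp] theorem cod_mu : (mu : Q R).cod = 1 := rfl
@[simp] theorem dom_et : (et : Q R).dom = 0 := rfl
@[simp] theorem cod_et : (et : Q R).cod = 1 := rfl
@[simp] theorem dom_de : (de : Q R).dom = 1 := rfl
@[simp] theorem cod_de : (de : Q R).cod = 2 := rfl
@[simp] theorem dom_ep : (ep : Q R).dom = 1 := rfl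
@[simp] theorem cod_ep : (ep : Q R).cod = 0 := rfl
@[simp] theorem dom_cd (y : R) : (cd y).dom = 1 := rfl
@[simp] theorem cod_cd (y : R) : (cd y).cod = 1 := rfl

instance : Semigroup (Q R) where
  mul_assoc f g h := by
    induction f using ind; induction g using ind; induction h using ind
    exact eq_of_law rfl rfl (by simp only [WellFormed, CircuitTerm.cod, CircuitTerm.dom]; tauto)
      fun _ => .comp_assoc _ _ _

theorem tens_assoc (f g h : Q R) : (f ⊙ g) ⊙ h = f ⊙ (g ⊙ h) := by
  induction f using ind; induction g using ind; induction h using ind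
  exact eq_of_law (Nat.add_assoc _ _ _) (Nat.add_assoc _ _ _)
    (by simp only [WellFormed]; tauto) fun _ => .tensor_assoc _ _ _

theorem one_mul' {n : ℕ} (f : Q R) (h : f.dom = n) : one n * f = f := by
  induction f using ind
  subst h
  exact eq_of_law rfl rfl (by simp [WellFormed, CircuitTerm.cod]) fun _ => .id_comp _ _

theorem mul_one' {n : ℕ} (f : Q R) (h : f.cod = n) : f * one n = f := by
  induction f using ind
  subst h
  exact eq_of_law rfl rfl (by simp [WellFormed, CircuitTerm.dom]) fun _ => .comp_id _ _

theorem one_tens_one (a b : ℕ) : (one a : Q R) ⊙ one b = one (a + b) :=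
  eq_of_law rfl rfl (by simp [WellFormed]) fun _ => .tensor_id _ _

/-- The hypothesis cannot be dropped: the left side can be well-formed although `f` and `f'` do not
match, if the total numbers of wires agree. -/
theorem interchange (f g f' g' : Q R) (h : f.cod = f'.dom) :
    (f ⊙ g) * (f' ⊙ g') = (f * f') ⊙ (g * g') := by
  induction f using ind; induction g using ind; induction f' using ind; induction g' using ind
  simp only [dom_mk, cod_mk] at h
  exact eq_of_law rfl rfl
    (by simp only [WellFormed, CircuitTerm.cod, CircuitTerm.dom, h, Nat.add_left_cancel_iff]; tauto)
    fun _ => .interchange _ _ _ _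

theorem one_zero_tens (f : Q R) : one 0 ⊙ f = f := by
  induction f using ind
  exact eq_of_law (Nat.zero_add _) (Nat.zero_add _) (by simp [WellFormed]) fun _ => .id_tensor _

theorem tens_one_zero (f : Q R) : f ⊙ one 0 = f := by
  induction f using ind
  exact eq_of_law rfl rfl (by simp [WellFormed]) fun _ => .tensor_id_zero _

theorem tens_mul_sw (f g : Q R) :
    (f ⊙ g) * sw f.cod g.cod = sw f.dom g.dom * (g ⊙ f) := by
  induction f using ind; induction g using ind
  exact eq_of_law rfl rfl
    (by simp only [WellFormed, CircuitTerm.cod, CircuitTerm.dom, dom_mk, cod_mk]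
        tauto)
    fun h => .swap_natural h.1.1.typed h.1.2.typed

theorem sw_mul_sw (a b : ℕ) : (sw a b : Q R) * sw b a = one (a + b) :=
  eq_of_law rfl rfl (by simp [WellFormed, CircuitTerm.cod, CircuitTerm.dom])
    fun _ => .swap_swap _ _

theorem sw_zero (a : ℕ) : (sw a 0 : Q R) = one a :=
  eq_of_law rfl (Nat.zero_add _) (by simp [WellFormed]) fun _ => .swap_zero _

theorem sw_add (a b c : ℕ) : (sw a (b + c) : Q R) = (sw a b ⊙ one c) * (one b ⊙ sw a c) :=
  eq_of_law (Nat.add_assoc _ _ _).symm (Nat.add_assoc _ _ _)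
    (by simp [WellFormed, CircuitTerm.cod, CircuitTerm.dom]; omega) fun _ => .swap_add _ _ _

theorem mu_assoc : (mu ⊙ one 1 : Q R) * mu = (one 1 ⊙ mu) * mu :=
  eq_of_law rfl rfl (by simp [WellFormed, CircuitTerm.cod, CircuitTerm.dom]) fun _ => .mul_assoc

theorem et_mu : (et ⊙ one 1 : Q R) * mu = one 1 :=
  eq_of_law rfl rfl (by simp [WellFormed, CircuitTerm.cod, CircuitTerm.dom]) fun _ => .unit_mul

theorem sw_mu : (sw 1 1 : Q R) * mu = mu :=
  eq_of_law rfl rfl (by simp [WellFormed, CircuitTerm.cod, CircuitTerm.dom]) fun _ => .mul_comm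

theorem de_assoc : (de : Q R) * (de ⊙ one 1) = de * (one 1 ⊙ de) :=
  eq_of_law rfl rfl (by simp [WellFormed, CircuitTerm.cod, CircuitTerm.dom])
    fun _ => .comul_assoc

theorem de_ep : (de : Q R) * (ep ⊙ one 1) = one 1 :=
  eq_of_law rfl rfl (by simp [WellFormed, CircuitTerm.cod, CircuitTerm.dom])
    fun _ => .comul_counit

theorem de_sw : (de : Q R) * sw 1 1 = de :=
  eq_of_law rfl rfl (by simp [WellFormed, CircuitTerm.cod, CircuitTerm.dom]) fun _ => .comul_comm

theorem frob_left : (de ⊙ one 1 : Q R) * (one 1 ⊙ mu) = mu * de :=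
  eq_of_law rfl rfl (by simp [WellFormed, CircuitTerm.cod, CircuitTerm.dom])
    fun _ => .frobenius_left

theorem frob_right : (one 1 ⊙ de : Q R) * (mu ⊙ one 1) = mu * de :=
  eq_of_law rfl rfl (by simp [WellFormed, CircuitTerm.cod, CircuitTerm.dom])
    fun _ => .frobenius_right

theorem de_mu : (de : Q R) * mu = one 1 :=
  eq_of_law rfl rfl (by simp [WellFormed, CircuitTerm.cod, CircuitTerm.dom]) fun _ => .special

end Q
end ResistorCircuit

namespace ResistorCircuit
open CircuitTerm
variable {R : Type*} [CommSemiring R]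
namespace Q

/-- Lets an equation between products be used at the front of a product that is associated to the
right. -/
theorem reassoc {A : Type*} [Semigroup A] {a b c : A} (h : a * b = c) (z : A) :
    a * (b * z) = c * z := by rw [← mul_assoc, h]

theorem reassoc₃ {A : Type*} [Semigroup A] {a b c d : A} (h : a * b * c = d) (z : A) :
    a * (b * (c * z)) = d * z := by rw [← h, mul_assoc, mul_assoc]

/-! ### Generators beside further wires -/

theorem eq_one_tens (k : ℕ) : (one (k + 1) : Q R) = one 1 ⊙ one k := by
  rw [one_tens_one, Nat.add_comm]

/-- Needs no matching of wires: if `f.cod ≠ g.dom`, both sides are ill-formed of the same type and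
hence equal. -/
theorem mul_tens_one (f g : Q R) (k : ℕ) : (f * g) ⊙ one k = (f ⊙ one k) * (g ⊙ one k) := by
  by_cases h : f.cod = g.dom
  · rw [interchange _ _ _ _ h, one_mul' _ (dom_one k)]
  · induction f using ind
    induction g using ind
    refine mk_eq_mk.2 ⟨rfl, rfl, fun h' => (h ?_).elim⟩
    simp only [WellFormed, CircuitTerm.cod, CircuitTerm.dom] at h'
    simp only [dom_mk, cod_mk]
    omega

/-- A circuit beside one further wire, put first. -/
def wh (f : Q R) : Q R := one 1 ⊙ f

@[simp] theorem dom_wh (f : Q R) : (wh f).dom = f.dom + 1 := by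
  rw [wh, dom_tens, dom_one, Nat.add_comm]
@[simp] theorem cod_wh (f : Q R) : (wh f).cod = f.cod + 1 := by
  rw [wh, cod_tens, cod_one, Nat.add_comm]

theorem wh_mul (f g : Q R) : wh (f * g) = wh f * wh g := by
  rw [wh, wh, wh, interchange _ _ _ _ rfl, one_mul' _ (dom_one 1)]

theorem wh_one (k : ℕ) : wh (one k : Q R) = one (k + 1) := (eq_one_tens k).symm

theorem one_succ_tens (k : ℕ) (f : Q R) : one (k + 1) ⊙ f = wh (one k ⊙ f) := by
  rw [eq_one_tens, tens_assoc, wh]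

theorem wh_tens (f g : Q R) : wh (f ⊙ g) = wh f ⊙ g := by rw [wh, wh, tens_assoc]

theorem tens_one_succ (f : Q R) (k : ℕ) : f ⊙ one (k + 1) = (f ⊙ one 1) ⊙ one k := by
  rw [eq_one_tens, tens_assoc]

theorem tens_eq_left (f g : Q R) : f ⊙ g = (f ⊙ one g.dom) * (one f.cod ⊙ g) := by
  rw [interchange _ _ _ _ rfl, mul_one' _ rfl, one_mul' _ rfl]

theorem tens_eq_right (f g : Q R) : f ⊙ g = (one f.dom ⊙ g) * (f ⊙ one g.cod) := by
  rw [interchange _ _ _ _ rfl, mul_one' _ rfl, one_mul' _ rfl]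

/-- Both sides are `f ⊙ g`. The lemmas `S_slide` to `C_slide` are the cases in which one factor is a
generator. -/
theorem slide (f g : Q R) :
    (f ⊙ one g.dom) * (one f.cod ⊙ g) = (one f.dom ⊙ g) * (f ⊙ one g.cod) := by
  rw [← tens_eq_left, ← tens_eq_right]

theorem sw_one_two : (sw 1 2 : Q R) = (sw 1 1 ⊙ one 1) * wh (sw 1 1) := sw_add 1 1 1

/-- Only the hexagon `sw_add` is among the laws. The other one follows because its right side is
inverse to `sw c (a + b)`, as `sw (a + b) c` is. -/
theorem sw_add_left (a b c : ℕ) :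
    (sw (a + b) c : Q R) = (one a ⊙ sw b c) * (sw a c ⊙ one b) := by
  have h : (sw c (a + b) : Q R) * ((one a ⊙ sw b c) * (sw a c ⊙ one b)) = one (c + (a + b)) := by
    rw [sw_add, mul_assoc, ← mul_assoc (one a ⊙ sw c b), interchange _ _ _ _ rfl, one_mul' _ (dom_one a),
      sw_mul_sw, one_tens_one, ← mul_assoc, mul_one' _ (by simp [Nat.add_assoc]), ← mul_tens_one,
      sw_mul_sw, one_tens_one, Nat.add_assoc]
  calc (sw (a + b) c : Q R)
      = sw (a + b) c * (sw c (a + b) * ((one a ⊙ sw b c) * (sw a c ⊙ one b))) := by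
        rw [h, mul_one' _ (by simp)]
    _ = _ := by
        rw [← mul_assoc, sw_mul_sw, one_mul' _ (by simp; omega)]

theorem sw_two_one : (sw 2 1 : Q R) = wh (sw 1 1) * (sw 1 1 ⊙ one 1) := sw_add_left 1 1 1

theorem zero_sw (a : ℕ) : (sw 0 a : Q R) = one a := by
  have := sw_mul_sw (R := R) 0 a
  rwa [sw_zero, mul_one' _ (by simp), Nat.zero_add] at this

/-- The crossing of the first two wires. -/
def S (k : ℕ) : Q R := sw 1 1 ⊙ one k
/-- The multiplication on the first two wires. -/
def M (k : ℕ) : Q R := mu ⊙ one k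
/-- The comultiplication on the first wire. -/
def D (k : ℕ) : Q R := de ⊙ one k
/-- A new first wire. -/
def E (k : ℕ) : Q R := et ⊙ one k
/-- The first wire ends. -/
def C (k : ℕ) : Q R := ep ⊙ one k

@[simp] theorem dom_S (k : ℕ) : (S k : Q R).dom = k + 2 := Nat.add_comm 2 _
@[simp] theorem cod_S (k : ℕ) : (S k : Q R).cod = k + 2 := Nat.add_comm 2 _
@[simp] theorem dom_M (k : ℕ) : (M k : Q R).dom = k + 2 := Nat.add_comm 2 _
@[simp] theorem cod_M (k : ℕ) : (M k : Q R).cod = k + 1 := Nat.add_comm 1 _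
@[simp] theorem dom_D (k : ℕ) : (D k : Q R).dom = k + 1 := Nat.add_comm 1 _
@[simp] theorem cod_D (k : ℕ) : (D k : Q R).cod = k + 2 := Nat.add_comm 2 _
@[simp] theorem dom_E (k : ℕ) : (E k : Q R).dom = k := Nat.zero_add k
@[simp] theorem cod_E (k : ℕ) : (E k : Q R).cod = k + 1 := Nat.add_comm 1 _
@[simp] theorem dom_C (k : ℕ) : (C k : Q R).dom = k + 1 := Nat.add_comm 1 _
@[simp] theorem cod_C (k : ℕ) : (C k : Q R).cod = k := Nat.zero_add k

theorem wh_wh_eq (f : Q R) : wh (wh f) = one 2 ⊙ f := by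
  rw [wh, wh, ← tens_assoc, one_tens_one]

theorem S_slide {k l : ℕ} (f : Q R) (hd : f.dom = k) (hc : f.cod = l) :
    wh (wh f) * S l = S k * wh (wh f) := by
  subst hd hc
  rw [wh_wh_eq]
  exact (slide (sw 1 1) f).symm

theorem M_slide {k l : ℕ} (f : Q R) (hd : f.dom = k) (hc : f.cod = l) :
    M k * wh f = wh (wh f) * M l := by
  subst hd hc
  rw [wh_wh_eq]
  exact slide mu f

theorem D_slide {k l : ℕ} (f : Q R) (hd : f.dom = k) (hc : f.cod = l) :
    D k * wh (wh f) = wh f * D l := by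
  subst hd hc
  rw [wh_wh_eq]
  exact slide de f

theorem E_slide {k l : ℕ} (f : Q R) (hd : f.dom = k) (hc : f.cod = l) :
    E k * wh f = f * E l := by
  subst hd hc
  have := slide et f
  rwa [dom_et, one_zero_tens] at this

theorem C_slide {k l : ℕ} (f : Q R) (hd : f.dom = k) (hc : f.cod = l) :
    C k * f = wh f * C l := by
  subst hd hc
  have := slide ep f
  rwa [cod_ep, one_zero_tens] at this

theorem S_S (k : ℕ) : (S k : Q R) * S k = one (k + 2) := by
  rw [S, ← mul_tens_one, sw_mul_sw, one_tens_one, Nat.add_comm]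

theorem S_S_mul (k : ℕ) (f : Q R) (h : f.dom = k + 2) : S k * (S k * f) = f := by
  rw [← mul_assoc, S_S, one_mul' _ h]

theorem mul_S_S (k : ℕ) (f : Q R) (h : f.cod = k + 2) : f * S k * S k = f := by
  rw [mul_assoc, S_S, mul_one' _ h]

theorem S_succ (k : ℕ) : (S (k + 1) : Q R) = (sw 1 1 ⊙ one 1) ⊙ one k := tens_one_succ _ _
theorem M_succ (k : ℕ) : (M (k + 1) : Q R) = (mu ⊙ one 1) ⊙ one k := tens_one_succ _ _
theorem D_succ (k : ℕ) : (D (k + 1) : Q R) = (de ⊙ one 1) ⊙ one k := tens_one_succ _ _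
theorem wh_S (k : ℕ) : wh (S k : Q R) = wh (sw 1 1) ⊙ one k := wh_tens _ _
theorem wh_M (k : ℕ) : wh (M k : Q R) = wh mu ⊙ one k := wh_tens _ _
theorem wh_D (k : ℕ) : wh (D k : Q R) = wh de ⊙ one k := wh_tens _ _

/-- The Yang–Baxter equation: naturality of the symmetry, applied to a crossing and one further
wire. -/
theorem braid (k : ℕ) :
    wh (S k : Q R) * S (k + 1) * wh (S k) = S (k + 1) * wh (S k) * S (k + 1) := by
  have h := tens_mul_sw (R := R) (sw 1 1) (one 1)
  change (sw 1 1 ⊙ one 1) * sw 2 1 = sw 2 1 * (one 1 ⊙ sw 1 1) at h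
  rw [sw_two_one, ← wh] at h
  rw [wh_S, S_succ, ← mul_tens_one, ← mul_tens_one, ← mul_tens_one, ← mul_tens_one, mul_assoc _ _
    (sw 1 1 ⊙ one 1), h]

/-- Naturality of the symmetry for `mu`. The lemmas up to `S_C` are the analogues with the wire on
the other side and for `de`, `et` and `ep`. -/
theorem M_S (k : ℕ) : (M (k + 1) : Q R) * S k = wh (S k) * S (k + 1) * wh (M k) := by
  have h := tens_mul_sw (R := R) mu (one 1)
  change (mu ⊙ one 1) * sw 1 1 = sw 2 1 * (one 1 ⊙ mu) at h
  rw [sw_two_one, ← wh] at h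
  rw [wh_S, S_succ, wh_M, M_succ, S, ← mul_tens_one, ← mul_tens_one, ← mul_tens_one, h]

theorem wh_M_S (k : ℕ) : wh (M k : Q R) * S k = S (k + 1) * wh (S k) * M (k + 1) := by
  have h := tens_mul_sw (R := R) (one 1) mu
  change (one 1 ⊙ mu) * sw 1 1 = sw 1 2 * (mu ⊙ one 1) at h
  rw [sw_one_two, ← wh] at h
  rw [wh_S, S_succ, wh_M, M_succ, S, ← mul_tens_one, ← mul_tens_one, ← mul_tens_one, h]

theorem S_wh_D (k : ℕ) : S k * wh (D k : Q R) = D (k + 1) * wh (S k) * S (k + 1) := by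
  have h := tens_mul_sw (R := R) de (one 1)
  change (de ⊙ one 1) * sw 2 1 = sw 1 1 * (one 1 ⊙ de) at h
  rw [sw_two_one, ← wh] at h
  rw [wh_S, S_succ, wh_D, D_succ, S, ← mul_tens_one, ← mul_tens_one, ← mul_tens_one, ← h, mul_assoc]

theorem S_D (k : ℕ) : S k * (D (k + 1) : Q R) = wh (D k) * S (k + 1) * wh (S k) := by
  have h := tens_mul_sw (R := R) (one 1) de
  change (one 1 ⊙ de) * sw 1 2 = sw 1 1 * (de ⊙ one 1) at h
  rw [sw_one_two, ← wh] at h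
  rw [wh_S, S_succ, wh_D, D_succ, S, ← mul_tens_one, ← mul_tens_one, ← mul_tens_one, ← h, mul_assoc]

theorem E_S (k : ℕ) : (E (k + 1) : Q R) * S k = wh (E k) := by
  have h := tens_mul_sw (R := R) et (one 1)
  change (et ⊙ one 1) * sw 1 1 = sw 0 1 * (one 1 ⊙ et) at h
  rw [zero_sw, one_mul' _ (by simp), ← wh] at h
  rw [E, tens_one_succ, S, ← mul_tens_one, h, E, wh_tens]

theorem S_C (k : ℕ) : (S k : Q R) * C (k + 1) = wh (C k) := by
  have h := tens_mul_sw (R := R) (one 1) ep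
  change (one 1 ⊙ ep) * sw 1 0 = sw 1 1 * (ep ⊙ one 1) at h
  rw [sw_zero, mul_one' _ (by simp), ← wh] at h
  rw [C, tens_one_succ, S, ← mul_tens_one, ← h, C, wh_tens]

theorem M_M (k : ℕ) : (M (k + 1) : Q R) * M k = wh (M k) * M k := by
  rw [M_succ, wh_M, M, ← mul_tens_one, ← mul_tens_one, mu_assoc, wh]

theorem D_D (k : ℕ) : (D k : Q R) * D (k + 1) = D k * wh (D k) := by
  rw [D_succ, wh_D, D, ← mul_tens_one, ← mul_tens_one, de_assoc, wh]

theorem S_M (k : ℕ) : (S k : Q R) * M k = M k := by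
  rw [S, M, ← mul_tens_one, sw_mu]

theorem D_S (k : ℕ) : (D k : Q R) * S k = D k := by
  rw [S, D, ← mul_tens_one, de_sw]

theorem E_M (k : ℕ) : (E (k + 1) : Q R) * M k = one (k + 1) := by
  rw [E, tens_one_succ, M, ← mul_tens_one, et_mu, ← eq_one_tens]

theorem D_C (k : ℕ) : (D k : Q R) * C (k + 1) = one (k + 1) := by
  rw [C, tens_one_succ, D, ← mul_tens_one, de_ep, ← eq_one_tens]

theorem D_M (k : ℕ) : (D k : Q R) * M k = one (k + 1) := by
  rw [M, D, ← mul_tens_one, de_mu, ← eq_one_tens]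

theorem D_wh_M (k : ℕ) : (D (k + 1) : Q R) * wh (M k) = M k * D k := by
  rw [D_succ, wh_M, M, D, ← mul_tens_one, ← mul_tens_one, ← frob_left, wh]

theorem wh_D_M (k : ℕ) : wh (D k : Q R) * M (k + 1) = M k * D k := by
  rw [M_succ, wh_D, M, D, ← mul_tens_one, ← mul_tens_one, ← frob_right, wh]

theorem wh_E_M (k : ℕ) : wh (E k : Q R) * M k = one (k + 1) := by
  rw [← E_S, mul_assoc, S_M, E_M]

theorem D_wh_C (k : ℕ) : (D k : Q R) * wh (C k) = one (k + 1) := by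
  rw [← S_C, ← mul_assoc, D_S, D_C]

/-- A Frobenius law with crossed inner wires: naturality moves the crossing to `mu`, whose
commutativity absorbs it. -/
theorem wh_D_S_wh_M (k : ℕ) : wh (D k : Q R) * S (k + 1) * wh (M k) = M k * D k := by
  have h1 : wh (D k : Q R) * S (k + 1) = S k * D (k + 1) * wh (S k) := by
    rw [S_D, mul_assoc _ (wh (S k)), ← wh_mul, S_S, wh_one, mul_one' _ (by simp)]
  rw [h1, mul_assoc, ← wh_mul, S_M, mul_assoc, D_wh_M, ← mul_assoc, S_M]

/-! ### Joining a wire to a named wire -/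

/-- The wires are named by the members of a list; `J L a` merges a new first wire into wire `a`. -/
def J : List ℕ → ℕ → Q R
  | [], _ => one 0
  | c :: L, a => if a = c then M L.length else S L.length * wh (J L a)

/-- `F L a` makes a copy of wire `a` and puts it first. -/
def F : List ℕ → ℕ → Q R
  | [], _ => one 0
  | c :: L, a => if a = c then D L.length else wh (F L a) * S L.length

theorem J_self (a : ℕ) (L : List ℕ) : (J (a :: L) a : Q R) = M L.length := if_pos rfl
theorem J_ne {a c : ℕ} (h : a ≠ c) (L : List ℕ) :
    (J (c :: L) a : Q R) = S L.length * wh (J L a) := if_neg h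
theorem F_self (a : ℕ) (L : List ℕ) : (F (a :: L) a : Q R) = D L.length := if_pos rfl
theorem F_ne {a c : ℕ} (h : a ≠ c) (L : List ℕ) :
    (F (c :: L) a : Q R) = wh (F L a) * S L.length := if_neg h

theorem mem_tail {a c : ℕ} {L : List ℕ} (h : a ∈ c :: L) (hc : a ≠ c) : a ∈ L :=
  (List.mem_cons.1 h).resolve_left hc

theorem dom_J {L : List ℕ} {a : ℕ} (h : a ∈ L) : (J L a : Q R).dom = L.length + 1 := by
  cases L with
  | nil => simp at h
  | cons c L => by_cases hc : a = c <;> simp [J, hc]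

theorem cod_J {L : List ℕ} {a : ℕ} (h : a ∈ L) : (J L a : Q R).cod = L.length := by
  induction L with
  | nil => simp at h
  | cons c L ih =>
    by_cases hc : a = c
    · simp [J, hc]
    · simp [J, hc, ih (mem_tail h hc)]

theorem dom_F {L : List ℕ} {a : ℕ} (h : a ∈ L) : (F L a : Q R).dom = L.length := by
  induction L with
  | nil => simp at h
  | cons c L ih =>
    by_cases hc : a = c
    · simp [F, hc]
    · simp [F, hc, ih (mem_tail h hc)]

theorem cod_F {L : List ℕ} {a : ℕ} (h : a ∈ L) : (F L a : Q R).cod = L.length + 1 := by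
  cases L with
  | nil => simp at h
  | cons c L => by_cases hc : a = c <;> simp [F, hc]

/-- Associativity of `mu`, carried along the list by naturality of the crossings. -/
theorem M_J {L : List ℕ} {a : ℕ} (h : a ∈ L) : M L.length * J L a = wh (J L a) * (J L a : Q R) := by
  induction L with
  | nil => simp at h
  | cons c L ih =>
    by_cases hc : a = c
    · subst hc
      rw [J_self, List.length_cons, M_M]
    · have h' := mem_tail h hc
      have h1 := M_S (R := R) L.length
      have h2 := congrArg wh (ih h')
      have h3 := S_slide (J L a : Q R) (dom_J h') (cod_J h')
      rw [wh_mul, wh_mul] at h2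
      rw [J_ne hc, List.length_cons, wh_mul]
      grind

/-- Joins commute: by associativity and commutativity of `mu` if both meet the head of the list, by
naturality if one does, and by the Yang–Baxter equation if neither does. `F_wh_F` is the dual
statement. -/
theorem wh_J_J {L : List ℕ} {a b : ℕ} (ha : a ∈ L) (hb : b ∈ L) :
    wh (J L a) * J L b = S L.length * wh (J L b) * (J L a : Q R) := by
  induction L with
  | nil => simp at ha
  | cons c L ih =>
    have hMS := wh_M_S (R := R) L.length
    have hM := M_M (R := R) L.length
    by_cases hac : a = c <;> by_cases hbc : b = c
    · subst hac hbc
      have h1 := M_M (R := R) L.length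
      have h2 := S_M (R := R) (L.length + 1)
      rw [J_self, List.length_cons]
      grind
    · subst hac
      have h' := mem_tail hb hbc
      have h3 := M_slide (J L b : Q R) (dom_J h') (cod_J h')
      rw [J_self, J_ne hbc, List.length_cons, wh_mul]
      grind
    · subst hbc
      have h' := mem_tail ha hac
      have h3 := M_slide (J L a : Q R) (dom_J h') (cod_J h')
      have hs := reassoc (S_S (R := R) (L.length + 1))
      rw [J_self, J_ne hac, List.length_cons, wh_mul, mul_assoc, ← h3]
      simp only [mul_assoc]
      rw [reassoc hMS]
      simp only [mul_assoc]
      rw [hs, one_mul' _ (by simp)]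
    · have ha' := mem_tail ha hac
      have hb' := mem_tail hb hbc
      have h2 := congrArg wh (ih ha' hb')
      have h3 := S_slide (J L a : Q R) (dom_J ha') (cod_J ha')
      have h4 := S_slide (J L b : Q R) (dom_J hb') (cod_J hb')
      have yb := braid (R := R) L.length
      simp only [wh_mul] at h2
      rw [J_ne hac, J_ne hbc, List.length_cons, wh_mul, wh_mul]
      simp only [mul_assoc]
      rw [reassoc h3]
      simp only [mul_assoc]
      rw [h2, reassoc h4]
      simp only [mul_assoc]
      rw [reassoc₃ yb]
      simp only [mul_assoc]

theorem F_D {L : List ℕ} {a : ℕ} (h : a ∈ L) : F L a * D L.length = F L a * wh (F L a : Q R) := by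
  induction L with
  | nil => simp at h
  | cons c L ih =>
    by_cases hc : a = c
    · subst hc
      rw [F_self, List.length_cons, D_D]
    · have h' := mem_tail h hc
      have h1 := S_D (R := R) L.length
      have h2 := congrArg wh (ih h')
      have h3 := S_slide (F L a : Q R) (dom_F h') (cod_F h')
      rw [wh_mul, wh_mul] at h2
      rw [F_ne hc, List.length_cons, wh_mul, mul_assoc, h1]
      simp only [mul_assoc]
      rw [reassoc h2, mul_assoc, reassoc h3]
      simp only [mul_assoc]

theorem F_wh_F {L : List ℕ} {a b : ℕ} (ha : a ∈ L) (hb : b ∈ L) :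
    F L b * wh (F L a) = F L a * wh (F L b) * (S L.length : Q R) := by
  induction L with
  | nil => simp at ha
  | cons c L ih =>
    have hSD := S_wh_D (R := R) L.length
    by_cases hac : a = c <;> by_cases hbc : b = c
    · subst hac hbc
      have h1 := D_D (R := R) L.length
      have h2 := D_S (R := R) (L.length + 1)
      rw [F_self, List.length_cons, ← h1, mul_assoc, h2]
    · subst hac
      have h' := mem_tail hb hbc
      have h3 := D_slide (F L b : Q R) (dom_F h') (cod_F h')
      rw [F_self, F_ne hbc, List.length_cons, wh_mul, mul_assoc, hSD]
      simp only [mul_assoc]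
      rw [reassoc h3.symm]
      simp only [mul_assoc]
    · subst hbc
      have h' := mem_tail ha hac
      have h3 := D_slide (F L a : Q R) (dom_F h') (cod_F h')
      rw [F_self, F_ne hac, List.length_cons, wh_mul, mul_assoc (wh _ * _), mul_assoc,
        ← mul_assoc (S _), hSD]
      simp only [mul_assoc]
      rw [S_S, mul_one' _ (by simp), reassoc h3]
      simp only [mul_assoc]
    · have ha' := mem_tail ha hac
      have hb' := mem_tail hb hbc
      have h2 := congrArg wh (ih ha' hb')
      have h3 := S_slide (F L a : Q R) (dom_F ha') (cod_F ha')
      have h4 := S_slide (F L b : Q R) (dom_F hb') (cod_F hb')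
      have yb := braid (R := R) L.length
      simp only [wh_mul, mul_assoc] at h2 yb
      rw [F_ne hac, F_ne hbc, List.length_cons, wh_mul, wh_mul]
      simp only [mul_assoc]
      rw [reassoc h3.symm, reassoc h4.symm]
      simp only [mul_assoc]
      rw [reassoc h2]
      simp only [mul_assoc]
      rw [yb]

theorem E_J {L : List ℕ} {a : ℕ} (h : a ∈ L) : E L.length * J L a = (one L.length : Q R) := by
  induction L with
  | nil => simp at h
  | cons c L ih =>
    by_cases hc : a = c
    · subst hc
      rw [J_self, List.length_cons, E_M]
    · rw [J_ne hc, List.length_cons, ← mul_assoc, E_S, ← wh_mul, ih (mem_tail h hc), wh_one]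

theorem F_C {L : List ℕ} {a : ℕ} (h : a ∈ L) : F L a * C L.length = (one L.length : Q R) := by
  induction L with
  | nil => simp at h
  | cons c L ih =>
    by_cases hc : a = c
    · subst hc
      rw [F_self, List.length_cons, D_C]
    · rw [F_ne hc, List.length_cons, mul_assoc, S_C, ← wh_mul, ih (mem_tail h hc), wh_one]

/-- The Frobenius law in its crossed form if both wires are the head of the list, naturality
otherwise. The wires `a` and `b` may be the same. -/
theorem J_F {L : List ℕ} {a b : ℕ} (ha : a ∈ L) (hb : b ∈ L) :
    J L a * F L b = wh (F L b) * S L.length * wh (J L a : Q R) := by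
  induction L with
  | nil => simp at ha
  | cons c L ih =>
    by_cases hac : a = c <;> by_cases hbc : b = c
    · subst hac hbc
      rw [F_self, J_self, List.length_cons, wh_D_S_wh_M]
    · subst hac
      have h' := mem_tail hb hbc
      have h3 := M_slide (F L b : Q R) (dom_F h') (cod_F h')
      have hMS := M_S (R := R) L.length
      rw [J_self, F_ne hbc, List.length_cons, wh_mul]
      simp only [mul_assoc]
      rw [reassoc h3, mul_assoc, hMS]
      simp only [mul_assoc]
    · subst hbc
      have h' := mem_tail ha hac
      have h3 := D_slide (J L a : Q R) (dom_J h') (cod_J h')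
      have hSD := S_D (R := R) L.length
      rw [F_self, J_ne hac, List.length_cons, wh_mul, mul_assoc, ← h3]
      simp only [mul_assoc]
      rw [reassoc hSD]
      simp only [mul_assoc]
    · have ha' := mem_tail ha hac
      have hb' := mem_tail hb hbc
      have h2 := congrArg wh (ih ha' hb')
      have h3 := S_slide (J L a : Q R) (dom_J ha') (cod_J ha')
      have h4 := S_slide (F L b : Q R) (dom_F hb') (cod_F hb')
      have yb := braid (R := R) L.length
      simp only [wh_mul, mul_assoc] at h2 yb
      rw [J_ne hac, F_ne hbc, List.length_cons, wh_mul, wh_mul]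
      simp only [mul_assoc]
      rw [reassoc h2]
      simp only [mul_assoc]
      rw [h3, reassoc h4.symm]
      simp only [mul_assoc]
      rw [reassoc₃ (braid (R := R) L.length)]
      simp only [mul_assoc]

/-- For a join and a copy at the same wire the uncrossed Frobenius laws are available too; this form
and the next one are used when two nodes are identified. -/
theorem J_F_self {L : List ℕ} {a : ℕ} (h : a ∈ L) :
    J L a * F L a = D L.length * wh (J L a : Q R) := by
  induction L with
  | nil => simp at h
  | cons c L ih =>
    by_cases hc : a = c
    · subst hc
      rw [J_self, F_self, List.length_cons, D_wh_M]
    · have h' := mem_tail h hc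
      have h2 := congrArg wh (ih h')
      have h3 := S_slide (J L a : Q R) (dom_J h') (cod_J h')
      have h4 := S_wh_D (R := R) L.length
      simp only [wh_mul] at h2
      rw [J_ne hc, F_ne hc, List.length_cons, wh_mul]
      simp only [mul_assoc]
      rw [reassoc h2, mul_assoc, h3, reassoc h4]
      simp only [mul_assoc]
      rw [reassoc (S_S _), one_mul' _ (by simp [dom_J h'])]

theorem J_F_self' {L : List ℕ} {a : ℕ} (h : a ∈ L) :
    J L a * F L a = wh (F L a) * (M L.length : Q R) := by
  induction L with
  | nil => simp at h
  | cons c L ih =>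
    by_cases hc : a = c
    · subst hc
      rw [J_self, F_self, List.length_cons, wh_D_M]
    · have h' := mem_tail h hc
      have h2 := congrArg wh (ih h')
      have h3 := S_slide (F L a : Q R) (dom_F h') (cod_F h')
      have h4 := wh_M_S (R := R) L.length
      simp only [wh_mul] at h2
      rw [J_ne hc, F_ne hc, List.length_cons, wh_mul]
      simp only [mul_assoc]
      rw [reassoc h2, mul_assoc, h4, reassoc h3.symm]
      simp only [mul_assoc]
      rw [reassoc (S_S _), one_mul' _ (by simp)]

/-! ### Edges -/

/-- A conductance on the first wire. -/
def W (y : R) (k : ℕ) : Q R := cd y ⊙ one k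

@[simp] theorem dom_W (y : R) (k : ℕ) : (W y k).dom = k + 1 := Nat.add_comm 1 _
@[simp] theorem cod_W (y : R) (k : ℕ) : (W y k).cod = k + 1 := Nat.add_comm 1 _

theorem W_slide {k l : ℕ} (y : R) (f : Q R) (hd : f.dom = k) (hc : f.cod = l) :
    W y k * wh f = wh f * W y l := by
  subst hd hc
  exact slide (cd y) f

theorem W_S (y : R) (k : ℕ) : W y (k + 1) * S k = S k * wh (W y k) := by
  have h := tens_mul_sw (cd y) (one 1)
  change (cd y ⊙ one 1) * sw 1 1 = sw 1 1 * (one 1 ⊙ cd y) at h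
  rw [← wh] at h
  rw [W, tens_one_succ, S, ← mul_tens_one, h, W, wh_tens, mul_tens_one]

theorem mk_cup : mk (cup : CircuitTerm R) = et * de := by
  have h := D_wh_C (R := R) 0
  rw [D, C, tens_one_zero, tens_one_zero, wh] at h
  simp only [cup, spider, merge, split, mk_comp, mk_tensor]
  change et * (de * (one 1 ⊙ (de * (one 1 ⊙ ep)))) = _
  rw [h, one_tens_one]
  exact congrArg _ (mul_one' de rfl)

theorem mk_cap : mk (cap : CircuitTerm R) = mu * ep := by
  have h := wh_E_M (R := R) 0
  rw [E, M, tens_one_zero, tens_one_zero, wh] at h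
  simp only [cap, spider, merge, split, mk_comp, mk_tensor]
  change (one 1 ⊙ ((one 1 ⊙ et) * mu)) * mu * ep = _
  rw [h, one_tens_one]
  exact congrArg (· * ep) (one_mul' mu rfl)

theorem snake_cd (y : R) :
    wh (E 0) * wh (D 0) * wh (W y 1) * M 1 * C 1 = W y 0 := by
  have h : mk (id 1 ⊠ cup ⨟ id 1 ⊠ cond y ⊠ id 1 ⨟ cap ⊠ id 1) = cd y := by
    refine mk_eq_mk.2 ⟨rfl, rfl, fun h => ?_⟩
    have hy : y ≠ 0 := by
      rcases h with h | h
      · simpa [WellFormed] using h.1.2.1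
      · exact h
    refine .law (.self_adjoint y) (typed_iff.2 ⟨?_, rfl, rfl⟩) (typed_iff.2 ⟨hy, rfl, rfl⟩)
    simp [WellFormed, cup, cap, spider, merge, split, CircuitTerm.dom, CircuitTerm.cod, hy]
  simp only [mk_comp, mk_tensor, mk_cup, mk_cap] at h
  rw [show W y 0 = cd y from tens_one_zero _, ← h, E, D, tens_one_zero, tens_one_zero, M, C, W]
  change _ = (one 1 ⊙ (et * de)) * (one 1 ⊙ cd y ⊙ one 1) * ((mu * ep) ⊙ one 1)
  rw [mul_tens_one, ← wh, ← wh, wh_mul]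
  simp only [mul_assoc]

/-- Self-adjointness moves a conductance from one leg of a cup to the other, and the cup itself is
symmetric; so the crossing can be dropped. -/
theorem E_D_W_S (y : R) (k : ℕ) :
    E k * D k * W y (k + 1) * S k = E k * D k * W y (k + 1) := by
  have h0 : E 0 * D 0 * wh (W y 0) = E 0 * D 0 * W y 1 := by
    -- A plain cup and a cup that carries `y` may be created in either order. The second cup comes
    -- from `snake_cd`, by which `W y 0` is rewritten below.
    have h1 : E 0 * D 0 * wh (wh (E 0 * D 0 * W y 1)) = E 0 * D 0 * W y 1 * E 2 * D 2 := by
      rw [mul_assoc, D_slide (k := 0) (l := 2) _ (by simp) (by simp), ← mul_assoc,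
        E_slide (k := 0) (l := 2) _ (by simp) (by simp)]
    rw [← snake_cd]
    simp only [wh_mul] at h1 ⊢
    have h2 := D_wh_M (R := R) 1
    have h3 := E_M (R := R) 1
    have h4 := D_wh_C (R := R) 1
    calc _ = E 0 * D 0 * (wh (wh (E 0)) * wh (wh (D 0)) * wh (wh (W y 1))) * wh (M 1) * wh (C 1) := by
          simp only [mul_assoc]
      _ = E 0 * D 0 * W y 1 * (E 2 * ((D 2 * wh (M 1)) * wh (C 1))) := by
          rw [h1]; simp only [mul_assoc]
      _ = _ := by
          rw [h2, mul_assoc (M 1), h4, mul_one' (M 1) (by simp), h3, mul_one' _ (by simp)]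
  have h5 : E 0 * D 0 * W y 1 * S 0 = E 0 * D 0 * W y 1 := by
    rw [← h0, h0, mul_assoc, W_S, mul_assoc, ← mul_assoc (D 0), D_S, ← mul_assoc, h0]
  have h6 := congrArg (· ⊙ one k) h5
  simp only [mul_tens_one] at h6
  simp only [E, D, W, S, tens_assoc, one_tens_one, Nat.zero_add, Nat.add_comm 1] at h6 ⊢
  exact h6

/-- `link L a b y` puts the conductance `y` between the wires `a` and `b`. -/
def link (L : List ℕ) (a b : ℕ) (y : R) : Q R := F L a * W y L.length * J L b

/-- By the Frobenius and unit laws copies can be expressed by joins, so that statements about `link`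
need only the behaviour of joins. -/
theorem F_eq {L : List ℕ} {a : ℕ} (h : a ∈ L) :
    F L a = E L.length * D L.length * wh (J L a : Q R) := by
  rw [mul_assoc, ← J_F_self h, ← mul_assoc, E_J h, one_mul' _ (dom_F h)]

/-- In this form a conductance is a cup with `y` on one leg and both legs joined to wires. That it
has no direction (`link_comm`) then follows from `wh_J_J` and `E_D_W_S`. -/
theorem link_eq {L : List ℕ} {a b : ℕ} (ha : a ∈ L) (y : R) :
    link L a b y = E L.length * D L.length * W y (L.length + 1) * wh (J L a) * J L b := by
  rw [link, F_eq ha, mul_assoc _ (wh _) (W _ _), ← W_slide y _ (dom_J ha) (cod_J ha)]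
  simp only [mul_assoc]

theorem link_comm {L : List ℕ} {a b : ℕ} (ha : a ∈ L) (hb : b ∈ L) (y : R) :
    link L a b y = link L b a y := by
  rw [link_eq ha, link_eq hb, mul_assoc, wh_J_J ha hb, ← mul_assoc, ← mul_assoc, E_D_W_S]

@[simp] theorem dom_link {L : List ℕ} {a : ℕ} (ha : a ∈ L) (b : ℕ) (y : R) :
    (link L a b y).dom = L.length := by simp [link, dom_F ha]
@[simp] theorem cod_link {L : List ℕ} {b : ℕ} (a : ℕ) (hb : b ∈ L) (y : R) :
    (link L a b y).cod = L.length := by simp [link, cod_J hb]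

end Q
end ResistorCircuit

namespace ResistorCircuit
open CircuitTerm
variable {R : Type*} [CommSemiring R]
namespace Q

/-! ### Legs and edges attached to named nodes -/

/-- `k` new wires. -/
def Un : ℕ → Q R
  | 0 => one 0
  | k + 1 => Un k * E k

/-- `k` wires end. -/
def CoUn : ℕ → Q R
  | 0 => one 0
  | k + 1 => C k * CoUn k

/-- Inputs attached to the named nodes. -/
def legsI (L : List ℕ) : List ℕ → Q R
  | [] => Un L.length
  | a :: l => wh (legsI L l) * J L a

/-- Outputs attached to the named nodes. -/
def legsO (L : List ℕ) : List ℕ → Q R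
  | [] => CoUn L.length
  | a :: l => F L a * wh (legsO L l)

/-- Conductances between the named nodes. -/
def links (L : List ℕ) : List (ℕ × ℕ × R) → Q R
  | [] => one L.length
  | e :: es => link L e.1 e.2.1 e.2.2 * links L es

@[simp] theorem cod_Un (k : ℕ) : (Un k : Q R).cod = k := by cases k <;> simp [Un]
@[simp] theorem dom_CoUn (k : ℕ) : (CoUn k : Q R).dom = k := by cases k <;> simp [CoUn]
@[simp] theorem cod_CoUn (k : ℕ) : (CoUn k : Q R).cod = 0 := by induction k <;> simp [CoUn, *]

theorem cod_legsI {L l : List ℕ} (h : l ⊆ L) : (legsI L l : Q R).cod = L.length := by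
  cases l with
  | nil => simp [legsI]
  | cons a l => simp [legsI, cod_J (h (List.mem_cons_self))]

theorem cod_legsO (L l : List ℕ) : (legsO L l : Q R).cod = l.length := by
  induction l <;> simp [legsO, *]

theorem dom_legsO {L l : List ℕ} (h : l ⊆ L) : (legsO L l : Q R).dom = L.length := by
  cases l with
  | nil => simp [legsO]
  | cons a l => simp [legsO, dom_F (h (List.mem_cons_self))]

/-- The ends of the edges are among the nodes. -/
def EdgesIn {α : Type*} (L : List ℕ) (es : List (ℕ × ℕ × α)) : Prop :=
  ∀ e ∈ es, e.1 ∈ L ∧ e.2.1 ∈ L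

theorem EdgesIn.tail {α : Type*} {L : List ℕ} {e : ℕ × ℕ × α} {es : List (ℕ × ℕ × α)}
    (h : EdgesIn L (e :: es)) : EdgesIn L es := fun f hf => h f (List.mem_cons_of_mem _ hf)

theorem EdgesIn.head {α : Type*} {L : List ℕ} {e : ℕ × ℕ × α} {es : List (ℕ × ℕ × α)}
    (h : EdgesIn L (e :: es)) : e.1 ∈ L ∧ e.2.1 ∈ L := h e (List.mem_cons_self)

theorem dom_links {L : List ℕ} {es : List (ℕ × ℕ × R)} (h : EdgesIn L es) :
    (links L es).dom = L.length := by
  cases es with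
  | nil => rfl
  | cons e es => simp [links, dom_link h.head.1]

theorem cod_links {L : List ℕ} {es : List (ℕ × ℕ × R)} (h : EdgesIn L es) :
    (links L es).cod = L.length := by
  induction es with
  | nil => rfl
  | cons e es ih => simp [links, ih h.tail]

theorem links_append {L : List ℕ} {es fs : List (ℕ × ℕ × R)} (h : EdgesIn L fs) :
    links L (es ++ fs) = links L es * links L fs := by
  induction es with
  | nil => simp [links, one_mul' _ (dom_links h)]
  | cons e es ih => simp [links, ih, mul_assoc]

/-! ### Circuits that act on names -/

/-- Joining wire `a` and then applying `f` is applying `f` and then joining wire `σ a`. -/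
structure JPush (f : Q R) (L L' : List ℕ) (σ : ℕ → ℕ) : Prop where
  dom_eq : f.dom = L.length
  cod_eq : f.cod = L'.length
  mem : ∀ a ∈ L, σ a ∈ L'
  push : ∀ a ∈ L, J L a * f = wh f * J L' (σ a)

/-- Copying wire `a` beside `f` is applying `f` and then copying wire `σ a`. -/
structure FPush (f : Q R) (L L' : List ℕ) (σ : ℕ → ℕ) : Prop where
  dom_eq : f.dom = L.length
  cod_eq : f.cod = L'.length
  mem : ∀ a ∈ L, σ a ∈ L'
  push : ∀ a ∈ L, F L a * wh f = f * F L' (σ a)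

/-- Relabelling the ends of edges. -/
def mapEdges {α : Type*} (σ : ℕ → ℕ) (es : List (ℕ × ℕ × α)) : List (ℕ × ℕ × α) :=
  es.map fun e => (σ e.1, σ e.2.1, e.2.2)

theorem FPush.comp {f g : Q R} {L L' L'' : List ℕ} {σ τ : ℕ → ℕ} (hf : FPush f L L' σ)
    (hg : FPush g L' L'' τ) : FPush (f * g) L L'' (fun a => τ (σ a)) where
  dom_eq := by simp [hf.dom_eq]
  cod_eq := by simp [hg.cod_eq]
  mem a ha := hg.mem _ (hf.mem _ ha)
  push a ha := by
    rw [wh_mul, ← mul_assoc, hf.push a ha, mul_assoc, hg.push _ (hf.mem _ ha), mul_assoc]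

theorem JPush.comp {f g : Q R} {L L' L'' : List ℕ} {σ τ : ℕ → ℕ} (hf : JPush f L L' σ)
    (hg : JPush g L' L'' τ) : JPush (f * g) L L'' (fun a => τ (σ a)) where
  dom_eq := by simp [hf.dom_eq]
  cod_eq := by simp [hg.cod_eq]
  mem a ha := hg.mem _ (hf.mem _ ha)
  push a ha := by
    rw [wh_mul, ← mul_assoc, hf.push a ha, mul_assoc, hg.push _ (hf.mem _ ha), mul_assoc]

theorem FPush.refl (L : List ℕ) : FPush (one L.length : Q R) L L fun a => a where
  dom_eq := rfl
  cod_eq := rfl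
  mem _ ha := ha
  push a ha := by rw [wh_one, mul_one' _ (cod_F ha), one_mul' _ (dom_F ha)]

theorem JPush.refl (L : List ℕ) : JPush (one L.length : Q R) L L fun a => a where
  dom_eq := rfl
  cod_eq := rfl
  mem _ ha := ha
  push a ha := by rw [wh_one, mul_one' _ (cod_J ha), one_mul' _ (dom_J ha)]

theorem JPush.legsI {f : Q R} {L L' : List ℕ} {σ : ℕ → ℕ} (hf : JPush f L L' σ)
    (hu : Un L.length * f = Un L'.length) {l : List ℕ} (hl : l ⊆ L) :
    legsI L l * f = legsI L' (l.map σ) := by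
  induction l with
  | nil => exact hu
  | cons a l ih =>
    rw [List.map_cons, Q.legsI, mul_assoc, hf.push a (hl List.mem_cons_self), ← mul_assoc,
      ← wh_mul, ih fun x hx => hl (List.mem_cons_of_mem _ hx), Q.legsI]

/-- By `link_eq` a conductance is a cup whose legs are joined to wires. The cup slides past `f`, so
it is enough that joins can be pushed through `f`. -/
theorem JPush.link {f : Q R} {L L' : List ℕ} {σ : ℕ → ℕ} (hf : JPush f L L' σ) {a b : ℕ}
    (ha : a ∈ L) (hb : b ∈ L) (y : R) :
    link L a b y * f = f * link L' (σ a) (σ b) y := by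
  have h1 := E_slide f hf.dom_eq hf.cod_eq
  have h2 := D_slide f hf.dom_eq hf.cod_eq
  have h3 := W_slide y (wh f) (k := L.length + 1) (l := L'.length + 1)
    (by simp [hf.dom_eq]) (by simp [hf.cod_eq])
  have h4 := congrArg wh (hf.push a ha)
  rw [wh_mul, wh_mul] at h4
  rw [link_eq ha, link_eq (hf.mem a ha)]
  simp only [mul_assoc]
  rw [hf.push b hb, reassoc h4, mul_assoc, reassoc h3, mul_assoc, reassoc h2, mul_assoc, reassoc h1,
    mul_assoc]

theorem JPush.links {f : Q R} {L L' : List ℕ} {σ : ℕ → ℕ} (hf : JPush f L L' σ)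
    {es : List (ℕ × ℕ × R)} (hes : EdgesIn L es) :
    links L es * f = f * links L' (mapEdges σ es) := by
  induction es with
  | nil => simp [Q.links, mapEdges, one_mul' _ hf.dom_eq, mul_one' _ hf.cod_eq]
  | cons e es ih =>
    rw [Q.links, mul_assoc, ih hes.tail, ← mul_assoc, hf.link hes.head.1 hes.head.2, mul_assoc]
    rfl

/-- Reduces the action of `g` on the last outputs to the case with no outputs in front: the outputs
`A` are copies of wires, and these pass `f`. -/
theorem FPush.legsO {f g : Q R} {L L' : List ℕ} {σ : ℕ → ℕ} (hf : FPush f L L' σ)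
    {l l' : List ℕ} (h : legsO L l * g = f * legsO L' l') {A : List ℕ} (hA : A ⊆ L) :
    legsO L (A ++ l) * (one A.length ⊙ g) = f * legsO L' (A.map σ ++ l') := by
  induction A with
  | nil => rwa [List.length_nil, one_zero_tens]
  | cons a A ih =>
    rw [List.length_cons, one_succ_tens, List.cons_append, Q.legsO, mul_assoc, ← wh_mul,
      ih fun x hx => hA (List.mem_cons_of_mem _ hx), wh_mul, ← mul_assoc,
      hf.push a (hA List.mem_cons_self), mul_assoc]
    rfl

theorem wh_E_S (k : ℕ) : wh (E k : Q R) * S k = E (k + 1) := by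
  rw [← E_S, mul_S_S _ _ (by simp)]

theorem S_wh_C (k : ℕ) : S k * wh (C k : Q R) = C (k + 1) := by
  rw [← S_C, S_S_mul _ _ (by simp)]

theorem fpush_E {L : List ℕ} {v : ℕ} (hv : v ∉ L) :
    FPush (E L.length : Q R) L (v :: L) fun a => a where
  dom_eq := by simp
  cod_eq := by simp
  mem a ha := List.mem_cons_of_mem _ ha
  push a ha := by
    rw [F_ne (by rintro rfl; exact hv ha), ← mul_assoc, E_slide _ (dom_F ha) (cod_F ha), mul_assoc,
      E_S]

theorem jpush_E {L : List ℕ} {v : ℕ} (hv : v ∉ L) :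
    JPush (E L.length : Q R) L (v :: L) fun a => a where
  dom_eq := by simp
  cod_eq := by simp
  mem a ha := List.mem_cons_of_mem _ ha
  push a ha := by
    rw [J_ne (by rintro rfl; exact hv ha), ← mul_assoc, wh_E_S, E_slide _ (dom_J ha) (cod_J ha)]

/-- The substitution of `a` for `b`. -/
def subst (b a x : ℕ) : ℕ := if x = b then a else x

theorem subst_self (b a : ℕ) : subst b a b = a := if_pos rfl
theorem subst_ne {b a x : ℕ} (h : x ≠ b) : subst b a x = x := if_neg h

theorem subst_mem {L : List ℕ} {a b x : ℕ} (ha : a ∈ L) (hx : x ∈ b :: L) : subst b a x ∈ L := by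
  unfold subst
  split
  · exact ha
  · exact mem_tail hx ‹_›

/-- `J L a` acts on networks as the identification of the first node `b` with `a`; this is why names
change by `subst b a`. -/
theorem jpush_J {L : List ℕ} {a : ℕ} (b : ℕ) (ha : a ∈ L) :
    JPush (J L a : Q R) (b :: L) L (subst b a) where
  dom_eq := dom_J ha
  cod_eq := cod_J ha
  mem x hx := subst_mem ha hx
  push x hx := by
    by_cases h : x = b
    · subst h
      rw [J_self, subst_self, M_J ha]
    · rw [J_ne h, subst_ne h, wh_J_J ha (mem_tail hx h)]

theorem fpush_J {L : List ℕ} {a : ℕ} (b : ℕ) (ha : a ∈ L) :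
    FPush (J L a : Q R) (b :: L) L (subst b a) where
  dom_eq := dom_J ha
  cod_eq := cod_J ha
  mem x hx := subst_mem ha hx
  push x hx := by
    by_cases h : x = b
    · subst h
      rw [F_self, subst_self, J_F_self ha]
    · rw [F_ne h, subst_ne h, J_F ha (mem_tail hx h)]

theorem Un_J {L : List ℕ} {a : ℕ} (ha : a ∈ L) :
    (Un (L.length + 1) : Q R) * J L a = Un L.length := by
  rw [Un, mul_assoc, E_J ha, mul_one' _ (by simp)]

theorem jpush_link {L : List ℕ} {a b : ℕ} (ha : a ∈ L) (hb : b ∈ L) (y : R) :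
    JPush (link L a b y) L L fun x => x where
  dom_eq := dom_link ha b y
  cod_eq := cod_link a hb y
  mem _ hx := hx
  push x hx := by
    -- Joining a wire with a new name to `x` is itself a circuit to which `JPush.link` applies. The
    -- name `L.sum + 1` exceeds every member of `L`.
    have h := (jpush_J (R := R) (L.sum + 1) hx).link (List.mem_cons_of_mem _ ha)
      (List.mem_cons_of_mem _ hb) y
    have hn : ∀ c ∈ L, c ≠ L.sum + 1 := fun c hc h' => by
      have := List.le_sum_of_mem hc
      omega
    rw [subst_ne (hn a ha), subst_ne (hn b hb)] at h
    rw [← h, Q.link, F_ne (hn a ha), J_ne (hn b hb), List.length_cons, Q.link]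
    simp only [wh_mul]
    have h1 := W_S y L.length
    rw [mul_assoc (wh (F L a)), mul_assoc (wh (F L a)), mul_assoc (S _), ← mul_assoc (W y _), h1]
    simp only [mul_assoc]
    rw [reassoc (S_S _), ← mul_assoc (one _), one_mul' _ (by simp)]

theorem fpush_link {L : List ℕ} {a b : ℕ} (ha : a ∈ L) (hb : b ∈ L) (y : R) :
    FPush (link L a b y) L L fun x => x where
  dom_eq := dom_link ha b y
  cod_eq := cod_link a hb y
  mem _ hx := hx
  push x hx := by
    have h1 := F_wh_F (R := R) ha hx
    have h2 := J_F (R := R) hb hx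
    have h3 := W_slide y (F L x) (dom_F hx) (cod_F hx)
    have h4 := W_S y L.length
    have h5 : S L.length * W y (L.length + 1) * S L.length = wh (W y L.length) := by
      rw [mul_assoc, h4, S_S_mul _ _ (by simp)]
    rw [Q.link]
    simp only [mul_assoc, wh_mul]
    rw [h2, reassoc h1]
    simp only [mul_assoc]
    rw [reassoc h3, mul_assoc, ← h5]
    simp only [mul_assoc]
    rw [reassoc (S_S _), one_mul' _ (by simp)]

/-! ### The order of the nodes and of the edges -/

/-- A circuit that reorders the nodes. -/
structure Reorder (f : Q R) (L L' : List ℕ) : Prop where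
  toJPush : JPush f L L' fun a => a
  toFPush : FPush f L L' fun a => a
  un : Un L.length * f = Un L'.length
  coun : f * CoUn L'.length = CoUn L.length

theorem Reorder.cons {f : Q R} {L L' : List ℕ} (h : Reorder f L L') (c : ℕ) :
    Reorder (wh f) (c :: L) (c :: L') where
  toJPush := {
    dom_eq := by simp [h.toFPush.dom_eq]
    cod_eq := by simp [h.toFPush.cod_eq]
    mem := fun a ha => by
      have := h.toFPush.mem a
      simp only [List.mem_cons] at *
      tauto
    push := fun a ha => by
      by_cases hc : a = c
      · subst hc
        rw [J_self, J_self, M_slide f h.toFPush.dom_eq h.toFPush.cod_eq]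
      · rw [J_ne hc, J_ne hc, mul_assoc, ← wh_mul, h.toJPush.push a (mem_tail ha hc), wh_mul,
          ← mul_assoc, ← S_slide f h.toFPush.dom_eq h.toFPush.cod_eq, mul_assoc] }
  toFPush := {
    dom_eq := by simp [h.toFPush.dom_eq]
    cod_eq := by simp [h.toFPush.cod_eq]
    mem := fun a ha => by
      have := h.toFPush.mem a
      simp only [List.mem_cons] at *
      tauto
    push := fun a ha => by
      by_cases hc : a = c
      · subst hc
        rw [F_self, F_self, D_slide f h.toFPush.dom_eq h.toFPush.cod_eq]
      · rw [F_ne hc, F_ne hc, mul_assoc, ← S_slide f h.toFPush.dom_eq h.toFPush.cod_eq, ← mul_assoc, ← wh_mul,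
          h.toFPush.push a (mem_tail ha hc), wh_mul, mul_assoc] }
  un := by
    rw [List.length_cons, List.length_cons, Un, Un, mul_assoc, E_slide f h.toFPush.dom_eq h.toFPush.cod_eq,
      ← mul_assoc, h.un]
  coun := by
    rw [List.length_cons, List.length_cons, CoUn, CoUn, ← mul_assoc, ← C_slide f h.toFPush.dom_eq h.toFPush.cod_eq,
      mul_assoc, h.coun]

theorem Reorder.refl (L : List ℕ) : Reorder (one L.length : Q R) L L where
  toJPush := .refl L
  toFPush := .refl L
  un := mul_one' _ (by simp)
  coun := one_mul' _ (by simp)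

theorem Reorder.comp {f g : Q R} {L L' L'' : List ℕ} (hf : Reorder f L L')
    (hg : Reorder g L' L'') : Reorder (f * g) L L'' where
  toJPush := hf.toJPush.comp hg.toJPush
  toFPush := hf.toFPush.comp hg.toFPush
  un := by rw [← mul_assoc, hf.un, hg.un]
  coun := by rw [mul_assoc, hg.coun, hf.coun]

theorem reorder_swap {a b : ℕ} (h : a ≠ b) (L : List ℕ) :
    Reorder (S L.length : Q R) (a :: b :: L) (b :: a :: L) where
  toJPush := {
    dom_eq := by simp
    cod_eq := by simp
    mem := fun x hx => by
      simp only [List.mem_cons] at *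
      tauto
    push := fun x hx => by
      by_cases hxa : x = a
      · subst hxa
        rw [J_self, J_ne h, J_self, List.length_cons, List.length_cons, M_S, mul_assoc]
      · by_cases hxb : x = b
        · subst hxb
          rw [J_self, J_ne hxa, J_self, List.length_cons, List.length_cons, mul_assoc, wh_M_S,
            mul_assoc, S_S_mul _ _ (by simp)]
        · have hm := mem_tail (mem_tail hx hxa) hxb
          have h3 := S_slide (J L x : Q R) (dom_J hm) (cod_J hm)
          rw [J_ne hxa, J_ne hxb, J_ne hxb, J_ne hxa, List.length_cons, List.length_cons]
          simp only [wh_mul, mul_assoc]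
          rw [h3, reassoc₃ (braid _)]
          simp only [mul_assoc] }
  toFPush := {
    dom_eq := by simp
    cod_eq := by simp
    mem := fun x hx => by
      simp only [List.mem_cons] at *
      tauto
    push := fun x hx => by
      by_cases hxa : x = a
      · subst hxa
        rw [F_self, F_ne h, F_self, List.length_cons, List.length_cons, ← mul_assoc, S_wh_D,
          mul_S_S _ _ (by simp)]
      · by_cases hxb : x = b
        · subst hxb
          rw [F_self, F_ne hxa, F_self, List.length_cons, List.length_cons, S_D]
        · have hm := mem_tail (mem_tail hx hxa) hxb
          have h3 := S_slide (F L x : Q R) (dom_F hm) (cod_F hm)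
          have yb := braid (R := R) L.length
          rw [F_ne hxa, F_ne hxb, F_ne hxb, F_ne hxa, List.length_cons, List.length_cons]
          simp only [wh_mul, mul_assoc] at yb ⊢
          rw [reassoc h3.symm, mul_assoc, yb] }
  un := by
    rw [List.length_cons, List.length_cons, List.length_cons, List.length_cons, Un, Un, mul_assoc,
      mul_assoc, E_S, E_slide (l := L.length + 1) _ (by simp) (by simp), mul_assoc]
  coun := by
    rw [List.length_cons, List.length_cons, List.length_cons, List.length_cons, CoUn, CoUn,
      ← mul_assoc, ← mul_assoc, S_C, ← C_slide (k := L.length + 1) _ (by simp) (by simp), mul_assoc]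

/-- Permutations of a list are generated by exchanges of neighbours, and these are crossings. -/
theorem exists_reorder {L L' : List ℕ} (h : L.Perm L') (hL : L.Nodup) :
    ∃ f : Q R, Reorder f L L' := by
  induction h with
  | nil => exact ⟨_, .refl []⟩
  | cons c _ ih =>
    obtain ⟨f, hf⟩ := ih hL.of_cons
    exact ⟨_, hf.cons c⟩
  | swap a b L =>
    refine ⟨_, reorder_swap ?_ L⟩
    simp only [List.nodup_cons, List.mem_cons] at hL
    tauto
  | trans h1 _ ih1 ih2 =>
    obtain ⟨f, hf⟩ := ih1 hL
    obtain ⟨g, hg⟩ := ih2 (h1.nodup_iff.1 hL)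
    exact ⟨_, hf.comp hg⟩

/-- Edges commute: a conductance lets joins pass (`jpush_link`), and therefore other conductances.
-/
theorem links_perm {L : List ℕ} {es fs : List (ℕ × ℕ × R)} (h : es.Perm fs) (hes : EdgesIn L es) :
    links L es = links L fs := by
  induction h with
  | nil => rfl
  | cons e _ ih => rw [links, links, ih hes.tail]
  | swap e f es =>
    rw [links, links, links, links, ← mul_assoc, ← mul_assoc,
      (jpush_link hes.tail.head.1 hes.tail.head.2 e.2.2).link hes.head.1 hes.head.2]
  | trans h1 _ ih1 ih2 => rw [ih1 hes, ih2 fun e he => hes e (h1.mem_iff.2 he)]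

/-- An edge without its direction. -/
def edge {α : Type*} (e : ℕ × ℕ × α) : Sym2 ℕ × α := (s(e.1, e.2.1), e.2.2)

theorem links_eq_of_edges {L : List ℕ} {es fs : List (ℕ × ℕ × R)} (hes : EdgesIn L es)
    (hfs : EdgesIn L fs) (h : (es.map edge).Perm (fs.map edge)) : links L es = links L fs := by
  -- Every edge is directed from its smaller to its larger end, which `link_comm` permits; then only
  -- the order of the edges remains.
  let g : Sym2 ℕ × R → ℕ × ℕ × R := fun e => (e.1.inf, e.1.sup, e.2)
  have key : ∀ es : List (ℕ × ℕ × R), EdgesIn L es →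
      links L es = links L ((es.map edge).map g) ∧ EdgesIn L ((es.map edge).map g) := by
    intro es hes
    induction es with
    | nil => exact ⟨rfl, hes⟩
    | cons e es ih =>
      obtain ⟨h1, h2⟩ := ih hes.tail
      obtain ⟨h3, h4⟩ := hes.head
      have h5 : link L e.1 e.2.1 e.2.2 = link L (e.1 ⊓ e.2.1) (e.1 ⊔ e.2.1) e.2.2 ∧
          e.1 ⊓ e.2.1 ∈ L ∧ e.1 ⊔ e.2.1 ∈ L := by
        rcases le_total e.1 e.2.1 with hle | hle
        · simp [hle, h3, h4]
        · simp [hle, h3, h4, link_comm h3 h4]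
      refine ⟨?_, fun f hf => ?_⟩
      · rw [links, h1, h5.1]
        rfl
      · rcases List.mem_cons.1 hf with rfl | hf
        · exact h5.2
        · exact h2 f hf
  rw [(key es hes).1, (key fs hfs).1]
  exact links_perm (h.map g) (key es hes).2

end Q
end ResistorCircuit

/-! ### Open networks with named nodes -/

namespace ResistorCircuit
variable {R : Type*} [CommSemiring R]

/-- An open network whose nodes are named by natural numbers. -/
structure Net (α : Type*) where
  nodes : List ℕ
  inputs : List ℕ
  outputs : List ℕ
  edges : List (ℕ × ℕ × α)

namespace Net
open Q

/-- All ends are nodes, and no node is listed twice. -/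
structure Valid {α : Type*} (N : Net α) : Prop where
  nodup : N.nodes.Nodup
  inputs_mem : N.inputs ⊆ N.nodes
  outputs_mem : N.outputs ⊆ N.nodes
  edges_mem : EdgesIn N.nodes N.edges

/-- The network as a circuit. -/
def toQ (N : Net R) : Q R :=
  legsI N.nodes N.inputs * Q.links N.nodes N.edges * legsO N.nodes N.outputs

/-- Relabelling of the conductances. -/
def map {α β : Type*} (φ : α → β) (N : Net α) : Net β :=
  ⟨N.nodes, N.inputs, N.outputs, N.edges.map fun e => (e.1, e.2.1, φ e.2.2)⟩

/-- The network drawn by an identity. -/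
def ofId {α : Type*} (n : ℕ) : Net α := ⟨List.range n, List.range n, List.range n, []⟩

/-- A name that is not in the list. -/
def fresh (L : List ℕ) : ℕ := L.sum + 1

theorem fresh_notMem (L : List ℕ) : fresh L ∉ L := fun h => by
  have := List.le_sum_of_mem h
  unfold fresh at this
  omega

/-- Two nodes are identified. -/
def identify {α : Type*} (x y : ℕ) (N : Net α) : Net α :=
  if x = y then N else
    ⟨N.nodes.erase y, N.inputs.map (subst y x), N.outputs.map (subst y x),
      mapEdges (subst y x) N.edges⟩

/-- The outputs from position `p` on are fed into a circuit. -/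
def act {α : Type*} : CircuitTerm α → ℕ → Net α → Net α
  | .id _, _, N => N
  | .comp f g, p, N => act g p (act f p N)
  | .tensor f g, p, N => act g (p + f.cod) (act f p N)
  | .swap a b, p, N =>
    { N with outputs := N.outputs.take p ++ ((N.outputs.drop p).drop a).take b ++
        (N.outputs.drop p).take a ++ (N.outputs.drop p).drop (a + b) }
  | .mul, p, N =>
    -- The default value `0` is never reached if there are enough outputs, as `act_spec` assumes.
    identify (N.outputs.getD p 0) (N.outputs.getD (p + 1) 0)
      { N with outputs := N.outputs.take p ++ N.outputs.getD p 0 :: N.outputs.drop (p + 2) }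
  | .unit, p, N =>
    { N with
      nodes := fresh N.nodes :: N.nodes
      outputs := N.outputs.take p ++ fresh N.nodes :: N.outputs.drop p }
  | .comul, p, N =>
    { N with outputs := N.outputs.take p ++ N.outputs.getD p 0 :: N.outputs.drop p }
  | .counit, p, N =>
    { N with outputs := N.outputs.take p ++ N.outputs.drop (p + 1) }
  | .cond y, p, N =>
    { nodes := fresh N.nodes :: N.nodes
      inputs := N.inputs
      outputs := N.outputs.take p ++ fresh N.nodes :: N.outputs.drop (p + 1)
      edges := (N.outputs.getD p 0, fresh N.nodes, y) :: N.edges }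

/-- The network drawn by a circuit. -/
def ofTerm {α : Type*} (t : CircuitTerm α) : Net α := act t 0 (ofId t.dom)

/-- A circuit that reorders the nodes is split off from the outputs, moved past the edges, and
absorbed by the inputs. -/
theorem toQ_perm {N : Net R} (hN : N.Valid) {L : List ℕ} (h : N.nodes.Perm L) :
    toQ N = toQ { N with nodes := L } := by
  obtain ⟨f, hf⟩ := exists_reorder (R := R) h hN.nodup
  have h1 := hf.toJPush.legsI hf.un hN.inputs_mem
  have h2 := hf.toJPush.links hN.edges_mem
  have h3 := hf.toFPush.legsO (l := []) (l' := []) (g := one 0)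
    (by rw [mul_one' _ (by simp [legsO])]; exact hf.coun.symm) hN.outputs_mem
  simp only [List.map_id', mapEdges, List.append_nil, tens_one_zero] at h1 h2 h3
  rw [mul_one' _ (cod_legsO _ _)] at h3
  rw [toQ, toQ, h3, ← h1, mul_assoc, ← mul_assoc (Q.links _ _), h2]
  simp only [mul_assoc]

theorem toQ_congr {N N' : Net R} (hN : N.Valid) (hN' : N'.Valid) (h : N.nodes.Perm N'.nodes)
    (hi : N.inputs = N'.inputs) (ho : N.outputs = N'.outputs)
    (he : (N.edges.map edge).Perm (N'.edges.map edge)) : toQ N = toQ N' := by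
  rw [toQ_perm hN h, toQ, toQ, hi, ho]
  congr 2
  exact links_eq_of_edges (fun e hm => ⟨h.mem_iff.1 (hN.edges_mem e hm).1,
    h.mem_iff.1 (hN.edges_mem e hm).2⟩) hN'.edges_mem he

theorem legsI_self {L : List ℕ} (hL : L.Nodup) : legsI L L = (one L.length : Q R) := by
  induction L with
  | nil => rfl
  | cons c L ih =>
    rw [List.nodup_cons] at hL
    have h := (jpush_E (R := R) hL.1).legsI rfl (List.Subset.refl L)
    rw [List.map_id', ih hL.2, one_mul' _ (by simp)] at h
    rw [legsI, ← h, J_self, wh_E_M, List.length_cons]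

theorem legsO_cons {L l : List ℕ} {v : ℕ} (hv : v ∉ L) (hl : l ⊆ L) :
    legsO (v :: L) l = C L.length * (legsO L l : Q R) := by
  induction l with
  | nil => rfl
  | cons a l ih =>
    have ha := hl List.mem_cons_self
    rw [legsO, F_ne (by rintro rfl; exact hv ha), ih fun x hx => hl (List.mem_cons_of_mem _ hx),
      wh_mul, mul_assoc, ← mul_assoc (S _), S_wh_C, ← mul_assoc,
      ← C_slide _ (dom_F ha) (cod_F ha), mul_assoc]
    rfl

theorem legsO_self {L : List ℕ} (hL : L.Nodup) : legsO L L = (one L.length : Q R) := by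
  induction L with
  | nil => rfl
  | cons c L ih =>
    rw [List.nodup_cons] at hL
    rw [legsO, legsO_cons hL.1 (List.Subset.refl L), ih hL.2, mul_one' _ (by simp), F_self, D_wh_C,
      List.length_cons]

theorem toQ_ofId (n : ℕ) : toQ (ofId n : Net R) = one n := by
  rw [toQ, ofId]
  simp only
  rw [legsI_self List.nodup_range, legsO_self List.nodup_range, Q.links, one_mul' _ (dom_one _),
    one_mul' _ (dom_one _), List.length_range]

theorem valid_ofId {α : Type*} (n : ℕ) : (ofId n : Net α).Valid :=
  ⟨List.nodup_range, List.Subset.refl _, List.Subset.refl _, fun _ h => absurd h List.not_mem_nil⟩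

/-! ### Feeding the outputs into a generator -/

theorem legsO_swap_one {L : List ℕ} {x : ℕ} (hx : x ∈ L) {Y B : List ℕ} (hY : Y ⊆ L) (hB : B ⊆ L) :
    legsO L (x :: (Y ++ B)) * (sw 1 Y.length ⊙ one B.length) = (legsO L (Y ++ x :: B) : Q R) := by
  induction Y with
  | nil =>
    rw [List.length_nil, sw_zero, one_tens_one, mul_one' _ (by simp [cod_legsO, Nat.add_comm])]
    rfl
  | cons y Y ih =>
    have hy := hY List.mem_cons_self
    have hY' : Y ⊆ L := fun z hz => hY (List.mem_cons_of_mem _ hz)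
    have h1 : (sw 1 (Y.length + 1) ⊙ one B.length : Q R) =
        S (Y ++ B).length * wh (sw 1 Y.length ⊙ one B.length) := by
      rw [Nat.add_comm Y.length, sw_add, mul_tens_one, tens_assoc, one_tens_one, tens_assoc, S,
        List.length_append, wh]
    have h2 := S_slide (legsO L (Y ++ B) : Q R) (dom_legsO (List.append_subset.2 ⟨hY', hB⟩))
      (cod_legsO _ _)
    have h3 := F_wh_F (R := R) hx hy
    rw [List.length_cons, h1, List.cons_append, legsO, legsO]
    simp only [wh_mul, mul_assoc]
    rw [reassoc h2]
    simp only [← mul_assoc]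
    rw [← h3]
    simp only [mul_assoc, ← wh_mul]
    rw [List.cons_append, legsO, ← ih hY', legsO, mul_assoc, wh_mul]

theorem legsO_swap {L X Y B : List ℕ} (hX : X ⊆ L) (hY : Y ⊆ L) (hB : B ⊆ L) :
    legsO L (X ++ (Y ++ B)) * (sw X.length Y.length ⊙ one B.length) =
      (legsO L (Y ++ (X ++ B)) : Q R) := by
  induction X with
  | nil =>
    rw [List.length_nil, zero_sw, one_tens_one, mul_one' _ (by simp [cod_legsO])]
    rfl
  | cons x X ih =>
    have hX' : X ⊆ L := fun z hz => hX (List.mem_cons_of_mem _ hz)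
    rw [List.length_cons, Nat.add_comm X.length, sw_add_left, mul_tens_one, ← mul_assoc,
      List.cons_append, legsO, tens_assoc, ← wh, mul_assoc, mul_assoc, ← mul_assoc (wh _), ← wh_mul,
      ih hX', tens_assoc, one_tens_one, ← mul_assoc, ← legsO, ← List.length_append,
      legsO_swap_one (hX List.mem_cons_self) hY (List.append_subset.2 ⟨hX', hB⟩)]
    rfl

/-- The special law `D_M` enters here: a node that is copied and merged again is unchanged. -/
theorem legsO_mul_self {L : List ℕ} {x : ℕ} (hx : x ∈ L) {B : List ℕ} (hB : B ⊆ L) :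
    legsO L (x :: x :: B) * M B.length = (legsO L (x :: B) : Q R) := by
  have h := M_slide (legsO L B : Q R) (dom_legsO hB) (cod_legsO L B)
  rw [legsO, legsO, wh_mul, mul_assoc, mul_assoc, ← h, ← mul_assoc, ← F_D hx, mul_assoc,
    ← mul_assoc (D _), D_M, one_mul' _ (by simp [dom_legsO hB])]

theorem legsO_subst {L : List ℕ} {x : ℕ} (hx : x ∈ L) {y : ℕ} {B : List ℕ} (hB : B ⊆ y :: L) :
    legsO L (B.map (subst y x)) = F L x * (legsO (y :: L) B : Q R) := by
  induction B with
  | nil => rw [List.map_nil, legsO, legsO, List.length_cons, CoUn, ← mul_assoc, F_C hx,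
      one_mul' _ (by simp)]
  | cons b B ih =>
    rw [List.map_cons, legsO, ih fun z hz => hB (List.mem_cons_of_mem _ hz), legsO, wh_mul,
      ← mul_assoc, ← mul_assoc]
    congr 1
    by_cases h : b = y
    · subst h
      rw [subst_self, F_self, F_D hx]
    · rw [subst_ne h, F_ne h, F_wh_F hx (mem_tail (hB List.mem_cons_self) h), mul_assoc]

/-- By the Frobenius law, merging outputs at two different nodes is the same as joining the node `y`
to `x` and taking one output there; `legsO_subst` renames the remaining outputs. -/
theorem legsO_mul {L : List ℕ} {x : ℕ} (hx : x ∈ L) {y : ℕ} (hxy : x ≠ y) {B : List ℕ}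
    (hB : B ⊆ y :: L) :
    legsO (y :: L) (x :: y :: B) * M B.length =
      J L x * (legsO L ((x :: B).map (subst y x)) : Q R) := by
  have h := M_slide (legsO (y :: L) B : Q R) (dom_legsO hB) (cod_legsO _ B)
  have h1 : F (y :: L) x * wh (F (y :: L) y) * M (L.length + 1) =
      J L x * F L x * (wh (F L x) : Q R) := by
    rw [F_self, F_ne hxy, mul_assoc, mul_assoc, wh_D_M, ← mul_assoc (S _), S_M, ← mul_assoc,
      ← J_F_self' hx, mul_assoc, F_D hx, mul_assoc]
  rw [List.map_cons, subst_ne hxy, legsO, legsO, legsO, legsO_subst hx hB, wh_mul, wh_mul,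
    mul_assoc, mul_assoc, ← h]
  simp only [← mul_assoc]
  rw [List.length_cons, h1]

theorem legsO_fresh {L : List ℕ} {v : ℕ} (hv : v ∉ L) {B : List ℕ} (hB : B ⊆ L) :
    legsO L B * E B.length = E L.length * (legsO (v :: L) (v :: B) : Q R) := by
  rw [legsO, legsO_cons hv hB, F_self, wh_mul, ← mul_assoc (D _), D_wh_C,
    one_mul' _ (by simp [dom_legsO hB]), E_slide _ (dom_legsO hB) (cod_legsO L B)]

/-- A conductance to a new node is a conductance on a copied wire: the join to the new node cancels
the unit that creates it. -/
theorem E_link {L : List ℕ} {x : ℕ} (hx : x ∈ L) {v : ℕ} (hv : v ∉ L) (y : R) :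
    E L.length * Q.link (v :: L) x v y = F L x * W y L.length := by
  have h1 := E_slide (F L x : Q R) (dom_F hx) (cod_F hx)
  have h2 := W_slide y (E L.length) (k := L.length) (l := L.length + 1) (by simp) (by simp)
  rw [Q.link, F_ne (by rintro rfl; exact hv hx), J_self]
  simp only [mul_assoc]
  rw [reassoc h1, mul_assoc, reassoc (E_S _), List.length_cons, reassoc h2.symm, mul_assoc, wh_E_M,
    mul_one' _ (by simp)]

theorem legsO_cond {L : List ℕ} {x : ℕ} (hx : x ∈ L) {v : ℕ} (hv : v ∉ L) {B : List ℕ} (hB : B ⊆ L)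
    (y : R) : legsO L (x :: B) * W y B.length =
      E L.length * Q.link (v :: L) x v y * legsO (v :: L) (v :: B) := by
  rw [E_link hx hv, legsO, legsO, legsO_cons hv hB, F_self, wh_mul, ← mul_assoc (D _), D_wh_C,
    one_mul' _ (by simp [dom_legsO hB]), mul_assoc, mul_assoc,
    W_slide y _ (dom_legsO hB) (cod_legsO L B)]

/-- A circuit beside further wires on both sides. -/
def layer (p : ℕ) (f : Q R) (q : ℕ) : Q R := one p ⊙ f ⊙ one q

theorem one_tens_mul (p : ℕ) (f g : Q R) : one p ⊙ (f * g) = (one p ⊙ f) * (one p ⊙ g) := by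
  rw [interchange _ _ _ _ rfl, one_mul' _ (dom_one p)]

theorem layer_mul (p : ℕ) (f g : Q R) (q : ℕ) : layer p (f * g) q = layer p f q * layer p g q := by
  rw [layer, mul_tens_one, one_tens_mul, layer, layer]

theorem layer_tens (p : ℕ) (f g : Q R) (q : ℕ) :
    layer p (f ⊙ g) q = layer p f (g.dom + q) * layer (p + f.cod) g q := by
  rw [layer, layer, layer, tens_eq_left f g, mul_tens_one, one_tens_mul, tens_assoc, one_tens_one,
    tens_assoc, ← tens_assoc (one p) (one f.cod), one_tens_one]

theorem legsO_append {L l l' : List ℕ} {g : Q R} (h : legsO L l * g = legsO L l') (A : List ℕ) :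
    legsO L (A ++ l) * (one A.length ⊙ g) = legsO L (A ++ l') := by
  induction A with
  | nil => rwa [List.length_nil, one_zero_tens]
  | cons a A ih =>
    rw [List.length_cons, one_succ_tens, List.cons_append, legsO, mul_assoc, ← wh_mul, ih]
    rfl

theorem toQ_mul_of_legsO {N : Net R} {A l l' : List ℕ} {g : Q R} (hA : N.outputs = A ++ l)
    (h : legsO N.nodes l * g = legsO N.nodes l') :
    toQ N * (one A.length ⊙ g) = toQ { N with outputs := A ++ l' } := by
  rw [toQ, toQ, hA, mul_assoc, legsO_append h]

theorem toQ_swap {N : Net R} (hN : N.Valid) {A X Y B : List ℕ}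
    (hA : N.outputs = A ++ (X ++ (Y ++ B))) :
    toQ N * layer A.length (sw X.length Y.length) B.length =
      toQ { N with outputs := A ++ (Y ++ (X ++ B)) } := by
  have h := hN.outputs_mem
  rw [hA, List.append_subset, List.append_subset, List.append_subset] at h
  exact toQ_mul_of_legsO hA (legsO_swap h.2.1 h.2.2.1 h.2.2.2)

theorem toQ_comul {N : Net R} (hN : N.Valid) {A B : List ℕ} {x : ℕ}
    (hA : N.outputs = A ++ x :: B) :
    toQ N * layer A.length de B.length = toQ { N with outputs := A ++ x :: x :: B } := by
  have h := hN.outputs_mem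
  rw [hA, List.append_subset, List.cons_subset] at h
  refine toQ_mul_of_legsO hA ?_
  have h1 := D_slide (legsO N.nodes B : Q R) (dom_legsO h.2.2) (cod_legsO _ B)
  change _ * D _ = _
  rw [legsO, legsO, legsO, mul_assoc, ← h1, ← mul_assoc, F_D h.2.1, wh_mul, mul_assoc]

theorem toQ_counit {N : Net R} (hN : N.Valid) {A B : List ℕ} {x : ℕ}
    (hA : N.outputs = A ++ x :: B) :
    toQ N * layer A.length ep B.length = toQ { N with outputs := A ++ B } := by
  have h := hN.outputs_mem
  rw [hA, List.append_subset, List.cons_subset] at h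
  refine toQ_mul_of_legsO hA ?_
  have h1 := C_slide (legsO N.nodes B : Q R) (dom_legsO h.2.2) (cod_legsO _ B)
  change _ * C _ = _
  rw [legsO, mul_assoc, ← h1, ← mul_assoc, F_C h.2.1, one_mul' _ (dom_legsO h.2.2)]

theorem toQ_unit {N : Net R} (hN : N.Valid) {A B : List ℕ} {v : ℕ} (hv : v ∉ N.nodes)
    (hA : N.outputs = A ++ B) :
    toQ N * layer A.length et B.length =
      toQ { N with nodes := v :: N.nodes, outputs := A ++ v :: B } := by
  have h := hN.outputs_mem
  rw [hA, List.append_subset] at h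
  have h1 := (fpush_E (R := R) hv).legsO (legsO_fresh hv h.2) h.1
  have h2 := (jpush_E (R := R) hv).legsI rfl hN.inputs_mem
  have h3 := (jpush_E (R := R) hv).links hN.edges_mem
  simp only [List.map_id', mapEdges] at h1 h2 h3
  change _ * (_ ⊙ E _) = _
  rw [toQ, toQ, hA, mul_assoc, h1, mul_assoc, ← mul_assoc (Q.links _ _), h3, mul_assoc, ← mul_assoc,
    h2, mul_assoc]

theorem toQ_cond {N : Net R} (hN : N.Valid) {A B : List ℕ} {v x : ℕ} (hv : v ∉ N.nodes)
    (hA : N.outputs = A ++ x :: B) (y : R) :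
    toQ N * layer A.length (cd y) B.length =
      toQ ⟨v :: N.nodes, N.inputs, A ++ v :: B, (x, v, y) :: N.edges⟩ := by
  have h := hN.outputs_mem
  rw [hA, List.append_subset, List.cons_subset] at h
  have hx : x ∈ v :: N.nodes := List.mem_cons_of_mem _ h.2.1
  have hl := (fpush_E (R := R) hv).comp (fpush_link hx List.mem_cons_self y)
  have h1 := hl.legsO (legsO_cond h.2.1 hv h.2.2 y) h.1
  have h2 := (jpush_E (R := R) hv).legsI rfl hN.inputs_mem
  have h3 := (jpush_E (R := R) hv).links hN.edges_mem
  have h4 := (jpush_link (R := R) hx List.mem_cons_self y).links (es := N.edges) fun e he =>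
    ⟨List.mem_cons_of_mem _ (hN.edges_mem e he).1, List.mem_cons_of_mem _ (hN.edges_mem e he).2⟩
  simp only [List.map_id', mapEdges] at h1 h2 h3 h4
  change _ * (_ ⊙ W _ _) = _
  rw [toQ, toQ, hA, mul_assoc, h1, mul_assoc]
  simp only [Q.links]
  rw [← h4, ← h2]
  simp only [mul_assoc]
  rw [reassoc h3, mul_assoc]

theorem toQ_mul_self {N : Net R} (hN : N.Valid) {A B : List ℕ} {x : ℕ}
    (hA : N.outputs = A ++ x :: x :: B) :
    toQ N * layer A.length mu B.length = toQ { N with outputs := A ++ x :: B } := by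
  have h := hN.outputs_mem
  rw [hA, List.append_subset, List.cons_subset, List.cons_subset] at h
  exact toQ_mul_of_legsO hA (legsO_mul_self h.2.1 h.2.2.2)

theorem toQ_mul_ne {N : Net R} (hN : N.Valid) {A B : List ℕ} {x y : ℕ} (hxy : x ≠ y)
    (hA : N.outputs = A ++ x :: y :: B) :
    toQ N * layer A.length mu B.length =
      toQ ⟨N.nodes.erase y, N.inputs.map (subst y x), (A ++ x :: B).map (subst y x),
        mapEdges (subst y x) N.edges⟩ := by
  have h := hN.outputs_mem
  rw [hA, List.append_subset, List.cons_subset, List.cons_subset] at h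
  have hp : N.nodes.Perm (y :: N.nodes.erase y) := List.perm_cons_erase h.2.2.1
  have hs : N.nodes ⊆ y :: N.nodes.erase y := hp.subset
  have hx : x ∈ N.nodes.erase y := (List.mem_erase_of_ne hxy).2 h.2.1
  have h1 := (fpush_J (R := R) y hx).legsO (legsO_mul hx hxy (List.Subset.trans h.2.2.2 hs)) (List.Subset.trans h.1 hs)
  have h2 := (jpush_J (R := R) y hx).legsI (Un_J hx) (List.Subset.trans hN.inputs_mem hs)
  have h3 := (jpush_J (R := R) y hx).links (es := N.edges) fun e he =>
    ⟨hs (hN.edges_mem e he).1, hs (hN.edges_mem e he).2⟩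
  change _ * (_ ⊙ M _) = _
  rw [toQ_perm hN hp, toQ, toQ, hA, List.map_append]
  simp only
  rw [mul_assoc, h1, ← h2]
  simp only [mul_assoc]
  rw [reassoc h3, mul_assoc]

theorem Valid.with_outputs {α : Type*} {N : Net α} (hN : N.Valid) {l : List ℕ} (h : l ⊆ N.outputs) :
    ({ N with outputs := l } : Net α).Valid :=
  ⟨hN.nodup, hN.inputs_mem, List.Subset.trans h hN.outputs_mem, hN.edges_mem⟩

theorem Valid.identify {α : Type*} {N : Net α} (hN : N.Valid) {x y : ℕ} (hx : x ∈ N.nodes)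
    (hy : y ∈ N.nodes) : (identify x y N).Valid := by
  unfold Net.identify
  split
  · exact hN
  · have key : ∀ z ∈ N.nodes, subst y x z ∈ N.nodes.erase y := fun z hz =>
      subst_mem ((List.mem_erase_of_ne ‹_›).2 hx) ((List.perm_cons_erase hy).subset hz)
    refine ⟨hN.nodup.erase y, ?_, ?_, ?_⟩
    · intro z hz
      obtain ⟨w, hw, rfl⟩ := List.mem_map.1 hz
      exact key w (hN.inputs_mem hw)
    · intro z hz
      obtain ⟨w, hw, rfl⟩ := List.mem_map.1 hz
      exact key w (hN.outputs_mem hw)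
    · intro z hz
      obtain ⟨w, hw, rfl⟩ := List.mem_map.1 hz
      exact ⟨key _ (hN.edges_mem w hw).1, key _ (hN.edges_mem w hw).2⟩

theorem exists_split {l : List ℕ} {p n q : ℕ} (h : l.length = p + n + q) :
    ∃ A X B, l = A ++ (X ++ B) ∧ A.length = p ∧ X.length = n ∧ B.length = q :=
  ⟨l.take p, (l.drop p).take n, (l.drop p).drop n, by simp, by simp; omega, by simp; omega,
    by simp; omega⟩

theorem length_inputs_identify {α : Type*} (x y : ℕ) (N : Net α) :
    (identify x y N).inputs.length = N.inputs.length := by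
  unfold identify
  split <;> simp

theorem length_outputs_identify {α : Type*} (x y : ℕ) (N : Net α) :
    (identify x y N).outputs.length = N.outputs.length := by
  unfold identify
  split <;> simp

/-- Induction on the circuit, for any `p` wires in front and `q` wires behind so that the tensor
product can be treated one factor after the other. Each generator is covered by one of the lemmas on
`toQ` and `layer`, with two cases for `mul` according to whether the merged outputs lie at the same
node. -/
theorem act_spec {t : CircuitTerm R} (ht : t.WellFormed) {p q : ℕ} {N : Net R} (hN : N.Valid)
    (hl : N.outputs.length = p + t.dom + q) :
    (act t p N).Valid ∧ (act t p N).inputs.length = N.inputs.length ∧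
      (act t p N).outputs.length = p + t.cod + q ∧
      toQ (act t p N) = toQ N * layer p (Q.mk t) q := by
  induction t generalizing p q N with
  | id n =>
    refine ⟨hN, rfl, hl, ?_⟩
    change _ = _ * layer p (one n) q
    rw [layer, one_tens_one, one_tens_one, mul_one']
    · rfl
    · rw [toQ, cod_mul, cod_legsO, hl, Nat.add_assoc]
      rfl
  | comp f g hf hg =>
    obtain ⟨h1, h2, h3⟩ := ht
    obtain ⟨h4, h5, h6, h7⟩ := hf h1 hN hl
    rw [h3] at h6
    obtain ⟨h8, h9, h10, h11⟩ := hg h2 h4 h6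
    exact ⟨h8, h9.trans h5, h10, by rw [act, h11, h7, mk_comp, layer_mul, mul_assoc]⟩
  | tensor f g hf hg =>
    obtain ⟨h4, h5, h6, h7⟩ := hf ht.1 hN (p := p) (q := g.dom + q)
      (by rw [hl, CircuitTerm.dom]; omega)
    obtain ⟨h8, h9, h10, h11⟩ := hg ht.2 h4 (p := p + f.cod) (q := q) (by rw [h6]; omega)
    exact ⟨h8, h9.trans h5, by rw [CircuitTerm.cod, act, h10]; omega, by
      rw [act, h11, h7, mk_tensor, layer_tens, mul_assoc]; rfl⟩
  | swap a b =>
    obtain ⟨A, XY, B, hA, rfl, hX, rfl⟩ := exists_split hl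
    obtain ⟨X, Y, Z, rfl, rfl, rfl, hZ⟩ := exists_split (p := a) (n := b) (q := 0)
      (l := XY) (by rw [hX, CircuitTerm.dom]; rfl)
    obtain rfl := List.length_eq_zero_iff.1 hZ
    have h1 : act (.swap X.length Y.length) A.length N =
        { N with outputs := A ++ (Y ++ (X ++ B)) } := by
      simp [act, hA]
    rw [h1]
    refine ⟨hN.with_outputs ?_, rfl, ?_, ?_⟩
    · rw [hA]
      intro z
      simp only [List.mem_append]
      tauto
    · simp [CircuitTerm.cod]
      omega
    · exact (toQ_swap hN (by simpa using hA)).symm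
  | mul =>
    obtain ⟨A, X, B, hA, rfl, hX, rfl⟩ := exists_split hl
    obtain ⟨x, y, rfl⟩ := List.length_eq_two.1 hX
    have h1 : act .mul A.length N = identify x y { N with outputs := A ++ x :: B } := by
      simp [act, hA]
    have h := hN.outputs_mem
    rw [hA, List.append_subset, List.append_subset, List.cons_subset, List.cons_subset] at h
    have hv : ({ N with outputs := A ++ x :: B } : Net R).Valid := by
      refine hN.with_outputs ?_
      rw [hA]
      intro z
      simp only [List.mem_append, List.mem_cons]
      tauto
    rw [h1]
    refine ⟨hv.identify h.2.1.1 h.2.1.2.1, length_inputs_identify _ _ _, ?_, ?_⟩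
    · rw [length_outputs_identify]
      simp [CircuitTerm.cod]
      omega
    · by_cases hxy : x = y
      · subst hxy
        rw [identify, if_pos rfl]
        exact (toQ_mul_self hN hA).symm
      · rw [identify, if_neg hxy]
        exact (toQ_mul_ne hN hxy hA).symm
  | unit =>
    obtain ⟨A, X, B, hA, rfl, hX, rfl⟩ := exists_split hl
    obtain rfl := List.length_eq_zero_iff.1 hX
    have h1 : act .unit A.length N = { N with
        nodes := fresh N.nodes :: N.nodes, outputs := A ++ fresh N.nodes :: B } := by
      simp [act, hA]
    have hf := fresh_notMem N.nodes
    rw [h1]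
    refine ⟨⟨List.nodup_cons.2 ⟨hf, hN.nodup⟩, List.subset_cons_of_subset _ hN.inputs_mem, ?_,
      fun e he => ?_⟩, rfl, ?_, ?_⟩
    · have := hN.outputs_mem
      rw [hA] at this
      intro z hz
      have := @this z
      simp only [List.mem_append, List.mem_cons] at hz this ⊢
      tauto
    · exact ⟨List.mem_cons_of_mem _ (hN.edges_mem e he).1,
        List.mem_cons_of_mem _ (hN.edges_mem e he).2⟩
    · simp [CircuitTerm.cod]
      omega
    · exact (toQ_unit hN hf hA).symm
  | comul =>
    obtain ⟨A, X, B, hA, rfl, hX, rfl⟩ := exists_split hl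
    obtain ⟨x, rfl⟩ := List.length_eq_one_iff.1 hX
    have h1 : act .comul A.length N = { N with outputs := A ++ x :: x :: B } := by
      simp [act, hA]
    rw [h1]
    refine ⟨hN.with_outputs ?_, rfl, ?_, ?_⟩
    · rw [hA]
      intro z
      simp only [List.mem_append, List.mem_cons]
      tauto
    · simp [CircuitTerm.cod]
      omega
    · exact (toQ_comul hN hA).symm
  | counit =>
    obtain ⟨A, X, B, hA, rfl, hX, rfl⟩ := exists_split hl
    obtain ⟨x, rfl⟩ := List.length_eq_one_iff.1 hX
    have h1 : act .counit A.length N = { N with outputs := A ++ B } := by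
      simp [act, hA]
    rw [h1]
    refine ⟨hN.with_outputs ?_, rfl, ?_, ?_⟩
    · rw [hA]
      intro z
      simp only [List.mem_append, List.mem_cons]
      tauto
    · simp [CircuitTerm.cod]
    · exact (toQ_counit hN hA).symm
  | cond y =>
    obtain ⟨A, X, B, hA, rfl, hX, rfl⟩ := exists_split hl
    obtain ⟨x, rfl⟩ := List.length_eq_one_iff.1 hX
    have h1 : act (.cond y) A.length N = ⟨fresh N.nodes :: N.nodes, N.inputs,
        A ++ fresh N.nodes :: B, (x, fresh N.nodes, y) :: N.edges⟩ := by
      simp [act, hA]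
    have hf := fresh_notMem N.nodes
    have h := hN.outputs_mem
    rw [hA] at h
    rw [h1]
    refine ⟨⟨List.nodup_cons.2 ⟨hf, hN.nodup⟩, List.subset_cons_of_subset _ hN.inputs_mem, ?_,
      fun e he => ?_⟩, rfl, ?_, ?_⟩
    · intro z hz
      have := @h z
      simp only [List.mem_append, List.mem_cons] at hz this ⊢
      tauto
    · rcases List.mem_cons.1 he with rfl | he
      · exact ⟨List.mem_cons_of_mem _ (h (by simp)), List.mem_cons_self⟩
      · exact ⟨List.mem_cons_of_mem _ (hN.edges_mem e he).1,
          List.mem_cons_of_mem _ (hN.edges_mem e he).2⟩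
    · simp [CircuitTerm.cod]
      omega
    · exact (toQ_cond hN hf hA y).symm

/-- The network of an identity draws the identity, and feeding its outputs into `t` gives `t`. So
the structural laws suffice to bring every circuit into the form of a network. -/
theorem ofTerm_spec {t : CircuitTerm R} (ht : t.WellFormed) :
    (ofTerm t).Valid ∧ (ofTerm t).inputs.length = t.dom ∧ (ofTerm t).outputs.length = t.cod ∧
      toQ (ofTerm t) = Q.mk t := by
  obtain ⟨h1, h2, h3, h4⟩ := act_spec ht (valid_ofId t.dom) (p := 0) (q := 0) (by simp [ofId])
  refine ⟨h1, by rw [ofTerm, h2]; simp [ofId], by rw [ofTerm, h3]; simp, ?_⟩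
  rw [ofTerm, h4, toQ_ofId, layer, one_zero_tens, tens_one_zero, one_mul' _ (dom_mk t)]

end Net
end ResistorCircuit

namespace ResistorCircuit
variable {R : Type*} [CommSemiring R]
open Q

/-! ### Networks with named nodes and networks with numbered nodes -/

theorem mk_join_zero (k : ℕ) : Q.mk (CircuitTerm.join (k + 1) 0 : CircuitTerm R) = M k := by
  change (sw 1 0 ⊙ one (k + 1)) * (one 0 ⊙ mu ⊙ one k) = _
  rw [sw_zero, one_tens_one, one_zero_tens, one_mul' _ (by simp; omega)]
  rfl

theorem mk_fork_zero (k : ℕ) : Q.mk (CircuitTerm.fork (k + 1) 0 : CircuitTerm R) = D k := by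
  change (one 0 ⊙ de ⊙ one k) * (sw 0 1 ⊙ one (k + 1)) = _
  rw [zero_sw, one_tens_one, one_zero_tens, mul_one' _ (by simp; omega)]
  rfl

theorem mk_join_succ {k i : ℕ} (h : i < k) :
    Q.mk (CircuitTerm.join (k + 1) (i + 1) : CircuitTerm R) =
      S k * wh (Q.mk (CircuitTerm.join k i)) := by
  -- With `k = i + r + 1` the truncated subtractions in `join` become explicit numbers.
  obtain ⟨r, rfl⟩ := Nat.exists_eq_add_of_lt h
  have h1 : i + r + 1 + 1 - (i + 1) = r + 1 := by omega
  have h2 : i + r + 1 - i = r + 1 := by omega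
  rw [CircuitTerm.join, CircuitTerm.join, h1, h2]
  change (sw 1 (i + 1) ⊙ one (r + 1)) * (one (i + 1) ⊙ mu ⊙ one r) =
    S (i + r + 1) * wh ((sw 1 i ⊙ one (r + 1)) * (one i ⊙ mu ⊙ one r))
  rw [wh_mul, one_succ_tens, ← mul_assoc, Nat.add_comm i 1, sw_add, mul_tens_one, tens_assoc,
    one_tens_one, tens_assoc, S, ← wh, Nat.add_assoc]

theorem mk_fork_succ {k i : ℕ} (h : i < k) :
    Q.mk (CircuitTerm.fork (k + 1) (i + 1) : CircuitTerm R) =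
      wh (Q.mk (CircuitTerm.fork k i)) * S k := by
  obtain ⟨r, rfl⟩ := Nat.exists_eq_add_of_lt h
  have h1 : i + r + 1 + 1 - (i + 1) = r + 1 := by omega
  have h2 : i + r + 1 - i = r + 1 := by omega
  rw [CircuitTerm.fork, CircuitTerm.fork, h1, h2]
  change (one (i + 1) ⊙ de ⊙ one r) * (sw (i + 1) 1 ⊙ one (r + 1)) =
    wh ((one i ⊙ de ⊙ one r) * (sw i 1 ⊙ one (r + 1))) * S (i + r + 1)
  rw [wh_mul, one_succ_tens, mul_assoc, Nat.add_comm i 1, sw_add_left, mul_tens_one, tens_assoc,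
    tens_assoc, one_tens_one, S, ← wh, Nat.add_assoc]

theorem mk_join {L : List ℕ} {a : ℕ} (h : a ∈ L) :
    Q.mk (CircuitTerm.join L.length (L.idxOf a) : CircuitTerm R) = J L a := by
  induction L with
  | nil => simp at h
  | cons c L ih =>
    by_cases hc : a = c
    · subst hc
      rw [List.idxOf_cons_self, List.length_cons, mk_join_zero, J_self]
    · have h' := mem_tail h hc
      rw [List.idxOf_cons_ne _ (Ne.symm hc), List.length_cons,
        mk_join_succ (List.idxOf_lt_length_iff.2 h'), ih h', J_ne hc]

theorem mk_fork {L : List ℕ} {a : ℕ} (h : a ∈ L) :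
    Q.mk (CircuitTerm.fork L.length (L.idxOf a) : CircuitTerm R) = F L a := by
  induction L with
  | nil => simp at h
  | cons c L ih =>
    by_cases hc : a = c
    · subst hc
      rw [List.idxOf_cons_self, List.length_cons, mk_fork_zero, F_self]
    · have h' := mem_tail h hc
      rw [List.idxOf_cons_ne _ (Ne.symm hc), List.length_cons,
        mk_fork_succ (List.idxOf_lt_length_iff.2 h'), ih h', F_ne hc]

theorem mk_units (k : ℕ) : Q.mk (CircuitTerm.units k : CircuitTerm R) = Un k := by
  induction k with
  | zero => rfl
  | succ k ih =>
    rw [CircuitTerm.units, mk_tensor, ih, tens_eq_right]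
    change (one 0 ⊙ _) * (et ⊙ one _) = _
    rw [one_zero_tens, cod_Un]
    rfl

theorem mk_counits (k : ℕ) : Q.mk (CircuitTerm.counits k : CircuitTerm R) = CoUn k := by
  induction k with
  | zero => rfl
  | succ k ih =>
    rw [CircuitTerm.counits, mk_tensor, ih, tens_eq_left]
    change (ep ⊙ one _) * (one 0 ⊙ _) = _
    rw [one_zero_tens, dom_CoUn]
    rfl

theorem mk_legsIn {L l : List ℕ} (h : l ⊆ L) :
    Q.mk (CircuitTerm.legsIn L.length (l.map L.idxOf) : CircuitTerm R) = legsI L l := by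
  induction l with
  | nil => exact mk_units _
  | cons a l ih =>
    rw [List.cons_subset] at h
    rw [List.map_cons, CircuitTerm.legsIn, mk_comp, mk_tensor, mk_join h.1, ih h.2]
    rfl

theorem mk_legsOut {L l : List ℕ} (h : l ⊆ L) :
    Q.mk (CircuitTerm.legsOut L.length (l.map L.idxOf) : CircuitTerm R) = legsO L l := by
  induction l with
  | nil => exact mk_counits _
  | cons a l ih =>
    rw [List.cons_subset] at h
    rw [List.map_cons, CircuitTerm.legsOut, mk_comp, mk_tensor, mk_fork h.1, ih h.2]
    rfl

theorem mk_links {L : List ℕ} {es : List (ℕ × ℕ × R)} (h : EdgesIn L es) :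
    Q.mk (CircuitTerm.links L.length (mapEdges L.idxOf es)) = Q.links L es := by
  induction es with
  | nil => rfl
  | cons e es ih =>
    rw [mapEdges, List.map_cons, CircuitTerm.links, mk_comp, CircuitTerm.link, mk_comp, mk_comp,
      mk_fork h.head.1, mk_join h.head.2, mk_tensor]
    exact congrArg _ (ih h.tail)

namespace Net

/-- The nodes are numbered in the order in which they are listed. -/
def toNetwork {α : Type*} (N : Net α) : Network α :=
  ⟨N.nodes.length, N.inputs.map N.nodes.idxOf, N.outputs.map N.nodes.idxOf,
    mapEdges N.nodes.idxOf N.edges⟩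

theorem mk_toTerm {N : Net R} (hN : N.Valid) : Q.mk N.toNetwork.toTerm = toQ N := by
  rw [Network.toTerm, mk_comp, mk_comp]
  exact congrArg₂ _ (congrArg₂ _ (mk_legsIn hN.inputs_mem) (mk_links hN.edges_mem))
    (mk_legsOut hN.outputs_mem)

end Net

/-- All ends are nodes. -/
structure Network.InRange {α : Type*} (N : Network α) : Prop where
  inputs_lt : ∀ i ∈ N.inputs, i < N.nodes
  outputs_lt : ∀ i ∈ N.outputs, i < N.nodes
  edges_lt : ∀ e ∈ N.edges, e.1 < N.nodes ∧ e.2.1 < N.nodes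

namespace CircuitTerm

theorem wellFormed_join {k i : ℕ} (h : i < k) : (join k i : CircuitTerm R).WellFormed ∧
    (join k i : CircuitTerm R).dom = k + 1 ∧ (join k i : CircuitTerm R).cod = k := by
  simp [join, WellFormed, dom, cod]
  omega

theorem wellFormed_fork {k i : ℕ} (h : i < k) : (fork k i : CircuitTerm R).WellFormed ∧
    (fork k i : CircuitTerm R).dom = k ∧ (fork k i : CircuitTerm R).cod = k + 1 := by
  simp [fork, WellFormed, dom, cod]
  omega

theorem wellFormed_units (k : ℕ) : (units k : CircuitTerm R).WellFormed ∧
    (units k : CircuitTerm R).dom = 0 ∧ (units k : CircuitTerm R).cod = k := by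
  induction k with
  | zero => simp [units, WellFormed, dom, cod]
  | succ k ih => simp [units, WellFormed, dom, cod, ih, Nat.add_comm]

theorem wellFormed_counits (k : ℕ) : (counits k : CircuitTerm R).WellFormed ∧
    (counits k : CircuitTerm R).dom = k ∧ (counits k : CircuitTerm R).cod = 0 := by
  induction k with
  | zero => simp [counits, WellFormed, dom, cod]
  | succ k ih => simp [counits, WellFormed, dom, cod, ih, Nat.add_comm]

theorem wellFormed_legsIn {k : ℕ} {l : List ℕ} (h : ∀ i ∈ l, i < k) :
    (legsIn k l : CircuitTerm R).WellFormed ∧ (legsIn k l : CircuitTerm R).dom = l.length ∧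
      (legsIn k l : CircuitTerm R).cod = k := by
  induction l with
  | nil => exact wellFormed_units k
  | cons a l ih =>
    have h1 := ih fun i hi => h i (List.mem_cons_of_mem _ hi)
    have h2 := wellFormed_join (R := R) (h a List.mem_cons_self)
    simp [legsIn, WellFormed, dom, cod, h1, h2, Nat.add_comm]

theorem wellFormed_legsOut {k : ℕ} {l : List ℕ} (h : ∀ i ∈ l, i < k) :
    (legsOut k l : CircuitTerm R).WellFormed ∧ (legsOut k l : CircuitTerm R).dom = k ∧
      (legsOut k l : CircuitTerm R).cod = l.length := by
  induction l with
  | nil => exact wellFormed_counits k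
  | cons a l ih =>
    have h1 := ih fun i hi => h i (List.mem_cons_of_mem _ hi)
    have h2 := wellFormed_fork (R := R) (h a List.mem_cons_self)
    simp [legsOut, WellFormed, dom, cod, h1, h2, Nat.add_comm]

theorem wellFormed_links {k : ℕ} {es : List (ℕ × ℕ × R)} (h : ∀ e ∈ es, e.1 < k ∧ e.2.1 < k)
    (h0 : ∀ e ∈ es, e.2.2 ≠ 0) :
    (links k es).WellFormed ∧ (links k es).dom = k ∧ (links k es).cod = k := by
  induction es with
  | nil => simp [links, WellFormed, dom, cod]
  | cons e es ih =>
    have h1 := ih (fun i hi => h i (List.mem_cons_of_mem _ hi))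
      (fun i hi => h0 i (List.mem_cons_of_mem _ hi))
    have h2 := wellFormed_fork (R := R) (h e List.mem_cons_self).1
    have h3 := wellFormed_join (R := R) (h e List.mem_cons_self).2
    simp [links, link, WellFormed, dom, cod, h1, h2, h3, Nat.add_comm, h0 e List.mem_cons_self]

end CircuitTerm

theorem Network.InRange.typed {N : Network R} (hN : N.InRange) (h0 : ∀ e ∈ N.edges, e.2.2 ≠ 0) :
    CircuitTerm.Typed N.inputs.length N.outputs.length N.toTerm := by
  have h1 := CircuitTerm.wellFormed_legsIn (R := R) hN.inputs_lt
  have h2 := CircuitTerm.wellFormed_links hN.edges_lt h0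
  have h3 := CircuitTerm.wellFormed_legsOut (R := R) hN.outputs_lt
  refine CircuitTerm.typed_iff.2 ?_
  simp [Network.toTerm, CircuitTerm.WellFormed, CircuitTerm.dom, CircuitTerm.cod, h1, h2, h3]

/-- The numbered nodes get names. -/
def Network.toNet {α : Type*} (z : ℕ → ℕ) (N : Network α) : Net α :=
  ⟨(List.range N.nodes).map z, N.inputs.map z, N.outputs.map z, mapEdges z N.edges⟩

theorem Network.InRange.valid_toNet {α : Type*} {N : Network α} (hN : N.InRange) {z : ℕ → ℕ}
    (hz : Set.InjOn z (Set.Iio N.nodes)) : (N.toNet z).Valid where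
  nodup := List.Nodup.map_on (fun i hi j hj h => hz (by simpa using hi) (by simpa using hj) h)
    List.nodup_range
  inputs_mem x hx := by
    obtain ⟨i, hi, rfl⟩ := List.mem_map.1 hx
    exact List.mem_map_of_mem (List.mem_range.2 (hN.inputs_lt i hi))
  outputs_mem x hx := by
    obtain ⟨i, hi, rfl⟩ := List.mem_map.1 hx
    exact List.mem_map_of_mem (List.mem_range.2 (hN.outputs_lt i hi))
  edges_mem x hx := by
    obtain ⟨i, hi, rfl⟩ := List.mem_map.1 hx
    exact ⟨List.mem_map_of_mem (List.mem_range.2 (hN.edges_lt i hi).1),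
      List.mem_map_of_mem (List.mem_range.2 (hN.edges_lt i hi).2)⟩

theorem idxOf_map_range {z : ℕ → ℕ} {k : ℕ} (hz : Set.InjOn z (Set.Iio k)) {i : ℕ} (hi : i < k) :
    ((List.range k).map z).idxOf (z i) = i := by
  have hn : ((List.range k).map z).Nodup := List.Nodup.map_on
    (fun i hi j hj h => hz (by simpa using hi) (by simpa using hj) h) List.nodup_range
  have := hn.idxOf_getElem i (by simpa using hi)
  simpa using this

theorem Network.InRange.toNetwork_toNet {α : Type*} {N : Network α} (hN : N.InRange) {z : ℕ → ℕ}
    (hz : Set.InjOn z (Set.Iio N.nodes)) : (N.toNet z).toNetwork = N := by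
  obtain ⟨k, ins, outs, es⟩ := N
  obtain ⟨h1, h2, h3⟩ := hN
  simp only at h1 h2 h3 hz
  have key : ∀ i < k, ((List.range k).map z).idxOf (z i) = i := fun i hi => idxOf_map_range hz hi
  simp only [Network.toNet, Net.toNetwork, mapEdges, List.length_map, List.length_range,
    List.map_map, Network.mk.injEq, true_and]
  refine ⟨?_, ?_, ?_⟩
  · conv_rhs => rw [← List.map_id ins]
    exact List.map_congr_left fun i hi => key i (h1 i hi)
  · conv_rhs => rw [← List.map_id outs]
    exact List.map_congr_left fun i hi => key i (h2 i hi)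
  · conv_rhs => rw [← List.map_id es]
    refine List.map_congr_left fun e he => ?_
    simp only [Function.comp_apply, key _ (h3 e he).1, key _ (h3 e he).2, id]

theorem Network.InRange.mk_toTerm {N : Network R} (hN : N.InRange) {z : ℕ → ℕ}
    (hz : Set.InjOn z (Set.Iio N.nodes)) : Q.mk N.toTerm = (N.toNet z).toQ := by
  rw [← Net.mk_toTerm (hN.valid_toNet hz), hN.toNetwork_toNet hz]

theorem Net.Valid.inRange {α : Type*} {N : Net α} (hN : N.Valid) : N.toNetwork.InRange where
  inputs_lt i hi := by
    obtain ⟨x, hx, rfl⟩ := List.mem_map.1 hi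
    exact List.idxOf_lt_length_iff.2 (hN.inputs_mem hx)
  outputs_lt i hi := by
    obtain ⟨x, hx, rfl⟩ := List.mem_map.1 hi
    exact List.idxOf_lt_length_iff.2 (hN.outputs_mem hx)
  edges_lt i hi := by
    obtain ⟨x, hx, rfl⟩ := List.mem_map.1 hi
    exact ⟨List.idxOf_lt_length_iff.2 (hN.edges_mem x hx).1,
      List.idxOf_lt_length_iff.2 (hN.edges_mem x hx).2⟩

theorem Net.Valid.typed {N : Net R} (hN : N.Valid) (h0 : ∀ e ∈ N.edges, e.2.2 ≠ 0) :
    CircuitTerm.Typed N.inputs.length N.outputs.length N.toNetwork.toTerm := by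
  have := hN.inRange.typed (R := R) (by
    intro e he
    obtain ⟨x, hx, rfl⟩ := List.mem_map.1 he
    exact h0 x hx)
  simpa [Net.toNetwork] using this

end ResistorCircuit

namespace ResistorCircuit
variable {R : Type*} [CommSemiring R]

/-! ### Rewriting steps between networks -/

namespace Q

/-- A class of well-formed circuits. -/
def WF (u : Q R) : Prop := ∃ t : CircuitTerm R, t.WellFormed ∧ mk t = u

/-- A rewriting step. -/
def Rewrites (u v : Q R) : Prop :=
  WF u ∧ WF v ∧ ∃ (p q : ℕ) (a b : Q R) (l r : CircuitTerm R), Rule l r ∧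
    u = a * Net.layer p (mk l) q * b ∧ v = a * Net.layer p (mk r) q * b

theorem toDiagram_eq {n m : ℕ} {s t : CircuitTerm R} (hs : s.Typed n m) (ht : t.Typed n m)
    (h : mk s = mk t) : Circuit.toDiagram ⟨s, hs⟩ = Circuit.toDiagram ⟨t, ht⟩ :=
  Quotient.sound (cong_of_eq h hs)

theorem mk_eq_of_toDiagram {n m : ℕ} {s t : CircuitTerm R} {hs : s.Typed n m} {ht : t.Typed n m}
    (h : Circuit.toDiagram ⟨s, hs⟩ = Circuit.toDiagram ⟨t, ht⟩) : mk s = mk t :=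
  eq_of_cong (Quotient.exact h)

theorem Rewrites.step {n m : ℕ} {s t : CircuitTerm R} (hs : s.Typed n m) (ht : t.Typed n m)
    (h : Rewrites (mk s) (mk t)) :
    Step (Circuit.toDiagram ⟨s, hs⟩) (Circuit.toDiagram ⟨t, ht⟩) := by
  obtain ⟨-, -, p, q, a, b, l, r, hr, h1, h2⟩ := h
  induction a using Q.ind with | h a =>
  induction b using Q.ind with | h b =>
  have h1' : mk s = mk (a ⨟ .id p ⊠ l ⊠ .id q ⨟ b) := h1
  have h2' : mk t = mk (a ⨟ .id p ⊠ r ⊠ .id q ⨟ b) := h2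
  have k1 := (cong_of_eq h1' hs).typed.2
  have k2 := (cong_of_eq h2' ht).typed.2
  exact ⟨p, q, a, b, l, r, hr, k1, k2, toDiagram_eq _ _ h1', toDiagram_eq _ _ h2'⟩

theorem Rewrites.dom_eq {u v : Q R} (h : Rewrites u v) : u.dom = v.dom := by
  obtain ⟨-, -, p, q, a, b, l, r, hr, rfl, rfl⟩ := h
  simp

theorem Rewrites.cod_eq {u v : Q R} (h : Rewrites u v) : u.cod = v.cod := by
  obtain ⟨-, -, p, q, a, b, l, r, hr, rfl, rfl⟩ := h
  simp

/-- Every class along the chain has a well-formed representative, and its type is fixed by the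
surroundings of the replaced part; so the chain lifts to diagrams of one type. -/
theorem reduces_of_rewrites {u v : Q R} (h : Relation.ReflTransGen Rewrites u v) {n m : ℕ}
    {s t : CircuitTerm R} (hs : s.Typed n m) (ht : t.Typed n m) (hu : mk s = u) (hv : mk t = v) :
    Reduces (Circuit.toDiagram ⟨s, hs⟩) (Circuit.toDiagram ⟨t, ht⟩) := by
  induction h using Relation.ReflTransGen.head_induction_on generalizing s with
  | refl =>
    rw [toDiagram_eq hs ht (hu.trans hv.symm)]
    exact .refl
  | head h1 _ ih =>
    obtain ⟨r, hr, rfl⟩ := h1.2.1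
    have hd := h1.dom_eq
    have hc := h1.cod_eq
    subst hu
    obtain ⟨-, rfl, rfl⟩ := CircuitTerm.typed_iff.1 hs
    have hr' : r.Typed s.dom s.cod := CircuitTerm.typed_iff.2 ⟨hr, hd.symm, hc.symm⟩
    exact .head (h1.step hs hr') (ih hr' rfl)

/-! ### Loops and parallel edges -/

theorem layer_wh (p : ℕ) (f : Q R) (q : ℕ) : wh (Net.layer p f q) = Net.layer (p + 1) f q := by
  rw [Net.layer, Net.layer, one_succ_tens]

theorem wh_layer_zero (f : Q R) (k : ℕ) : f ⊙ one k = Net.layer 0 f k := by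
  rw [Net.layer, one_zero_tens]

theorem S_W_S (y : R) (k : ℕ) : S k * W y (k + 1) * S k = wh (W y k) := by
  rw [mul_assoc, W_S, S_S_mul _ _ (by simp)]

theorem link_cons {L : List ℕ} {a b c : ℕ} (ha : a ≠ c) (hb : b ≠ c) (y : R) :
    link (c :: L) a b y = wh (link L a b y) := by
  rw [link, F_ne ha, J_ne hb, link, wh_mul, wh_mul, ← S_W_S, List.length_cons]
  simp only [mul_assoc]

theorem exists_layer_loop {L : List ℕ} {a : ℕ} (ha : a ∈ L) (y : R) : ∃ p q,
    link L a a y = Net.layer p (mk (.comul ⨟ .cond y ⊠ .id 1 ⨟ .mul)) q ∧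
      one L.length = Net.layer p (mk (.id 1 : CircuitTerm R)) q := by
  induction L with
  | nil => simp at ha
  | cons c L ih =>
    by_cases h : a = c
    · subst h
      refine ⟨0, L.length, ?_, ?_⟩
      · rw [← wh_layer_zero, link, F_self, J_self]
        change _ = ((de * (cd y ⊙ one 1)) * mu) ⊙ one L.length
        rw [mul_tens_one, mul_tens_one, tens_assoc, one_tens_one, List.length_cons,
          Nat.add_comm L.length, D, M, W]
      · rw [← wh_layer_zero, List.length_cons, Nat.add_comm L.length]
        exact (one_tens_one 1 _).symm
    · obtain ⟨p, q, h1, h2⟩ := ih (mem_tail ha h)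
      exact ⟨p + 1, q, by rw [link_cons h h, h1, layer_wh], by
        rw [← layer_wh, ← h2, wh_one, List.length_cons]⟩

/-- Joins, copies and conductances are moved past each other until both conductances lie between a
single copy of `a` and a single join to `b`; this is the left side of the parallel rule. -/
theorem link_link {L : List ℕ} {a b : ℕ} (ha : a ∈ L) (hb : b ∈ L) (y z : R) :
    link L a b y * link L a b z =
      F L a * Net.layer 0 (mk (.comul ⨟ .cond y ⊠ .cond z ⨟ .mul)) L.length * J L b := by
  have h1 := J_F (R := R) hb ha
  have h2 := W_slide y (F L a) (dom_F ha) (cod_F ha)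
  have h3 := W_slide z (J L b) (dom_J hb) (cod_J hb)
  have h4 : Net.layer 0 (mk (.comul ⨟ .cond y ⊠ .cond z ⨟ .mul)) L.length =
      D L.length * (W y (L.length + 1) * wh (W z L.length)) * M L.length := by
    change Net.layer 0 (de * (cd y ⊙ cd z) * mu) _ = _
    rw [← wh_layer_zero, mul_tens_one, mul_tens_one, tens_eq_left (cd y), mul_tens_one, tens_assoc,
      one_tens_one]
    change D _ * (W y (1 + L.length) * ((one 1 ⊙ cd z) ⊙ one _)) * M _ = _
    rw [tens_assoc, Nat.add_comm 1]
    rfl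
  have h5 := W_S z L.length
  rw [h4, link, link]
  simp only [mul_assoc]
  rw [reassoc h1]
  simp only [mul_assoc]
  rw [reassoc h2, reassoc (F_D ha), M_J hb]
  simp only [mul_assoc]
  -- The crossing of the two legs disappears because they are merged before being joined to `b`.
  have h6 : S L.length * (W z (L.length + 1) * (wh (J L b) * J L b)) =
      wh (W z L.length) * (wh (J L b) * J L b) := by
    rw [← M_J hb, ← S_W_S]
    simp only [mul_assoc]
    rw [reassoc (S_M _)]
  rw [← h6, reassoc h3, mul_assoc]

theorem cd_layer {L : List ℕ} {a b : ℕ} (y : R) :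
    link L a b y = F L a * Net.layer 0 (mk (.cond y)) L.length * J L b := by
  rw [← wh_layer_zero]
  rfl

/-! ### Stars and meshes -/

/-- `us.length` new wires are joined to the wires `us`. -/
def Js (L : List ℕ) : List ℕ → Q R
  | [] => one L.length
  | u :: us => wh (Js L us) * J L u

theorem dom_Js (L us : List ℕ) : (Js L us : Q R).dom = us.length + L.length := by
  induction us with
  | nil => simp [Js]
  | cons u us ih => simp [Js, ih]; omega

theorem cod_Js {L us : List ℕ} (h : us ⊆ L) : (Js L us : Q R).cod = L.length := by
  cases us with
  | nil => simp [Js]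
  | cons u us => simp [Js, cod_J (h List.mem_cons_self)]

theorem jpush_links {L : List ℕ} {es : List (ℕ × ℕ × R)} (h : EdgesIn L es) :
    JPush (links L es) L L fun x => x := by
  induction es with
  | nil => exact .refl L
  | cons e es ih => exact (jpush_link h.head.1 h.head.2 _).comp (ih h.tail)

/-- The edges of a star with centre `w`. -/
def spokes {α : Type*} (w : ℕ) (l : List (ℕ × α)) : List (ℕ × ℕ × α) := l.map fun p => (w, p)

theorem edgesIn_spokes {α : Type*} {L : List ℕ} {l : List (ℕ × α)} (h : l.map Prod.fst ⊆ L)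
    (w : ℕ) : EdgesIn (w :: L) (spokes w l) := by
  intro e he
  obtain ⟨p, hp, rfl⟩ := List.mem_map.1 he
  exact ⟨List.mem_cons_self, List.mem_cons_of_mem _ (h (List.mem_map_of_mem hp))⟩

/-- The centre is copied once for each spoke and then ends, so it is a split junction with a
conductance on each leg; `Js` attaches the legs to the outer ends. -/
theorem links_spokes {L : List ℕ} {w : ℕ} (hw : w ∉ L) {l : List (ℕ × R)}
    (h : l.map Prod.fst ⊆ L) :
    links (w :: L) (spokes w l) * C L.length =
      (mk (.split l.length ⨟ .conds (l.map Prod.snd)) ⊙ one L.length) * Js L (l.map Prod.fst) := by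
  induction l with
  | nil =>
    change one _ * C _ = ((ep * one 0) ⊙ one _) * one _
    rw [mul_one' (n := 0) ep rfl, one_mul' _ (by simp), mul_one' _ (by simp)]
    rfl
  | cons p l ih =>
    obtain ⟨u, y⟩ := p
    rw [List.map_cons, List.cons_subset] at h
    have hu : u ≠ w := by rintro rfl; exact hw h.1
    have hd : (mk (.split l.length ⨟ .conds (l.map Prod.snd)) : Q R).dom = 1 := by
      cases l <;> rfl
    have key : (mk (.split (l.length + 1) ⨟ .conds (y :: l.map Prod.snd)) ⊙ one L.length : Q R) =
        D L.length * W y (L.length + 1) *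
          wh (mk (.split l.length ⨟ .conds (l.map Prod.snd)) ⊙ one L.length) := by
      change ((de * (one 1 ⊙ mk (.split l.length))) * (cd y ⊙ mk (.conds (l.map Prod.snd)))) ⊙ _ = _
      rw [mul_assoc, interchange _ _ _ _ rfl, one_mul' _ (dom_cd y), ← mk_comp, mul_tens_one,
        tens_eq_left (cd y), hd, mul_tens_one, mul_assoc, tens_assoc, one_tens_one, tens_assoc,
        Nat.add_comm L.length]
      rfl
    have h1 := (jpush_links (edgesIn_spokes h.2 w)).push u (List.mem_cons_of_mem _ h.1)
    have h2 := C_slide (J L u : Q R) (dom_J h.1) (cod_J h.1)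
    rw [J_ne hu] at h1
    rw [List.length_cons, List.map_cons, List.map_cons, key, Js]
    change link (w :: L) w u y * links (w :: L) (spokes w l) * _ = _
    have ih' := congrArg wh (ih h.2)
    rw [wh_mul, wh_mul] at ih'
    rw [mul_assoc _ (wh _) (wh _ * _), ← mul_assoc (wh _) (wh _), ← ih', link, F_self, J_ne hu]
    simp only [mul_assoc] at h1 ⊢
    have h3 := congrArg (· * C L.length) h1
    simp only [mul_assoc] at h3
    rw [h3, ← h2, reassoc (S_C _), List.length_cons]

theorem J_tens {K : List ℕ} {a : ℕ} (ha : a ∈ K) (L : List ℕ) :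
    J K a ⊙ one L.length = (J (K ++ L) a : Q R) := by
  induction K with
  | nil => simp at ha
  | cons c K ih =>
    by_cases h : a = c
    · subst h
      rw [List.cons_append, J_self, J_self, M, tens_assoc, one_tens_one, M, List.length_append]
    · rw [List.cons_append, J_ne h, J_ne h, mul_tens_one, S, tens_assoc, one_tens_one, S,
        List.length_append, ← wh_tens, ih (mem_tail ha h)]

theorem F_tens {K : List ℕ} {a : ℕ} (ha : a ∈ K) (L : List ℕ) :
    F K a ⊙ one L.length = (F (K ++ L) a : Q R) := by
  induction K with
  | nil => simp at ha
  | cons c K ih =>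
    by_cases h : a = c
    · subst h
      rw [List.cons_append, F_self, F_self, D, tens_assoc, one_tens_one, D, List.length_append]
    · rw [List.cons_append, F_ne h, F_ne h, mul_tens_one, S, tens_assoc, one_tens_one, S,
        List.length_append, ← wh_tens, ih (mem_tail ha h)]

theorem links_tens {K : List ℕ} {es : List (ℕ × ℕ × R)} (h : EdgesIn K es) (L : List ℕ) :
    links K es ⊙ one L.length = links (K ++ L) es := by
  induction es with
  | nil => rw [links, links, one_tens_one, List.length_append]
  | cons e es ih =>
    rw [links, links, mul_tens_one, ih h.tail, link, mul_tens_one, mul_tens_one,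
      F_tens h.head.1, J_tens h.head.2, W, tens_assoc, one_tens_one, ← List.length_append]
    rfl

theorem Un_Js {L us : List ℕ} (h : us ⊆ L) :
    (Un us.length ⊙ one L.length) * Js L us = (one L.length : Q R) := by
  induction us with
  | nil => rw [Js, List.length_nil, Un, one_tens_one, mul_one' _ (by simp), Nat.zero_add]
  | cons u us ih =>
    rw [List.cons_subset] at h
    have h1 := E_slide (Js L us : Q R) (dom_Js L us) (cod_Js h.2)
    rw [Js, List.length_cons, Un, mul_tens_one, E, tens_assoc, one_tens_one]
    change _ * E _ * _ = _
    rw [mul_assoc, reassoc h1, mul_assoc, E_J h.1, mul_one' _ (by simp [cod_Js h.2]), ih h.2]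

theorem JPush.cons {f : Q R} {L L' : List ℕ} {σ : ℕ → ℕ} (h : JPush f L L' σ) {v : ℕ}
    (hv : v ∉ L) (hv' : v ∉ L') : JPush (wh f) (v :: L) (v :: L') (Function.update σ v v) where
  dom_eq := by simp [h.dom_eq]
  cod_eq := by simp [h.cod_eq]
  mem a ha := by
    by_cases hc : a = v
    · subst hc
      simp
    · rw [Function.update_of_ne hc]
      exact List.mem_cons_of_mem _ (h.mem a (mem_tail ha hc))
  push a ha := by
    by_cases hc : a = v
    · subst hc
      rw [J_self, Function.update_self, J_self, M_slide f h.dom_eq h.cod_eq]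
    · have hm := mem_tail ha hc
      have hne : σ a ≠ v := fun hh => hv' (hh ▸ h.mem a hm)
      rw [J_ne hc, Function.update_of_ne hc, J_ne hne, mul_assoc, ← wh_mul, h.push a hm, wh_mul,
          ← mul_assoc, ← S_slide f h.dom_eq h.cod_eq, mul_assoc]

/-- A mesh is drawn on new, distinct nodes `vs`, and `Js` identifies them with the outer ends `us`,
among which there may be repetitions. The map `σ` records this identification. -/
theorem exists_jpush_Js {L us vs : List ℕ} (h : us ⊆ L) (hl : vs.length = us.length)
    (hvs : vs.Nodup) (hd : ∀ v ∈ vs, v ∉ L) :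
    ∃ σ, JPush (Js L us : Q R) (vs ++ L) L σ ∧ vs.map σ = us ∧ ∀ a ∈ L, σ a = a := by
  induction us generalizing vs with
  | nil =>
    obtain rfl := List.length_eq_zero_iff.1 hl
    exact ⟨fun a => a, .refl L, rfl, fun _ _ => rfl⟩
  | cons u us ih =>
    obtain ⟨v, vs, rfl⟩ := List.exists_cons_of_length_eq_add_one hl
    rw [List.cons_subset] at h
    rw [List.nodup_cons] at hvs
    obtain ⟨σ, h1, h2, h3⟩ := ih (vs := vs) h.2 (by simpa using hl) hvs.2
      fun x hx => hd x (List.mem_cons_of_mem _ hx)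
    have hv : v ∉ L := hd v List.mem_cons_self
    have h4 := h1.cons (v := v) (by simp [hvs.1, hv]) hv
    have key : ∀ a ∈ vs ++ L, subst v u (Function.update σ v v a) = σ a := by
      intro a ha
      have hne : a ≠ v := by
        rintro rfl
        simp [hvs.1, hv] at ha
      have := h1.mem a ha
      rw [Function.update_of_ne hne, subst_ne (by rintro hh; exact hv (hh ▸ this))]
    refine ⟨_, h4.comp (jpush_J v h.1), ?_, fun a ha => ?_⟩
    · rw [List.map_cons, Function.update_self, subst_self, ← h2]
      exact congrArg _ (List.map_congr_left fun a ha => key a (List.mem_append_left _ ha))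
    · rw [key a (List.mem_append_right _ ha), h3 a ha]

end Q

namespace Net
open Q

/-- The edges of the mesh that replaces a star with the given ends and conductances. -/
def meshEdges {α : Type*} (φ : α → α → α) (l : List (ℕ × α)) : List (ℕ × ℕ × α) :=
  ((List.finRange l.length ×ˢ List.finRange l.length).filter fun p => p.1 < p.2).map fun p =>
    (l[p.1].1, l[p.2].1, φ l[p.1].2 l[p.2].2)

theorem edgesIn_meshEdges {α : Type*} (φ : α → α → α) {L : List ℕ} {l : List (ℕ × α)}
    (h : l.map Prod.fst ⊆ L) : EdgesIn L (meshEdges φ l) := by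
  intro e he
  obtain ⟨p, hp, rfl⟩ := List.mem_map.1 he
  exact ⟨h (List.mem_map.2 ⟨_, List.getElem_mem _, rfl⟩), h (List.mem_map.2 ⟨_, List.getElem_mem _, rfl⟩)⟩

theorem Valid.wf {N : Net R} (hN : N.Valid) (h0 : ∀ e ∈ N.edges, e.2.2 ≠ 0) : WF N.toQ :=
  ⟨_, (hN.typed h0).wellFormed.1, mk_toTerm hN⟩

theorem mk_mesh_tens {l : List (ℕ × R)} {L : List ℕ} (h : l.map Prod.fst ⊆ L) :
    (Q.mk (mesh fun i : Fin l.length => l[i].2) ⊙ one L.length) * Js L (l.map Prod.fst) =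
      Q.links L (meshEdges (fun y z => y * z * Ring.inverse (l.map Prod.snd).sum) l) := by
  -- The nodes of the mesh get names that exceed every member of `L`.
  let z : ℕ → ℕ := fun i => L.sum + 1 + i
  have hz : ∀ s, Set.InjOn z s := fun s i _ j _ hij => by
    simp only [z] at hij
    omega
  have hzL : ∀ i, z i ∉ L := fun i hi => by
    have := List.le_sum_of_mem hi
    simp only [z] at this
    omega
  set y : Fin l.length → R := fun i => l[i].2 with hy
  let E : List (ℕ × ℕ × R) :=
    ((List.finRange l.length ×ˢ List.finRange l.length).filter fun p => p.1 < p.2).map fun p =>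
        ((p.1 : ℕ), (p.2 : ℕ), y p.1 * y p.2 * Ring.inverse (∑ k, y k))
  have hr : (⟨l.length, [], List.range l.length, E⟩ : Network R).InRange := by
    refine ⟨by simp, by simp, fun e he => ?_⟩
    obtain ⟨p, hp, rfl⟩ := List.mem_map.1 he
    simp
  have hv := hr.valid_toNet (z := z) (hz _)
  have hm := hr.mk_toTerm (z := z) (hz _)
  set vs := (List.range l.length).map z with hvs
  have hvn : vs.Nodup := hv.nodup
  have hve : EdgesIn vs (mapEdges z E) := hv.edges_mem
  have h1 : Q.mk (mesh y) = Un l.length * Q.links vs (mapEdges z E) := by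
    refine hm.trans ?_
    change (Un vs.length * Q.links vs (mapEdges z E)) * legsO vs vs = _
    rw [legsO_self hvn, mul_one' _ (by simp [cod_links hve])]
    simp [hvs]
  obtain ⟨σ, h2, h3, h4⟩ := exists_jpush_Js (R := R) (vs := vs) h (by simp [hvs]) hv.nodup
    (by simp [hvs, hzL])
  have h5 := h2.links (es := mapEdges z E) fun e he =>
    ⟨List.mem_append_left _ (hv.edges_mem e he).1, List.mem_append_left _ (hv.edges_mem e he).2⟩
  rw [h1, mul_tens_one, links_tens hve, mul_assoc, h5, ← mul_assoc]
  have h6 := Un_Js (R := R) h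
  rw [List.length_map] at h6
  rw [h6]
  have h7 : mapEdges σ (mapEdges z E) =
      meshEdges (fun y z => y * z * Ring.inverse (l.map Prod.snd).sum) l := by
    have hs : ∑ k, y k = (l.map Prod.snd).sum := by
      rw [← List.sum_ofFn]
      congr 1
      exact List.ext_getElem (by simp) (by simp [hy])
    have hσ : ∀ i : Fin l.length, σ (z i) = l[i].1 := fun i => by
      have := congrArg (fun t : List ℕ => t[(i : ℕ)]?) h3
      simpa [hvs] using this
    simp only [mapEdges, E, List.map_map, meshEdges, hs]
    refine List.map_congr_left fun p _ => ?_
    simp [hσ, hy]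
  rw [h7, one_mul' _ (dom_links (edgesIn_meshEdges _ h))]

/-- As `w` carries no legs, it begins with a unit and ends with a counit, and with its spokes it is
a star in the sense of the rule. Spokes may have the same outer end; the mesh then has loops or
parallel edges. -/
theorem rewrites_star {L ins outs : List ℕ} {f : List (ℕ × ℕ × R)} {w : ℕ} {l : List (ℕ × R)}
    (hN : (⟨L, ins, outs, f⟩ : Net R).Valid) (hw : w ∉ L) (hl : l.map Prod.fst ⊆ L)
    (h0 : ∀ e ∈ f, e.2.2 ≠ 0) (hl0 : ∀ p ∈ l, p.2 ≠ 0)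
    (hm0 : ∀ p ∈ l, ∀ q ∈ l, p.2 * q.2 * Ring.inverse (l.map Prod.snd).sum ≠ 0) :
    Rewrites (toQ ⟨w :: L, ins, outs, f ++ spokes w l⟩)
      (toQ ⟨L, ins, outs, f ++
        meshEdges (fun y z => y * z * Ring.inverse (l.map Prod.snd).sum) l⟩) := by
  have he : EdgesIn (w :: L) (f ++ spokes w l) := by
    intro e he
    rcases List.mem_append.1 he with h | h
    · exact ⟨List.mem_cons_of_mem _ (hN.edges_mem e h).1,
        List.mem_cons_of_mem _ (hN.edges_mem e h).2⟩
    · exact edgesIn_spokes hl w e h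
  have hv : (⟨w :: L, ins, outs, f ++ spokes w l⟩ : Net R).Valid :=
    ⟨List.nodup_cons.2 ⟨hw, hN.nodup⟩, List.subset_cons_of_subset _ hN.inputs_mem,
      List.subset_cons_of_subset _ hN.outputs_mem, he⟩
  have hv' : (⟨L, ins, outs, f ++
      meshEdges (fun y z => y * z * Ring.inverse (l.map Prod.snd).sum) l⟩ : Net R).Valid :=
    ⟨hN.nodup, hN.inputs_mem, hN.outputs_mem, fun e he => (List.mem_append.1 he).elim
      (hN.edges_mem e) (edgesIn_meshEdges _ hl e)⟩
  refine ⟨hv.wf ?_, hv'.wf ?_, 0, L.length, legsI L ins * Q.links L f,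
    Js L (l.map Prod.fst) * legsO L outs, .star (List.ofFn fun i : Fin l.length => l[i].2),
    mesh fun i : Fin l.length => l[i].2, .star_mesh _ fun i => hl0 _ (List.getElem_mem _), ?_, ?_⟩
  · intro e he
    rcases List.mem_append.1 he with h | h
    · exact h0 e h
    · obtain ⟨p, hp, rfl⟩ := List.mem_map.1 h
      exact hl0 p hp
  · intro e he
    rcases List.mem_append.1 he with h | h
    · exact h0 e h
    · obtain ⟨p, hp, rfl⟩ := List.mem_map.1 h
      exact hm0 _ (List.getElem_mem _) _ (List.getElem_mem _)
  · have h2 := (jpush_E (R := R) hw).legsI rfl hN.inputs_mem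
    have h3 := (jpush_E (R := R) hw).links hN.edges_mem
    simp only [List.map_id', mapEdges] at h2 h3
    have h4 := links_spokes hw hl
    have h5 : Q.mk (.star (List.ofFn fun i : Fin l.length => l[i].2)) ⊙ one L.length =
        E L.length * (Q.mk (.split l.length ⨟ .conds (l.map Prod.snd)) ⊙ one L.length) := by
      have : (List.ofFn fun i : Fin l.length => l[i].2) = l.map Prod.snd :=
        List.ext_getElem (by simp) (by simp)
      rw [this, CircuitTerm.star, List.length_map]
      change ((et * Q.mk _) * Q.mk _) ⊙ _ = _
      rw [mul_assoc, ← mk_comp, mul_tens_one]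
      rfl
    rw [← wh_layer_zero, h5, toQ]
    simp only
    rw [legsO_cons hw hN.outputs_mem, links_append (edgesIn_spokes hl w), ← h2]
    simp only [mul_assoc]
    rw [reassoc h4, mul_assoc, reassoc h3, mul_assoc]
  · rw [← wh_layer_zero, ← mul_assoc, mul_assoc (_ * _) (_ ⊙ _), mk_mesh_tens hl, toQ]
    simp only
    rw [links_append (edgesIn_meshEdges _ hl)]
    simp only [mul_assoc]

theorem rewrites_loop {L ins outs : List ℕ} {f : List (ℕ × ℕ × R)} {a : ℕ} {y : R}
    (hN : (⟨L, ins, outs, f⟩ : Net R).Valid) (ha : a ∈ L) (h0 : ∀ e ∈ f, e.2.2 ≠ 0) (hy : y ≠ 0) :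
    Rewrites (toQ ⟨L, ins, outs, (a, a, y) :: f⟩) (toQ ⟨L, ins, outs, f⟩) := by
  have hv : (⟨L, ins, outs, (a, a, y) :: f⟩ : Net R).Valid :=
    ⟨hN.nodup, hN.inputs_mem, hN.outputs_mem, fun e he => (List.mem_cons.1 he).elim
      (by rintro rfl; exact ⟨ha, ha⟩) (hN.edges_mem e)⟩
  obtain ⟨p, q, h1, h2⟩ := exists_layer_loop ha y
  refine ⟨hv.wf ?_, hN.wf h0, p, q, legsI L ins, Q.links L f * legsO L outs, _, _,
    .short_circuit y, ?_, ?_⟩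
  · simpa [hy] using h0
  · rw [← h1, toQ]
    simp only [Q.links, mul_assoc]
  · rw [← h2, toQ, mul_one' _ (cod_legsI hN.inputs_mem)]
    simp only [mul_assoc]

theorem rewrites_parallel {L ins outs : List ℕ} {f : List (ℕ × ℕ × R)} {a b : ℕ} {y z : R}
    (hN : (⟨L, ins, outs, f⟩ : Net R).Valid) (ha : a ∈ L) (hb : b ∈ L) (h0 : ∀ e ∈ f, e.2.2 ≠ 0)
    (hy : y ≠ 0) (hz : z ≠ 0) (hyz : y + z ≠ 0) :
    Rewrites (toQ ⟨L, ins, outs, (a, b, y) :: (a, b, z) :: f⟩)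
      (toQ ⟨L, ins, outs, (a, b, y + z) :: f⟩) := by
  have hv : (⟨L, ins, outs, (a, b, y) :: (a, b, z) :: f⟩ : Net R).Valid :=
    ⟨hN.nodup, hN.inputs_mem, hN.outputs_mem, by
      simpa [EdgesIn, ha, hb] using hN.edges_mem⟩
  have hv' : (⟨L, ins, outs, (a, b, y + z) :: f⟩ : Net R).Valid :=
    ⟨hN.nodup, hN.inputs_mem, hN.outputs_mem, by
      simpa [EdgesIn, ha, hb] using hN.edges_mem⟩
  refine ⟨hv.wf ?_, hv'.wf ?_, 0, L.length, legsI L ins * F L a,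
    J L b * (Q.links L f * legsO L outs), _, _, .parallel y z, ?_, ?_⟩
  · simpa [hy, hz] using h0
  · simpa [hyz] using h0
  · have := link_link ha hb y z
    rw [toQ]
    simp only [Q.links]
    rw [← mul_assoc (link L _ _ _), this]
    simp only [mul_assoc]
  · rw [toQ]
    simp only [Q.links, cd_layer, mul_assoc]

end Net
end ResistorCircuit

namespace ResistorCircuit
section
variable {R : Type*}

/-! ### Labellings of the nodes of a circuit -/

/-- `Lab t x y U e`: the nodes of the network drawn by `t` are labelled by the elements of `U`
(different nodes may get the same label), the inputs and outputs are attached to the nodes `x` and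
`y`, and the edges are `e`. -/
def Lab : CircuitTerm R → List ℕ → List ℕ → Finset ℕ → Multiset (Sym2 ℕ × R) → Prop
  | .id n, x, y, U, e => x.length = n ∧ y = x ∧ U = x.toFinset ∧ e = 0
  | .comp f g, x, y, U, e => ∃ z U₁ U₂ e₁ e₂, Lab f x z U₁ e₁ ∧ Lab g z y U₂ e₂ ∧ U = U₁ ∪ U₂ ∧
      e = e₁ + e₂
  | .tensor f g, x, y, U, e => ∃ x₁ x₂ y₁ y₂ U₁ U₂ e₁ e₂, Lab f x₁ y₁ U₁ e₁ ∧ Lab g x₂ y₂ U₂ e₂ ∧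
      x = x₁ ++ x₂ ∧ y = y₁ ++ y₂ ∧ U = U₁ ∪ U₂ ∧ e = e₁ + e₂
  | .swap a b, x, y, U, e => ∃ p q, p.length = a ∧ q.length = b ∧ x = p ++ q ∧ y = q ++ p ∧
      U = x.toFinset ∧ e = 0
  | .mul, x, y, U, e => ∃ v, x = [v, v] ∧ y = [v] ∧ U = {v} ∧ e = 0
  | .unit, x, y, U, e => ∃ v, x = [] ∧ y = [v] ∧ U = {v} ∧ e = 0
  | .comul, x, y, U, e => ∃ v, x = [v] ∧ y = [v, v] ∧ U = {v} ∧ e = 0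
  | .counit, x, y, U, e => ∃ v, x = [v] ∧ y = [] ∧ U = {v} ∧ e = 0
  | .cond c, x, y, U, e => ∃ u v, x = [u] ∧ y = [v] ∧ U = {u, v} ∧ e = {(s(u, v), c)}

theorem Lab.length {t : CircuitTerm R} {x y : List ℕ} {U : Finset ℕ} {e : Multiset (Sym2 ℕ × R)}
    (h : Lab t x y U e) : x.length = t.dom ∧ y.length = t.cod := by
  induction t generalizing x y U e with
  | id n => obtain ⟨h, rfl, -⟩ := h; exact ⟨h, h⟩
  | comp f g hf hg =>
    obtain ⟨z, U₁, U₂, e₁, e₂, h1, h2, -⟩ := h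
    exact ⟨(hf h1).1, (hg h2).2⟩
  | tensor f g hf hg =>
    obtain ⟨x₁, x₂, y₁, y₂, U₁, U₂, e₁, e₂, h1, h2, rfl, rfl, -⟩ := h
    simp [CircuitTerm.dom, CircuitTerm.cod, hf h1, hg h2]
  | swap a b =>
    obtain ⟨p, q, rfl, rfl, rfl, rfl, -⟩ := h
    simp [CircuitTerm.dom, CircuitTerm.cod]
  | cond c => obtain ⟨u, v, rfl, rfl, -⟩ := h; exact ⟨rfl, rfl⟩
  | _ => obtain ⟨v, rfl, rfl, -⟩ := h; exact ⟨rfl, rfl⟩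

theorem Lab.subset {t : CircuitTerm R} {x y : List ℕ} {U : Finset ℕ} {e : Multiset (Sym2 ℕ × R)}
    (h : Lab t x y U e) : x.toFinset ⊆ U ∧ y.toFinset ⊆ U := by
  induction t generalizing x y U e with
  | id n => obtain ⟨h, rfl, rfl, -⟩ := h; simp
  | comp f g hf hg =>
    obtain ⟨z, U₁, U₂, e₁, e₂, h1, h2, rfl, -⟩ := h
    exact ⟨(hf h1).1.trans Finset.subset_union_left, (hg h2).2.trans Finset.subset_union_right⟩
  | tensor f g hf hg =>
    obtain ⟨x₁, x₂, y₁, y₂, U₁, U₂, e₁, e₂, h1, h2, rfl, rfl, rfl, -⟩ := h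
    simp only [List.toFinset_append]
    exact ⟨Finset.union_subset_union (hf h1).1 (hg h2).1,
      Finset.union_subset_union (hf h1).2 (hg h2).2⟩
  | swap a b =>
    obtain ⟨p, q, rfl, rfl, rfl, rfl, rfl, -⟩ := h
    simp [Finset.union_comm]
  | cond c => obtain ⟨u, v, rfl, rfl, rfl, -⟩ := h; simp
  | _ => obtain ⟨v, rfl, rfl, rfl, -⟩ := h; simp

theorem lab_id_one {x y : List ℕ} {U : Finset ℕ} {e : Multiset (Sym2 ℕ × R)} :
    Lab (.id 1) x y U e ↔ ∃ v, x = [v] ∧ y = [v] ∧ U = {v} ∧ e = 0 := by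
  simp only [Lab, List.length_eq_one_iff]
  constructor
  · rintro ⟨⟨v, rfl⟩, rfl, rfl, rfl⟩
    exact ⟨v, by simp⟩
  · rintro ⟨v, rfl, rfl, rfl, rfl⟩
    exact ⟨⟨v, rfl⟩, by simp⟩

theorem lab_swap_one {x y : List ℕ} {U : Finset ℕ} {e : Multiset (Sym2 ℕ × R)} :
    Lab (.swap 1 1) x y U e ↔ ∃ u v, x = [u, v] ∧ y = [v, u] ∧ U = {u, v} ∧ e = 0 := by
  simp only [Lab, List.length_eq_one_iff]
  constructor
  · rintro ⟨_, _, ⟨v, rfl⟩, ⟨u, rfl⟩, rfl, rfl, rfl, rfl⟩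
    exact ⟨v, u, by simp⟩
  · rintro ⟨u, v, rfl, rfl, rfl, rfl⟩
    exact ⟨[u], [v], by simp⟩

theorem Lab.comp {f g : CircuitTerm R} {x y z : List ℕ} {U V : Finset ℕ}
    {e e' : Multiset (Sym2 ℕ × R)} (hf : Lab f x y U e) (hg : Lab g y z V e') :
    Lab (f ⨟ g) x z (U ∪ V) (e + e') := ⟨_, _, _, _, _, hf, hg, rfl, rfl⟩

theorem Lab.tensor {f g : CircuitTerm R} {x y x' y' : List ℕ} {U V : Finset ℕ}
    {e e' : Multiset (Sym2 ℕ × R)} (hf : Lab f x y U e) (hg : Lab g x' y' V e') :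
    Lab (f ⊠ g) (x ++ x') (y ++ y') (U ∪ V) (e + e') :=
  ⟨_, _, _, _, _, _, _, _, hf, hg, rfl, rfl, rfl, rfl⟩

theorem Lab.mul (v : ℕ) : Lab (.mul : CircuitTerm R) [v, v] [v] {v} 0 := ⟨v, rfl, rfl, rfl, rfl⟩
theorem Lab.unit (v : ℕ) : Lab (.unit : CircuitTerm R) [] [v] {v} 0 := ⟨v, rfl, rfl, rfl, rfl⟩
theorem Lab.comul (v : ℕ) : Lab (.comul : CircuitTerm R) [v] [v, v] {v} 0 :=
  ⟨v, rfl, rfl, rfl, rfl⟩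
theorem Lab.counit (v : ℕ) : Lab (.counit : CircuitTerm R) [v] [] {v} 0 := ⟨v, rfl, rfl, rfl, rfl⟩
theorem Lab.cond (u v : ℕ) (c : R) : Lab (.cond c) [u] [v] {u, v} {(s(u, v), c)} :=
  ⟨u, v, rfl, rfl, rfl, rfl⟩
theorem Lab.id_one (v : ℕ) : Lab (.id 1 : CircuitTerm R) [v] [v] {v} 0 := ⟨rfl, rfl, rfl, rfl⟩
theorem Lab.swap_one (u v : ℕ) : Lab (.swap 1 1 : CircuitTerm R) [u, v] [v, u] {u, v} 0 :=
  ⟨[u], [v], rfl, rfl, rfl, rfl, by simp, rfl⟩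

theorem lab_comp {f g : CircuitTerm R} {x y : List ℕ} {U : Finset ℕ}
    {e : Multiset (Sym2 ℕ × R)} : Lab (f ⨟ g) x y U e ↔ ∃ z U₁ U₂ e₁ e₂, Lab f x z U₁ e₁ ∧
      Lab g z y U₂ e₂ ∧ U = U₁ ∪ U₂ ∧ e = e₁ + e₂ := Iff.rfl

theorem lab_tensor {f g : CircuitTerm R} {x y : List ℕ} {U : Finset ℕ}
    {e : Multiset (Sym2 ℕ × R)} : Lab (f ⊠ g) x y U e ↔ ∃ x₁ x₂ y₁ y₂ U₁ U₂ e₁ e₂,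
      Lab f x₁ y₁ U₁ e₁ ∧ Lab g x₂ y₂ U₂ e₂ ∧ x = x₁ ++ x₂ ∧ y = y₁ ++ y₂ ∧ U = U₁ ∪ U₂ ∧
      e = e₁ + e₂ := Iff.rfl

/-- The labellings of a junction. -/
theorem lab_frobenius {s : CircuitTerm R} {k l : ℕ}
    (h1 : ∀ x y U e, Lab s x y U e → ∃ v, x = List.replicate k v ∧ y = List.replicate l v ∧
      U = {v} ∧ e = 0)
    (h2 : ∀ v, Lab s (List.replicate k v) (List.replicate l v) {v} 0) (x y : List ℕ)
    (U : Finset ℕ) (e : Multiset (Sym2 ℕ × R)) : Lab s x y U e ↔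
      ∃ v, x = List.replicate k v ∧ y = List.replicate l v ∧ U = {v} ∧ e = 0 :=
  ⟨h1 x y U e, by rintro ⟨v, rfl, rfl, rfl, rfl⟩; exact h2 v⟩

end
variable {R : Type*} [CommSemiring R]

/-- The laws of the Frobenius algebra hold since both sides allow exactly the labellings with a
single label. The other laws rearrange lists, unions and sums; the types fix the lengths at which
the lists are cut. -/
theorem lab_hypergraph {s t : CircuitTerm R} (h : HypergraphLaw s t) (hs : s.WellFormed)
    (hd : s.dom = t.dom) (hc : s.cod = t.cod) (ht : t.WellFormed)
    (x y : List ℕ) (U : Finset ℕ) (e : Multiset (Sym2 ℕ × R)) : Lab s x y U e ↔ Lab t x y U e := by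
  cases h with
  | id_comp n f =>
    constructor
    · rintro ⟨z, U₁, U₂, e₁, e₂, ⟨h1, rfl, rfl, rfl⟩, h2, rfl, rfl⟩
      rwa [Finset.union_eq_right.2 h2.subset.1, zero_add]
    · intro h2
      refine ⟨x, _, _, _, _, ⟨?_, rfl, rfl, rfl⟩, h2, ?_, (zero_add _).symm⟩
      · rw [h2.length.1, ← hd]; rfl
      · rw [Finset.union_eq_right.2 h2.subset.1]
  | comp_id n f =>
    constructor
    · rintro ⟨z, U₁, U₂, e₁, e₂, h2, ⟨h1, rfl, rfl, rfl⟩, rfl, rfl⟩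
      rwa [Finset.union_eq_left.2 h2.subset.2, add_zero]
    · intro h2
      refine ⟨y, _, _, _, _, h2, ⟨?_, rfl, rfl, rfl⟩, ?_, (add_zero _).symm⟩
      · rw [h2.length.2, ← hc]; rfl
      · rw [Finset.union_eq_left.2 h2.subset.2]
  | comp_assoc f g h =>
    constructor
    · rintro ⟨z, _, U₃, _, e₃, ⟨z', U₁, U₂, e₁, e₂, h1, h2, rfl, rfl⟩, h3, rfl, rfl⟩
      exact ⟨z', _, _, _, _, h1, ⟨z, _, _, _, _, h2, h3, rfl, rfl⟩, Finset.union_assoc _ _ _,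
        add_assoc _ _ _⟩
    · rintro ⟨z, U₁, _, e₁, _, h1, ⟨z', U₂, U₃, e₂, e₃, h2, h3, rfl, rfl⟩, rfl, rfl⟩
      exact ⟨z', _, _, _, _, ⟨z, _, _, _, _, h1, h2, rfl, rfl⟩, h3, (Finset.union_assoc _ _ _).symm,
        (add_assoc _ _ _).symm⟩
  | tensor_id a b =>
    constructor
    · rintro ⟨x₁, x₂, y₁, y₂, U₁, U₂, e₁, e₂, ⟨h1, rfl, rfl, rfl⟩, ⟨h2, rfl, rfl, rfl⟩, rfl, rfl,
        rfl, rfl⟩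
      exact ⟨by simp [h1, h2], rfl, by simp, rfl⟩
    · rintro ⟨h1, rfl, rfl, rfl⟩
      refine ⟨y.take a, y.drop a, y.take a, y.drop a, _, _, _, _, ⟨by simp; omega, rfl, rfl, rfl⟩,
        ⟨by simp; omega, rfl, rfl, rfl⟩, by simp, by simp, ?_, rfl⟩
      rw [← List.toFinset_append, List.take_append_drop]
  | interchange f g f' g' =>
    constructor
    · rintro ⟨z, _, _, _, _, ⟨x₁, x₂, z₁, z₂, U₁, U₂, e₁, e₂, h1, h2, rfl, rfl, rfl, rfl⟩,
        ⟨z₁', z₂', y₁, y₂, U₃, U₄, e₃, e₄, h3, h4, hz, rfl, rfl, rfl⟩, rfl, rfl⟩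
      -- The middle list is cut in two ways; well-formedness of the right side makes the cuts agree.
      have hl : z₁.length = z₁'.length := by rw [h1.length.2, h3.length.1]; exact ht.1.2.2
      obtain ⟨rfl, rfl⟩ := List.append_inj hz hl
      exact ⟨_, _, _, _, _, _, _, _, ⟨_, _, _, _, _, h1, h3, rfl, rfl⟩,
        ⟨_, _, _, _, _, h2, h4, rfl, rfl⟩, rfl, rfl, Finset.union_union_union_comm _ _ _ _,
        add_add_add_comm _ _ _ _⟩
    · rintro ⟨x₁, x₂, y₁, y₂, _, _, _, _, ⟨z₁, U₁, U₃, e₁, e₃, h1, h3, rfl, rfl⟩,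
        ⟨z₂, U₂, U₄, e₂, e₄, h2, h4, rfl, rfl⟩, rfl, rfl, rfl, rfl⟩
      exact ⟨z₁ ++ z₂, _, _, _, _, ⟨_, _, _, _, _, _, _, _, h1, h2, rfl, rfl, rfl, rfl⟩,
        ⟨_, _, _, _, _, _, _, _, h3, h4, rfl, rfl, rfl, rfl⟩, Finset.union_union_union_comm _ _ _ _,
        add_add_add_comm _ _ _ _⟩
  | tensor_assoc f g h =>
    constructor
    · rintro ⟨_, x₃, _, y₃, _, U₃, _, e₃, ⟨x₁, x₂, y₁, y₂, U₁, U₂, e₁, e₂, h1, h2, rfl, rfl, rfl,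
        rfl⟩, h3, rfl, rfl, rfl, rfl⟩
      exact ⟨_, _, _, _, _, _, _, _, h1, ⟨_, _, _, _, _, _, _, _, h2, h3, rfl, rfl, rfl, rfl⟩,
        List.append_assoc _ _ _, List.append_assoc _ _ _, Finset.union_assoc _ _ _,
        add_assoc _ _ _⟩
    · rintro ⟨x₁, _, y₁, _, U₁, _, e₁, _, h1, ⟨x₂, x₃, y₂, y₃, U₂, U₃, e₂, e₃, h2, h3, rfl, rfl,
        rfl, rfl⟩, rfl, rfl, rfl, rfl⟩
      exact ⟨_, _, _, _, _, _, _, _, ⟨_, _, _, _, _, _, _, _, h1, h2, rfl, rfl, rfl, rfl⟩, h3,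
        (List.append_assoc _ _ _).symm, (List.append_assoc _ _ _).symm,
        (Finset.union_assoc _ _ _).symm, (add_assoc _ _ _).symm⟩
  | id_tensor f =>
    constructor
    · rintro ⟨x₁, x₂, y₁, y₂, U₁, U₂, e₁, e₂, ⟨h1, rfl, rfl, rfl⟩, h2, rfl, rfl, rfl, rfl⟩
      obtain rfl := List.length_eq_zero_iff.1 h1
      simpa using h2
    · intro h
      exact ⟨[], x, [], y, ∅, U, 0, e, by simp [Lab], h, by simp⟩
  | tensor_id_zero f =>
    constructor
    · rintro ⟨x₁, x₂, y₁, y₂, U₁, U₂, e₁, e₂, h2, ⟨h1, rfl, rfl, rfl⟩, rfl, rfl, rfl, rfl⟩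
      obtain rfl := List.length_eq_zero_iff.1 h1
      simpa using h2
    · intro h
      exact ⟨x, [], y, [], U, ∅, e, 0, h, by simp [Lab], by simp⟩
  | @swap_natural a b c d f g hf hg =>
    constructor
    · rintro ⟨z, _, _, _, _, ⟨x₁, x₂, z₁, z₂, U₁, U₂, e₁, e₂, h1, h2, rfl, rfl, rfl, rfl⟩,
        ⟨p, q, hp, hq, hz, rfl, rfl, rfl⟩, rfl, rfl⟩
      have l1 := h1.length
      have l2 := h2.length
      have hl : z₁.length = p.length := by rw [l1.2, hp, hf.wellFormed.2.2]
      obtain ⟨rfl, rfl⟩ := List.append_inj hz hl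
      refine ⟨x₂ ++ x₁, _, _, _, _, ⟨x₁, x₂, by rw [l1.1, hf.wellFormed.2.1],
        by rw [l2.1, hg.wellFormed.2.1], rfl, rfl, rfl, rfl⟩,
        ⟨_, _, _, _, _, _, _, _, h2, h1, rfl, rfl, rfl, rfl⟩, ?_, ?_⟩
      · rw [List.toFinset_append, List.toFinset_append, Finset.union_eq_left.2
          (Finset.union_subset_union h1.subset.2 h2.subset.2), Finset.union_comm U₂,
          Finset.union_eq_right.2 (Finset.union_subset_union h1.subset.1 h2.subset.1)]
      · rw [add_zero, zero_add, add_comm]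
    · rintro ⟨z, _, _, _, _, ⟨p, q, hp, hq, rfl, rfl, rfl, rfl⟩, ⟨x₂, x₁, z₂, z₁, U₂, U₁, e₂, e₁,
        h2, h1, hz, rfl, rfl, rfl⟩, rfl, rfl⟩
      have l1 := h1.length
      have l2 := h2.length
      have hl : q.length = x₂.length := by rw [l2.1, hq, hg.wellFormed.2.1]
      obtain ⟨rfl, rfl⟩ := List.append_inj hz hl
      refine ⟨z₁ ++ z₂, _, _, _, _, ⟨_, _, _, _, _, _, _, _, h1, h2, rfl, rfl, rfl, rfl⟩,
        ⟨z₁, z₂, by rw [l1.2, hf.wellFormed.2.2], by rw [l2.2, hg.wellFormed.2.2], rfl, rfl, rfl,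
          rfl⟩, ?_, ?_⟩
      · rw [List.toFinset_append, List.toFinset_append, Finset.union_eq_left.2
          (Finset.union_subset_union h1.subset.2 h2.subset.2), Finset.union_comm U₂,
          Finset.union_eq_right.2 (Finset.union_subset_union h1.subset.1 h2.subset.1)]
      · rw [add_zero, zero_add, add_comm]
  | swap_swap a b =>
    constructor
    · rintro ⟨z, _, _, _, _, ⟨p, q, rfl, rfl, rfl, rfl, rfl, rfl⟩, ⟨q', p', hq, hp, hz, rfl, rfl,
        rfl⟩, rfl, rfl⟩
      obtain ⟨rfl, rfl⟩ := List.append_inj hz hq.symm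
      exact ⟨by simp, rfl, by simp [Finset.union_comm], rfl⟩
    · rintro ⟨h1, rfl, rfl, rfl⟩
      refine ⟨y.drop a ++ y.take a, _, _, 0, 0, ⟨y.take a, y.drop a, by simp; omega, by simp; omega,
        by simp, rfl, rfl, rfl⟩, ⟨y.drop a, y.take a, by simp; omega, by simp; omega, rfl, by simp,
        rfl, rfl⟩, ?_, rfl⟩
      rw [List.toFinset_append (l := y.drop a), Finset.union_comm (y.drop a).toFinset,
        ← List.toFinset_append, List.take_append_drop, Finset.union_self]
  | swap_zero a =>
    constructor
    · rintro ⟨p, q, rfl, hq, rfl, rfl, rfl, rfl⟩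
      obtain rfl := List.length_eq_zero_iff.1 hq
      exact ⟨by simp, by simp, rfl, rfl⟩
    · rintro ⟨rfl, rfl, rfl, rfl⟩
      exact ⟨y, [], rfl, rfl, by simp, by simp, rfl, rfl⟩
  | swap_add a b c =>
    constructor
    · rintro ⟨p, q, rfl, hq, rfl, rfl, rfl, rfl⟩
      obtain ⟨q, r, rfl, rfl, rfl⟩ : ∃ q' r, q'.length = b ∧ r.length = c ∧ q = q' ++ r :=
        ⟨q.take b, q.drop b, by simp; omega, by simp; omega, by simp⟩
      refine ⟨q ++ (p ++ r), _, _, _, _, ⟨p ++ q, r, q ++ p, r, _, _, _, _, ⟨p, q, rfl, rfl, rfl,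
        rfl, rfl, rfl⟩, ⟨rfl, rfl, rfl, rfl⟩, by simp, by simp, rfl, rfl⟩, ⟨q, p ++ r, q, r ++ p,
        _, _, _, _, ⟨rfl, rfl, rfl, rfl⟩, ⟨p, r, rfl, rfl, rfl, rfl, rfl, rfl⟩, by simp, by simp,
        rfl, rfl⟩, ?_, rfl⟩
      ext
      simp
      tauto
    · rintro ⟨z, _, _, _, _, ⟨x₁, x₂, z₁, z₂, _, _, _, _, ⟨p, q, rfl, rfl, rfl, rfl, rfl, rfl⟩,
        ⟨rfl, rfl, rfl, rfl⟩, rfl, rfl, rfl, rfl⟩, ⟨x₃, x₄, y₃, y₄, _, _, _, _, ⟨h3, rfl, rfl,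
        rfl⟩, ⟨p', r', h5, h6, rfl, rfl, rfl, rfl⟩, h4, rfl, rfl, rfl⟩, rfl, rfl⟩
      rw [List.append_assoc] at h4
      obtain ⟨rfl, h7⟩ := List.append_inj h4 h3.symm
      obtain ⟨rfl, rfl⟩ := List.append_inj h7 h5.symm
      refine ⟨p, q ++ z₂, rfl, by simp, by simp, by simp, ?_, rfl⟩
      ext
      simp
      tauto
  | mul_assoc =>
    refine (lab_frobenius (k := 3) (l := 1) ?_ ?_ _ _ _ _).trans
      (lab_frobenius (k := 3) (l := 1) ?_ ?_ _ _ _ _).symm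
    · rintro _ _ _ _ ⟨_, _, _, _, _, ⟨_, _, _, _, _, _, _, _, ⟨v, rfl, rfl, rfl, rfl⟩, i1, rfl, rfl, rfl, rfl⟩, ⟨w, hz, rfl, rfl, rfl⟩, rfl, rfl⟩
      obtain ⟨i1, hi1⟩ := lab_id_one.1 i1
      obtain ⟨rfl, rfl, rfl, rfl⟩ := hi1
      simp at hz
      try obtain ⟨rfl, rfl, rfl⟩ := hz
      try obtain ⟨rfl, rfl⟩ := hz
      try subst hz
      exact ⟨_, by simp; rfl⟩
    · intro v
      simpa using ((Lab.mul v).tensor (.id_one v)).comp (.mul v)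
    · rintro _ _ _ _ ⟨_, _, _, _, _, ⟨_, _, _, _, _, _, _, _, i1, ⟨v, rfl, rfl, rfl, rfl⟩, rfl, rfl, rfl, rfl⟩, ⟨w, hz, rfl, rfl, rfl⟩, rfl, rfl⟩
      obtain ⟨i1, hi1⟩ := lab_id_one.1 i1
      obtain ⟨rfl, rfl, rfl, rfl⟩ := hi1
      simp at hz
      try obtain ⟨rfl, rfl, rfl⟩ := hz
      try obtain ⟨rfl, rfl⟩ := hz
      try subst hz
      exact ⟨_, by simp; rfl⟩
    · intro v
      simpa using ((Lab.id_one v).tensor (.mul v)).comp (.mul v)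
  | unit_mul =>
    refine (lab_frobenius (k := 1) (l := 1) ?_ ?_ _ _ _ _).trans
      (lab_frobenius (k := 1) (l := 1) ?_ ?_ _ _ _ _).symm
    · rintro _ _ _ _ ⟨_, _, _, _, _, ⟨_, _, _, _, _, _, _, _, ⟨v, rfl, rfl, rfl, rfl⟩, i1, rfl, rfl, rfl, rfl⟩, ⟨w, hz, rfl, rfl, rfl⟩, rfl, rfl⟩
      obtain ⟨i1, hi1⟩ := lab_id_one.1 i1
      obtain ⟨rfl, rfl, rfl, rfl⟩ := hi1
      simp at hz
      try obtain ⟨rfl, rfl, rfl⟩ := hz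
      try obtain ⟨rfl, rfl⟩ := hz
      try subst hz
      exact ⟨_, by simp; rfl⟩
    · intro v
      simpa using ((Lab.unit v).tensor (.id_one v)).comp (.mul v)
    · rintro _ _ _ _ i2
      obtain ⟨i2, hi2⟩ := lab_id_one.1 i2
      obtain ⟨rfl, rfl, rfl, rfl⟩ := hi2
      exact ⟨_, rfl, rfl, rfl, rfl⟩
    · intro v
      simpa using Lab.id_one v
  | mul_comm =>
    refine (lab_frobenius (k := 2) (l := 1) ?_ ?_ _ _ _ _).trans
      (lab_frobenius (k := 2) (l := 1) ?_ ?_ _ _ _ _).symm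
    · rintro _ _ _ _ ⟨_, _, _, _, _, s1, ⟨w, hz, rfl, rfl, rfl⟩, rfl, rfl⟩
      obtain ⟨a, b, rfl, rfl, rfl, rfl⟩ := lab_swap_one.1 s1
      simp at hz
      try obtain ⟨rfl, rfl, rfl⟩ := hz
      try obtain ⟨rfl, rfl⟩ := hz
      try subst hz
      exact ⟨_, by simp; rfl⟩
    · intro v
      simpa using (Lab.swap_one v v).comp (.mul v)
    · rintro _ _ _ _ ⟨w, rfl, rfl, rfl, rfl⟩
      exact ⟨_, rfl, rfl, rfl, rfl⟩
    · intro v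
      simpa using Lab.mul v
  | comul_assoc =>
    refine (lab_frobenius (k := 1) (l := 3) ?_ ?_ _ _ _ _).trans
      (lab_frobenius (k := 1) (l := 3) ?_ ?_ _ _ _ _).symm
    · rintro _ _ _ _ ⟨_, _, _, _, _, ⟨w, rfl, rfl, rfl, rfl⟩, ⟨_, _, _, _, _, _, _, _, ⟨v, rfl, rfl, rfl, rfl⟩, i1, hz, rfl, rfl, rfl⟩, rfl, rfl⟩
      obtain ⟨i1, hi1⟩ := lab_id_one.1 i1
      obtain ⟨rfl, rfl, rfl, rfl⟩ := hi1
      simp at hz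
      try obtain ⟨rfl, rfl, rfl⟩ := hz
      try obtain ⟨rfl, rfl⟩ := hz
      try subst hz
      exact ⟨_, by simp; rfl⟩
    · intro v
      simpa using (Lab.comul v).comp ((Lab.comul v).tensor (.id_one v))
    · rintro _ _ _ _ ⟨_, _, _, _, _, ⟨w, rfl, rfl, rfl, rfl⟩, ⟨_, _, _, _, _, _, _, _, i1, ⟨v, rfl, rfl, rfl, rfl⟩, hz, rfl, rfl, rfl⟩, rfl, rfl⟩
      obtain ⟨i1, hi1⟩ := lab_id_one.1 i1
      obtain ⟨rfl, rfl, rfl, rfl⟩ := hi1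
      simp at hz
      try obtain ⟨rfl, rfl, rfl⟩ := hz
      try obtain ⟨rfl, rfl⟩ := hz
      try subst hz
      exact ⟨_, by simp; rfl⟩
    · intro v
      simpa using (Lab.comul v).comp ((Lab.id_one v).tensor (.comul v))
  | comul_counit =>
    refine (lab_frobenius (k := 1) (l := 1) ?_ ?_ _ _ _ _).trans
      (lab_frobenius (k := 1) (l := 1) ?_ ?_ _ _ _ _).symm
    · rintro _ _ _ _ ⟨_, _, _, _, _, ⟨w, rfl, rfl, rfl, rfl⟩, ⟨_, _, _, _, _, _, _, _, ⟨v, rfl, rfl, rfl, rfl⟩, i1, hz, rfl, rfl, rfl⟩, rfl, rfl⟩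
      obtain ⟨i1, hi1⟩ := lab_id_one.1 i1
      obtain ⟨rfl, rfl, rfl, rfl⟩ := hi1
      simp at hz
      try obtain ⟨rfl, rfl, rfl⟩ := hz
      try obtain ⟨rfl, rfl⟩ := hz
      try subst hz
      exact ⟨_, by simp; rfl⟩
    · intro v
      simpa using (Lab.comul v).comp ((Lab.counit v).tensor (.id_one v))
    · rintro _ _ _ _ i2
      obtain ⟨i2, hi2⟩ := lab_id_one.1 i2
      obtain ⟨rfl, rfl, rfl, rfl⟩ := hi2
      exact ⟨_, rfl, rfl, rfl, rfl⟩
    · intro v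
      simpa using Lab.id_one v
  | comul_comm =>
    refine (lab_frobenius (k := 1) (l := 2) ?_ ?_ _ _ _ _).trans
      (lab_frobenius (k := 1) (l := 2) ?_ ?_ _ _ _ _).symm
    · rintro _ _ _ _ ⟨_, _, _, _, _, ⟨w, rfl, rfl, rfl, rfl⟩, s2, rfl, rfl⟩
      obtain ⟨a, b, hz, rfl, rfl, rfl⟩ := lab_swap_one.1 s2
      simp at hz
      try obtain ⟨rfl, rfl, rfl⟩ := hz
      try obtain ⟨rfl, rfl⟩ := hz
      try subst hz
      exact ⟨_, by simp; rfl⟩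
    · intro v
      simpa using (Lab.comul v).comp (.swap_one v v)
    · rintro _ _ _ _ ⟨w, rfl, rfl, rfl, rfl⟩
      exact ⟨_, rfl, rfl, rfl, rfl⟩
    · intro v
      simpa using Lab.comul v
  | frobenius_left =>
    refine (lab_frobenius (k := 2) (l := 2) ?_ ?_ _ _ _ _).trans
      (lab_frobenius (k := 2) (l := 2) ?_ ?_ _ _ _ _).symm
    · rintro _ _ _ _ ⟨_, _, _, _, _, ⟨_, _, _, _, _, _, _, _, ⟨v, rfl, rfl, rfl, rfl⟩, i1, rfl, rfl, rfl, rfl⟩, ⟨_, _, _, _, _, _, _, _, i3, ⟨w, rfl, rfl, rfl, rfl⟩, hz, rfl, rfl, rfl⟩, rfl, rfl⟩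
      obtain ⟨i1, hi1⟩ := lab_id_one.1 i1
      obtain ⟨rfl, rfl, rfl, rfl⟩ := hi1
      obtain ⟨i3, hi3⟩ := lab_id_one.1 i3
      obtain ⟨rfl, rfl, rfl, rfl⟩ := hi3
      simp at hz
      try obtain ⟨rfl, rfl, rfl⟩ := hz
      try obtain ⟨rfl, rfl⟩ := hz
      try subst hz
      exact ⟨_, by simp; rfl⟩
    · intro v
      simpa using ((Lab.comul v).tensor (.id_one v)).comp ((Lab.id_one v).tensor (.mul v))
    · rintro _ _ _ _ ⟨_, _, _, _, _, ⟨v, rfl, rfl, rfl, rfl⟩, ⟨w, hz, rfl, rfl, rfl⟩, rfl, rfl⟩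
      simp at hz
      try obtain ⟨rfl, rfl, rfl⟩ := hz
      try obtain ⟨rfl, rfl⟩ := hz
      try subst hz
      exact ⟨_, by simp; rfl⟩
    · intro v
      simpa using (Lab.mul v).comp (.comul v)
  | frobenius_right =>
    refine (lab_frobenius (k := 2) (l := 2) ?_ ?_ _ _ _ _).trans
      (lab_frobenius (k := 2) (l := 2) ?_ ?_ _ _ _ _).symm
    · rintro _ _ _ _ ⟨_, _, _, _, _, ⟨_, _, _, _, _, _, _, _, i1, ⟨v, rfl, rfl, rfl, rfl⟩, rfl, rfl, rfl, rfl⟩, ⟨_, _, _, _, _, _, _, _, ⟨w, rfl, rfl, rfl, rfl⟩, i3, hz, rfl, rfl, rfl⟩, rfl, rfl⟩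
      obtain ⟨i1, hi1⟩ := lab_id_one.1 i1
      obtain ⟨rfl, rfl, rfl, rfl⟩ := hi1
      obtain ⟨i3, hi3⟩ := lab_id_one.1 i3
      obtain ⟨rfl, rfl, rfl, rfl⟩ := hi3
      simp at hz
      try obtain ⟨rfl, rfl, rfl⟩ := hz
      try obtain ⟨rfl, rfl⟩ := hz
      try subst hz
      exact ⟨_, by simp; rfl⟩
    · intro v
      simpa using ((Lab.id_one v).tensor (.comul v)).comp ((Lab.mul v).tensor (.id_one v))
    · rintro _ _ _ _ ⟨_, _, _, _, _, ⟨v, rfl, rfl, rfl, rfl⟩, ⟨w, hz, rfl, rfl, rfl⟩, rfl, rfl⟩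
      simp at hz
      try obtain ⟨rfl, rfl, rfl⟩ := hz
      try obtain ⟨rfl, rfl⟩ := hz
      try subst hz
      exact ⟨_, by simp; rfl⟩
    · intro v
      simpa using (Lab.mul v).comp (.comul v)
  | special =>
    refine (lab_frobenius (k := 1) (l := 1) ?_ ?_ _ _ _ _).trans
      (lab_frobenius (k := 1) (l := 1) ?_ ?_ _ _ _ _).symm
    · rintro _ _ _ _ ⟨_, _, _, _, _, ⟨v, rfl, rfl, rfl, rfl⟩, ⟨w, hz, rfl, rfl, rfl⟩, rfl, rfl⟩
      simp at hz
      try obtain ⟨rfl, rfl, rfl⟩ := hz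
      try obtain ⟨rfl, rfl⟩ := hz
      try subst hz
      exact ⟨_, by simp; rfl⟩
    · intro v
      simpa using (Lab.comul v).comp (.mul v)
    · rintro _ _ _ _ i2
      obtain ⟨i2, hi2⟩ := lab_id_one.1 i2
      obtain ⟨rfl, rfl, rfl, rfl⟩ := hi2
      exact ⟨_, rfl, rfl, rfl, rfl⟩
    · intro v
      simpa using Lab.id_one v

end ResistorCircuit

/-! ### Labellings of junctions, stars and networks -/

namespace ResistorCircuit

section
variable {R : Type*} {x y : List ℕ} {U : Finset ℕ} {e : Multiset (Sym2 ℕ × R)}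

theorem lab_split {n : ℕ} : Lab (.split n : CircuitTerm R) x y U e ↔
    ∃ v, x = [v] ∧ y = List.replicate n v ∧ U = {v} ∧ e = 0 := by
  induction n generalizing x y U e with
  | zero => exact Iff.rfl
  | succ n ih =>
    constructor
    · rintro ⟨_, _, _, _, _, ⟨w, rfl, rfl, rfl, rfl⟩, ⟨_, _, _, _, _, _, _, _, h1, h2, hz, rfl, rfl,
        rfl⟩, rfl, rfl⟩
      obtain ⟨v, rfl, rfl, rfl, rfl⟩ := ih.1 h2
      obtain ⟨u, rfl, rfl, rfl, rfl⟩ := lab_id_one.1 h1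
      simp at hz
      obtain ⟨rfl, rfl⟩ := hz
      exact ⟨w, by simp [List.replicate_succ]⟩
    · rintro ⟨v, rfl, rfl, rfl, rfl⟩
      simpa [List.replicate_succ, CircuitTerm.split] using
        (Lab.comul v).comp ((Lab.id_one v).tensor (ih.2 ⟨v, rfl, rfl, rfl, rfl⟩))

theorem lab_merge {n : ℕ} : Lab (.merge n : CircuitTerm R) x y U e ↔
    ∃ v, x = List.replicate n v ∧ y = [v] ∧ U = {v} ∧ e = 0 := by
  induction n generalizing x y U e with
  | zero => exact Iff.rfl
  | succ n ih =>
    constructor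
    · rintro ⟨_, _, _, _, _, ⟨_, _, _, _, _, _, _, _, h1, h2, rfl, rfl, rfl, rfl⟩,
        ⟨w, hz, rfl, rfl, rfl⟩, rfl, rfl⟩
      obtain ⟨v, rfl, rfl, rfl, rfl⟩ := ih.1 h2
      obtain ⟨u, rfl, rfl, rfl, rfl⟩ := lab_id_one.1 h1
      simp at hz
      obtain ⟨rfl, rfl⟩ := hz
      exact ⟨v, by simp [List.replicate_succ]⟩
    · rintro ⟨v, rfl, rfl, rfl, rfl⟩
      simpa [List.replicate_succ, CircuitTerm.merge] using
        ((Lab.id_one v).tensor (ih.2 ⟨v, rfl, rfl, rfl, rfl⟩)).comp (Lab.mul v)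

theorem lab_spider {k n : ℕ} : Lab (.spider k n : CircuitTerm R) x y U e ↔
    ∃ v, x = List.replicate k v ∧ y = List.replicate n v ∧ U = {v} ∧ e = 0 := by
  constructor
  · rintro ⟨_, _, _, _, _, h1, h2, rfl, rfl⟩
    obtain ⟨v, rfl, rfl, rfl, rfl⟩ := lab_merge.1 h1
    obtain ⟨w, hw, rfl, rfl, rfl⟩ := lab_split.1 h2
    simp at hw
    subst hw
    exact ⟨v, by simp⟩
  · rintro ⟨v, rfl, rfl, rfl, rfl⟩
    simpa [CircuitTerm.spider] using (lab_merge.2 ⟨v, rfl, rfl, rfl, rfl⟩).comp (lab_split.2 ⟨v, rfl, rfl, rfl, rfl⟩)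

theorem lab_conds {l : List R} : Lab (.conds l) x y U e ↔
    x.length = l.length ∧ y.length = l.length ∧ U = x.toFinset ∪ y.toFinset ∧
      e = (List.zipWith (fun p c => (s(p.1, p.2), c)) (x.zip y) l : List (Sym2 ℕ × R)) := by
  induction l generalizing x y U e with
  | nil =>
    constructor
    · rintro ⟨h, rfl, rfl, rfl⟩
      exact ⟨h, h, by simp, by simp⟩
    · rintro ⟨h1, h2, rfl, rfl⟩
      obtain rfl := List.length_eq_zero_iff.1 h1
      obtain rfl := List.length_eq_zero_iff.1 h2
      simp [CircuitTerm.conds, Lab]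
  | cons c l ih =>
    constructor
    · rintro ⟨_, _, _, _, _, _, _, _, ⟨u, v, rfl, rfl, rfl, rfl⟩, h2, rfl, rfl, rfl, rfl⟩
      obtain ⟨h3, h4, rfl, rfl⟩ := ih.1 h2
      refine ⟨by simp [h3], by simp [h4], ?_, rfl⟩
      ext
      simp
      tauto
    · rintro ⟨h1, h2, rfl, rfl⟩
      obtain ⟨u, x, rfl⟩ := List.exists_cons_of_length_eq_add_one h1
      obtain ⟨v, y, rfl⟩ := List.exists_cons_of_length_eq_add_one h2
      refine ⟨[u], x, [v], y, _, _, _, _, ⟨u, v, rfl, rfl, rfl, rfl⟩,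
        ih.2 ⟨by simpa using h1, by simpa using h2, rfl, rfl⟩, rfl, rfl, ?_, rfl⟩
      ext
      simp
      tauto

/-- The centre takes an arbitrary label `w`, which may also occur at the outer ends; that it is new
is obtained only from maximality, in `Step.effect`. -/
theorem lab_star {l : List R} : Lab (.star l) x y U e ↔
    x = [] ∧ y.length = l.length ∧ ∃ w, U = insert w y.toFinset ∧
      e = (List.zipWith (fun u c => (s(w, u), c)) y l : List (Sym2 ℕ × R)) := by
  have key : ∀ (w : ℕ) (n : ℕ) (y : List ℕ) (l : List R), y.length = n → l.length = n →
      List.zipWith (fun p c => (s(p.1, p.2), c)) ((List.replicate n w).zip y) l =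
      List.zipWith (fun u c => (s(w, u), c)) y l := by
    intro w n y l h1 h2
    refine List.ext_getElem (by simp [h1, h2]) fun i _ _ => by simp
  constructor
  · rintro ⟨_, _, _, _, _, h1, h2, rfl, rfl⟩
    obtain ⟨w, rfl, rfl, rfl, rfl⟩ := lab_spider.1 h1
    obtain ⟨-, h4, rfl, rfl⟩ := lab_conds.1 h2
    refine ⟨rfl, h4, w, ?_, ?_⟩
    · ext
      simp [List.mem_replicate]
      tauto
    · rw [key _ _ _ _ h4 rfl, zero_add]
  · rintro ⟨rfl, h, w, rfl, rfl⟩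
    refine ⟨_, _, _, _, _, lab_spider.2 ⟨w, rfl, rfl, rfl, rfl⟩,
      lab_conds.2 ⟨by simp, h, rfl, rfl⟩, ?_, ?_⟩
    · ext
      simp [List.mem_replicate]
      tauto
    · rw [key _ _ _ _ h rfl, zero_add]

theorem lab_units {k : ℕ} : Lab (.units k : CircuitTerm R) x y U e ↔
    x = [] ∧ y.length = k ∧ U = y.toFinset ∧ e = 0 := by
  induction k generalizing x y U e with
  | zero =>
    simp only [CircuitTerm.units, Lab, List.length_eq_zero_iff]
    constructor
    · rintro ⟨rfl, rfl, rfl, rfl⟩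
      simp
    · rintro ⟨rfl, rfl, rfl, rfl⟩
      simp
  | succ k ih =>
    constructor
    · rintro ⟨_, _, _, _, _, _, _, _, ⟨v, rfl, rfl, rfl, rfl⟩, h2, rfl, rfl, rfl, rfl⟩
      obtain ⟨rfl, h, rfl, rfl⟩ := ih.1 h2
      exact ⟨rfl, by simp [h], by simp, rfl⟩
    · rintro ⟨rfl, h, rfl, rfl⟩
      obtain ⟨v, y, rfl⟩ := List.exists_cons_of_length_eq_add_one h
      simpa [CircuitTerm.units] using (Lab.unit v).tensor (ih.2 ⟨rfl, by simpa using h, rfl, rfl⟩)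

theorem lab_counits {k : ℕ} : Lab (.counits k : CircuitTerm R) x y U e ↔
    y = [] ∧ x.length = k ∧ U = x.toFinset ∧ e = 0 := by
  induction k generalizing x y U e with
  | zero =>
    simp only [CircuitTerm.counits, Lab, List.length_eq_zero_iff]
    constructor
    · rintro ⟨rfl, rfl, rfl, rfl⟩
      simp
    · rintro ⟨rfl, rfl, rfl, rfl⟩
      simp
  | succ k ih =>
    constructor
    · rintro ⟨_, _, _, _, _, _, _, _, ⟨v, rfl, rfl, rfl, rfl⟩, h2, rfl, rfl, rfl, rfl⟩
      obtain ⟨rfl, h, rfl, rfl⟩ := ih.1 h2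
      exact ⟨rfl, by simp [h], by simp, rfl⟩
    · rintro ⟨rfl, h, rfl, rfl⟩
      obtain ⟨v, x, rfl⟩ := List.exists_cons_of_length_eq_add_one h
      simpa [CircuitTerm.counits] using (Lab.counit v).tensor (ih.2 ⟨rfl, by simpa using h, rfl, rfl⟩)

theorem exists_split_at {y : List ℕ} {i : ℕ} (h : i < y.length) :
    ∃ p v r, y = p ++ v :: r ∧ p.length = i ∧ r.length = y.length - i - 1 ∧ y.getD i 0 = v :=
  ⟨y.take i, y[i], y.drop (i + 1), by simp, by simp; omega, by simp; omega, by simp [h]⟩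

theorem lab_join {k i : ℕ} (hi : i < k) : Lab (.join k i : CircuitTerm R) x y U e ↔
    y.length = k ∧ x = y.getD i 0 :: y ∧ U = y.toFinset ∧ e = 0 := by
  constructor
  · rintro ⟨_, _, _, _, _, ⟨_, _, _, _, _, _, _, _, ⟨v, p, hv, hp, rfl, rfl, rfl, rfl⟩,
      ⟨hr, rfl, rfl, rfl⟩, rfl, rfl, rfl, rfl⟩, ⟨_, _, _, _, _, _, _, _, ⟨hp', rfl, rfl, rfl⟩,
      ⟨_, _, _, _, _, _, _, _, ⟨w, rfl, rfl, rfl, rfl⟩, ⟨hr', rfl, rfl, rfl⟩, rfl, rfl, rfl, rfl⟩,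
      hz, rfl, rfl, rfl⟩, rfl, rfl⟩
    obtain ⟨v, rfl⟩ := List.length_eq_one_iff.1 hv
    rw [List.append_assoc] at hz
    obtain ⟨rfl, h1⟩ := List.append_inj hz (hp.trans hp'.symm)
    simp at h1
    obtain ⟨rfl, rfl⟩ := h1
    refine ⟨by simp; omega, ?_, ?_, rfl⟩
    · simp [← hp]
    · ext
      simp
  · rintro ⟨hk, rfl, rfl, rfl⟩
    obtain ⟨p, v, r, h1, h2, h3, h4⟩ := exists_split_at (hi.trans_eq hk.symm)
    rw [h4]
    subst h1
    refine ⟨p ++ ([v] ++ v :: r), _, _, 0, 0, ⟨[v] ++ p, v :: r, p ++ [v], v :: r, _, _, _, _, ⟨[v], p, rfl, h2, rfl, rfl,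
      rfl, rfl⟩, ⟨?_, rfl, rfl, rfl⟩, ?_, ?_, rfl, rfl⟩, ⟨_, _, _, _, _, _, _, _, ⟨h2, rfl, rfl,
      rfl⟩, ⟨_, _, _, _, _, _, _, _, ⟨v, rfl, rfl, rfl, rfl⟩, ⟨?_, rfl, rfl, rfl⟩, rfl, rfl, rfl,
      rfl⟩, rfl, rfl, rfl, rfl⟩, ?_, rfl⟩
    · simp at hk ⊢; omega
    · simp
    · simp
    · simp at hk ⊢; omega
    · ext
      simp

theorem lab_fork {k i : ℕ} (hi : i < k) : Lab (.fork k i : CircuitTerm R) x y U e ↔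
    x.length = k ∧ y = x.getD i 0 :: x ∧ U = x.toFinset ∧ e = 0 := by
  constructor
  · rintro ⟨_, _, _, _, _, ⟨_, _, _, _, _, _, _, _, ⟨hp', rfl, rfl, rfl⟩,
      ⟨_, _, _, _, _, _, _, _, ⟨w, rfl, rfl, rfl, rfl⟩, ⟨hr', rfl, rfl, rfl⟩, rfl, rfl, rfl, rfl⟩,
      rfl, rfl, rfl, rfl⟩, ⟨_, _, _, _, _, _, _, _, ⟨p, v, hp, hv, rfl, rfl, rfl, rfl⟩,
      ⟨hr, rfl, rfl, rfl⟩, hz, rfl, rfl, rfl⟩, rfl, rfl⟩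
    obtain ⟨v, rfl⟩ := List.length_eq_one_iff.1 hv
    rw [List.append_assoc] at hz
    obtain ⟨rfl, h1⟩ := List.append_inj hz (hp'.trans hp.symm)
    simp at h1
    obtain ⟨rfl, rfl⟩ := h1
    refine ⟨by simp; omega, ?_, ?_, rfl⟩
    · simp [← hp]
    · ext
      simp
  · rintro ⟨hk, rfl, rfl, rfl⟩
    obtain ⟨p, v, r, h1, h2, h3, h4⟩ := exists_split_at (hi.trans_eq hk.symm)
    rw [h4]
    subst h1
    refine ⟨p ++ ([v] ++ v :: r), _, _, 0, 0, ⟨_, _, _, _, _, _, _, _, ⟨h2, rfl, rfl,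
      rfl⟩, ⟨_, _, _, _, _, _, _, _, ⟨v, rfl, rfl, rfl, rfl⟩, ⟨?_, rfl, rfl, rfl⟩, rfl, rfl, rfl,
      rfl⟩, rfl, rfl, rfl, rfl⟩, ⟨p ++ [v], v :: r, [v] ++ p, v :: r, _, _, _, _, ⟨p, [v], h2, rfl, rfl, rfl,
      rfl, rfl⟩, ⟨?_, rfl, rfl, rfl⟩, ?_, ?_, rfl, rfl⟩, ?_, rfl⟩
    · simp at hk ⊢; omega
    · simp at hk ⊢; omega
    · simp
    · simp
    · ext
      simp

theorem lab_link {k i j : ℕ} (hi : i < k) (hj : j < k) (c : R) : Lab (.link k i j c) x y U e ↔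
    x.length = k ∧ y = x ∧ U = x.toFinset ∧ e = {(s(x.getD i 0, x.getD j 0), c)} := by
  constructor
  · rintro ⟨_, _, _, _, _, ⟨_, _, _, _, _, h1, ⟨_, _, _, _, _, _, _, _, ⟨u, v, rfl, rfl, rfl, rfl⟩,
      ⟨h2, rfl, rfl, rfl⟩, hz, rfl, rfl, rfl⟩, rfl, rfl⟩, h3, rfl, rfl⟩
    obtain ⟨h4, rfl, rfl, rfl⟩ := (lab_fork hi).1 h1
    obtain ⟨h5, h6, rfl, rfl⟩ := (lab_join hj).1 h3
    simp only [List.singleton_append, List.cons.injEq] at hz h6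
    obtain ⟨rfl, rfl⟩ := hz
    obtain ⟨rfl, rfl⟩ := h6
    refine ⟨h4, rfl, ?_, by simp⟩
    have hm : ∀ i < k, x.getD i 0 ∈ x.toFinset := fun i hi => by
      rw [List.getD_eq_getElem _ _ (hi.trans_eq h4.symm)]
      simp
    have h7 := hm i hi
    have h8 := hm j hj
    ext a
    simp only [Finset.mem_union, Finset.mem_insert, Finset.mem_singleton]
    constructor
    · rintro ((h | ((rfl | rfl) | h)) | h) <;> assumption
    · tauto
  · rintro ⟨hk, rfl, rfl, rfl⟩
    refine ⟨_, _, _, _, 0, ⟨_, _, _, 0, _, (lab_fork hi).2 ⟨hk, rfl, rfl, rfl⟩,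
      ⟨_, _, _, _, _, _, _, 0, ⟨y.getD i 0, y.getD j 0, rfl, rfl, rfl, rfl⟩, ⟨hk, rfl, rfl, rfl⟩,
        rfl, rfl, rfl, rfl⟩, rfl, rfl⟩, (lab_join hj).2 ⟨hk, rfl, rfl, rfl⟩, ?_, by simp⟩
    have hm : ∀ i < k, y.getD i 0 ∈ y.toFinset := fun i hi => by
      rw [List.getD_eq_getElem _ _ (hi.trans_eq hk.symm)]
      simp
    have h7 := hm i hi
    have h8 := hm j hj
    ext a
    simp only [Finset.mem_union, Finset.mem_insert, Finset.mem_singleton]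
    constructor
    · tauto
    · rintro ((h | ((rfl | rfl) | h)) | h) <;> assumption

theorem lab_links {k : ℕ} {es : List (ℕ × ℕ × R)} (hes : ∀ e ∈ es, e.1 < k ∧ e.2.1 < k) :
    Lab (.links k es) x y U e ↔ x.length = k ∧ y = x ∧ U = x.toFinset ∧
      e = ((Q.mapEdges (fun i => x.getD i 0) es).map Q.edge : List (Sym2 ℕ × R)) := by
  induction es generalizing x y U e with
  | nil => exact Iff.rfl
  | cons a es ih =>
    have ih' := fun {x y U e} => ih (x := x) (y := y) (U := U) (e := e)
      fun e he => hes e (List.mem_cons_of_mem _ he)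
    obtain ⟨h1, h2⟩ := hes a List.mem_cons_self
    constructor
    · rintro ⟨_, _, _, _, _, h3, h4, rfl, rfl⟩
      obtain ⟨h5, rfl, rfl, rfl⟩ := (lab_link h1 h2 _).1 h3
      obtain ⟨h6, rfl, rfl, rfl⟩ := ih'.1 h4
      exact ⟨h5, rfl, Finset.union_self _, rfl⟩
    · rintro ⟨h3, rfl, rfl, rfl⟩
      exact ⟨_, _, _, _, _, (lab_link h1 h2 _).2 ⟨h3, rfl, rfl, rfl⟩, ih'.2 ⟨h3, rfl, rfl, rfl⟩,
        (Finset.union_self _).symm, rfl⟩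

theorem lab_legsIn {k : ℕ} {l : List ℕ} (hl : ∀ i ∈ l, i < k) :
    Lab (.legsIn k l : CircuitTerm R) x y U e ↔ y.length = k ∧ x = l.map (fun i => y.getD i 0) ∧
      U = y.toFinset ∧ e = 0 := by
  induction l generalizing x y U e with
  | nil =>
    rw [CircuitTerm.legsIn, lab_units]
    simp
    tauto
  | cons a l ih =>
    have ih' := fun {x y U e} => ih (x := x) (y := y) (U := U) (e := e)
      fun e he => hl e (List.mem_cons_of_mem _ he)
    have h1 := hl a List.mem_cons_self
    constructor
    · rintro ⟨_, _, _, _, _, ⟨_, _, _, _, _, _, _, _, h2, h3, rfl, rfl, rfl, rfl⟩, h4, rfl, rfl⟩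
      obtain ⟨v, rfl, rfl, rfl, rfl⟩ := lab_id_one.1 h2
      obtain ⟨h5, rfl, rfl, rfl⟩ := ih'.1 h3
      obtain ⟨h6, h7, rfl, rfl⟩ := (lab_join h1).1 h4
      simp only [List.singleton_append, List.cons.injEq] at h7
      obtain ⟨rfl, rfl⟩ := h7
      refine ⟨h5, rfl, ?_, rfl⟩
      rw [Finset.union_assoc, Finset.union_self, Finset.union_eq_right, List.getD_eq_getElem _ _
        (h1.trans_eq h5.symm)]
      simp
    · rintro ⟨h3, rfl, rfl, rfl⟩
      refine ⟨_, _, _, 0, 0, ⟨_, _, _, _, _, _, 0, 0, Lab.id_one _, ih'.2 ⟨h3, rfl, rfl, rfl⟩, rfl,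
        rfl, rfl, rfl⟩, (lab_join h1).2 ⟨h3, rfl, rfl, rfl⟩, ?_, rfl⟩
      simp only
      rw [Finset.union_assoc, Finset.union_self, eq_comm, Finset.union_eq_right,
        List.getD_eq_getElem _ _ (h1.trans_eq h3.symm)]
      simp

theorem lab_legsOut {k : ℕ} {l : List ℕ} (hl : ∀ i ∈ l, i < k) :
    Lab (.legsOut k l : CircuitTerm R) x y U e ↔ x.length = k ∧ y = l.map (fun i => x.getD i 0) ∧
      U = x.toFinset ∧ e = 0 := by
  induction l generalizing x y U e with
  | nil =>
    rw [CircuitTerm.legsOut, lab_counits]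
    simp
    tauto
  | cons a l ih =>
    have ih' := fun {x y U e} => ih (x := x) (y := y) (U := U) (e := e)
      fun e he => hl e (List.mem_cons_of_mem _ he)
    have h1 := hl a List.mem_cons_self
    constructor
    · rintro ⟨_, _, _, _, _, h4, ⟨_, _, _, _, _, _, _, _, h2, h3, h7, rfl, rfl, rfl⟩, rfl, rfl⟩
      obtain ⟨v, rfl, rfl, rfl, rfl⟩ := lab_id_one.1 h2
      obtain ⟨h5, rfl, rfl, rfl⟩ := ih'.1 h3
      obtain ⟨h6, rfl, rfl, rfl⟩ := (lab_fork h1).1 h4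
      simp only [List.singleton_append, List.cons.injEq] at h7
      obtain ⟨rfl, rfl⟩ := h7
      refine ⟨h5, rfl, ?_, rfl⟩
      rw [← Finset.union_assoc, Finset.union_right_comm, Finset.union_self, Finset.union_eq_left,
        List.getD_eq_getElem _ _ (h1.trans_eq h5.symm)]
      simp
    · rintro ⟨h3, rfl, rfl, rfl⟩
      refine ⟨_, _, _, 0, 0, (lab_fork h1).2 ⟨h3, rfl, rfl, rfl⟩, ⟨_, _, _, _, _, _, 0, 0,
        Lab.id_one _, ih'.2 ⟨h3, rfl, rfl, rfl⟩, rfl, rfl, rfl, rfl⟩, ?_, rfl⟩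
      rw [← Finset.union_assoc, Finset.union_right_comm, Finset.union_self, eq_comm,
        Finset.union_eq_left, List.getD_eq_getElem _ _ (h1.trans_eq h3.symm)]
      simp

/-- The wires between the legs and the edges are the nodes, so their labels form a function `g` on
the nodes, and it can be chosen freely. -/
theorem lab_toTerm {N : Network R} (hN : N.InRange) : Lab N.toTerm x y U e ↔
    ∃ g : ℕ → ℕ, x = (N.toNet g).inputs ∧ y = (N.toNet g).outputs ∧
      U = (N.toNet g).nodes.toFinset ∧ e = ((N.toNet g).edges.map Q.edge : List (Sym2 ℕ × R)) := by
  constructor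
  · rintro ⟨_, _, _, _, _, ⟨z, _, _, _, _, h1, h2, rfl, rfl⟩, h3, rfl, rfl⟩
    obtain ⟨h4, rfl, rfl, rfl⟩ := (lab_legsIn hN.inputs_lt).1 h1
    obtain ⟨h5, rfl, rfl, rfl⟩ := (lab_links hN.edges_lt).1 h2
    obtain ⟨h6, rfl, rfl, rfl⟩ := (lab_legsOut hN.outputs_lt).1 h3
    rename_i z
    refine ⟨fun i => z.getD i 0, rfl, rfl, ?_, by simp [Network.toNet]⟩
    rw [Finset.union_self, Finset.union_self]
    congr 1
    exact List.ext_getElem (by simp [Network.toNet, h4]) fun i hi _ => by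
      simp [Network.toNet, List.getElem?_eq_getElem hi]
  · rintro ⟨g, rfl, rfl, rfl, rfl⟩
    have key : ∀ i < N.nodes, ((List.range N.nodes).map g).getD i 0 = g i := fun i hi => by
      rw [List.getD_eq_getElem _ _ (by simpa using hi)]
      simp
    have hl : ((List.range N.nodes).map g).length = N.nodes := by simp
    refine ⟨(List.range N.nodes).map g, _, _, _, 0, ⟨_, _, _, 0, _, (lab_legsIn hN.inputs_lt).2
      ⟨hl, ?_, rfl, rfl⟩, (lab_links hN.edges_lt).2 ⟨hl, rfl, rfl, rfl⟩, rfl, rfl⟩,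
      (lab_legsOut hN.outputs_lt).2 ⟨hl, ?_, rfl, rfl⟩, ?_, ?_⟩
    · exact List.map_congr_left fun i hi => (key i (hN.inputs_lt i hi)).symm
    · exact List.map_congr_left fun i hi => (key i (hN.outputs_lt i hi)).symm
    · rw [Finset.union_self, Finset.union_self]
      rfl
    · rw [add_zero, zero_add]
      congr 2
      exact List.map_congr_left fun e he => by
        simp only
        rw [key _ (hN.edges_lt e he).1, key _ (hN.edges_lt e he).2]

end

variable {R : Type*} [CommSemiring R]

theorem lab_structural {s t : CircuitTerm R} (h : StructuralLaw s t) (hs : s.WellFormed)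
    (hd : s.dom = t.dom) (hc : s.cod = t.cod) (ht : t.WellFormed)
    (x y : List ℕ) (U : Finset ℕ) (e : Multiset (Sym2 ℕ × R)) : Lab s x y U e ↔ Lab t x y U e := by
  cases h with
  | hypergraph h => exact lab_hypergraph h hs hd hc ht x y U e
  -- Bending a conductance around exchanges its ends, which is invisible because edges are unordered
  -- pairs.
  | self_adjoint c =>
    constructor
    · rintro ⟨_, _, _, _, _, ⟨_, _, _, _, _, ⟨_, _, _, _, _, _, _, _, h1, h2, rfl, rfl, rfl, rfl⟩,
        ⟨_, _, _, _, _, _, _, _, h3, ⟨_, _, _, _, _, _, _, _, ⟨u, v, rfl, rfl, rfl, rfl⟩, h4, rfl,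
        rfl, rfl, rfl⟩, hz, rfl, rfl, rfl⟩, rfl, rfl⟩, ⟨_, _, _, _, _, _, _, _, h5, h6, hz', rfl,
        rfl, rfl⟩, rfl, rfl⟩
      obtain ⟨a, rfl, rfl, rfl, rfl⟩ := lab_id_one.1 h1
      obtain ⟨b, rfl, rfl, rfl, rfl⟩ := lab_id_one.1 h3
      obtain ⟨d, rfl, rfl, rfl, rfl⟩ := lab_id_one.1 h4
      obtain ⟨f, rfl, rfl, rfl, rfl⟩ := lab_id_one.1 h6
      obtain ⟨g, rfl, rfl, rfl, rfl⟩ := lab_spider.1 h2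
      obtain ⟨h, rfl, rfl, rfl, rfl⟩ := lab_spider.1 h5
      simp [List.replicate_succ] at hz hz'
      obtain ⟨rfl, rfl, rfl⟩ := hz
      obtain ⟨rfl, rfl, rfl⟩ := hz'
      refine ⟨v, g, rfl, by simp, ?_, by simp [Sym2.eq_swap]⟩
      ext
      simp
    · rintro ⟨u, v, rfl, rfl, rfl, rfl⟩
      have h1 : Lab (.cup : CircuitTerm R) [] [v, v] {v} 0 := lab_spider.2 ⟨v, rfl, rfl, rfl, rfl⟩
      have h2 : Lab (.cap : CircuitTerm R) [u, u] [] {u} 0 := lab_spider.2 ⟨u, rfl, rfl, rfl, rfl⟩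
      have := ((((Lab.id_one (R := R) u).tensor h1)).comp ((Lab.id_one u).tensor
        ((Lab.cond v u c).tensor (Lab.id_one v)))).comp (h2.tensor (Lab.id_one v))
      convert this using 1
      · simp
      · simp
      · ext
        simp
      · simp [Sym2.eq_swap]

theorem lab_cong {n m : ℕ} {s t : CircuitTerm R} (h : Cong StructuralLaw n m s t) :
    Lab s = Lab t := by
  induction h with
  | law h hs ht =>
    obtain ⟨h1, h2, h3⟩ := hs.wellFormed
    obtain ⟨h4, h5, h6⟩ := ht.wellFormed
    ext x y U e
    exact lab_structural h h1 (h2.trans h5.symm) (h3.trans h6.symm) h4 x y U e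
  | refl _ => rfl
  | symm _ ih => exact ih.symm
  | trans _ _ ih1 ih2 => exact ih1.trans ih2
  | comp _ _ ih1 ih2 => ext x y U e; simp only [lab_comp, ih1, ih2]
  | tensor _ _ ih1 ih2 => ext x y U e; simp only [lab_tensor, ih1, ih2]

end ResistorCircuit

namespace ResistorCircuit
variable {R : Type*}

/-! ### The effect of rewriting on labellings -/

theorem Lab.edges_mem {t : CircuitTerm R} {x y : List ℕ} {U : Finset ℕ}
    {e : Multiset (Sym2 ℕ × R)} (h : Lab t x y U e) : ∀ p ∈ e, ∀ v ∈ p.1, v ∈ U := by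
  induction t generalizing x y U e with
  | id n => obtain ⟨h, rfl, rfl, rfl⟩ := h; simp
  | comp f g hf hg =>
    obtain ⟨z, U₁, U₂, e₁, e₂, h1, h2, rfl, rfl⟩ := h
    intro p hp v hv
    rcases Multiset.mem_add.1 hp with hp | hp
    · exact Finset.mem_union_left _ (hf h1 p hp v hv)
    · exact Finset.mem_union_right _ (hg h2 p hp v hv)
  | tensor f g hf hg =>
    obtain ⟨x₁, x₂, y₁, y₂, U₁, U₂, e₁, e₂, h1, h2, rfl, rfl, rfl, rfl⟩ := h
    intro p hp v hv
    rcases Multiset.mem_add.1 hp with hp | hp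
    · exact Finset.mem_union_left _ (hf h1 p hp v hv)
    · exact Finset.mem_union_right _ (hg h2 p hp v hv)
  | swap a b =>
    obtain ⟨p, q, rfl, rfl, rfl, rfl, rfl, rfl⟩ := h
    simp
  | cond c =>
    obtain ⟨u, v, rfl, rfl, rfl, rfl⟩ := h
    simp
  | _ => obtain ⟨v, rfl, rfl, rfl, rfl⟩ := h; simp

/-- The labellings of the surroundings of a hole. -/
def LabAround (a b : CircuitTerm R) (p q : ℕ) (x y x₁ y₁ : List ℕ) (U : Finset ℕ)
    (e : Multiset (Sym2 ℕ × R)) : Prop :=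
  ∃ P P' Ua Ub ea eb, P.length = p ∧ P'.length = q ∧ Lab a x (P ++ (x₁ ++ P')) Ua ea ∧
    Lab b (P ++ (y₁ ++ P')) y Ub eb ∧ U = Ua ∪ Ub ∧ e = ea + eb

theorem LabAround.subset {a b : CircuitTerm R} {p q : ℕ} {x y x₁ y₁ : List ℕ} {U : Finset ℕ}
    {e : Multiset (Sym2 ℕ × R)} (h : LabAround a b p q x y x₁ y₁ U e) :
    x.toFinset ⊆ U ∧ y.toFinset ⊆ U ∧ x₁.toFinset ⊆ U ∧ y₁.toFinset ⊆ U := by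
  obtain ⟨P, P', Ua, Ub, ea, eb, -, -, h1, h2, rfl, -⟩ := h
  have k1 := h1.subset
  have k2 := h2.subset
  simp only [List.toFinset_append, Finset.union_subset_iff] at k1 k2
  exact ⟨k1.1.trans Finset.subset_union_left, k2.2.trans Finset.subset_union_right,
    k1.2.2.1.trans Finset.subset_union_left, k2.1.2.1.trans Finset.subset_union_right⟩

theorem LabAround.edges_mem {a b : CircuitTerm R} {p q : ℕ} {x y x₁ y₁ : List ℕ} {U : Finset ℕ}
    {e : Multiset (Sym2 ℕ × R)} (h : LabAround a b p q x y x₁ y₁ U e) :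
    ∀ p ∈ e, ∀ v ∈ p.1, v ∈ U := by
  obtain ⟨P, P', Ua, Ub, ea, eb, -, -, h1, h2, rfl, rfl⟩ := h
  intro p hp v hv
  rcases Multiset.mem_add.1 hp with hp | hp
  · exact Finset.mem_union_left _ (h1.edges_mem p hp v hv)
  · exact Finset.mem_union_right _ (h2.edges_mem p hp v hv)

theorem lab_around {a b l : CircuitTerm R} {p q : ℕ} {x y : List ℕ} {U : Finset ℕ}
    {e : Multiset (Sym2 ℕ × R)} : Lab (a ⨟ .id p ⊠ l ⊠ .id q ⨟ b) x y U e ↔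
    ∃ x₁ y₁ U₀ e₀ U₁ e₁, LabAround a b p q x y x₁ y₁ U₀ e₀ ∧ Lab l x₁ y₁ U₁ e₁ ∧ U = U₀ ∪ U₁ ∧
      e = e₀ + e₁ := by
  constructor
  · rintro ⟨_, _, _, _, _, ⟨_, _, _, _, _, h1, ⟨_, _, _, _, _, _, _, _, ⟨rfl, rfl, rfl, rfl⟩,
      ⟨_, _, _, _, _, _, _, _, h3, ⟨rfl, rfl, rfl, rfl⟩, rfl, rfl, rfl, rfl⟩, rfl, rfl, rfl, rfl⟩,
      rfl, rfl⟩, h5, rfl, rfl⟩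
    refine ⟨_, _, _, _, _, _, ⟨_, _, _, _, _, _, rfl, rfl, h1, h5, rfl, rfl⟩, h3, ?_, ?_⟩
    -- The labels of the wires beside the hole already occur among those of `a`.
    · have := h1.subset.2
      simp only [List.toFinset_append, Finset.union_subset_iff] at this
      ext v
      have h6 := @this.1 v
      have h7 := @this.2.2 v
      simp only [Finset.mem_union] at *
      tauto
    · simp only [zero_add, add_zero]
      exact add_right_comm _ _ _
  · rintro ⟨x₁, y₁, _, _, U₁, e₁, ⟨P, P', Ua, Ub, ea, eb, rfl, rfl, h1, h5, rfl, rfl⟩, h3, rfl, rfl⟩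
    refine ⟨_, _, _, _, _, ⟨_, _, _, _, _, h1, ⟨P, _, P, _, _, _, _, _, ⟨rfl, rfl, rfl, rfl⟩,
      ⟨x₁, P', y₁, P', _, _, _, _, h3, ⟨rfl, rfl, rfl, rfl⟩, rfl, rfl, rfl, rfl⟩, rfl, rfl, rfl,
      rfl⟩, rfl, rfl⟩, h5, ?_, ?_⟩
    · have := h1.subset.2
      simp only [List.toFinset_append, Finset.union_subset_iff] at this
      ext v
      have h6 := @this.1 v
      have h7 := @this.2.2 v
      simp only [Finset.mem_union] at *
      tauto
    · simp only [zero_add, add_zero]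
      exact add_right_comm _ _ _

theorem exists_labels {n : ℕ} (us : List ℕ) (hus : us.length = n) (y : Fin n → R) :
    ∃ l : List (ℕ × R), l.map Prod.fst = us ∧ l.map Prod.snd = List.ofFn y := by
  refine ⟨us.zip (List.ofFn y), ?_, ?_⟩
  · exact List.map_fst_zip (by simp [hus])
  · exact List.map_snd_zip (by simp [hus])

theorem lab_star_spokes (w : ℕ) (l : List (ℕ × R)) :
    Lab (.star (l.map Prod.snd)) [] (l.map Prod.fst) (insert w (l.map Prod.fst).toFinset)
      ((Q.spokes w l).map Q.edge : List (Sym2 ℕ × R)) := by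
  refine lab_star.2 ⟨rfl, by simp, w, rfl, ?_⟩
  rw [List.zipWith_map, List.zipWith_self, Q.spokes, List.map_map]
  rfl

theorem lab_short {y : R} {x x' : List ℕ} {U : Finset ℕ} {e : Multiset (Sym2 ℕ × R)} :
    Lab (.comul ⨟ .cond y ⊠ .id 1 ⨟ .mul) x x' U e ↔
      ∃ v, x = [v] ∧ x' = [v] ∧ U = {v} ∧ e = {(s(v, v), y)} := by
  constructor
  · rintro ⟨_, _, _, _, _, ⟨_, _, _, _, _, ⟨v, rfl, rfl, rfl, rfl⟩, ⟨_, _, _, _, _, _, _, _,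
      ⟨a, b, rfl, rfl, rfl, rfl⟩, h, hz, rfl, rfl, rfl⟩, rfl, rfl⟩, ⟨w, hz', rfl, rfl, rfl⟩, rfl,
      rfl⟩
    obtain ⟨u, rfl, rfl, rfl, rfl⟩ := lab_id_one.1 h
    simp at hz hz'
    obtain ⟨rfl, rfl⟩ := hz
    obtain ⟨rfl, rfl⟩ := hz'
    exact ⟨v, by simp⟩
  · rintro ⟨v, rfl, rfl, rfl, rfl⟩
    simpa using ((Lab.comul v).comp ((Lab.cond v v y).tensor (.id_one v))).comp (.mul v)

theorem lab_parallel {y z : R} {x x' : List ℕ} {U : Finset ℕ} {e : Multiset (Sym2 ℕ × R)} :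
    Lab (.comul ⨟ .cond y ⊠ .cond z ⨟ .mul) x x' U e ↔
      ∃ u v, x = [u] ∧ x' = [v] ∧ U = {u, v} ∧ e = {(s(u, v), y), (s(u, v), z)} := by
  constructor
  · rintro ⟨_, _, _, _, _, ⟨_, _, _, _, _, ⟨v, rfl, rfl, rfl, rfl⟩, ⟨_, _, _, _, _, _, _, _,
      ⟨a, b, rfl, rfl, rfl, rfl⟩, ⟨a', b', rfl, rfl, rfl, rfl⟩, hz, rfl, rfl, rfl⟩, rfl, rfl⟩,
      ⟨w, hz', rfl, rfl, rfl⟩, rfl, rfl⟩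
    simp at hz hz'
    obtain ⟨rfl, rfl⟩ := hz
    obtain ⟨rfl, rfl⟩ := hz'
    refine ⟨v, b', rfl, rfl, ?_, ?_⟩
    · ext
      simp
    · simp
  · rintro ⟨u, v, rfl, rfl, rfl, rfl⟩
    convert ((Lab.comul u).comp ((Lab.cond u v y).tensor (.cond u v z))).comp (.mul v) using 1
    · ext
      simp
    · simp

variable [CommSemiring R]

/-- The labellings of a diagram. -/
def Diagram.Lab {n m : ℕ} (d : Diagram R n m) :
    List ℕ → List ℕ → Finset ℕ → Multiset (Sym2 ℕ × R) → Prop :=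
  Quotient.lift (fun s : Circuit R n m => ResistorCircuit.Lab s.1) (fun _ _ h => lab_cong h) d

/-- Labellings with as many labels as possible. -/
def Diagram.Gen {n m : ℕ} (d : Diagram R n m) (x y : List ℕ) (U : Finset ℕ)
    (e : Multiset (Sym2 ℕ × R)) : Prop :=
  d.Lab x y U e ∧ ∀ x' y' U' e', d.Lab x' y' U' e' → U'.card ≤ U.card

/-- The conductances of the mesh of a star. -/
noncomputable def meshOf (l : List (ℕ × R)) : List (ℕ × ℕ × R) :=
  Net.meshEdges (fun y z => y * z * Ring.inverse (l.map Prod.snd).sum) l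

/-- The effect of a rewriting step on labellings. -/
inductive Effect : Finset ℕ → Multiset (Sym2 ℕ × R) → Finset ℕ → Multiset (Sym2 ℕ × R) → Prop
  | loop (U : Finset ℕ) (f : Multiset (Sym2 ℕ × R)) (v : ℕ) (c : R) :
      Effect U (f + {(s(v, v), c)}) U f
  | parallel (U : Finset ℕ) (f : Multiset (Sym2 ℕ × R)) (u v : ℕ) (c c' : R) :
      Effect U (f + {(s(u, v), c), (s(u, v), c')}) U (f + {(s(u, v), c + c')})
  | star (U : Finset ℕ) (f : Multiset (Sym2 ℕ × R)) (w : ℕ) (l : List (ℕ × R)) (hw : w ∉ U)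
      (hl : ∀ p ∈ l, p.1 ∈ U) (hf : ∀ p ∈ f, w ∉ p.1) (h0 : ∀ p ∈ l, p.2 ≠ 0) :
      Effect (insert w U) (f + ((Q.spokes w l).map Q.edge : List (Sym2 ℕ × R))) U
        (f + ((meshOf l).map Q.edge : List (Sym2 ℕ × R)))

theorem mesh_inRange {n : ℕ} (y : Fin n → R) : (⟨n, [], List.range n,
    ((List.finRange n ×ˢ List.finRange n).filter fun p => p.1 < p.2).map fun p =>
        ((p.1 : ℕ), (p.2 : ℕ), y p.1 * y p.2 * Ring.inverse (∑ k, y k))⟩ : Network R).InRange := by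
  refine ⟨by simp, by simp, fun e he => ?_⟩
  obtain ⟨p, hp, rfl⟩ := List.mem_map.1 he
  simp

theorem lab_mesh {n : ℕ} {y : Fin n → R} {x us : List ℕ} {U : Finset ℕ}
    {e : Multiset (Sym2 ℕ × R)} (h : Lab (mesh y) x us U e) :
    x = [] ∧ us.length = n ∧ U = us.toFinset := by
  obtain ⟨g, rfl, rfl, rfl, -⟩ := (lab_toTerm (mesh_inRange y)).1 h
  exact ⟨rfl, by simp [Network.toNet], rfl⟩

theorem lab_mesh_meshOf {n : ℕ} {y : Fin n → R} {l : List (ℕ × R)}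
    (hl : l.map Prod.snd = List.ofFn y) :
    Lab (mesh y) [] (l.map Prod.fst) (l.map Prod.fst).toFinset
      ((meshOf l).map Q.edge : List (Sym2 ℕ × R)) := by
  obtain rfl : l.length = n := by simpa using congrArg List.length hl
  have hy : ∀ i, y i = l[i].2 := fun i => by
    have := congrArg (fun t : List R => t[(i : ℕ)]?) hl
    simpa using this.symm
  have hs : ∑ k, y k = (l.map Prod.snd).sum := by rw [hl, List.sum_ofFn]
  have hg : l.map Prod.fst = (List.range l.length).map fun i => (l.map Prod.fst).getD i 0 :=
    List.ext_getElem (by simp) fun i h _ => by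
      simp at h
      simp [h]
  refine (lab_toTerm (mesh_inRange y)).2 ⟨fun i => (l.map Prod.fst).getD i 0, rfl, hg, ?_, ?_⟩
  · exact congrArg _ hg
  · simp only [Network.toNet, Q.mapEdges, meshOf, Net.meshEdges, List.map_map, hs]
    congr 1
    exact List.map_congr_left fun p _ => by simp [hy]

/-- The labelling of the surroundings is kept and extended to the right side of the rule. Maximality
is used to see that the centre of a star has a label of its own. It is inherited by the result
because, conversely, every labelling of the result extends to the diagram before the step. -/
theorem Step.effect {n m : ℕ} {d d' : Diagram R n m} (h : Step d d') {x y : List ℕ} {U : Finset ℕ}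
    {e : Multiset (Sym2 ℕ × R)} (hg : d.Gen x y U e) :
    ∃ U' e', d'.Gen x y U' e' ∧ Effect U e U' e' := by
  obtain ⟨p, q, a, b, l, r, hrule, hl, hr, rfl, rfl⟩ := h
  obtain ⟨h1, hmax⟩ := hg
  obtain ⟨x₁, y₁, U₀, e₀, U₁, e₁, h2, h3, rfl, rfl⟩ := lab_around.1 h1
  cases hrule with
  | short_circuit c =>
    obtain ⟨v, rfl, rfl, rfl, rfl⟩ := lab_short.1 h3
    refine ⟨U₀ ∪ {v}, e₀, ⟨lab_around.2 ⟨_, _, _, _, _, 0, h2, Lab.id_one v, rfl, by simp⟩, ?_⟩,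
      .loop _ _ _ _⟩
    intro x' y' U' e' h'
    obtain ⟨x₁, y₁, U₂, e₂, U₃, e₃, h4, h5, rfl, rfl⟩ := lab_around.1 h'
    obtain ⟨u, rfl, rfl, rfl, rfl⟩ := lab_id_one.1 h5
    exact hmax _ _ _ _ (lab_around.2 ⟨_, _, _, _, _, _, h4, lab_short.2 ⟨u, rfl, rfl, rfl, rfl⟩,
      rfl, rfl⟩)
  | parallel c c' =>
    obtain ⟨u, v, rfl, rfl, rfl, rfl⟩ := lab_parallel.1 h3
    refine ⟨U₀ ∪ {u, v}, _, ⟨lab_around.2 ⟨_, _, _, _, _, _, h2, Lab.cond u v (c + c'), rfl, rfl⟩,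
      ?_⟩, .parallel _ _ _ _ _ _⟩
    intro x' y' U' e' h'
    obtain ⟨x₁, y₁, U₂, e₂, U₃, e₃, h4, ⟨u, v, rfl, rfl, rfl, rfl⟩, rfl, rfl⟩ := lab_around.1 h'
    exact hmax _ _ _ _ (lab_around.2 ⟨_, _, _, _, _, _, h4,
      lab_parallel.2 ⟨u, v, rfl, rfl, rfl, rfl⟩, rfl, rfl⟩)
  | @star_mesh k c hc =>
    obtain ⟨rfl, hlen, w, rfl, rfl⟩ := lab_star.1 h3
    rw [List.length_ofFn] at hlen
    obtain ⟨L, rfl, hL⟩ := exists_labels y₁ hlen c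
    have hsub := h2.subset.2.2.2
    have hsp : (List.zipWith (fun u c => (s(w, u), c)) (L.map Prod.fst) (List.ofFn c)) =
        (Q.spokes w L).map Q.edge := by
      rw [← hL, List.zipWith_map, List.zipWith_self, Q.spokes, List.map_map]
      rfl
    have hU : U₀ ∪ insert w (L.map Prod.fst).toFinset = insert w U₀ := by
      rw [Finset.union_insert, Finset.union_eq_left.2 hsub]
    -- If the centre shared its label with the surroundings, a new label there would give more
    -- labels.
    have hw : w ∉ U₀ := by
      intro hw
      obtain ⟨w', hw'⟩ := Infinite.exists_notMem_finset U₀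
      have := hmax _ _ _ _ (lab_around.2 ⟨_, _, _, _, _, _, h2,
        by have := lab_star_spokes w' L; rwa [hL] at this, rfl, rfl⟩)
      rw [hU, Finset.union_insert, Finset.union_eq_left.2 hsub, Finset.insert_eq_of_mem hw,
        Finset.card_insert_of_notMem hw'] at this
      omega
    refine ⟨U₀, _, ⟨lab_around.2 ⟨_, _, _, _, _, _, h2, lab_mesh_meshOf hL,
      (Finset.union_eq_left.2 hsub).symm, rfl⟩, ?_⟩, ?_⟩
    -- A labelling of the result gives one of the star with a new label at the centre; so both label
    -- counts rise by one.
    · intro x' y' U' e' h'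
      obtain ⟨x₁, y₁, U₂, e₂, U₃, e₃, h4, h5, rfl, rfl⟩ := lab_around.1 h'
      obtain ⟨rfl, h6, rfl⟩ := lab_mesh h5
      obtain ⟨L', rfl, hL'⟩ := exists_labels y₁ h6 c
      have hsub' := h4.subset.2.2.2
      obtain ⟨w', hw'⟩ := Infinite.exists_notMem_finset U₂
      have := hmax _ _ _ _ (lab_around.2 ⟨_, _, _, _, _, _, h4,
        by have := lab_star_spokes w' L'; rwa [hL'] at this, rfl, rfl⟩)
      rw [hU, Finset.card_insert_of_notMem hw, Finset.union_insert, Finset.union_eq_left.2 hsub',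
        Finset.card_insert_of_notMem hw'] at this
      rw [Finset.union_eq_left.2 hsub']
      omega
    · rw [hU, hsp]
      refine .star _ _ _ _ hw ?_ ?_ ?_
      · intro p hp
        exact hsub (by simpa using ⟨_, hp⟩)
      · exact fun p hp hw' => hw (h2.edges_mem p hp w hw')
      · intro p hp
        have : p.2 ∈ List.ofFn c := hL ▸ List.mem_map_of_mem hp
        obtain ⟨i, hi⟩ := (List.mem_ofFn' _ _).1 this
        exact hi ▸ hc i

end ResistorCircuit

namespace ResistorCircuit

/-! ### Elimination of nodes from a matrix of conductances -/

/-- Here `x` is the conductance between the two eliminated nodes, and `A`, `B` are their total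
conductances to all other nodes. If `A` and `B` are non-zero, then so is `x A + x B + A B` by
positivity, and over this denominator both sides agree. If one of them vanishes, the conductances
that are part of it vanish as well, and a single elimination remains. -/
theorem elim_symm_aux {K : Type*} [Semifield K] (hK : ∀ x y : K, x + y = 0 → x = 0 ∧ y = 0)
    {c ai aj ib jb x A B : K} (hA : A = 0 → ai = 0 ∧ ib = 0) (hB : B = 0 → aj = 0 ∧ jb = 0) :
    c + ai * ib * (x + A)⁻¹ +
        (aj + ai * x * (x + A)⁻¹) * (jb + x * ib * (x + A)⁻¹) * (B + x * A * (x + A)⁻¹)⁻¹ =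
      c + aj * jb * (x + B)⁻¹ +
        (ai + aj * x * (x + B)⁻¹) * (ib + x * jb * (x + B)⁻¹) * (A + x * B * (x + B)⁻¹)⁻¹ := by
  -- One node is a dead end, joined only to the other one, whose total to the rest is `z`;
  -- eliminating the dead end first changes nothing.
  have aux : ∀ {u v w z : K}, z ≠ 0 →
      c + u * v * z⁻¹ = c + u * v * (x + z)⁻¹ +
        (0 + u * x * (x + z)⁻¹) * (0 + x * v * (x + z)⁻¹) * (0 + x * z * (x + z)⁻¹)⁻¹ := by
    intro u v w z hz
    by_cases hx : x = 0
    · subst hx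
      simp
    · have h : x + z ≠ 0 := fun h => hz (hK _ _ h).2
      simp only [zero_add]
      field_simp
      ring
  by_cases hA0 : A = 0
  · obtain ⟨rfl, rfl⟩ := hA hA0
    subst hA0
    by_cases hB0 : B = 0
    · obtain ⟨rfl, rfl⟩ := hB hB0
      simp
    · have := aux (u := aj) (v := jb) (w := 0) hB0
      rw [← this]
      simp
  · by_cases hB0 : B = 0
    · obtain ⟨rfl, rfl⟩ := hB hB0
      subst hB0
      have := aux (u := ai) (v := ib) (w := 0) hA0
      rw [← this]
      simp
    · have h1 : x + A ≠ 0 := fun h => hA0 (hK _ _ h).2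
      have h2 : x + B ≠ 0 := fun h => hB0 (hK _ _ h).2
      have h3 : x * A + x * B + A * B ≠ 0 := fun h =>
        (mul_ne_zero hA0 hB0) (hK _ _ h).2
      obtain ⟨D, hD⟩ : ∃ D, D = x * A + x * B + A * B := ⟨_, rfl⟩
      rw [← hD] at h3
      have e1 : B + x * A * (x + A)⁻¹ = D * (x + A)⁻¹ := by
        rw [hD]
        field_simp
        ring
      have e2 : A + x * B * (x + B)⁻¹ = D * (x + B)⁻¹ := by
        rw [hD]
        field_simp
        ring
      rw [e1, e2, mul_inv, mul_inv, inv_inv, inv_inv]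
      field_simp
      rw [hD]
      ring

/-- A nontrivial positive division rig is a semifield. -/
noncomputable abbrev IsPositiveDivisionRig.semifield {R : Type*} [i : CommSemiring R]
    (hR : IsPositiveDivisionRig R) [Nontrivial R] : Semifield R where
  __ := i
  inv := Ring.inverse
  exists_pair_ne := exists_pair_ne R
  mul_inv_cancel a ha := by
    obtain ⟨b, hb⟩ := hR.exists_inv a ha
    exact Ring.mul_inverse_cancel a (IsUnit.of_mul_eq_one b hb)
  inv_zero := Ring.inverse_zero R
  nnqsmul := _
  nnqsmul_def _ _ := rfl

variable {R : Type*} [CommSemiring R]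

theorem elim_symm (hR : IsPositiveDivisionRig R)
    {c ai aj ib jb x A B : R} (hA : A = 0 → ai = 0 ∧ ib = 0) (hB : B = 0 → aj = 0 ∧ jb = 0) :
    c + ai * ib * Ring.inverse (x + A) +
        (aj + ai * x * Ring.inverse (x + A)) * (jb + x * ib * Ring.inverse (x + A)) *
          Ring.inverse (B + x * A * Ring.inverse (x + A)) =
      c + aj * jb * Ring.inverse (x + B) +
        (ai + aj * x * Ring.inverse (x + B)) * (ib + x * jb * Ring.inverse (x + B)) *
          Ring.inverse (A + x * B * Ring.inverse (x + B)) := by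
  rcases subsingleton_or_nontrivial R with h | h
  · exact Subsingleton.elim _ _
  · let _ := hR.semifield
    exact elim_symm_aux hR.positive hA hB

theorem IsPositiveDivisionRig.mul_ne_zero (hR : IsPositiveDivisionRig R) {x y : R} (hx : x ≠ 0)
    (hy : y ≠ 0) : x * y ≠ 0 := by
  obtain ⟨z, hz⟩ := hR.exists_inv x hx
  intro h
  apply hy
  rw [← one_mul y, ← hz, mul_right_comm, h, zero_mul]

theorem IsPositiveDivisionRig.inverse_ne_zero (hR : IsPositiveDivisionRig R) {x : R} (hx : x ≠ 0) :
    Ring.inverse x ≠ 0 := by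
  obtain ⟨z, hz⟩ := hR.exists_inv x hx
  have := Ring.mul_inverse_cancel x (IsUnit.of_mul_eq_one z hz)
  intro h
  rw [h, mul_zero] at this
  exact hx (by rw [← one_mul x, ← this, zero_mul])

theorem IsPositiveDivisionRig.sum_eq_zero (hR : IsPositiveDivisionRig R) {ι : Type*} {s : Finset ι}
    {f : ι → R} (h : ∑ i ∈ s, f i = 0) : ∀ i ∈ s, f i = 0 := by
  classical
  induction s using Finset.induction_on with
  | empty => simp
  | insert a s ha ih =>
    rw [Finset.sum_insert ha] at h
    obtain ⟨h1, h2⟩ := hR.positive _ _ h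
    intro i hi
    rcases Finset.mem_insert.1 hi with rfl | hi
    · exact h1
    · exact ih h2 i hi

/-- A symmetric matrix of conductances between the nodes `B`. -/
structure CondMat (R : Type*) [CommSemiring R] (B : Finset ℕ) where
  val : ℕ → ℕ → R
  symm : ∀ a b, val a b = val b a
  diag : ∀ a, val a a = 0
  supp : ∀ a b, a ∉ B → val a b = 0

namespace CondMat
variable {B : Finset ℕ}

theorem ext' {c d : CondMat R B} (h : ∀ a b, c.val a b = d.val a b) : c = d := by
  cases c
  cases d
  congr
  ext a b
  exact h a b

theorem supp' (c : CondMat R B) (a b : ℕ) (h : b ∉ B) : c.val a b = 0 := by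
  rw [c.symm, c.supp b a h]

/-- Elimination of a node by the star-mesh transformation. -/
noncomputable def elim (c : CondMat R B) (w : ℕ) : CondMat R B where
  -- The row and column of the eliminated node become zero instead of being deleted, so the index
  -- set `B` stays fixed. The diagonal is kept zero, which drops the loops of the mesh.
  val a b := if a = b ∨ a = w ∨ b = w then 0 else
    c.val a b + c.val a w * c.val w b * Ring.inverse (∑ v ∈ B, c.val w v)
  symm a b := by
    by_cases h : a = b ∨ a = w ∨ b = w
    · rw [if_pos h, if_pos (by tauto)]
    · rw [if_neg h, if_neg (by tauto), c.symm a b, c.symm a w, c.symm w b, mul_comm (c.val w a)]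
  diag a := if_pos (Or.inl rfl)
  supp a b h := by
    split
    · rfl
    · rw [c.supp a b h, c.supp a w h, zero_mul, zero_mul, zero_add]

theorem elim_val (c : CondMat R B) {w a b : ℕ} (hab : a ≠ b) (ha : a ≠ w) (hb : b ≠ w) :
    (c.elim w).val a b =
      c.val a b + c.val a w * c.val w b * Ring.inverse (∑ v ∈ B, c.val w v) :=
  if_neg (by tauto)

theorem sum_eq (c : CondMat R B) (i j : ℕ) :
    ∑ v ∈ B, c.val i v = c.val i j + ∑ v ∈ (B.erase i).erase j, c.val i v := by
  have h1 : ∑ v ∈ B, c.val i v = ∑ v ∈ B.erase i, c.val i v := by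
    rw [Finset.sum_erase _ (c.diag i)]
  rw [h1]
  by_cases hj : j ∈ B.erase i
  · exact (Finset.add_sum_erase _ _ hj).symm
  · rw [Finset.erase_eq_of_notMem hj]
    have : c.val i j = 0 := by
      by_cases hij : j = i
      · rw [hij, c.diag]
      · exact c.supp' _ _ fun h => hj (Finset.mem_erase.2 ⟨hij, h⟩)
    rw [this, zero_add]

/-- Brings a double elimination into the shape of `elim_symm`. The term of `i j` is split off from
both row sums; the total at `j` after the first step has no diagonal term. -/
theorem elim_elim_val (c : CondMat R B) {i j a b : ℕ} (hij : i ≠ j) (hab : a ≠ b) (hai : a ≠ i)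
    (haj : a ≠ j) (hbi : b ≠ i) (hbj : b ≠ j) :
    ((c.elim i).elim j).val a b =
      c.val a b + c.val a i * c.val i b *
          Ring.inverse (c.val i j + ∑ v ∈ (B.erase i).erase j, c.val i v) +
        (c.val a j + c.val a i * c.val i j *
            Ring.inverse (c.val i j + ∑ v ∈ (B.erase i).erase j, c.val i v)) *
          (c.val j b + c.val i j * c.val i b *
            Ring.inverse (c.val i j + ∑ v ∈ (B.erase i).erase j, c.val i v)) *
          Ring.inverse (∑ v ∈ (B.erase i).erase j, c.val j v +
            c.val i j * (∑ v ∈ (B.erase i).erase j, c.val i v) *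
              Ring.inverse (c.val i j + ∑ v ∈ (B.erase i).erase j, c.val i v)) := by
  have hS : ∑ v ∈ B, (c.elim i).val j v = ∑ v ∈ (B.erase i).erase j, c.val j v +
            c.val i j * (∑ v ∈ (B.erase i).erase j, c.val i v) *
              Ring.inverse (c.val i j + ∑ v ∈ (B.erase i).erase j, c.val i v) := by
    rw [(c.elim i).sum_eq j i, Finset.erase_right_comm]
    have h0 : (c.elim i).val j i = 0 := if_pos (by tauto)
    rw [h0, zero_add, Finset.mul_sum, Finset.sum_mul, ← Finset.sum_add_distrib]
    refine Finset.sum_congr rfl fun v hv => ?_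
    simp only [Finset.mem_erase] at hv
    rw [c.elim_val (Ne.symm hv.1) (Ne.symm hij) hv.2.1, c.symm j i, c.sum_eq i j]
  rw [elim_val _ hab haj hbj, hS, c.elim_val hab hai hbi, c.elim_val haj hai (Ne.symm hij),
    c.elim_val (Ne.symm hbj) (Ne.symm hij) hbi, c.sum_eq i j, c.symm j i]

/-- Entries on the diagonal or in a row or column of `i` or `j` vanish in both orders. The others
are compared by `elim_symm`, whose side conditions hold because by positivity a vanishing sum has
vanishing terms. -/
theorem elim_comm (hR : IsPositiveDivisionRig R) (c : CondMat R B) (i j : ℕ) :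
    (c.elim i).elim j = (c.elim j).elim i := by
  by_cases hij : i = j
  · rw [hij]
  apply ext'
  intro a b
  by_cases h : a = b ∨ a = i ∨ a = j ∨ b = i ∨ b = j
  · have key : ∀ i j, a = b ∨ a = i ∨ a = j ∨ b = i ∨ b = j → ((c.elim i).elim j).val a b = 0 := by
      intro i j h
      change (if a = b ∨ a = j ∨ b = j then (0 : R) else _) = 0
      split
      · rfl
      · have h1 : (c.elim i).val a b = 0 := if_pos (by tauto)
        rw [h1, zero_add]
        have h2 : (c.elim i).val a j = 0 ∨ (c.elim i).val j b = 0 := by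
          rcases h with h | h | h | h | h
          · tauto
          · exact Or.inl (if_pos (by tauto))
          · tauto
          · exact Or.inr (if_pos (by tauto))
          · tauto
        rcases h2 with h2 | h2 <;> simp [h2]
    rw [key i j h, key j i (by tauto)]
  · push Not at h
    obtain ⟨hab, hai, haj, hbi, hbj⟩ := h
    rw [c.elim_elim_val hij hab hai haj hbi hbj, c.elim_elim_val (Ne.symm hij) hab haj hai hbj hbi,
      c.symm j i, Finset.erase_right_comm (a := j)]
    have key : ∀ k, (∑ v ∈ (B.erase i).erase j, c.val k v = 0) → c.val a k = 0 ∧ c.val k b = 0 := by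
      intro k hk
      have hk' : ∀ v, v ≠ i → v ≠ j → c.val k v = 0 := fun v hvi hvj => by
        by_cases hv : v ∈ B
        · exact hR.sum_eq_zero hk v (by simp [hv, hvi, hvj])
        · exact c.supp' _ _ hv
      exact ⟨by rw [c.symm]; exact hk' a hai haj, hk' b hbi hbj⟩
    exact elim_symm hR (key i) (key j)

end CondMat

/-! ### The matrix of a multiset of edges -/

/-- The multiset of edges of a network. -/
abbrev edgesOf (es : List (ℕ × ℕ × R)) : Multiset (Sym2 ℕ × R) :=
  ((es.map Q.edge : List (Sym2 ℕ × R)) : Multiset (Sym2 ℕ × R))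

/-- The total conductance of the edges with given ends. -/
noncomputable def weight (e : Multiset (Sym2 ℕ × R)) (p : Sym2 ℕ) : R :=
  (e.map fun q => if q.1 = p then q.2 else 0).sum

theorem weight_add (e f : Multiset (Sym2 ℕ × R)) (p : Sym2 ℕ) :
    weight (e + f) p = weight e p + weight f p := by simp [weight]

theorem weight_eq_zero {e : Multiset (Sym2 ℕ × R)} {p : Sym2 ℕ} (h : ∀ q ∈ e, q.1 ≠ p) :
    weight e p = 0 := by
  rw [weight]
  refine Multiset.sum_eq_zero fun x hx => ?_
  obtain ⟨q, hq, rfl⟩ := Multiset.mem_map.1 hx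
  exact if_neg (h q hq)

/-- The matrix of conductances of a multiset of edges. -/
noncomputable def matOf (B : Finset ℕ) (e : Multiset (Sym2 ℕ × R)) : CondMat R B where
  val a b := if a = b ∨ a ∉ B ∨ b ∉ B then 0 else weight e s(a, b)
  symm a b := by
    by_cases h : a = b ∨ a ∉ B ∨ b ∉ B
    · rw [if_pos h, if_pos (by tauto)]
    · rw [if_neg h, if_neg (by tauto), Sym2.eq_swap]
  diag a := if_pos (Or.inl rfl)
  supp a b h := if_pos (Or.inr (Or.inl h))

theorem matOf_congr {B : Finset ℕ} {e f : Multiset (Sym2 ℕ × R)}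
    (h : ∀ a b, a ≠ b → weight e s(a, b) = weight f s(a, b)) : matOf B e = matOf B f := by
  apply CondMat.ext'
  intro a b
  change ite _ _ _ = ite _ _ _
  by_cases hab : a = b ∨ a ∉ B ∨ b ∉ B
  · rw [if_pos hab, if_pos hab]
  · rw [if_neg hab, if_neg hab, h a b (by tauto)]

/-- The total conductance of the spokes of a star that end at a node. -/
noncomputable def spokeWeight (l : List (ℕ × R)) (u : ℕ) : R :=
  (l.map fun p => if p.1 = u then p.2 else 0).sum

theorem weight_spokes {w u : ℕ} (hu : u ≠ w) (l : List (ℕ × R)) :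
    weight (edgesOf (Q.spokes w l)) s(w, u) =
      spokeWeight l u := by
  rw [weight, Multiset.map_coe, Multiset.sum_coe, spokeWeight, Q.spokes, List.map_map, List.map_map]
  congr 1
  refine List.map_congr_left fun p _ => ?_
  simp only [Function.comp_apply, Q.edge]
  refine if_congr ?_ rfl rfl
  simp only [Sym2.eq_iff]
  constructor
  · rintro (h | h)
    · exact h.2
    · exact absurd h.1.symm hu
  · intro h
    simp [h]

theorem sum_spokeWeight {B : Finset ℕ} {l : List (ℕ × R)} (hl : ∀ p ∈ l, p.1 ∈ B) :
    ∑ u ∈ B, spokeWeight l u = (l.map Prod.snd).sum := by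
  induction l with
  | nil => simp [spokeWeight]
  | cons p l ih =>
    have h1 := ih fun q hq => hl q (List.mem_cons_of_mem _ hq)
    simp only [spokeWeight, List.map_cons, List.sum_cons] at h1 ⊢
    rw [Finset.sum_add_distrib, h1, Finset.sum_ite_eq, if_pos (hl p List.mem_cons_self)]

theorem sum_filter_map {β : Type*} (P : β → Prop) [DecidablePred P] (f : β → R) (l : List β) :
    ((l.filter fun b => decide (P b)).map f).sum = (l.map fun b => if P b then f b else 0).sum := by
  induction l with
  | nil => rfl
  | cons b l ih => by_cases h : P b <;> simp [h, ih]

theorem sum_finRange_product {n : ℕ} (f : Fin n × Fin n → R) :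
    ((List.finRange n ×ˢ List.finRange n).map f).sum = ∑ i, ∑ j, f (i, j) := by
  simp only [SProd.sprod, List.product, List.flatMap_def, List.map_flatten, List.sum_flatten,
    List.map_map, Fin.sum_univ_def]
  congr 1
  refine List.map_congr_left fun i _ => ?_
  simp only [Function.comp_apply, List.map_map]
  rfl

theorem sum_lt_add_sum_lt {n : ℕ} (f : Fin n → Fin n → R) (h : ∀ i, f i i = 0) :
    (∑ i, ∑ j, if i < j then f i j + f j i else 0) = ∑ i, ∑ j, f i j := by
  have h1 : ∀ i j, f i j = (if i < j then f i j else 0) + (if j < i then f i j else 0) := by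
    intro i j
    rcases lt_trichotomy i j with hij | rfl | hij
    · simp [hij, not_lt_of_gt hij]
    · simp [h]
    · simp [hij, not_lt_of_gt hij]
  have h2 : ∑ i, ∑ j, f i j = (∑ i, ∑ j, if i < j then f i j else 0) +
      ∑ i, ∑ j, if j < i then f i j else 0 := by
    simp only [← Finset.sum_add_distrib]
    exact Finset.sum_congr rfl fun i _ => Finset.sum_congr rfl fun j _ => h1 i j
  rw [h2, Finset.sum_comm (f := fun i j => if j < i then f i j else 0)]
  simp only [← Finset.sum_add_distrib]
  refine Finset.sum_congr rfl fun i _ => Finset.sum_congr rfl fun j _ => ?_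
  split <;> simp

theorem spokeWeight_eq (l : List (ℕ × R)) (u : ℕ) :
    spokeWeight l u = ∑ i : Fin l.length, if l[i].1 = u then l[i].2 else 0 := by
  rw [spokeWeight, ← List.sum_ofFn]
  congr 1
  exact List.ext_getElem (by simp) (by simp)

theorem mesh_weight_aux {a b : ℕ} (hab : a ≠ b) (u v : ℕ) (y z k : R) :
    (if s(u, v) = s(a, b) then y * z * k else 0) =
      (if u = a then y else 0) * (if v = b then z else 0) * k +
        (if v = a then z else 0) * (if u = b then y else 0) * k := by
  have hba := Ne.symm hab
  simp only [Sym2.eq_iff]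
  by_cases h1 : u = a
  · subst h1
    by_cases h3 : v = b
    · subst h3
      simp [hab]
    · simp [h3, hab]
  · by_cases h2 : u = b
    · subst h2
      by_cases h3 : v = a
      · subst h3
        simp [hba, mul_comm]
      · simp [h3, hba]
    · simp [h1, h2]

/-- Several spokes may end at the same node. The product of the two spoke totals has a term for each
ordered pair of spokes; the terms of `(i, j)` and `(j, i)` together are the contribution of the mesh
edge `i < j`, and those of `(i, i)` vanish as `a ≠ b`. -/
theorem weight_meshOf {a b : ℕ} (hab : a ≠ b) (l : List (ℕ × R)) :
    weight (edgesOf (meshOf l)) s(a, b) =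
      spokeWeight l a * spokeWeight l b * Ring.inverse (l.map Prod.snd).sum := by
  rw [weight, Multiset.map_coe, Multiset.sum_coe, meshOf, Net.meshEdges, List.map_map, List.map_map,
    sum_filter_map, sum_finRange_product, spokeWeight_eq, spokeWeight_eq, Finset.sum_mul_sum,
    Finset.sum_mul]
  simp only [Finset.sum_mul]
  rw [← sum_lt_add_sum_lt fun i j => ((if l[i].1 = a then l[i].2 else 0) *
    if l[j].1 = b then l[j].2 else 0) * Ring.inverse (l.map Prod.snd).sum]
  · refine Finset.sum_congr rfl fun i _ => Finset.sum_congr rfl fun j _ => ?_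
    exact if_congr Iff.rfl (mesh_weight_aux hab _ _ _ _ _) rfl
  · intro i
    split
    · rw [if_neg (by rw [‹l[i].1 = a›]; exact hab)]
      simp
    · simp

/-- All edges at `w` are spokes, so the row of `w` consists of the spoke totals, and its sum is the
sum of all conductances of the star. The formula for `elim` then adds the weights of the mesh;
possible loops of the mesh do not enter the matrix. -/
theorem elim_matOf_star {B : Finset ℕ} {f : Multiset (Sym2 ℕ × R)} {w : ℕ} {l : List (ℕ × R)}
    (hw : w ∈ B) (hl : ∀ p ∈ l, p.1 ∈ B) (hlw : ∀ p ∈ l, p.1 ≠ w) (hf : ∀ p ∈ f, w ∉ p.1) :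
    (matOf B (f + edgesOf (Q.spokes w l))).elim w =
      matOf B (f + edgesOf (meshOf l)) := by
  have h0 : spokeWeight l w = 0 := by
    rw [spokeWeight]
    refine List.sum_eq_zero fun x hx => ?_
    obtain ⟨p, hp, rfl⟩ := List.mem_map.1 hx
    exact if_neg (hlw p hp)
  have hB : ∀ u, u ∉ B → spokeWeight l u = 0 := fun u hu => by
    rw [spokeWeight]
    refine List.sum_eq_zero fun x hx => ?_
    obtain ⟨p, hp, rfl⟩ := List.mem_map.1 hx
    exact if_neg fun h : p.1 = u => hu (h ▸ hl p hp)
  have hwu : ∀ u, (matOf B (f + edgesOf (Q.spokes w l))).val w u =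
      spokeWeight l u := by
    intro u
    change ite _ _ _ = _
    by_cases hu : u = w
    · rw [if_pos (Or.inl hu.symm), hu, h0]
    by_cases huB : u ∈ B
    · rw [if_neg (by tauto), weight_add, weight_spokes hu, weight_eq_zero, zero_add]
      intro q hq h
      exact hf q hq (h ▸ Sym2.mem_mk_left w u)
    · rw [if_pos (by tauto), hB u huB]
  apply CondMat.ext'
  intro a b
  by_cases hab : a = b
  · rw [hab, CondMat.diag, CondMat.diag]
  by_cases haw : a = w ∨ b = w
  · have h1 : ((matOf B (f + edgesOf (Q.spokes w l))).elim w).val a b = 0 :=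
      if_pos (by tauto)
    have h2 : (matOf B (f + edgesOf (meshOf l))).val a b = 0 := by
      change ite _ _ _ = _
      split
      · rfl
      · rw [weight_add, weight_meshOf hab, weight_eq_zero]
        · rcases haw with rfl | rfl <;> simp [h0]
        · intro q hq h
          refine hf q hq (h ▸ ?_)
          rcases haw with rfl | rfl <;> simp
    rw [h1, h2]
  · push Not at haw
    rw [CondMat.elim_val _ hab haw.1 haw.2, CondMat.symm _ a w, hwu, hwu]
    simp only [hwu]
    rw [sum_spokeWeight hl]
    change ite _ _ _ + _ = ite _ _ _
    by_cases hB' : a = b ∨ a ∉ B ∨ b ∉ B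
    · rw [if_pos hB', if_pos hB']
      rcases hB' with h | h | h
      · exact absurd h hab
      · simp [hB _ h]
      · simp [hB _ h]
    · rw [if_neg hB', if_neg hB', weight_add, weight_add, weight_meshOf hab]
      have : weight (edgesOf (Q.spokes w l))
          s(a, b) = 0 := by
        refine weight_eq_zero fun q hq h => ?_
        simp only [Multiset.mem_coe, Q.spokes, List.map_map, List.mem_map] at hq
        obtain ⟨p, hp, rfl⟩ := hq
        simp only [Function.comp_apply, Q.edge, Sym2.eq_iff] at h
        rcases h with h | h
        · exact haw.1 h.1.symm
        · exact haw.2 h.1.symm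
      rw [this, add_zero]

end ResistorCircuit

namespace ResistorCircuit
variable {R : Type*} [CommSemiring R]

/-! ### Uniqueness of families of meshes -/

/-- Gives a meaning to the elimination of an unordered set of nodes. -/
theorem rightCommutative_elim (hR : IsPositiveDivisionRig R) (B : Finset ℕ) :
    RightCommutative (CondMat.elim (R := R) (B := B)) := ⟨CondMat.elim_comm hR⟩

/-- The matrix of conductances after the elimination of all nodes outside `X`. -/
noncomputable def reducedMat (hR : IsPositiveDivisionRig R) (B X U : Finset ℕ)
    (e : Multiset (Sym2 ℕ × R)) : CondMat R B :=
  haveI := rightCommutative_elim hR B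
  (U \ X).val.foldl CondMat.elim (matOf B e)

/-- Removing a loop or merging parallel edges keeps the total conductance between different nodes.
For a star, `X ⊆ U'` shows that the centre is one of the nodes to be eliminated, and by
commutativity it can be eliminated first. -/
theorem Effect.reducedMat_eq (hR : IsPositiveDivisionRig R) {B X U U' : Finset ℕ}
    {e e' : Multiset (Sym2 ℕ × R)} (h : Effect U e U' e') (hX : X ⊆ U') (hB : U ⊆ B) :
    U' ⊆ B ∧ reducedMat hR B X U e = reducedMat hR B X U' e' := by
  have := rightCommutative_elim hR B
  cases h with
  | loop _ f v c =>
    refine ⟨hB, ?_⟩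
    rw [reducedMat, reducedMat, matOf_congr]
    intro a b hab
    rw [weight_add, weight_eq_zero (e := {(s(v, v), c)}), add_zero]
    intro q hq h
    obtain rfl := Multiset.mem_singleton.1 hq
    simp only [Sym2.eq_iff] at h
    rcases h with ⟨rfl, rfl⟩ | ⟨rfl, rfl⟩ <;> exact hab rfl
  | parallel _ f u v c c' =>
    refine ⟨hB, ?_⟩
    rw [reducedMat, reducedMat, matOf_congr]
    intro a b hab
    rw [weight_add, weight_add]
    congr 1
    by_cases h : s(u, v) = s(a, b) <;> simp [weight, h]
  | star _ f w l hw hl hf h0 =>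
    rw [Finset.insert_subset_iff] at hB
    refine ⟨hB.2, ?_⟩
    have h1 : (insert w U' \ X).val = w ::ₘ (U' \ X).val := by
      rw [Finset.insert_sdiff_of_notMem _ fun h => hw (hX h), Finset.insert_val_of_notMem]
      exact fun h => hw (Finset.mem_sdiff.1 h).1
    rw [reducedMat, reducedMat, h1, Multiset.foldl_cons,
      elim_matOf_star hB.1 (fun p hp => hB.2 (hl p hp)) (fun p hp h => hw (h ▸ hl p hp)) hf]

theorem Diagram.Gen.subset {n m : ℕ} {d : Diagram R n m} {x y : List ℕ} {U : Finset ℕ}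
    {e : Multiset (Sym2 ℕ × R)} (h : d.Gen x y U e) : (x ++ y).toFinset ⊆ U := by
  induction d using Quotient.ind with | _ s =>
  rw [List.toFinset_append]
  exact Finset.union_subset (Lab.subset h.1).1 (Lab.subset h.1).2

/-- The ambient set `B` stays the same while labels disappear, so that matrices along a reduction
can be compared. -/
theorem Reduces.gen (hR : IsPositiveDivisionRig R) {n m : ℕ} {d d' : Diagram R n m}
    (h : Reduces d d') {x y : List ℕ} {B U : Finset ℕ} {e : Multiset (Sym2 ℕ × R)}
    (hg : d.Gen x y U e) (hB : U ⊆ B) : ∃ U' e', d'.Gen x y U' e' ∧ U' ⊆ B ∧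
      reducedMat hR B (x ++ y).toFinset U e = reducedMat hR B (x ++ y).toFinset U' e' := by
  induction h with
  | refl => exact ⟨U, e, hg, hB, rfl⟩
  | tail _ hs ih =>
    obtain ⟨U₁, e₁, h1, h2, h3⟩ := ih
    obtain ⟨U₂, e₂, h4, h5⟩ := hs.effect h1
    obtain ⟨h6, h7⟩ := h5.reducedMat_eq hR (X := (x ++ y).toFinset) h4.subset h2
    exact ⟨U₂, e₂, h4, h6, h3.trans h7⟩

/-- No labelling of a network has more labels than there are nodes. -/
theorem gen_toTerm {n m : ℕ} {N : Network R} (hN : N.InRange) (ht : N.toTerm.Typed n m) {g : ℕ → ℕ}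
    (hg : Set.InjOn g (Set.Iio N.nodes)) :
    (Circuit.toDiagram ⟨_, ht⟩).Gen (N.toNet g).inputs (N.toNet g).outputs
      (N.toNet g).nodes.toFinset (edgesOf (N.toNet g).edges) := by
  refine ⟨(lab_toTerm hN).2 ⟨g, rfl, rfl, rfl, rfl⟩, fun x' y' U' e' h => ?_⟩
  obtain ⟨g', -, -, rfl, -⟩ := (lab_toTerm hN).1 h
  refine (List.toFinset_card_le _).trans ?_
  rw [List.toFinset_card_of_nodup (hN.valid_toNet hg).nodup]
  simp [Network.toNet]

/-- Numbering the nodes uses as many labels as there are nodes; a labelling with the greatest number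
of labels therefore cannot identify nodes. -/
theorem Diagram.Gen.exists_injOn {n m : ℕ} {N : Network R} (hN : N.InRange)
    {ht : N.toTerm.Typed n m} {x y : List ℕ} {U : Finset ℕ} {e : Multiset (Sym2 ℕ × R)}
    (h : (Circuit.toDiagram ⟨_, ht⟩).Gen x y U e) : ∃ g, Set.InjOn g (Set.Iio N.nodes) ∧
      x = (N.toNet g).inputs ∧ y = (N.toNet g).outputs ∧ U = (N.toNet g).nodes.toFinset ∧
      e = edgesOf (N.toNet g).edges := by
  obtain ⟨g, rfl, rfl, rfl, rfl⟩ := (lab_toTerm hN).1 h.1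
  refine ⟨g, ?_, rfl, rfl, rfl, rfl⟩
  have h1 := h.2 _ _ _ _ (gen_toTerm hN ht (g := fun i => i) fun i _ j _ hij => hij).1
  simp only [Network.toNet, List.map_id'] at h1
  rw [List.toFinset_card_of_nodup List.nodup_range, List.length_range] at h1
  have h2 : ((List.range N.nodes).map g).toFinset = (Finset.range N.nodes).image g := by
    ext
    simp
  rw [h2] at h1
  have h3 := Finset.card_image_iff.1 (le_antisymm Finset.card_image_le
    (by rwa [Finset.card_range]))
  intro i hi j hj hij
  exact h3 (by simpa using hi) (by simpa using hj) hij

theorem exists_toTerm {n m : ℕ} (d : Diagram R n m) :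
    ∃ (N : Network R) (_ : N.InRange) (ht : N.toTerm.Typed n m), d = Circuit.toDiagram ⟨_, ht⟩ := by
  induction d using Quotient.ind with | _ s =>
  obtain ⟨t, ht⟩ := s
  obtain ⟨h1, h2, h3⟩ := ht.wellFormed
  obtain ⟨h4, -, -, h7⟩ := Net.ofTerm_spec h1
  have h8 : Q.mk t = Q.mk (Net.ofTerm t).toNetwork.toTerm := by rw [Net.mk_toTerm h4, h7]
  exact ⟨_, h4.inRange, (Q.cong_of_eq h8 ht).typed.2, Q.toDiagram_eq _ _ h8⟩

theorem exists_gen {n m : ℕ} (d : Diagram R n m) : ∃ x y U e, d.Gen x y U e := by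
  obtain ⟨N, hN, ht, rfl⟩ := exists_toTerm d
  exact ⟨_, _, _, _, gen_toTerm hN ht (g := fun i => i) fun i _ j _ hij => hij⟩

theorem Network.IsMeshFamily.inRange {N : Network R} (h : N.IsMeshFamily) : N.InRange :=
  ⟨h.inputs_lt, h.outputs_lt, fun e he =>
    ⟨(h.edges_lt e he).1.trans (h.edges_lt e he).2, (h.edges_lt e he).2⟩⟩

theorem Network.IsMeshFamily.nodup {N : Network R} (h : N.IsMeshFamily) {g : ℕ → ℕ}
    (hg : Set.InjOn g (Set.Iio N.nodes)) :
    ((edgesOf (N.toNet g).edges).map Prod.fst).Nodup := by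
  simp only [Multiset.map_coe, Multiset.coe_nodup, List.map_map, Network.toNet, Q.mapEdges]
  refine List.pairwise_map.2 (h.simple.imp_of_mem ?_)
  intro a b ha hb hab heq
  simp only [Function.comp_apply, Q.edge, Sym2.eq_iff] at heq
  obtain ⟨a1, a2⟩ := h.edges_lt a ha
  obtain ⟨b1, b2⟩ := h.edges_lt b hb
  have a3 := a1.trans a2
  have b3 := b1.trans b2
  rcases heq with ⟨h1, h2⟩ | ⟨h1, h2⟩
  · exact hab (by rw [hg a3 b3 h1, hg a2 b2 h2])
  · have := hg a3 b2 h1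
    have := hg a2 b3 h2
    omega

theorem Network.IsMeshFamily.edge_ne {N : Network R} (h : N.IsMeshFamily) {g : ℕ → ℕ}
    (hg : Set.InjOn g (Set.Iio N.nodes)) {p : Sym2 ℕ × R}
    (hp : p ∈ edgesOf (N.toNet g).edges) : p.2 ≠ 0 ∧ ∃ a b, p.1 = s(a, b) ∧ a ≠ b ∧
      a ∈ (N.toNet g).nodes ∧ b ∈ (N.toNet g).nodes := by
  simp only [Multiset.mem_coe, List.mem_map, Network.toNet, Q.mapEdges] at hp
  obtain ⟨_, ⟨e, he, rfl⟩, rfl⟩ := hp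
  obtain ⟨a1, a2⟩ := h.edges_lt e he
  have a3 := a1.trans a2
  exact ⟨h.edges_ne e he, g e.1, g e.2.1, rfl, fun hh => a1.ne (hg a3 a2 hh),
    List.mem_map_of_mem (List.mem_range.2 a3), List.mem_map_of_mem (List.mem_range.2 a2)⟩

theorem Network.IsMeshFamily.nodes_toFinset {N : Network R} (h : N.IsMeshFamily) (g : ℕ → ℕ) :
    (N.toNet g).nodes.toFinset = ((N.toNet g).inputs ++ (N.toNet g).outputs).toFinset := by
  ext v
  simp only [List.mem_toFinset, List.mem_append, Network.toNet, List.mem_map, List.mem_range]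
  constructor
  · rintro ⟨i, hi, rfl⟩
    exact (h.external i hi).imp (fun hi => ⟨i, hi, rfl⟩) fun hi => ⟨i, hi, rfl⟩
  · rintro (⟨i, hi, rfl⟩ | ⟨i, hi, rfl⟩)
    · exact ⟨i, h.inputs_lt i hi, rfl⟩
    · exact ⟨i, h.outputs_lt i hi, rfl⟩

theorem weight_of_mem {e : Multiset (Sym2 ℕ × R)} (he : (e.map Prod.fst).Nodup)
    {p : Sym2 ℕ × R} (hp : p ∈ e) : weight e p.1 = p.2 := by
  obtain ⟨f, rfl⟩ := Multiset.exists_cons_of_mem hp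
  rw [Multiset.map_cons, Multiset.nodup_cons] at he
  rw [← Multiset.singleton_add, weight_add, weight_eq_zero (e := f), add_zero]
  · simp [weight]
  · intro q hq h
    exact he.1 (h ▸ Multiset.mem_map_of_mem _ hq)

theorem mem_of_weight_ne_zero {e : Multiset (Sym2 ℕ × R)} (he : (e.map Prod.fst).Nodup)
    {p : Sym2 ℕ} (hp : weight e p ≠ 0) : (p, weight e p) ∈ e := by
  by_contra h
  apply hp
  refine weight_eq_zero fun q hq h' => h ?_
  subst h'
  rw [weight_of_mem he hq]
  exact hq

/-- Without loops, parallel edges and zero conductances, the edges are exactly the non-zero entries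
of the matrix. -/
theorem eq_of_matOf_eq {B : Finset ℕ} {e f : Multiset (Sym2 ℕ × R)}
    (he : (e.map Prod.fst).Nodup) (hf : (f.map Prod.fst).Nodup)
    (he' : ∀ p ∈ e, p.2 ≠ 0 ∧ ∃ a b, p.1 = s(a, b) ∧ a ≠ b ∧ a ∈ B ∧ b ∈ B)
    (hf' : ∀ p ∈ f, p.2 ≠ 0 ∧ ∃ a b, p.1 = s(a, b) ∧ a ≠ b ∧ a ∈ B ∧ b ∈ B)
    (h : matOf B e = matOf B f) : e = f := by
  have key : ∀ {e f : Multiset (Sym2 ℕ × R)}, (e.map Prod.fst).Nodup → (f.map Prod.fst).Nodup →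
      (∀ p ∈ e, p.2 ≠ 0 ∧ ∃ a b, p.1 = s(a, b) ∧ a ≠ b ∧ a ∈ B ∧ b ∈ B) →
      matOf B e = matOf B f → ∀ p ∈ e, p ∈ f := by
    intro e f he hf he' h p hp
    obtain ⟨h0, a, b, hab, hne, ha, hb⟩ := he' p hp
    have h1 := congrArg (fun c => c.val a b) h
    change ite _ _ _ = ite _ _ _ at h1
    rw [if_neg (by tauto), if_neg (by tauto), ← hab, weight_of_mem he hp] at h1
    have := mem_of_weight_ne_zero hf (p := p.1) (h1 ▸ h0)
    rwa [← h1] at this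
  exact (Multiset.Nodup.ext (Multiset.Nodup.of_map _ he) (Multiset.Nodup.of_map _ hf)).2 fun p =>
    ⟨key he hf he' h p, key hf he hf' h.symm p⟩

/-- A maximal labelling of `d` is carried along both reductions, with the same labels at the legs,
and names the nodes of both results injectively. As every node of the results carries a leg, both
have the same nodes and nothing is left to eliminate; the invariance of `reducedMat` becomes
equality of their matrices, and these determine the edges. -/
theorem IsMeshFamily.unique (hR : IsPositiveDivisionRig R) {n m : ℕ} {d d₁ d₂ : Diagram R n m}
    (h1 : Reduces d d₁) (h2 : Reduces d d₂) (hd1 : IsMeshFamily d₁) (hd2 : IsMeshFamily d₂) :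
    d₁ = d₂ := by
  obtain ⟨x, y, U, e, hg⟩ := exists_gen d
  obtain ⟨U₁, e₁, k1, l1, r1⟩ := h1.gen hR hg (Finset.Subset.refl U)
  obtain ⟨U₂, e₂, k2, l2, r2⟩ := h2.gen hR hg (Finset.Subset.refl U)
  obtain ⟨N₁, m1, t1, rfl⟩ := hd1
  obtain ⟨N₂, m2, t2, rfl⟩ := hd2
  obtain ⟨g₁, hg1, hx1, hy1, rfl, rfl⟩ := k1.exists_injOn m1.inRange
  obtain ⟨g₂, hg2, hx2, hy2, rfl, rfl⟩ := k2.exists_injOn m2.inRange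
  have hU1 := m1.nodes_toFinset g₁
  have hU2 := m2.nodes_toFinset g₂
  rw [← hx1, ← hy1] at hU1
  rw [← hx2, ← hy2] at hU2
  rw [r1] at r2
  simp only [reducedMat, hU1, hU2, Finset.sdiff_self, Finset.empty_val, Multiset.foldl_zero] at r2
  have he := eq_of_matOf_eq (m1.nodup hg1) (m2.nodup hg2)
    (fun p hp => by
      obtain ⟨h0, a, b, h3, h4, h5, h6⟩ := m1.edge_ne hg1 hp
      exact ⟨h0, a, b, h3, h4, l1 (by simpa using h5), l1 (by simpa using h6)⟩)
    (fun p hp => by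
      obtain ⟨h0, a, b, h3, h4, h5, h6⟩ := m2.edge_ne hg2 hp
      exact ⟨h0, a, b, h3, h4, l2 (by simpa using h5), l2 (by simpa using h6)⟩) r2
  have v1 := m1.inRange.valid_toNet hg1
  have v2 := m2.inRange.valid_toNet hg2
  refine Q.toDiagram_eq _ _ ?_
  rw [m1.inRange.mk_toTerm hg1, m2.inRange.mk_toTerm hg2]
  refine Net.toQ_congr v1 v2 ?_ (hx1.symm.trans hx2) (hy1.symm.trans hy2) (Multiset.coe_eq_coe.1 he)
  refine (List.perm_ext_iff_of_nodup v1.nodup v2.nodup).2 fun a => ?_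
  rw [← List.mem_toFinset, ← List.mem_toFinset, hU1, hU2]

/-- By `Step.effect` a step would require a loop, two parallel edges, or a centre of a star whose
label disappears. The last is impossible since all labels of a family of meshes occur at legs, and
the labels at legs persist. -/
theorem IsMeshFamily.isNormal {n m : ℕ} {d : Diagram R n m} (h : IsMeshFamily d) : IsNormal d := by
  obtain ⟨N, hN, ht, rfl⟩ := h
  intro d' hs
  have hid : Set.InjOn (fun i : ℕ => i) (Set.Iio N.nodes) := fun i _ j _ hij => hij
  have hg := gen_toTerm hN.inRange ht hid
  have hnd := hN.nodup hid
  have hne := fun {p} => hN.edge_ne hid (p := p)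
  have hU := hN.nodes_toFinset fun i => i
  obtain ⟨U', e', h1, h2⟩ := hs.effect hg
  have hsub := h1.subset
  generalize edgesOf (N.toNet fun i => i).edges = e at h2 hnd hne
  generalize (N.toNet fun i => i).nodes.toFinset = U at h2 hU
  cases h2 with
  | loop _ f v c =>
    obtain ⟨-, a, b, hab, hne', -⟩ := @hne (s(v, v), c) (by simp)
    simp only [Sym2.eq_iff] at hab
    rcases hab with ⟨rfl, rfl⟩ | ⟨rfl, rfl⟩ <;> exact hne' rfl
  | parallel _ f u v c c' =>
    rw [Multiset.map_add, Multiset.nodup_add] at hnd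
    simp at hnd
  | star _ f w l hw hl hf h0 => exact hw (hsub (hU ▸ Finset.mem_insert_self w _))

/-! ### Equality in the category of resistor circuits -/

namespace Q

theorem WF.mul {u v : Q R} (hu : WF u) (hv : WF v) (h : u.cod = v.dom) : WF (u * v) := by
  obtain ⟨s, hs, rfl⟩ := hu
  obtain ⟨t, ht, rfl⟩ := hv
  exact ⟨s ⨟ t, ⟨hs, ht, h⟩, rfl⟩

theorem WF.tens {u v : Q R} (hu : WF u) (hv : WF v) : WF (u ⊙ v) := by
  obtain ⟨s, hs, rfl⟩ := hu
  obtain ⟨t, ht, rfl⟩ := hv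
  exact ⟨s ⊠ t, ⟨hs, ht⟩, rfl⟩

theorem Rewrites.mul_right {u v w : Q R} (h : Rewrites u v) (hw : WF w) (hc : u.cod = w.dom) :
    Rewrites (u * w) (v * w) := by
  obtain ⟨h1, h2, p, q, a, b, l, r, hr, rfl, rfl⟩ := id h
  exact ⟨h1.mul hw hc, h2.mul hw (h.cod_eq ▸ hc), p, q, a, b * w, l, r, hr, mul_assoc _ _ _,
    mul_assoc _ _ _⟩

theorem Rewrites.mul_left {u v w : Q R} (h : Rewrites u v) (hw : WF w) (hc : w.cod = u.dom) :
    Rewrites (w * u) (w * v) := by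
  obtain ⟨h1, h2, p, q, a, b, l, r, hr, rfl, rfl⟩ := id h
  refine ⟨hw.mul h1 hc, hw.mul h2 (h.dom_eq ▸ hc), p, q, w * a, b, l, r, hr, ?_, ?_⟩ <;>
    simp only [mul_assoc]

/-- The circuit `w` is postponed until after the replacement, so that its inputs pass beside the
hole. -/
theorem Rewrites.tens_right {u v w : Q R} (h : Rewrites u v) (hw : WF w) :
    Rewrites (u ⊙ w) (v ⊙ w) := by
  obtain ⟨h1, h2, p, q, a, b, l, r, hr, rfl, rfl⟩ := id h
  refine ⟨h1.tens hw, h2.tens hw, p, q + w.dom, a ⊙ one w.dom,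
    (b ⊙ one w.dom) * (one b.cod ⊙ w), l, r, hr, ?_, ?_⟩ <;>
  · rw [tens_eq_left, mul_tens_one, mul_tens_one, Net.layer, Net.layer, tens_assoc (one p),
      tens_assoc (mk _), one_tens_one, cod_mul]
    simp only [mul_assoc]

theorem Rewrites.tens_left {u v w : Q R} (h : Rewrites u v) (hw : WF w) :
    Rewrites (w ⊙ u) (w ⊙ v) := by
  obtain ⟨h1, h2, p, q, a, b, l, r, hr, rfl, rfl⟩ := id h
  refine ⟨hw.tens h1, hw.tens h2, w.cod + p, q, (w ⊙ one a.dom) * (one w.cod ⊙ a),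
    one w.cod ⊙ b, l, r, hr, ?_, ?_⟩ <;>
  · rw [tens_eq_left, Net.one_tens_mul, Net.one_tens_mul, Net.layer, Net.layer, ← one_tens_one,
      tens_assoc (one w.cod), dom_mul, dom_mul]
    simp only [mul_assoc]

end Q

theorem Step.rewrites {n m : ℕ} {s t : CircuitTerm R} {hs : s.Typed n m} {ht : t.Typed n m}
    (h : Step (Circuit.toDiagram ⟨s, hs⟩) (Circuit.toDiagram ⟨t, ht⟩)) :
    Q.Rewrites (Q.mk s) (Q.mk t) := by
  obtain ⟨p, q, a, b, l, r, hr, hl, hr', h1, h2⟩ := h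
  exact ⟨⟨s, hs.wellFormed.1, rfl⟩, ⟨t, ht.wellFormed.1, rfl⟩, p, q, Q.mk a, Q.mk b, l, r, hr,
    Q.mk_eq_of_toDiagram h1, Q.mk_eq_of_toDiagram h2⟩

/-- The diagrams along a chain of steps have representatives, so it is enough that `F` respects
structural equality and single steps. -/
theorem eqvGen_map {n m n' m' : ℕ} {F : Circuit R n m → Circuit R n' m'}
    (hF : ∀ s t : Circuit R n m, Q.mk s.1 = Q.mk t.1 → Q.mk (F s).1 = Q.mk (F t).1)
    (hF' : ∀ s t : Circuit R n m, Q.Rewrites (Q.mk s.1) (Q.mk t.1) →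
      Q.Rewrites (Q.mk (F s).1) (Q.mk (F t).1)) {s t : Circuit R n m}
    (h : Relation.EqvGen Step s.toDiagram t.toDiagram) :
    Relation.EqvGen Step (F s).toDiagram (F t).toDiagram := by
  generalize hd : s.toDiagram = d at h
  generalize hd' : t.toDiagram = d' at h
  induction h generalizing s t with
  | rel _ _ h =>
    subst hd hd'
    exact .rel _ _ ((hF' s t h.rewrites).step (F s).2 (F t).2)
  | refl _ =>
    subst hd
    rw [show (F s).toDiagram = (F t).toDiagram from
      Q.toDiagram_eq _ _ (hF s t (Q.mk_eq_of_toDiagram hd'.symm))]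
    exact .refl _
  | symm _ _ _ ih => exact .symm _ _ (ih hd' hd)
  | trans _ d _ _ _ ih1 ih2 =>
    obtain ⟨r, rfl⟩ : ∃ r : Circuit R n m, r.toDiagram = d := Quotient.exists_rep d
    exact .trans _ _ _ (ih1 hd rfl) (ih2 rfl hd')

/-- Since steps are stable under composition and tensor product, the relation that they generate is
a congruence; two-sided congruence rules are applied to one factor after the other. -/
theorem eqvGen_of_cong {n m : ℕ} {s t : CircuitTerm R} (h : Cong ResistLaw n m s t)
    (hs : s.Typed n m) (ht : t.Typed n m) :
    Relation.EqvGen Step (Circuit.toDiagram ⟨s, hs⟩) (Circuit.toDiagram ⟨t, ht⟩) := by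
  induction h with
  | @law n m s t h h1 h2 =>
    cases h with
    | structural h =>
      rw [show Circuit.toDiagram ⟨_, hs⟩ = Circuit.toDiagram ⟨_, ht⟩ from
        Quotient.sound (.law h h1 h2)]
      exact .refl _
    | rule h =>
      -- A rule applied to a whole circuit is a step with identities around the hole and no wires
      -- beside it.
      refine .rel _ _ (Q.Rewrites.step hs ht ⟨⟨_, hs.wellFormed.1, rfl⟩, ⟨_, ht.wellFormed.1, rfl⟩,
        0, 0, Q.one n, Q.one m, _, _, h, ?_, ?_⟩)
      · rw [Net.layer, Q.one_zero_tens, Q.tens_one_zero, Q.one_mul' (Q.mk _) (by exact hs.wellFormed.2.1),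
          Q.mul_one' (Q.mk _) (by exact hs.wellFormed.2.2)]
      · rw [Net.layer, Q.one_zero_tens, Q.tens_one_zero, Q.one_mul' (Q.mk _) (by exact ht.wellFormed.2.1),
          Q.mul_one' (Q.mk _) (by exact ht.wellFormed.2.2)]
  | refl _ => exact .refl _
  | symm _ ih => exact .symm _ _ (ih ht hs)
  | trans h1 _ ih1 ih2 => exact .trans _ _ _ (ih1 hs h1.typed.2) (ih2 h1.typed.2 ht)
  | @comp n k m s s' t t' h1 h2 ih1 ih2 =>
    obtain ⟨a1, a2⟩ := h1.typed
    obtain ⟨b1, b2⟩ := h2.typed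
    refine .trans _ (Circuit.toDiagram ⟨s' ⨟ t, .comp a2 b1⟩) _ ?_ ?_
    · refine eqvGen_map (F := fun u : Circuit R n k => ⟨u.1 ⨟ t, .comp u.2 b1⟩) ?_ ?_
        (ih1 a1 a2)
      · intro u v h
        simp only [Q.mk_comp, h]
      · intro u v h
        exact h.mul_right ⟨t, b1.wellFormed.1, rfl⟩
          (u.2.wellFormed.2.2.trans b1.wellFormed.2.1.symm)
    · refine eqvGen_map (F := fun u : Circuit R k m => ⟨s' ⨟ u.1, .comp a2 u.2⟩) ?_ ?_
        (ih2 b1 b2)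
      · intro u v h
        simp only [Q.mk_comp, h]
      · intro u v h
        exact h.mul_left ⟨s', a2.wellFormed.1, rfl⟩
          (a2.wellFormed.2.2.trans u.2.wellFormed.2.1.symm)
  | @tensor a b c d s s' t t' h1 h2 ih1 ih2 =>
    obtain ⟨a1, a2⟩ := h1.typed
    obtain ⟨b1, b2⟩ := h2.typed
    refine .trans _ (Circuit.toDiagram ⟨s' ⊠ t, .tensor a2 b1⟩) _ ?_ ?_
    · refine eqvGen_map (F := fun u : Circuit R a b => ⟨u.1 ⊠ t, .tensor u.2 b1⟩) ?_ ?_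
        (ih1 a1 a2)
      · intro u v h
        simp only [Q.mk_tensor, h]
      · intro u v h
        exact h.tens_right ⟨t, b1.wellFormed.1, rfl⟩
    · refine eqvGen_map (F := fun u : Circuit R c d => ⟨s' ⊠ u.1, .tensor a2 u.2⟩) ?_ ?_
        (ih2 b1 b2)
      · intro u v h
        simp only [Q.mk_tensor, h]
      · intro u v h
        exact h.tens_left ⟨s', a2.wellFormed.1, rfl⟩

theorem Cong.mono {A A' : CircuitTerm R → CircuitTerm R → Prop} (hA : ∀ s t, A s t → A' s t)
    {n m : ℕ} {s t : CircuitTerm R} (h : Cong A n m s t) : Cong A' n m s t := by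
  induction h with
  | law h h1 h2 => exact .law (hA _ _ h) h1 h2
  | refl h => exact .refl h
  | symm _ ih => exact .symm ih
  | trans _ _ ih1 ih2 => exact .trans ih1 ih2
  | comp _ _ ih1 ih2 => exact .comp ih1 ih2
  | tensor _ _ ih1 ih2 => exact .tensor ih1 ih2

/-- The map of the category of resistor circuits given by a diagram. -/
def Diagram.toResist {n m : ℕ} (d : Diagram R n m) : (⟨n⟩ : Resist R) ⟶ ⟨m⟩ :=
  Quotient.lift (fun s : Circuit R n m => s.toResist)
    (fun _ _ h => Quotient.sound (Cong.mono (fun _ _ => .structural) h)) d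

theorem Step.toResist_eq {n m : ℕ} {d d' : Diagram R n m} (h : Step d d') :
    d.toResist = d'.toResist := by
  obtain ⟨p, q, a, b, l, r, hr, h1, h2, rfl, rfl⟩ := h
  refine Quotient.sound ?_
  change Cong ResistLaw n m _ _
  obtain ⟨⟨⟨ha, ⟨hp, ⟨hl, hq⟩⟩, hc⟩, hb, hc'⟩, hd, hcd⟩ := h1.wellFormed
  obtain ⟨⟨⟨-, ⟨-, ⟨hr', -⟩⟩, kc⟩, -, kc'⟩, kd, kcd⟩ := h2.wellFormed
  simp only [CircuitTerm.dom, CircuitTerm.cod] at hc hc' hd hcd kc kc' kd kcd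
  have hlr : Cong ResistLaw l.dom l.cod l r := .law (.rule hr) hl.typed
    (CircuitTerm.typed_iff.2 ⟨hr', by omega, by omega⟩)
  have := Cong.comp (Cong.comp (Cong.refl (A := ResistLaw) ha.typed) (hc ▸ Cong.tensor
    (Cong.refl (.id p)) (Cong.tensor hlr (Cong.refl (.id q))))) (hc' ▸ Cong.refl hb.typed)
  rwa [hd, hcd] at this

theorem Reduces.toResist_eq {n m : ℕ} {d d' : Diagram R n m} (h : Reduces d d') :
    d.toResist = d'.toResist := by
  induction h with
  | refl => rfl
  | tail _ h ih => exact ih.trans h.toResist_eq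

theorem IsNormal.eq_of_reduces {n m : ℕ} {d e : Diagram R n m} (hd : IsNormal d)
    (h : Reduces d e) : d = e := by
  rcases Relation.ReflTransGen.cases_head h with h | ⟨c, hc, -⟩
  · exact h
  · exact absurd hc (hd c)

end ResistorCircuit

namespace ResistorCircuit
variable {R : Type*} [CommSemiring R]

/-! ### Computation of families of meshes -/

theorem IsPositiveDivisionRig.list_sum_eq_zero (hR : IsPositiveDivisionRig R) {l : List R}
    (h : l.sum = 0) : ∀ x ∈ l, x = 0 := by
  induction l with
  | nil => simp
  | cons a l ih =>
    rw [List.sum_cons] at h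
    obtain ⟨h1, h2⟩ := hR.positive _ _ h
    simpa [h1] using ih h2

/-- Operations on labels. -/
structure Ops (α : Type*) where
  zero : α
  add : α → α → α
  mul : α → α → α
  inv : α → α
  -- Chooses one label among those with the same value; `normalize` applies it only to the edges of
  -- the result.
  canon : α → α

/-- The operations of a rig. -/
noncomputable def Ops.ofRig (R : Type*) [CommSemiring R] : Ops R :=
  ⟨0, (· + ·), (· * ·), Ring.inverse, fun a => a⟩

namespace Ops
variable {α : Type*}

/-- The sum of a non-empty list of labels. -/
def total (o : Ops α) : List α → α
  | [] => o.zero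
  | a :: l => l.foldl o.add a

/-- The ends, other than `w`, of the edges at `w`, with their labels. -/
def legs (w : ℕ) (es : List (ℕ × ℕ × α)) : List (ℕ × α) :=
  es.flatMap fun e => if e.1 = w then [(e.2.1, e.2.2)] else if e.2.1 = w then [(e.1, e.2.2)] else []

/-- The edges that are not loops. -/
def dropLoops (es : List (ℕ × ℕ × α)) : List (ℕ × ℕ × α) :=
  es.flatMap fun e => if e.1 = e.2.1 then [] else [e]

/-- The edges that do not end at `w`. -/
def avoiding (w : ℕ) (es : List (ℕ × ℕ × α)) : List (ℕ × ℕ × α) :=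
  es.flatMap fun e => if e.1 = w then [] else if e.2.1 = w then [] else [e]

/-- The mesh that replaces a star. -/
def starMesh (o : Ops α) (l : List (ℕ × α)) : List (ℕ × ℕ × α) :=
  Net.meshEdges (fun y z => o.mul (o.mul y z) (o.inv (o.total (l.map Prod.snd)))) l

/-- The edges after the elimination of the node `w`. -/
def elimNode (o : Ops α) (es : List (ℕ × ℕ × α)) (w : ℕ) : List (ℕ × ℕ × α) :=
  avoiding w (dropLoops es) ++ o.starMesh (legs w (dropLoops es))

/-- The pairs `i < j < k`. -/
def pairs (k : ℕ) : List (ℕ × ℕ) :=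
  (List.range k).flatMap fun j => (List.range j).map fun i => (i, j)

/-- The labels of the edges with ends `p`. -/
def between (p : ℕ × ℕ) (es : List (ℕ × ℕ × α)) : List α :=
  es.flatMap fun e => if s(e.1, e.2.1) = s(p.1, p.2) then [e.2.2] else []

/-- The edge in place of the edges with ends `p` and labels `l`. -/
def mergeEdges (o : Ops α) (p : ℕ × ℕ) (l : List α) : List (ℕ × ℕ × α) :=
  if l.length = 0 then [] else [(p.1, p.2, o.canon (o.total l))]

/-- Parallel edges between `k` nodes are merged. -/
def simplify (o : Ops α) (k : ℕ) (es : List (ℕ × ℕ × α)) : List (ℕ × ℕ × α) :=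
  (pairs k).flatMap fun p => o.mergeEdges p (between p es)

/-- The family of meshes drawn by the normal form of a network. -/
def normalize (o : Ops α) (N : Net α) : Network α :=
  -- The nodes of the result are those with a leg, numbered by their position in the list of legs
  -- without repetitions; so the numbering does not depend on the names of the nodes.
  ⟨(N.inputs ++ N.outputs).dedup.length,
    N.inputs.map (N.inputs ++ N.outputs).dedup.idxOf,
    N.outputs.map (N.inputs ++ N.outputs).dedup.idxOf,
    o.simplify (N.inputs ++ N.outputs).dedup.length
      (Q.mapEdges (N.inputs ++ N.outputs).dedup.idxOf
        ((N.nodes.flatMap fun w => if w ∈ N.inputs ++ N.outputs then [] else [w]).foldl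
          o.elimNode N.edges))⟩

theorem total_ofRig (l : List R) : (ofRig R).total l = l.sum := by
  have h : ∀ (l : List R) (a : R), l.foldl (· + ·) a = a + l.sum := by
    intro l
    induction l with
    | nil => simp
    | cons b l ih => intro a; rw [List.foldl_cons, ih, List.sum_cons, add_assoc]
  cases l with
  | nil => rfl
  | cons a l => exact (h l a).trans List.sum_cons.symm

end Ops

namespace Net
open Q Ops

/-- A network with non-zero conductances, all of whose ends are nodes. -/
def Proper (N : Net R) : Prop := N.Valid ∧ ∀ e ∈ N.edges, e.2.2 ≠ 0

/-- `N'` is obtained from `N` by rewriting. -/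
def RewritesTo (N N' : Net R) : Prop :=
  N'.Proper ∧ Relation.ReflTransGen Rewrites N.toQ N'.toQ

theorem RewritesTo.trans {N N' N'' : Net R} (h : RewritesTo N N') (h' : RewritesTo N' N'') :
    RewritesTo N N'' := ⟨h'.1, h.2.trans h'.2⟩

theorem Proper.refl {N : Net R} (h : N.Proper) : RewritesTo N N := ⟨h, .refl⟩

theorem Proper.congr {L L' ins outs : List ℕ} {es es' : List (ℕ × ℕ × R)}
    (h : Proper ⟨L, ins, outs, es⟩) (hL : L.Perm L') (hp : (es.map edge).Perm (es'.map edge)) :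
    RewritesTo ⟨L, ins, outs, es⟩ ⟨L', ins, outs, es'⟩ := by
  obtain ⟨⟨h1, h2, h3, h4⟩, h0⟩ := h
  have hv : (⟨L', ins, outs, es'⟩ : Net R).Valid ∧ ∀ e ∈ es', e.2.2 ≠ 0 := by
    have key : ∀ e ∈ es', e.2.2 ≠ 0 ∧ e.1 ∈ L' ∧ e.2.1 ∈ L' := by
      intro e he
      obtain ⟨f, hf, hfe⟩ := List.mem_map.1 (hp.symm.subset (List.mem_map_of_mem he))
      simp only [edge, Prod.mk.injEq, Sym2.eq_iff] at hfe
      obtain ⟨a, b⟩ := h4 f hf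
      have a' := hL.subset a
      have b' := hL.subset b
      refine ⟨hfe.2 ▸ h0 f hf, ?_⟩
      rcases hfe.1 with ⟨c, d⟩ | ⟨c, d⟩ <;> simp [← c, ← d, a', b']
    exact ⟨⟨hL.nodup_iff.1 h1, fun _ h => hL.subset (h2 h), fun _ h => hL.subset (h3 h),
      fun e he => (key e he).2⟩, fun e he => (key e he).1⟩
  refine ⟨hv, ?_⟩
  rw [toQ_congr ⟨h1, h2, h3, h4⟩ hv.1 hL rfl rfl hp]

/-- The list `f` collects the edges already inspected; edges that are not loops are moved into it.
-/
theorem rewritesTo_dropLoops {L ins outs : List ℕ} (es : List (ℕ × ℕ × R)) :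
    ∀ f : List (ℕ × ℕ × R), Proper ⟨L, ins, outs, es ++ f⟩ →
      RewritesTo ⟨L, ins, outs, es ++ f⟩ ⟨L, ins, outs, dropLoops es ++ f⟩ := by
  induction es with
  | nil => exact fun f h => h.refl
  | cons e es ih =>
    intro f h
    obtain ⟨a, b, y⟩ := e
    by_cases hab : a = b
    · subst hab
      have h1 : Proper ⟨L, ins, outs, es ++ f⟩ :=
        ⟨⟨h.1.nodup, h.1.inputs_mem, h.1.outputs_mem, fun e he => h.1.edges_mem e (by simp_all)⟩,
          fun e he => h.2 e (by simp_all)⟩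
      have h2 : RewritesTo ⟨L, ins, outs, (a, a, y) :: (es ++ f)⟩ ⟨L, ins, outs, es ++ f⟩ :=
        ⟨h1, .single (rewrites_loop h1.1 (h.1.edges_mem (a, a, y) (by simp)).1 h1.2
          (h.2 (a, a, y) (by simp)))⟩
      simpa [dropLoops] using h2.trans (ih f h1)
    · have h1 := h.congr (es' := es ++ (a, b, y) :: f) (List.Perm.refl _)
        (List.Perm.map _ List.perm_middle.symm)
      have h2 := ih _ h1.1
      have h3 := h2.1.congr (es' := (a, b, y) :: (dropLoops es ++ f)) (List.Perm.refl _)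
        (List.Perm.map _ List.perm_middle)
      simpa [dropLoops, hab] using (h1.trans h2).trans h3

theorem mem_dropLoops {α : Type*} {es : List (ℕ × ℕ × α)} {e : ℕ × ℕ × α} :
    e ∈ dropLoops es ↔ e ∈ es ∧ e.1 ≠ e.2.1 := by
  rw [dropLoops, List.mem_flatMap]
  constructor
  · rintro ⟨a, ha, h⟩
    split at h
    · simp at h
    · simp_all
  · rintro ⟨h, h'⟩
    exact ⟨e, h, by simp [h']⟩

theorem perm_avoiding_legs {α : Type*} (w : ℕ) (es : List (ℕ × ℕ × α)) :
    (es.map edge).Perm ((avoiding w es ++ spokes w (legs w es)).map edge) := by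
  induction es with
  | nil => exact .refl _
  | cons e es ih =>
    obtain ⟨a, b, y⟩ := e
    have hc := ih.cons (edge (a, b, y))
    simp only [List.map_cons]
    refine hc.trans ?_
    by_cases ha : a = w
    · subst ha
      simp only [avoiding, legs, List.flatMap_cons, if_true, List.nil_append, List.map_append,
        spokes, List.map_cons, List.singleton_append]
      exact List.perm_middle.symm
    by_cases hb : b = w
    · subst hb
      simp only [avoiding, legs, List.flatMap_cons, if_true, List.nil_append, List.map_append,
        spokes, List.map_cons, List.singleton_append, ha, if_false]
      rw [show edge (a, b, y) = edge (b, a, y) by simp [edge, Sym2.eq_swap]]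
      exact List.perm_middle.symm
    · simp [avoiding, legs, ha, hb, spokes]

theorem mem_avoiding {α : Type*} {w : ℕ} {es : List (ℕ × ℕ × α)} {e : ℕ × ℕ × α} :
    e ∈ avoiding w es ↔ e ∈ es ∧ e.1 ≠ w ∧ e.2.1 ≠ w := by
  rw [avoiding, List.mem_flatMap]
  constructor
  · rintro ⟨a, ha, h⟩
    split at h
    · simp at h
    split at h
    · simp at h
    · simp_all
  · rintro ⟨h, h1, h2⟩
    exact ⟨e, h, by simp [h1, h2]⟩

theorem mem_legs {α : Type*} {w : ℕ} {es : List (ℕ × ℕ × α)} {p : ℕ × α} (h : p ∈ legs w es) :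
    (w, p.1, p.2) ∈ es ∨ (p.1, w, p.2) ∈ es := by
  rw [legs, List.mem_flatMap] at h
  obtain ⟨⟨a, b, y⟩, ha, h⟩ := h
  split at h
  · simp_all
  split at h
  · simp_all
  · simp at h

/-- Loops are removed first because the spokes of a star must end at nodes other than the centre.
The total conductance of the star is non-zero by positivity as soon as there is a spoke, so all
conductances of the mesh are non-zero. -/
theorem rewritesTo_elimNode (hR : IsPositiveDivisionRig R) {L ins outs : List ℕ} {w : ℕ}
    {es : List (ℕ × ℕ × R)} (h : Proper ⟨w :: L, ins, outs, es⟩) (hi : w ∉ ins) (ho : w ∉ outs) :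
    RewritesTo ⟨w :: L, ins, outs, es⟩ ⟨L, ins, outs, (ofRig R).elimNode es w⟩ := by
  have h1 := rewritesTo_dropLoops es [] (by simpa using h)
  simp only [List.append_nil] at h1
  have h2 := h1.1.congr (.refl _) (perm_avoiding_legs w (dropLoops es))
  refine (h1.trans h2).trans ?_
  obtain ⟨⟨k1, k2, k3, k4⟩, k0⟩ := h1.1
  simp only at k1 k2 k3 k4 k0
  have hw : w ∉ L := (List.nodup_cons.1 k1).1
  have hl : ∀ p ∈ legs w (dropLoops es), p.1 ∈ L ∧ p.2 ≠ 0 := by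
    intro p hp
    rcases mem_legs hp with hp | hp
    · have a := (k4 _ hp).2
      have b := (mem_dropLoops.1 hp).2
      exact ⟨(List.mem_cons.1 a).resolve_left fun hh => b hh.symm, k0 _ hp⟩
    · have a := (k4 _ hp).1
      have b := (mem_dropLoops.1 hp).2
      exact ⟨(List.mem_cons.1 a).resolve_left fun hh => b hh, k0 _ hp⟩
  have hl1 : (legs w (dropLoops es)).map Prod.fst ⊆ L := by
    intro a ha
    obtain ⟨p, hp, rfl⟩ := List.mem_map.1 ha
    exact (hl p hp).1
  have hv : (⟨L, ins, outs, avoiding w (dropLoops es)⟩ : Net R).Valid :=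
    ⟨(List.nodup_cons.1 k1).2,
      fun x hx => (List.mem_cons.1 (k2 hx)).resolve_left fun hh => hi (hh ▸ hx),
      fun x hx => (List.mem_cons.1 (k3 hx)).resolve_left fun hh => ho (hh ▸ hx), fun e he => by
        obtain ⟨a, b, c⟩ := mem_avoiding.1 he
        exact ⟨(List.mem_cons.1 (k4 e a).1).resolve_left b,
          (List.mem_cons.1 (k4 e a).2).resolve_left c⟩⟩
  have h0 : ∀ e ∈ avoiding w (dropLoops es), e.2.2 ≠ 0 := fun e he => k0 e (mem_avoiding.1 he).1
  have hm0 : ∀ p ∈ legs w (dropLoops es), ∀ q ∈ legs w (dropLoops es),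
      p.2 * q.2 * Ring.inverse ((legs w (dropLoops es)).map Prod.snd).sum ≠ 0 := by
    intro p hp q hq
    refine hR.mul_ne_zero (hR.mul_ne_zero (hl p hp).2 (hl q hq).2) (hR.inverse_ne_zero fun hs => ?_)
    exact (hl p hp).2 (hR.list_sum_eq_zero hs _ (List.mem_map_of_mem hp))
  have h3 := rewrites_star hv hw hl1 h0 (fun p hp => (hl p hp).2) hm0
  have h4 : (ofRig R).elimNode es w = avoiding w (dropLoops es) ++ meshEdges (fun y z =>
      y * z * Ring.inverse ((legs w (dropLoops es)).map Prod.snd).sum) (legs w (dropLoops es)) := by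
    rw [elimNode, starMesh, total_ofRig]
    rfl
  rw [h4]
  refine ⟨⟨⟨hv.nodup, hv.inputs_mem, hv.outputs_mem, ?_⟩, ?_⟩, .single h3⟩
  · intro e he
    rcases List.mem_append.1 he with he | he
    · exact hv.edges_mem e he
    · exact edgesIn_meshEdges _ hl1 e he
  · intro e he
    rcases List.mem_append.1 he with he | he
    · exact h0 e he
    · obtain ⟨p, hp, rfl⟩ := List.mem_map.1 he
      exact hm0 _ (List.getElem_mem _) _ (List.getElem_mem _)

theorem rewritesTo_foldl_elimNode (hR : IsPositiveDivisionRig R) {L ins outs : List ℕ}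
    (ws : List ℕ) : ∀ es : List (ℕ × ℕ × R), Proper ⟨ws ++ L, ins, outs, es⟩ →
      (∀ w ∈ ws, w ∉ ins ∧ w ∉ outs) →
      RewritesTo ⟨ws ++ L, ins, outs, es⟩ ⟨L, ins, outs, ws.foldl (ofRig R).elimNode es⟩ := by
  induction ws with
  | nil => exact fun es h _ => h.refl
  | cons w ws ih =>
    intro es h hw
    obtain ⟨h1, h2⟩ := hw w (by simp)
    have h3 := rewritesTo_elimNode hR h h1 h2
    exact h3.trans (ih _ h3.1 fun v hv => hw v (by simp [hv]))

theorem rewritesTo_merge (hR : IsPositiveDivisionRig R) {L ins outs : List ℕ} {a b : ℕ}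
    {f : List (ℕ × ℕ × R)} (l : List R) : ∀ y : R,
    Proper ⟨L, ins, outs, (y :: l).map (fun z => (a, b, z)) ++ f⟩ →
    RewritesTo ⟨L, ins, outs, (y :: l).map (fun z => (a, b, z)) ++ f⟩
      ⟨L, ins, outs, (a, b, (y :: l).sum) :: f⟩ := by
  induction l with
  | nil => exact fun y h => by simpa using h.refl
  | cons z l ih =>
    intro y h
    have hab := h.1.edges_mem (a, b, y) (by simp)
    have hy := h.2 (a, b, y) (by simp)
    have hz := h.2 (a, b, z) (by simp)
    have hyz : y + z ≠ 0 := fun hh => hy (hR.positive _ _ hh).1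
    have h1 : Proper ⟨L, ins, outs, l.map (fun z => (a, b, z)) ++ f⟩ :=
      ⟨⟨h.1.nodup, h.1.inputs_mem, h.1.outputs_mem, fun e he => h.1.edges_mem e (by simp_all)⟩,
        fun e he => h.2 e (by simp_all)⟩
    have h2 : Proper ⟨L, ins, outs, ((y + z) :: l).map (fun z => (a, b, z)) ++ f⟩ := by
      refine ⟨⟨h.1.nodup, h.1.inputs_mem, h.1.outputs_mem, ?_⟩, ?_⟩
      · intro e he
        rcases List.mem_cons.1 he with rfl | he
        · exact hab
        · exact h1.1.edges_mem e he
      · intro e he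
        rcases List.mem_cons.1 he with rfl | he
        · exact hyz
        · exact h1.2 e he
    have h3 : RewritesTo ⟨L, ins, outs, (y :: z :: l).map (fun z => (a, b, z)) ++ f⟩
      ⟨L, ins, outs, ((y + z) :: l).map (fun z => (a, b, z)) ++ f⟩ :=
      ⟨h2, .single (rewrites_parallel h1.1 hab.1 hab.2 h1.2 hy hz hyz)⟩
    have h4 := h3.trans (ih (y + z) h2)
    rwa [List.sum_cons, add_assoc, ← List.sum_cons, ← List.sum_cons] at h4

theorem rewritesTo_mergeEdges (hR : IsPositiveDivisionRig R) {L ins outs : List ℕ} {p : ℕ × ℕ}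
    {f : List (ℕ × ℕ × R)} {l : List R}
    (h : Proper ⟨L, ins, outs, l.map (fun z => (p.1, p.2, z)) ++ f⟩) :
    RewritesTo ⟨L, ins, outs, l.map (fun z => (p.1, p.2, z)) ++ f⟩
      ⟨L, ins, outs, (ofRig R).mergeEdges p l ++ f⟩ := by
  cases l with
  | nil => exact h.refl
  | cons y l =>
    rw [mergeEdges, total_ofRig]
    exact rewritesTo_merge hR l y h

theorem rewritesTo_flatMap_mergeEdges (hR : IsPositiveDivisionRig R) {L ins outs : List ℕ}
    (g : ℕ × ℕ → List R) (P : List (ℕ × ℕ)) : ∀ f : List (ℕ × ℕ × R),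
    Proper ⟨L, ins, outs, P.flatMap (fun p => (g p).map fun z => (p.1, p.2, z)) ++ f⟩ →
    RewritesTo ⟨L, ins, outs, P.flatMap (fun p => (g p).map fun z => (p.1, p.2, z)) ++ f⟩
      ⟨L, ins, outs, P.flatMap (fun p => (ofRig R).mergeEdges p (g p)) ++ f⟩ := by
  induction P with
  | nil => exact fun f h => h.refl
  | cons p P ih =>
    intro f h
    simp only [List.flatMap_cons, List.append_assoc] at h ⊢
    have h1 := rewritesTo_mergeEdges hR h
    have h2 := h1.1.congr (es' := P.flatMap (fun p => (g p).map fun z => (p.1, p.2, z)) ++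
      ((ofRig R).mergeEdges p (g p) ++ f)) (.refl _) (List.Perm.map _ (by
        rw [← List.append_assoc, ← List.append_assoc]
        exact List.perm_append_comm.append_right _))
    have h3 := ih _ h2.1
    have h4 := h3.1.congr (es' := (ofRig R).mergeEdges p (g p) ++
      (P.flatMap (fun p => (ofRig R).mergeEdges p (g p)) ++ f)) (.refl _) (List.Perm.map _ (by
        rw [← List.append_assoc, ← List.append_assoc]
        exact List.perm_append_comm.append_right _))
    exact ((h1.trans h2).trans h3).trans h4

/-- Sorts the edges by their pairs of ends. The list `P` contains each unordered pair at most once,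
so no edge is counted twice, and it covers all edges. -/
theorem perm_flatMap_between {α : Type*} (P : List (ℕ × ℕ))
    (hP : P.Pairwise fun p q => s(p.1, p.2) ≠ s(q.1, q.2)) : ∀ es : List (ℕ × ℕ × α),
    (∀ e ∈ es, ∃ p ∈ P, s(e.1, e.2.1) = s(p.1, p.2)) →
    (es.map edge).Perm ((P.flatMap fun p => (between p es).map fun z => (p.1, p.2, z)).map edge) := by
  induction P with
  | nil =>
    intro es h
    cases es with
    | nil => exact .refl _
    | cons e es => simpa using h e (by simp)
  | cons p P ih =>
    intro es h
    obtain ⟨h1, h2⟩ := List.pairwise_cons.1 hP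
    have h3 := ih h2 (es.filter fun e => s(e.1, e.2.1) ≠ s(p.1, p.2)) (by
      intro e he
      obtain ⟨he, hne⟩ := List.mem_filter.1 he
      obtain ⟨q, hq, hq'⟩ := h e he
      rcases List.mem_cons.1 hq with rfl | hq
      · simp [hq'] at hne
      · exact ⟨q, hq, hq'⟩)
    have h4 : ∀ q ∈ P, between q (es.filter fun e => s(e.1, e.2.1) ≠ s(p.1, p.2)) =
        between q es := by
      intro q hq
      have := h1 q hq
      clear h h3
      induction es with
      | nil => rfl
      | cons e es ihe =>
        simp only [between, List.flatMap_cons] at ihe ⊢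
        by_cases hc : s(e.1, e.2.1) = s(p.1, p.2)
        · rw [List.filter_cons_of_neg (by simp [hc]), ihe, hc, if_neg this, List.nil_append]
        · rw [List.filter_cons_of_pos (by simpa using hc), List.flatMap_cons, ihe]
    have h5 : ((es.filter fun e => s(e.1, e.2.1) = s(p.1, p.2)).map edge) =
        ((between p es).map fun z => (p.1, p.2, z)).map edge := by
      clear h h3 h4
      induction es with
      | nil => rfl
      | cons e es ihe =>
        simp only [between, List.flatMap_cons] at ihe ⊢
        by_cases hc : s(e.1, e.2.1) = s(p.1, p.2)
        · rw [List.filter_cons_of_pos (by simpa using hc), if_pos hc, List.map_cons, ihe]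
          simp [edge, hc]
        · rw [List.filter_cons_of_neg (by simpa using hc), if_neg hc, ihe, List.nil_append]
    rw [List.flatMap_cons, List.map_append, ← h5]
    rw [List.flatMap_congr (g := fun q => (between q es).map fun z => (q.1, q.2, z))
      fun q hq => by rw [h4 q hq]] at h3
    refine List.Perm.trans ?_ (h3.append_left _)
    rw [← List.map_append]
    refine List.Perm.map _ ?_
    simpa using (List.filter_append_perm (fun e => decide (s(e.1, e.2.1) = s(p.1, p.2))) es).symm

theorem mem_pairs {k : ℕ} {p : ℕ × ℕ} : p ∈ pairs k ↔ p.1 < p.2 ∧ p.2 < k := by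
  simp only [pairs, List.mem_flatMap, List.mem_range, List.mem_map]
  constructor
  · rintro ⟨j, hj, i, hi, rfl⟩
    exact ⟨hi, hj⟩
  · rintro ⟨h1, h2⟩
    exact ⟨p.2, h2, p.1, h1, rfl⟩

theorem nodup_pairs (k : ℕ) : (pairs k).Nodup := by
  refine List.nodup_flatMap.2 ⟨fun j _ => List.nodup_range.map fun a b h => by simpa using h, ?_⟩
  refine List.nodup_range.imp fun {a b} hab => ?_
  intro p hp hq
  simp only [List.mem_map] at hp hq
  obtain ⟨_, _, rfl⟩ := hp
  obtain ⟨_, _, h⟩ := hq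
  exact hab (by simpa using (congrArg Prod.snd h).symm)

theorem pairwise_pairs (k : ℕ) :
    (pairs k).Pairwise fun p q => s(p.1, p.2) ≠ s(q.1, q.2) := by
  refine (nodup_pairs k).imp_of_mem fun {p q} hp hq hne h => hne ?_
  rw [mem_pairs] at hp hq
  rw [Sym2.eq_iff] at h
  rcases h with ⟨h1, h2⟩ | ⟨h1, h2⟩
  · exact Prod.ext h1 h2
  · omega

theorem between_dropLoops {α : Type*} {p : ℕ × ℕ} (hp : p.1 ≠ p.2) (es : List (ℕ × ℕ × α)) :
    between p (dropLoops es) = between p es := by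
  induction es with
  | nil => rfl
  | cons e es ih =>
    simp only [between, dropLoops, List.flatMap_cons, List.flatMap_append] at ih ⊢
    rw [ih]
    congr 1
    by_cases h : e.1 = e.2.1
    · rw [if_pos h, List.flatMap_nil, if_neg]
      rw [h]
      intro h'
      rw [Sym2.eq_iff] at h'
      rcases h' with ⟨h1, h2⟩ | ⟨h1, h2⟩
      · exact hp (h1.symm.trans h2)
      · exact hp (h2.symm.trans h1)
    · simp [if_neg h]

theorem rewritesTo_simplify (hR : IsPositiveDivisionRig R) {k : ℕ} {ins outs : List ℕ}
    {es : List (ℕ × ℕ × R)} (h : Proper ⟨List.range k, ins, outs, es⟩) :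
    RewritesTo ⟨List.range k, ins, outs, es⟩
      ⟨List.range k, ins, outs, (ofRig R).simplify k es⟩ := by
  have h1 := rewritesTo_dropLoops es [] (by simpa using h)
  simp only [List.append_nil] at h1
  have h2 := h1.1.congr (.refl _) (perm_flatMap_between (pairs k) (pairwise_pairs k) _ (by
    intro e he
    obtain ⟨a, b⟩ := h1.1.1.edges_mem e he
    simp only [List.mem_range] at a b
    rcases lt_or_gt_of_ne (mem_dropLoops.1 he).2 with hlt | hlt
    · exact ⟨(e.1, e.2.1), mem_pairs.2 ⟨hlt, b⟩, rfl⟩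
    · exact ⟨(e.2.1, e.1), mem_pairs.2 ⟨hlt, a⟩, Sym2.eq_swap⟩))
  have h3 := rewritesTo_flatMap_mergeEdges hR (fun p => between p (dropLoops es)) (pairs k) []
    (by simpa using h2.1)
  simp only [List.append_nil] at h3
  -- `simplify` needs no separate removal of loops in its definition, since the members of `pairs`
  -- have different entries.
  have h4 : (pairs k).flatMap (fun p => (ofRig R).mergeEdges p (between p (dropLoops es))) =
      (ofRig R).simplify k es :=
    List.flatMap_congr fun p hp => by rw [between_dropLoops (mem_pairs.1 hp).1.ne]
  rw [h4] at h3
  exact (h1.trans h2).trans h3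

end Net

end ResistorCircuit

/-! ### The normal form of a network is a family of meshes -/

namespace ResistorCircuit
variable {R : Type*} [CommSemiring R]

namespace Net
open Q Ops

theorem mem_mergeEdges {α : Type*} {o : Ops α} {p : ℕ × ℕ} {l : List α} {e : ℕ × ℕ × α}
    (h : e ∈ o.mergeEdges p l) : e = (p.1, p.2, o.canon (o.total l)) := by
  rw [mergeEdges] at h
  split at h
  · simp at h
  · simpa using h

theorem pairwise_simplify {α : Type*} (o : Ops α) (k : ℕ) (es : List (ℕ × ℕ × α)) :
    (o.simplify k es).Pairwise fun e f => (e.1, e.2.1) ≠ (f.1, f.2.1) := by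
  refine List.pairwise_flatMap.2 ⟨fun p _ => ?_, (nodup_pairs k).imp fun {p q} hpq => ?_⟩
  · rw [mergeEdges]
    split <;> simp
  · intro e he f hf
    rw [mem_mergeEdges he, mem_mergeEdges hf]
    exact hpq

theorem perm_internal {α : Type*} {N : Net α} (hN : N.Valid) :
    N.nodes.Perm ((N.nodes.flatMap fun w => if w ∈ N.inputs ++ N.outputs then [] else [w]) ++
      (N.inputs ++ N.outputs).dedup) := by
  have h1 : (N.nodes.flatMap fun w => if w ∈ N.inputs ++ N.outputs then [] else [w]) =
      N.nodes.filter fun w => w ∉ N.inputs ++ N.outputs := by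
    induction N.nodes with
    | nil => rfl
    | cons w l ih =>
      rw [List.flatMap_cons, ih]
      by_cases h : w ∈ N.inputs ++ N.outputs
      · rw [if_pos h, List.filter_cons_of_neg (by simp only [h, not_true, decide_false]; simp), List.nil_append]
      · rw [if_neg h, List.filter_cons_of_pos (by simpa using h), List.singleton_append]
  rw [h1]
  refine (List.perm_ext_iff_of_nodup hN.nodup ?_).2 fun a => ?_
  · refine List.Nodup.append (hN.nodup.filter _) (List.nodup_dedup _) fun a ha hb => ?_
    simp only [List.mem_filter, List.mem_dedup, decide_eq_true_eq] at ha hb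
    exact ha.2 hb
  · simp only [List.mem_append, List.mem_filter, List.mem_dedup, decide_eq_true_eq]
    have h2 := @hN.inputs_mem a
    have h3 := @hN.outputs_mem a
    tauto

theorem toNet_self {α : Type*} (N : Network α) :
    N.toNet (fun i => i) = ⟨List.range N.nodes, N.inputs, N.outputs, N.edges⟩ := by
  simp [Network.toNet, mapEdges]

/-- Elimination leaves exactly the nodes with legs. Numbering them does not change the class of the
drawn circuit, and merging then yields at most one edge for each pair `i < j`. -/
theorem normalize_spec (hR : IsPositiveDivisionRig R) {N : Net R} (hN : N.Proper) :
    ((ofRig R).normalize N).IsMeshFamily ∧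
      Relation.ReflTransGen Rewrites N.toQ (Q.mk ((ofRig R).normalize N).toTerm) := by
  obtain ⟨L, ins, outs, es⟩ := N
  simp only [Ops.normalize]
  set ws := L.flatMap fun w => if w ∈ ins ++ outs then [] else [w]
  set K := (ins ++ outs).dedup with hK
  set fs := ws.foldl (ofRig R).elimNode es
  have h1 := hN.congr (es' := es) (perm_internal hN.1) (.refl _)
  have h2 := h1.trans (rewritesTo_foldl_elimNode hR ws es h1.1 (by
    intro w hw
    obtain ⟨v, -, hv⟩ := List.mem_flatMap.1 hw
    split at hv
    · simp at hv
    · simp_all))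
  obtain ⟨h3, h4⟩ : RewritesTo ⟨L, ins, outs, es⟩ ⟨K, ins, outs, fs⟩ := h2
  have hid : Set.InjOn (fun i : ℕ => i) (Set.Iio K.length) := fun i _ j _ hij => hij
  have h5 : toQ ⟨K, ins, outs, fs⟩ =
      toQ ⟨List.range K.length, ins.map K.idxOf, outs.map K.idxOf, mapEdges K.idxOf fs⟩ := by
    rw [← mk_toTerm h3.1, h3.1.inRange.mk_toTerm hid, toNet_self]
    rfl
  have h6 : Proper ⟨List.range K.length, ins.map K.idxOf, outs.map K.idxOf,
      mapEdges K.idxOf fs⟩ := by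
    have := h3.1.inRange.valid_toNet hid
    rw [toNet_self] at this
    refine ⟨this, ?_⟩
    intro e he
    obtain ⟨f, hf, rfl⟩ := List.mem_map.1 he
    exact h3.2 f hf
  have h7 := rewritesTo_simplify hR h6
  have h8 : Network.IsMeshFamily ⟨K.length, ins.map K.idxOf, outs.map K.idxOf,
      (ofRig R).simplify K.length (mapEdges K.idxOf fs)⟩ := by
    constructor
    · exact fun i hi => List.mem_range.1 (h7.1.1.inputs_mem hi)
    · exact fun i hi => List.mem_range.1 (h7.1.1.outputs_mem hi)
    · intro i hi
      have hm : K[i] ∈ ins ++ outs := List.mem_dedup.1 (List.getElem_mem hi)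
      have hx : K.idxOf K[i] = i := (List.nodup_dedup _).idxOf_getElem i hi
      exact (List.mem_append.1 hm).imp (fun h => List.mem_map.2 ⟨_, h, hx⟩)
        fun h => List.mem_map.2 ⟨_, h, hx⟩
    · intro e he
      obtain ⟨p, hp, hpe⟩ := List.mem_flatMap.1 he
      rw [mem_mergeEdges hpe]
      exact mem_pairs.1 hp
    · exact h7.1.2
    · exact pairwise_simplify _ _ _
  refine ⟨h8, ?_⟩
  rw [h8.inRange.mk_toTerm hid, toNet_self]
  exact h4.trans (h5 ▸ h7.2)

end Net

/-! ### Normal forms of diagrams -/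

theorem Net.act_edges_ne {t : CircuitTerm R} (ht : t.WellFormed) {p : ℕ} {N : Net R}
    (hN : ∀ e ∈ N.edges, e.2.2 ≠ 0) : ∀ e ∈ (Net.act t p N).edges, e.2.2 ≠ 0 := by
  induction t generalizing p N with
  | comp f g hf hg => exact hg ht.2.1 (hf ht.1 hN)
  | tensor f g hf hg => exact hg ht.2 (hf ht.1 hN)
  | mul =>
    simp only [act, identify]
    split
    · exact hN
    · intro e he
      obtain ⟨f, hf, rfl⟩ := List.mem_map.1 he
      exact hN f hf
  | cond y =>
    intro e he
    rcases List.mem_cons.1 he with rfl | he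
    · exact ht
    · exact hN e he
  | _ => exact hN

theorem Net.ofTerm_edges_ne {t : CircuitTerm R} (ht : t.WellFormed) :
    ∀ e ∈ (Net.ofTerm t).edges, e.2.2 ≠ 0 :=
  Net.act_edges_ne ht (by simp [ofId])

theorem CircuitTerm.Typed.proper_ofTerm {n m : ℕ} {t : CircuitTerm R} (ht : t.Typed n m) :
    (Net.ofTerm t).Proper ∧ (Net.ofTerm t).inputs.length = n ∧
      (Net.ofTerm t).outputs.length = m ∧ (Net.ofTerm t).toQ = Q.mk t := by
  obtain ⟨h1, h2, h3⟩ := ht.wellFormed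
  obtain ⟨h4, h5, h6, h7⟩ := Net.ofTerm_spec h1
  exact ⟨⟨h4, Net.ofTerm_edges_ne h1⟩, h5.trans h2, h6.trans h3, h7⟩

theorem reduces_normalize (hR : IsPositiveDivisionRig R) {n m : ℕ} {t : CircuitTerm R}
    (ht : t.Typed n m) : ∃ ht' : ((Ops.ofRig R).normalize (Net.ofTerm t)).toTerm.Typed n m,
      IsMeshFamily (Circuit.toDiagram ⟨_, ht'⟩) ∧
      Reduces (Circuit.toDiagram ⟨_, ht⟩) (Circuit.toDiagram ⟨_, ht'⟩) := by
  obtain ⟨h1, h2, h3, h4⟩ := ht.proper_ofTerm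
  obtain ⟨h5, h6⟩ := Net.normalize_spec hR h1
  have h7 := h5.inRange.typed h5.edges_ne
  simp only [Ops.normalize, List.length_map, h2, h3] at h7
  exact ⟨h7, ⟨_, h5, h7, rfl⟩, Q.reduces_of_rewrites h6 ht h7 h4.symm rfl⟩

theorem exists_reduces_isMeshFamily (hR : IsPositiveDivisionRig R) {n m : ℕ} (d : Diagram R n m) :
    ∃ e, Reduces d e ∧ IsMeshFamily e := by
  induction d using Quotient.ind with | _ s =>
  obtain ⟨h, h1, h2⟩ := reduces_normalize hR s.2
  exact ⟨_, h2, h1⟩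

/-- A normal diagram reduces to nothing but itself, and every diagram reduces to some family of
meshes. -/
theorem isNormal_iff (hR : IsPositiveDivisionRig R) {n m : ℕ} {d : Diagram R n m} :
    IsNormal d ↔ IsMeshFamily d := by
  refine ⟨fun h => ?_, fun h => h.isNormal⟩
  obtain ⟨e, h1, h2⟩ := exists_reduces_isMeshFamily hR d
  rwa [h.eq_of_reduces h1]

/-- Uniqueness is needed for transitivity, where the middle diagram reduces to two families of
meshes. -/
theorem exists_common_of_eqvGen (hR : IsPositiveDivisionRig R) {n m : ℕ} {d d' : Diagram R n m}
    (h : Relation.EqvGen Step d d') : ∃ e, IsMeshFamily e ∧ Reduces d e ∧ Reduces d' e := by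
  induction h with
  | rel d d' h =>
    obtain ⟨e, h1, h2⟩ := exists_reduces_isMeshFamily hR d'
    exact ⟨e, h2, .head h h1, h1⟩
  | refl d =>
    obtain ⟨e, h1, h2⟩ := exists_reduces_isMeshFamily hR d
    exact ⟨e, h2, h1, h1⟩
  | symm _ _ _ ih =>
    obtain ⟨e, h1, h2, h3⟩ := ih
    exact ⟨e, h1, h3, h2⟩
  | trans _ _ _ _ _ ih1 ih2 =>
    obtain ⟨e, h1, h2, h3⟩ := ih1
    obtain ⟨e', h1', h2', h3'⟩ := ih2
    obtain rfl := IsMeshFamily.unique hR h3 h2' h1 h1'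
    exact ⟨e, h1, h2, h3'⟩

theorem toResist_eq_iff (hR : IsPositiveDivisionRig R) {n m : ℕ} {s t : Circuit R n m} :
    s.toResist = t.toResist ↔
      ∃ e, IsMeshFamily e ∧ Reduces s.toDiagram e ∧ Reduces t.toDiagram e := by
  constructor
  · intro h
    exact exists_common_of_eqvGen hR (eqvGen_of_cong (Quotient.exact h) s.2 t.2)
  · rintro ⟨e, -, h1, h2⟩
    exact h1.toResist_eq.trans h2.toResist_eq.symm

end ResistorCircuit

namespace ResistorCircuit

/-! ### Relabelling -/

/-- Relabelling of edges. -/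
def mapLabels {α β : Type*} (φ : α → β) (es : List (ℕ × ℕ × α)) : List (ℕ × ℕ × β) :=
  es.map fun e => (e.1, e.2.1, φ e.2.2)

/-- Relabelling of the conductances. -/
def Network.map {α β : Type*} (φ : α → β) (N : Network α) : Network β :=
  ⟨N.nodes, N.inputs, N.outputs, mapLabels φ N.edges⟩

namespace CircuitTerm
variable {α β : Type*} (φ : α → β)

theorem dom_map (t : CircuitTerm α) : (t.map φ).dom = t.dom := by
  induction t <;> simp_all [map, dom]

theorem cod_map (t : CircuitTerm α) : (t.map φ).cod = t.cod := by
  induction t <;> simp_all [map, cod]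

theorem map_units (k : ℕ) : (units k : CircuitTerm α).map φ = units k := by
  induction k with
  | zero => rfl
  | succ k ih => simp only [units, map, ih]

theorem map_counits (k : ℕ) : (counits k : CircuitTerm α).map φ = counits k := by
  induction k with
  | zero => rfl
  | succ k ih => simp only [counits, map, ih]

theorem map_legsIn (k : ℕ) (l : List ℕ) : (legsIn k l : CircuitTerm α).map φ = legsIn k l := by
  induction l with
  | nil => exact map_units φ k
  | cons i l ih => simp only [legsIn, map, ih, join]

theorem map_legsOut (k : ℕ) (l : List ℕ) : (legsOut k l : CircuitTerm α).map φ = legsOut k l := by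
  induction l with
  | nil => exact map_counits φ k
  | cons i l ih => simp only [legsOut, map, ih, fork]

theorem map_links (k : ℕ) (es : List (ℕ × ℕ × α)) :
    (links k es).map φ = links k (mapLabels φ es) := by
  induction es with
  | nil => rfl
  | cons e es ih =>
    obtain ⟨i, j, y⟩ := e
    simp only [mapLabels, List.map_cons, links, map, link, join, fork] at ih ⊢
    rw [ih]

theorem map_toTerm (N : Network α) : N.toTerm.map φ = (N.map φ).toTerm := by
  simp only [Network.toTerm, map, map_legsIn, map_legsOut, map_links, Network.map]

end CircuitTerm

/-- The network drawn by a circuit is built without looking at the labels. -/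
theorem Net.map_act {α β : Type*} (φ : α → β) (t : CircuitTerm α) (p : ℕ) (N : Net α) :
    Net.act (t.map φ) p (N.map φ) = (Net.act t p N).map φ := by
  induction t generalizing p N with
  | comp f g hf hg => simp only [CircuitTerm.map, act, hf, hg]
  | tensor f g hf hg => simp only [CircuitTerm.map, act, hf, hg, CircuitTerm.cod_map]
  | mul =>
    simp only [CircuitTerm.map, act, identify, Net.map]
    split
    · rfl
    · simp [Q.mapEdges]
  | _ => rfl

theorem Net.map_ofTerm {α β : Type*} (φ : α → β) (t : CircuitTerm α) :
    Net.ofTerm (t.map φ) = (Net.ofTerm t).map φ := by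
  rw [ofTerm, ofTerm, ← map_act, CircuitTerm.dom_map]
  rfl

theorem product_map {α β γ δ : Type*} (f : α → β) (g : γ → δ) (l : List α) (l' : List γ) :
    l.map f ×ˢ l'.map g = (l ×ˢ l').map (Prod.map f g) := by
  simp only [SProd.sprod, List.product, List.flatMap_map, List.map_flatMap, List.map_map]
  rfl

/-- Replaces the bounded indices by natural numbers, with a default `d` that is never used; in this
form meshes of relabelled stars can be compared and meshes can be computed. -/
theorem Net.meshEdges_eq {α : Type*} (φ : α → α → α) (l : List (ℕ × α)) (d : ℕ × α) :
    Net.meshEdges φ l = ((List.range l.length ×ˢ List.range l.length).filter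
      fun p => p.1 < p.2).map fun p =>
        ((l.getD p.1 d).1, (l.getD p.2 d).1, φ (l.getD p.1 d).2 (l.getD p.2 d).2) := by
  rw [← List.map_coe_finRange_eq_range, product_map, List.filter_map, List.map_map, meshEdges]
  refine List.map_congr_left fun p _ => ?_
  simp

namespace Ops
variable {R : Type*} [CommSemiring R] {α : Type*}

/-- The labels are names of elements of a rig. -/
structure Hom (o : Ops α) (val : α → R) : Prop where
  add : ∀ a b, val (o.add a b) = val a + val b
  mul : ∀ a b, val (o.mul a b) = val a * val b
  inv : ∀ a, val a ≠ 0 → val (o.inv a) = Ring.inverse (val a)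
  canon : ∀ a, val (o.canon a) = val a

section
variable {β : Type*} (φ : α → β)

theorem dropLoops_mapLabels (es : List (ℕ × ℕ × α)) :
    dropLoops (mapLabels φ es) = mapLabels φ (dropLoops es) := by
  simp only [dropLoops, mapLabels, List.flatMap_map, List.map_flatMap]
  exact List.flatMap_congr fun e _ => by split <;> rfl

theorem avoiding_mapLabels (w : ℕ) (es : List (ℕ × ℕ × α)) :
    avoiding w (mapLabels φ es) = mapLabels φ (avoiding w es) := by
  simp only [avoiding, mapLabels, List.flatMap_map, List.map_flatMap]
  exact List.flatMap_congr fun e _ => by split <;> [rfl; (split <;> rfl)]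

theorem legs_mapLabels (w : ℕ) (es : List (ℕ × ℕ × α)) :
    legs w (mapLabels φ es) = (legs w es).map (Prod.map (fun i => i) φ) := by
  simp only [legs, mapLabels, List.flatMap_map, List.map_flatMap]
  exact List.flatMap_congr fun e _ => by split <;> [rfl; (split <;> rfl)]

theorem between_mapLabels (p : ℕ × ℕ) (es : List (ℕ × ℕ × α)) :
    between p (mapLabels φ es) = (between p es).map φ := by
  simp only [between, mapLabels, List.flatMap_map, List.map_flatMap]
  exact List.flatMap_congr fun e _ => by split <;> rfl

theorem mapEdges_mapLabels (σ : ℕ → ℕ) (es : List (ℕ × ℕ × α)) :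
    Q.mapEdges σ (mapLabels φ es) = mapLabels φ (Q.mapEdges σ es) := by
  simp only [Q.mapEdges, mapLabels, List.map_map]
  rfl

end

variable {o : Ops α} {val : α → R}

/-- The list must be non-empty because `o.zero` need not be a name of `0`; there may be no such
name. -/
theorem Hom.total (h : o.Hom val) {l : List α} (hl : l ≠ []) :
    val (o.total l) = (l.map val).sum := by
  rw [← total_ofRig]
  cases l with
  | nil => exact absurd rfl hl
  | cons a l =>
    simp only [Ops.total, List.map_cons]
    clear hl
    induction l generalizing a with
    | nil => rfl
    | cons b l ih =>
      rw [List.foldl_cons, ih, List.map_cons, List.foldl_cons, h.add]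
      rfl

/-- The star has non-zero conductances, so by positivity its total is non-zero, and `inv` is applied
only where it is an inverse. -/
theorem Hom.starMesh (hR : IsPositiveDivisionRig R) (h : o.Hom val) {l : List (ℕ × α)}
    (h0 : ∀ p ∈ l, val p.2 ≠ 0) :
    mapLabels val (o.starMesh l) = (ofRig R).starMesh (l.map (Prod.map (fun i => i) val)) := by
  cases l with
  | nil => rfl
  | cons p l =>
    have hs : ((((p :: l).map Prod.snd).map val)).sum ≠ 0 := fun hs =>
      h0 p (by simp) (hR.list_sum_eq_zero hs _ (by simp))
    rw [Ops.starMesh, Ops.starMesh, Net.meshEdges_eq _ _ p,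
      Net.meshEdges_eq _ _ (Prod.map (fun i => i) val p), mapLabels, List.map_map, List.length_map]
    refine List.map_congr_left fun q _ => ?_
    have h1 : val (o.total ((p :: l).map Prod.snd)) = (((p :: l).map Prod.snd).map val).sum :=
      h.total (by simp)
    have h2 := h.inv (o.total ((p :: l).map Prod.snd)) (h1 ▸ hs)
    rw [List.getD_map, List.getD_map, total_ofRig, Function.comp_apply]
    simp only [h.mul, h2, h1, Prod.map_fst, Prod.map_snd]
    simp only [List.map_map]
    rfl

theorem Hom.starMesh_ne (hR : IsPositiveDivisionRig R) (h : o.Hom val) {l : List (ℕ × α)}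
    (h0 : ∀ p ∈ l, val p.2 ≠ 0) : ∀ e ∈ o.starMesh l, val e.2.2 ≠ 0 := by
  intro e he
  obtain ⟨q, hq, rfl⟩ := List.mem_map.1 he
  have h1 : l.map Prod.snd ≠ [] := by
    rintro hl
    rw [List.map_eq_nil_iff] at hl
    subst hl
    exact q.1.elim0
  have h2 : val (o.total (l.map Prod.snd)) ≠ 0 := by
    rw [h.total h1]
    intro hs
    exact h0 _ (List.getElem_mem q.1.2) (hR.list_sum_eq_zero hs _
      (List.mem_map_of_mem (List.mem_map_of_mem (List.getElem_mem q.1.2))))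
  simp only [h.mul, h.inv _ h2]
  exact hR.mul_ne_zero (hR.mul_ne_zero (h0 _ (List.getElem_mem _)) (h0 _ (List.getElem_mem _)))
    (hR.inverse_ne_zero h2)

theorem Hom.elimNode (hR : IsPositiveDivisionRig R) (h : o.Hom val) {es : List (ℕ × ℕ × α)}
    (h0 : ∀ e ∈ es, val e.2.2 ≠ 0) (w : ℕ) :
    mapLabels val (o.elimNode es w) = (ofRig R).elimNode (mapLabels val es) w ∧
      ∀ e ∈ o.elimNode es w, val e.2.2 ≠ 0 := by
  have h1 : ∀ p ∈ legs w (dropLoops es), val p.2 ≠ 0 := by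
    intro p hp
    rcases Net.mem_legs hp with hp | hp <;> exact h0 _ (Net.mem_dropLoops.1 hp).1
  constructor
  · rw [Ops.elimNode, Ops.elimNode, dropLoops_mapLabels, avoiding_mapLabels, legs_mapLabels,
      ← h.starMesh hR h1]
    exact List.map_append
  · intro e he
    rcases List.mem_append.1 he with he | he
    · exact h0 e (Net.mem_dropLoops.1 (Net.mem_avoiding.1 he).1).1
    · exact h.starMesh_ne hR h1 e he

theorem Hom.foldl_elimNode (hR : IsPositiveDivisionRig R) (h : o.Hom val) (ws : List ℕ) :
    ∀ es : List (ℕ × ℕ × α), (∀ e ∈ es, val e.2.2 ≠ 0) →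
    mapLabels val (ws.foldl o.elimNode es) = ws.foldl (ofRig R).elimNode (mapLabels val es) := by
  induction ws with
  | nil => exact fun es _ => rfl
  | cons w ws ih =>
    intro es h0
    obtain ⟨h1, h2⟩ := h.elimNode hR h0 w
    rw [List.foldl_cons, List.foldl_cons, ih _ h2, h1]

theorem Hom.simplify (h : o.Hom val) (k : ℕ) (es : List (ℕ × ℕ × α)) :
    mapLabels val (o.simplify k es) = (ofRig R).simplify k (mapLabels val es) := by
  rw [Ops.simplify, Ops.simplify, mapLabels, List.map_flatMap]
  refine List.flatMap_congr fun p _ => ?_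
  rw [between_mapLabels]
  cases between p es with
  | nil => rfl
  | cons a l =>
    have := h.total (l := a :: l) (by simp)
    rw [← total_ofRig, List.map_cons] at this
    simp only [mergeEdges, List.map_cons, List.length_cons, Nat.add_one_ne_zero, if_false,
      List.map_nil, h.canon]
    rw [this]
    rfl

/-- No decision of the algorithm depends on the value of a label, so it commutes with the evaluation
of names. -/
theorem Hom.normalize (hR : IsPositiveDivisionRig R) (h : o.Hom val) {N : Net α}
    (h0 : ∀ e ∈ N.edges, val e.2.2 ≠ 0) :
    (o.normalize N).map val = (ofRig R).normalize (N.map val) := by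
  simp only [Ops.normalize, Network.map, h.simplify, ← mapEdges_mapLabels,
    h.foldl_elimNode hR _ _ h0]
  rfl

end Ops

/-! ### Patterns of legs, independent of the names of the nodes -/

theorem dedup_map_of_injOn {c : List ℕ} {g : ℕ → ℕ} (hg : Set.InjOn g {a | a ∈ c}) :
    (c.map g).dedup = c.dedup.map g := by
  induction c with
  | nil => rfl
  | cons a c ih =>
    have ih' := ih (hg.mono fun b hb => List.mem_cons_of_mem _ hb)
    by_cases h : a ∈ c
    · rw [List.map_cons, List.dedup_cons_of_mem (List.mem_map_of_mem h), ih',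
        List.dedup_cons_of_mem h]
    · rw [List.map_cons, List.dedup_cons_of_notMem, ih', List.dedup_cons_of_notMem h, List.map_cons]
      intro h'
      obtain ⟨b, hb, hab⟩ := List.mem_map.1 h'
      exact h (hg (List.mem_cons_of_mem _ hb) List.mem_cons_self hab ▸ hb)

theorem idxOf_map_of_injOn {c : List ℕ} {g : ℕ → ℕ} {a : ℕ}
    (hg : ∀ b ∈ c, g b = g a → b = a) : (c.map g).idxOf (g a) = c.idxOf a := by
  induction c with
  | nil => rfl
  | cons b c ih =>
    rw [List.map_cons, List.idxOf_cons, List.idxOf_cons,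
      ih fun x hx => hg x (List.mem_cons_of_mem _ hx)]
    by_cases h : b = a
    · simp [h]
    · have : g b ≠ g a := fun h' => h (hg b List.mem_cons_self h')
      rw [beq_eq_false_iff_ne.2 h, beq_eq_false_iff_ne.2 this]

/-- The pattern of repetitions in a list. -/
def pattern (c : List ℕ) : List ℕ := c.map c.dedup.idxOf

/-- The pattern depends only on which members of the list are equal to each other, and an injective
renaming preserves this. -/
theorem pattern_map {c : List ℕ} {g : ℕ → ℕ} (hg : Set.InjOn g {a | a ∈ c}) :
    pattern (c.map g) = pattern c := by
  rw [pattern, pattern, dedup_map_of_injOn hg, List.map_map]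
  refine List.map_congr_left fun a ha => ?_
  exact idxOf_map_of_injOn fun b hb h => hg (List.mem_dedup.1 hb) ha h

theorem pattern_pattern (c : List ℕ) : pattern (pattern c) = pattern c := by
  conv_lhs => rw [pattern.eq_1 c]
  refine pattern_map fun a ha b _ h => ?_
  exact (List.idxOf_inj (List.mem_dedup.2 ha)).1 h

/-- A pattern is its own pattern, so two patterns that differ by an injective renaming are equal. -/
theorem pattern_eq_of_map {c c' : List ℕ} {g : ℕ → ℕ} (hg : Set.InjOn g {a | a ∈ pattern c'})
    (h : pattern c = (pattern c').map g) : pattern c = pattern c' := by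
  rw [← pattern_pattern c, h, pattern_map hg, pattern_pattern]

theorem length_dedup_pattern (c : List ℕ) : (pattern c).dedup.length = c.dedup.length := by
  rw [pattern, dedup_map_of_injOn, List.length_map]
  exact fun a ha b _ h => (List.idxOf_inj (List.mem_dedup.2 ha)).1 h

theorem normalize_pattern {α : Type*} (o : Ops α) (N : Net α) :
    (o.normalize N).inputs ++ (o.normalize N).outputs = pattern (N.inputs ++ N.outputs) := by
  simp [Ops.normalize, pattern]

theorem mem_pattern {c : List ℕ} {i : ℕ} (hi : i < c.dedup.length) : i ∈ pattern c :=
  List.mem_map.2 ⟨c.dedup[i], List.mem_dedup.1 (List.getElem_mem hi),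
    (List.nodup_dedup _).idxOf_getElem i hi⟩

end ResistorCircuit

/-! ### Normal forms as expressions are determined by the diagram -/

namespace ResistorCircuit
variable {R : Type*} [CommSemiring R] {α : Type*}

theorem Network.ext' {N N' : Network α} (h : N.nodes = N'.nodes) (hi : N.inputs = N'.inputs)
    (ho : N.outputs = N'.outputs) (he : N.edges = N'.edges) : N = N' := by
  cases N
  cases N'
  simp_all

/-- The edges are listed in the order of `pairs k`, at most one for each pair and with a canonical
label. So the values of the undirected edges determine the list of labelled edges. -/
theorem Ops.Hom.simplify_inj {o : Ops α} {val : α → R} (h : o.Hom val)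
    (hc : ∀ a b, val a = val b → o.canon a = o.canon b) {k : ℕ} {es fs : List (ℕ × ℕ × α)}
    (hp : ((mapLabels val (o.simplify k es)).map Q.edge).Perm
      ((mapLabels val (o.simplify k fs)).map Q.edge)) : o.simplify k es = o.simplify k fs := by
  have key : ∀ {es fs : List (ℕ × ℕ × α)}, ((mapLabels val (o.simplify k es)).map Q.edge).Perm
      ((mapLabels val (o.simplify k fs)).map Q.edge) → ∀ p ∈ pairs k, between p es ≠ [] →
      between p fs ≠ [] ∧ val (o.total (between p es)) = val (o.total (between p fs)) := by
    intro es fs hp p hpk hne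
    have h1 : (p.1, p.2, o.canon (o.total (between p es))) ∈ o.simplify k es := by
      refine List.mem_flatMap.2 ⟨p, hpk, ?_⟩
      rw [mergeEdges, if_neg (by simpa using hne)]
      simp
    have h2 := hp.subset (List.mem_map_of_mem (List.mem_map_of_mem h1))
    simp only [mapLabels, List.mem_map] at h2
    obtain ⟨_, ⟨f, hf, rfl⟩, h3⟩ := h2
    obtain ⟨q, hq, hqf⟩ := List.mem_flatMap.1 hf
    have hfe := Net.mem_mergeEdges hqf
    rw [mergeEdges] at hqf
    subst hfe
    simp only [Q.edge, Prod.mk.injEq, h.canon] at h3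
    have hqp : q = p := by
      by_contra hqp
      have a := Net.mem_pairs.1 hpk
      have b := Net.mem_pairs.1 hq
      rw [Sym2.eq_iff] at h3
      rcases h3.1 with ⟨c, d⟩ | ⟨c, d⟩
      · exact hqp (Prod.ext c d)
      · omega
    subst hqp
    refine ⟨fun h0 => ?_, h3.2.symm⟩
    rw [h0] at hqf
    simp at hqf
  refine List.flatMap_congr fun p hpk => ?_
  by_cases h1 : between p es = []
  · by_cases h2 : between p fs = []
    · rw [h1, h2]
    · exact absurd h1 (key hp.symm p hpk h2).1
  · obtain ⟨h2, h3⟩ := key hp p hpk h1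
    rw [mergeEdges, mergeEdges, if_neg (by simpa using h1), if_neg (by simpa using h2), hc _ _ h3]

/-- The numbering of one network is a maximal labelling of the common diagram, hence an injective
naming `g` of the other network. The legs of both are patterns, and therefore equal; this makes `g`
the identity on the nodes, and the edges are compared by `simplify_inj`. -/
theorem Ops.Hom.normalize_eq {o : Ops α} {val : α → R} (h : o.Hom val)
    (hc : ∀ a b, val a = val b → o.canon a = o.canon b) {N N' : Net α} {n m : ℕ}
    (hN : ((o.normalize N).map val).IsMeshFamily) (hN' : ((o.normalize N').map val).IsMeshFamily)
    {ht : ((o.normalize N).map val).toTerm.Typed n m}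
    {ht' : ((o.normalize N').map val).toTerm.Typed n m}
    (hd : Circuit.toDiagram ⟨_, ht⟩ = Circuit.toDiagram ⟨_, ht'⟩) :
    o.normalize N = o.normalize N' := by
  have h1 := gen_toTerm hN.inRange ht (g := fun i => i) fun i _ j _ hij => hij
  rw [Net.toNet_self, hd] at h1
  obtain ⟨g, hg, hi, ho, -, he⟩ := h1.exists_injOn hN'.inRange
  simp only [Network.toNet, Network.map] at hg hi ho he
  have hlt : ∀ i ∈ pattern (N'.inputs ++ N'.outputs), i < (o.normalize N').nodes := by
    intro i hi
    rw [← normalize_pattern o] at hi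
    rcases List.mem_append.1 hi with hi | hi
    · exact hN'.inputs_lt i hi
    · exact hN'.outputs_lt i hi
  have hp : pattern (N.inputs ++ N.outputs) = (pattern (N'.inputs ++ N'.outputs)).map g := by
    rw [← normalize_pattern o, ← normalize_pattern o, hi, ho, List.map_append]
  have hp' := pattern_eq_of_map (fun a ha b hb hab => hg (hlt a ha) (hlt b hb) hab) hp
  have hk : (o.normalize N).nodes = (o.normalize N').nodes := by
    change (N.inputs ++ N.outputs).dedup.length = (N'.inputs ++ N'.outputs).dedup.length
    rw [← length_dedup_pattern, hp', length_dedup_pattern]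
  -- Every node occurs in the pattern of the legs (`mem_pattern`), and `g` fixes this pattern member
  -- by member.
  have hgi : ∀ i < (o.normalize N').nodes, g i = i := by
    intro i hi
    have h2 : (pattern (N'.inputs ++ N'.outputs)).map g =
        (pattern (N'.inputs ++ N'.outputs)).map fun i => i := by
      rw [← hp, hp', List.map_id']
    exact List.map_inj_left.1 h2 i (mem_pattern hi)
  have hi' : (o.normalize N).inputs = (o.normalize N').inputs := by
    rw [hi]
    exact (List.map_congr_left fun i hi => hgi i (hN'.inputs_lt i hi)).trans (List.map_id' _)
  have ho' : (o.normalize N).outputs = (o.normalize N').outputs := by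
    rw [ho]
    exact (List.map_congr_left fun i hi => hgi i (hN'.outputs_lt i hi)).trans (List.map_id' _)
  have he' : Q.mapEdges g (mapLabels val (o.normalize N').edges) =
      mapLabels val (o.normalize N').edges := by
    conv_rhs => rw [← List.map_id' (mapLabels val (o.normalize N').edges)]
    refine List.map_congr_left fun e he => ?_
    obtain ⟨a, b⟩ := hN'.inRange.edges_lt e he
    rw [hgi _ a, hgi _ b]
  rw [he'] at he
  have hee : (o.normalize N).edges = (o.normalize N').edges := by
    have hk' : (N.inputs ++ N.outputs).dedup.length = (N'.inputs ++ N'.outputs).dedup.length := hk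
    simp only [Ops.normalize] at he ⊢
    rw [hk'] at he ⊢
    exact h.simplify_inj hc (Multiset.coe_eq_coe.1 he)
  exact Network.ext' hk hi' ho' hee

/-- The normal form of a circuit. -/
def Ops.nf (o : Ops α) (t : CircuitTerm α) : CircuitTerm α := (o.normalize (Net.ofTerm t)).toTerm

theorem Ops.Hom.map_normalize (hR : IsPositiveDivisionRig R) {o : Ops α} {val : α → R}
    (h : o.Hom val) {n m : ℕ} {t : CircuitTerm α} (ht : (t.map val).Typed n m) :
    (o.normalize (Net.ofTerm t)).map val = (ofRig R).normalize (Net.ofTerm (t.map val)) := by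
  rw [Net.map_ofTerm, h.normalize hR]
  intro e he
  refine ht.proper_ofTerm.1.2 (e.1, e.2.1, val e.2.2) ?_
  rw [Net.map_ofTerm]
  exact List.mem_map_of_mem he

theorem Ops.Hom.nf_spec (hR : IsPositiveDivisionRig R) {o : Ops α} {val : α → R} (h : o.Hom val)
    {n m : ℕ} {t : CircuitTerm α} (ht : (t.map val).Typed n m) :
    ∃ ht' : ((o.nf t).map val).Typed n m, IsMeshFamily (Circuit.toDiagram ⟨_, ht'⟩) ∧
      Reduces (Circuit.toDiagram ⟨_, ht⟩) (Circuit.toDiagram ⟨_, ht'⟩) := by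
  have h1 := reduces_normalize hR ht
  rwa [← h.map_normalize hR ht, ← CircuitTerm.map_toTerm] at h1

theorem Ops.Hom.nf_eq_iff (hR : IsPositiveDivisionRig R) {o : Ops α} {val : α → R} (h : o.Hom val)
    (hc : ∀ a b, val a = val b → o.canon a = o.canon b) {n m : ℕ} {s t : CircuitTerm α}
    (hs : (s.map val).Typed n m) (ht : (t.map val).Typed n m) :
    Circuit.toResist ⟨_, hs⟩ = Circuit.toResist ⟨_, ht⟩ ↔ o.nf s = o.nf t := by
  obtain ⟨hs', m1, r1⟩ := h.nf_spec hR hs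
  obtain ⟨ht', m2, r2⟩ := h.nf_spec hR ht
  rw [toResist_eq_iff hR]
  constructor
  · rintro ⟨e, he, k1, k2⟩
    have h1 := IsMeshFamily.unique hR r1 k1 m1 he
    have h2 := IsMeshFamily.unique hR r2 k2 m2 he
    have hd := h1.trans h2.symm
    have hs1 := (Net.normalize_spec hR hs.proper_ofTerm.1).1
    have ht1 := (Net.normalize_spec hR ht.proper_ofTerm.1).1
    rw [← h.map_normalize hR hs] at hs1
    rw [← h.map_normalize hR ht] at ht1
    have hs2 : ((o.normalize (Net.ofTerm s)).map val).toTerm.Typed n m := by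
      rw [← CircuitTerm.map_toTerm]
      exact hs'
    have ht2 : ((o.normalize (Net.ofTerm t)).map val).toTerm.Typed n m := by
      rw [← CircuitTerm.map_toTerm]
      exact ht'
    have := h.normalize_eq hc hs1 ht1 (ht := hs2) (ht' := ht2) (by
      refine Q.toDiagram_eq _ _ ?_
      rw [← CircuitTerm.map_toTerm, ← CircuitTerm.map_toTerm]
      exact Q.mk_eq_of_toDiagram hd)
    rw [Ops.nf, Ops.nf, this]
  · intro he
    refine ⟨_, m1, r1, ?_⟩
    have : Circuit.toDiagram ⟨_, hs'⟩ = Circuit.toDiagram ⟨_, ht'⟩ :=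
      Q.toDiagram_eq _ _ (by rw [he])
    rw [this]
    exact r2

end ResistorCircuit

namespace ResistorCircuit

/-! ### Computable functions on lists -/

attribute [fun_prop] Computable

namespace ComputableFun
variable {α β γ σ : Type*} [Primcodable α] [Primcodable β] [Primcodable γ] [Primcodable σ]

@[fun_prop]
theorem id : Computable fun a : α => a := Computable.id

@[fun_prop]
theorem const (b : β) : Computable fun _ : α => b := Computable.const b

@[fun_prop]
theorem comp {f : β → γ} {g : α → β} (hf : Computable f) (hg : Computable g) :
    Computable fun a => f (g a) := Computable.comp hf hg

@[fun_prop]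
theorem fst {f : α → β × γ} (hf : Computable f) : Computable fun a => (f a).1 :=
  Computable.fst.comp hf

@[fun_prop]
theorem snd {f : α → β × γ} (hf : Computable f) : Computable fun a => (f a).2 :=
  Computable.snd.comp hf

@[fun_prop]
theorem pair {f : α → β} {g : α → γ} (hf : Computable f) (hg : Computable g) :
    Computable fun a => (f a, g a) := Computable.pair hf hg

@[fun_prop]
theorem add {f g : α → ℕ} (hf : Computable f) (hg : Computable g) :
    Computable fun a => f a + g a := Primrec.nat_add.to_comp.comp hf hg

@[fun_prop]
theorem sub {f g : α → ℕ} (hf : Computable f) (hg : Computable g) :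
    Computable fun a => f a - g a := Primrec.nat_sub.to_comp.comp hf hg

@[fun_prop]
theorem decide_eq [DecidableEq β] {f g : α → β} (hf : Computable f) (hg : Computable g) :
    Computable fun a => decide (f a = g a) := Primrec.eq.decide.to_comp.comp hf hg

theorem decide_lt {f g : α → ℕ} (hf : Computable f) (hg : Computable g) :
    Computable fun a => decide (f a < g a) := Primrec.nat_lt.decide.to_comp.comp hf hg

@[fun_prop]
theorem bool_and {f g : α → Bool} (hf : Computable f) (hg : Computable g) :
    Computable fun a => f a && g a := Primrec.and.to_comp.comp hf hg

@[fun_prop]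
theorem bool_or {f g : α → Bool} (hf : Computable f) (hg : Computable g) :
    Computable fun a => f a || g a := Primrec.or.to_comp.comp hf hg

@[fun_prop]
theorem bool_not {f : α → Bool} (hf : Computable f) : Computable fun a => !f a :=
  Primrec.not.to_comp.comp hf

@[fun_prop]
theorem ite {c : α → Prop} [DecidablePred c] {f g : α → β} (hc : Computable fun a => decide (c a))
    (hf : Computable f) (hg : Computable g) : Computable fun a => if c a then f a else g a :=
  (Computable.cond hc hf hg).of_eq fun a => by by_cases h : c a <;> simp [h]

theorem decide_sym2 {f g h k : α → ℕ} (hf : Computable f) (hg : Computable g) (hh : Computable h)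
    (hk : Computable k) : Computable fun a => decide (s(f a, g a) = s(h a, k a)) := by
  have : Computable fun a => (decide (f a = h a) && decide (g a = k a)) ||
    (decide (f a = k a) && decide (g a = h a)) := by fun_prop
  exact this.of_eq fun a => by simp only [Sym2.eq_iff, Bool.decide_or, Bool.decide_and]

@[fun_prop]
theorem cons {f : α → β} {g : α → List β} (hf : Computable f) (hg : Computable g) :
    Computable fun a => f a :: g a := Computable.list_cons.comp hf hg

@[fun_prop]
theorem append {f g : α → List β} (hf : Computable f) (hg : Computable g) :
    Computable fun a => f a ++ g a := Computable.list_append.comp hf hg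

@[fun_prop]
theorem length {f : α → List β} (hf : Computable f) : Computable fun a => (f a).length :=
  Computable.list_length.comp hf

@[fun_prop]
theorem reverse {f : α → List β} (hf : Computable f) : Computable fun a => (f a).reverse :=
  Computable.list_reverse.comp hf

@[fun_prop]
theorem tail {f : α → List β} (hf : Computable f) : Computable fun a => (f a).tail :=
  Primrec.list_tail.to_comp.comp hf

@[fun_prop]
theorem headD {f : α → List β} {g : α → β} (hf : Computable f) (hg : Computable g) :
    Computable fun a => (f a).headD (g a) :=
  (Computable.option_getD (Primrec.list_head?.to_comp.comp hf) hg).of_eq fun a => by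
    cases f a <;> rfl

@[fun_prop]
theorem range {f : α → ℕ} (hf : Computable f) : Computable fun a => List.range (f a) :=
  Primrec.list_range.to_comp.comp hf

@[fun_prop]
theorem getD {f : α → List β} {g : α → ℕ} (hf : Computable f) (hg : Computable g) (d : β) :
    Computable fun a => (f a).getD (g a) d := (Primrec.list_getD d).to_comp.comp hf hg

@[fun_prop]
theorem take {f : α → ℕ} {g : α → List β} (hf : Computable f) (hg : Computable g) :
    Computable fun a => (g a).take (f a) := Primrec.list_take.to_comp.comp hf hg

@[fun_prop]
theorem drop {f : α → ℕ} {g : α → List β} (hf : Computable f) (hg : Computable g) :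
    Computable fun a => (g a).drop (f a) := Primrec.list_drop.to_comp.comp hf hg

@[fun_prop]
theorem idxOf [DecidableEq β] {f : α → β} {g : α → List β} (hf : Computable f)
    (hg : Computable g) : Computable fun a => (g a).idxOf (f a) :=
  Primrec.list_idxOf.to_comp.comp hf hg

theorem decide_mem [DecidableEq β] {f : α → β} {g : α → List β} (hf : Computable f)
    (hg : Computable g) : Computable fun a => decide (f a ∈ g a) := by
  have : Computable fun a => decide ((g a).idxOf (f a) < (g a).length) :=
    decide_lt (by fun_prop) (by fun_prop)
  exact this.of_eq fun a => by simp only [List.idxOf_lt_length_iff]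

-- A fold is a recursion on the number of members already folded, the next member being looked up in
-- the list. The recursion stops at the length of the list, so the look-up does not fail.
@[fun_prop]
theorem foldl {f : α → List β} {g : α → σ} {h : α → σ → β → σ} (hf : Computable f)
    (hg : Computable g) (hh : Computable fun p : α × σ × β => h p.1 p.2.1 p.2.2) :
    Computable fun a => (f a).foldl (h a) (g a) := by
  have h1 : Computable₂ fun (a : α) (p : ℕ × σ) =>
      Option.casesOn (motive := fun _ => σ) (f a)[p.1]? p.2 fun b => h a p.2 b := by
    refine Computable.option_casesOn (o := fun q : α × ℕ × σ => (f q.1)[q.2.1]?)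
      (f := fun q => q.2.2) (g := fun q b => h q.1 q.2.2 b) ?_ (by fun_prop) ?_
    · exact Computable.list_getElem?.comp (hf.comp Computable.fst)
        (Computable.fst.comp Computable.snd)
    · exact hh.comp (g := fun q : (α × ℕ × σ) × β => (q.1.1, q.1.2.2, q.2)) (by fun_prop)
  refine (Computable.nat_rec (f := fun a => (f a).length) (by fun_prop) hg h1).of_eq fun a => ?_
  have key : ∀ n ≤ (f a).length, Nat.rec (motive := fun _ => σ) (g a) (fun n x =>
      Option.casesOn (motive := fun _ => σ) (f a)[n]? x fun b => h a x b) n =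
      ((f a).take n).foldl (h a) (g a) := by
    intro n hn
    induction n with
    | zero => simp
    | succ n ih =>
      have hlt : n < (f a).length := hn
      simp only [ih (Nat.le_of_succ_le hn), List.getElem?_eq_getElem hlt]
      rw [List.take_add_one, List.getElem?_eq_getElem hlt, List.foldl_append]
      rfl
  simpa using key _ le_rfl

@[fun_prop]
theorem foldr {f : α → List β} {g : α → σ} {h : α → β → σ → σ} (hf : Computable f)
    (hg : Computable g) (hh : Computable fun p : α × β × σ => h p.1 p.2.1 p.2.2) :
    Computable fun a => (f a).foldr (h a) (g a) := by
  have h1 : Computable fun p : α × σ × β => h p.1 p.2.2 p.2.1 :=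
    hh.comp (g := fun p : α × σ × β => (p.1, p.2.2, p.2.1)) (by fun_prop)
  have h2 : Computable fun a => (f a).reverse.foldl (fun s b => h a b s) (g a) :=
    foldl (by fun_prop) hg h1
  exact h2.of_eq fun a => by rw [List.foldl_reverse]

@[fun_prop]
theorem flatMap {f : α → List β} {g : α → β → List σ} (hf : Computable f)
    (hg : Computable fun p : α × β => g p.1 p.2) : Computable fun a => (f a).flatMap (g a) := by
  have h1 : Computable fun a => (f a).foldr (fun b s => g a b ++ s) [] :=
    foldr hf (by fun_prop) (append
      (hg.comp (g := fun p : α × β × List σ => (p.1, p.2.1)) (by fun_prop)) (by fun_prop))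
  refine h1.of_eq fun a => ?_
  induction f a with
  | nil => rfl
  | cons b l ih => rw [List.foldr_cons, ih, List.flatMap_cons]

@[fun_prop]
theorem map {f : α → List β} {g : α → β → σ} (hf : Computable f)
    (hg : Computable fun p : α × β => g p.1 p.2) : Computable fun a => (f a).map (g a) := by
  have h1 : Computable fun a => (f a).flatMap fun b => [g a b] := by fun_prop
  exact h1.of_eq fun a => List.flatMap_pure_eq_map _ _

@[fun_prop]
theorem sum {f : α → List ℕ} (hf : Computable f) : Computable fun a => (f a).sum := by
  have h1 : Computable fun a => (f a).foldr (fun x y => x + y) 0 := by fun_prop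
  exact h1.of_eq fun a => rfl

@[fun_prop]
theorem erase [DecidableEq β] {f : α → List β} {g : α → β} (hf : Computable f)
    (hg : Computable g) : Computable fun a => (f a).erase (g a) := by
  have h1 : Computable fun a =>
    (f a).take ((f a).idxOf (g a)) ++ (f a).drop ((f a).idxOf (g a) + 1) := by fun_prop
  exact h1.of_eq fun a => by rw [List.erase_eq_eraseIdx_of_idxOf rfl, List.eraseIdx_eq_take_drop_succ]

@[fun_prop]
theorem dedup [DecidableEq β] {f : α → List β} (hf : Computable f) :
    Computable fun a => (f a).dedup := by
  have h1 : Computable fun a => (f a).foldr (fun x s => if x ∈ s then s else x :: s) [] :=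
    foldr hf (by fun_prop) (ite (decide_mem (by fun_prop) (by fun_prop)) (by fun_prop)
      (by fun_prop))
  refine h1.of_eq fun a => ?_
  induction f a with
  | nil => rfl
  | cons b l ih =>
    rw [List.foldr_cons, ih, List.dedup_cons]
    simp only [List.mem_dedup]

end ComputableFun

end ResistorCircuit

namespace ResistorCircuit

/-! ### Computability of normal forms -/

/-- A network as a tuple. -/
def Net.equivProd : Net ℕ ≃ List ℕ × List ℕ × List ℕ × List (ℕ × ℕ × ℕ) where
  toFun N := (N.nodes, N.inputs, N.outputs, N.edges)
  invFun p := ⟨p.1, p.2.1, p.2.2.1, p.2.2.2⟩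

instance : Primcodable (Net ℕ) := .ofEquiv _ Net.equivProd

/-- A network as a tuple. -/
def Network.equivProd : Network ℕ ≃ ℕ × List ℕ × List ℕ × List (ℕ × ℕ × ℕ) where
  toFun N := (N.nodes, N.inputs, N.outputs, N.edges)
  invFun p := ⟨p.1, p.2.1, p.2.2.1, p.2.2.2⟩

instance : Primcodable (Network ℕ) := .ofEquiv _ Network.equivProd

namespace ComputableFun
variable {α : Type*} [Primcodable α]

theorem net_equivProd {f : α → Net ℕ} (hf : Computable f) :
    Computable fun a => Net.equivProd (f a) :=
  (Primrec.of_equiv (e := Net.equivProd)).to_comp.comp hf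

@[fun_prop]
theorem net_nodes {f : α → Net ℕ} (hf : Computable f) : Computable fun a => (f a).nodes :=
  .comp (f := fun p => p.1) (by fun_prop) (net_equivProd hf)

@[fun_prop]
theorem net_inputs {f : α → Net ℕ} (hf : Computable f) : Computable fun a => (f a).inputs :=
  .comp (f := fun p => p.2.1) (by fun_prop) (net_equivProd hf)

@[fun_prop]
theorem net_outputs {f : α → Net ℕ} (hf : Computable f) : Computable fun a => (f a).outputs :=
  .comp (f := fun p => p.2.2.1) (by fun_prop) (net_equivProd hf)

@[fun_prop]
theorem net_edges {f : α → Net ℕ} (hf : Computable f) : Computable fun a => (f a).edges :=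
  .comp (f := fun p => p.2.2.2) (by fun_prop) (net_equivProd hf)

@[fun_prop]
theorem net_mk {f g h : α → List ℕ} {k : α → List (ℕ × ℕ × ℕ)} (hf : Computable f)
    (hg : Computable g) (hh : Computable h) (hk : Computable k) :
    Computable fun a => Net.mk (f a) (g a) (h a) (k a) :=
  (Primrec.of_equiv_symm (e := Net.equivProd)).to_comp.comp
    (f := fun p => Net.equivProd.symm p) (hf.pair (hg.pair (hh.pair hk)))

theorem network_equivProd {f : α → Network ℕ} (hf : Computable f) :
    Computable fun a => Network.equivProd (f a) :=
  (Primrec.of_equiv (e := Network.equivProd)).to_comp.comp hf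

@[fun_prop]
theorem network_nodes {f : α → Network ℕ} (hf : Computable f) : Computable fun a => (f a).nodes :=
  .comp (f := fun p => p.1) (by fun_prop) (network_equivProd hf)

@[fun_prop]
theorem network_inputs {f : α → Network ℕ} (hf : Computable f) :
    Computable fun a => (f a).inputs :=
  .comp (f := fun p => p.2.1) (by fun_prop) (network_equivProd hf)

@[fun_prop]
theorem network_outputs {f : α → Network ℕ} (hf : Computable f) :
    Computable fun a => (f a).outputs :=
  .comp (f := fun p => p.2.2.1) (by fun_prop) (network_equivProd hf)

@[fun_prop]
theorem network_edges {f : α → Network ℕ} (hf : Computable f) : Computable fun a => (f a).edges :=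
  .comp (f := fun p => p.2.2.2) (by fun_prop) (network_equivProd hf)

@[fun_prop]
theorem network_mk {f : α → ℕ} {g h : α → List ℕ} {k : α → List (ℕ × ℕ × ℕ)} (hf : Computable f)
    (hg : Computable g) (hh : Computable h) (hk : Computable k) :
    Computable fun a => Network.mk (f a) (g a) (h a) (k a) :=
  (Primrec.of_equiv_symm (e := Network.equivProd)).to_comp.comp
    (f := fun p => Network.equivProd.symm p) (hf.pair (hg.pair (hh.pair hk)))

end ComputableFun

/-- The operations on labels are computable. -/
class Ops.IsComputable (o : Ops ℕ) : Prop where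
  add : Computable₂ o.add
  mul : Computable₂ o.mul
  inv : Computable o.inv
  canon : Computable o.canon

namespace ComputableFun
variable {α : Type*} [Primcodable α] {o : Ops ℕ} [ho : o.IsComputable]

@[fun_prop]
theorem ops_add {f g : α → ℕ} (hf : Computable f) (hg : Computable g) :
    Computable fun a => o.add (f a) (g a) := ho.add.comp hf hg

@[fun_prop]
theorem ops_mul {f g : α → ℕ} (hf : Computable f) (hg : Computable g) :
    Computable fun a => o.mul (f a) (g a) := ho.mul.comp hf hg

@[fun_prop]
theorem ops_inv {f : α → ℕ} (hf : Computable f) : Computable fun a => o.inv (f a) :=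
  ho.inv.comp hf

@[fun_prop]
theorem ops_canon {f : α → ℕ} (hf : Computable f) : Computable fun a => o.canon (f a) :=
  ho.canon.comp hf

@[fun_prop]
theorem total {f : α → List ℕ} (hf : Computable f) : Computable fun a => o.total (f a) := by
  have h1 : Computable fun a => (f a).tail.foldl o.add ((f a).headD o.zero) := by fun_prop
  exact h1.of_eq fun a => by cases f a <;> rfl

@[fun_prop]
theorem legs {f : α → ℕ} {g : α → List (ℕ × ℕ × ℕ)} (hf : Computable f) (hg : Computable g) :
    Computable fun a => Ops.legs (f a) (g a) := by
  unfold Ops.legs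
  fun_prop

@[fun_prop]
theorem dropLoops {f : α → List (ℕ × ℕ × ℕ)} (hf : Computable f) :
    Computable fun a => Ops.dropLoops (f a) := by
  unfold Ops.dropLoops
  fun_prop

@[fun_prop]
theorem avoiding {f : α → ℕ} {g : α → List (ℕ × ℕ × ℕ)} (hf : Computable f) (hg : Computable g) :
    Computable fun a => Ops.avoiding (f a) (g a) := by
  unfold Ops.avoiding
  fun_prop

@[fun_prop]
theorem between {f : α → ℕ × ℕ} {g : α → List (ℕ × ℕ × ℕ)} (hf : Computable f)
    (hg : Computable g) : Computable fun a => Ops.between (f a) (g a) := by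
  unfold Ops.between
  exact flatMap hg (ite
    (decide_sym2 (by fun_prop) (by fun_prop) (by fun_prop) (by fun_prop))
    (by fun_prop) (by fun_prop))

theorem offDiag {f : α → ℕ} (hf : Computable f) : Computable fun a =>
    (List.range (f a) ×ˢ List.range (f a)).filter fun p => p.1 < p.2 := by
  -- The order `i < j` is tested by `j - i ≠ 0`, with truncated subtraction.
  have h0 : Computable fun p : ℕ × ℕ =>
      (List.range p.1).flatMap fun j => if j - p.2 = 0 then [] else [(p.2, j)] := by
    fun_prop
  have h1 : Computable fun a => (List.range (f a)).flatMap fun i =>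
      (List.range (f a)).flatMap fun j => if j - i = 0 then [] else [(i, j)] :=
    flatMap (by fun_prop)
      (h0.comp (g := fun p : α × ℕ => (f p.1, p.2)) (by fun_prop))
  refine h1.of_eq fun a => ?_
  simp only [SProd.sprod, List.product, List.filter_flatMap]
  refine List.flatMap_congr fun i _ => ?_
  induction List.range (f a) with
  | nil => rfl
  | cons j l ih =>
    rw [List.flatMap_cons, ih, List.map_cons]
    by_cases h : i < j
    · simp [h, Nat.sub_eq_zero_iff_le, not_le.2 h]
    · simp [h, not_lt.1 h]

theorem meshEdge : Computable fun p : (ℕ × List (ℕ × ℕ)) × ℕ × ℕ =>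
    ((p.1.2.getD p.2.1 (0, 0)).1, (p.1.2.getD p.2.2 (0, 0)).1,
      o.mul (o.mul (p.1.2.getD p.2.1 (0, 0)).2 (p.1.2.getD p.2.2 (0, 0)).2) p.1.1) := by
  fun_prop

@[fun_prop]
theorem starMesh {f : α → List (ℕ × ℕ)} (hf : Computable f) :
    Computable fun a => o.starMesh (f a) := by
  have h1 : Computable fun p : ℕ × List (ℕ × ℕ) =>
      ((List.range p.2.length ×ˢ List.range p.2.length).filter fun q => q.1 < q.2).map fun q =>
        ((p.2.getD q.1 (0, 0)).1, (p.2.getD q.2 (0, 0)).1,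
          o.mul (o.mul (p.2.getD q.1 (0, 0)).2 (p.2.getD q.2 (0, 0)).2) p.1) :=
    map (offDiag (by fun_prop)) meshEdge
  have h2 : Computable fun a => (o.inv (o.total ((f a).map Prod.snd)), f a) := by fun_prop
  refine (h1.comp h2).of_eq fun a => ?_
  rw [Ops.starMesh, Net.meshEdges_eq _ _ (0, 0)]

@[fun_prop]
theorem elimNode {f : α → List (ℕ × ℕ × ℕ)} {g : α → ℕ} (hf : Computable f) (hg : Computable g) :
    Computable fun a => o.elimNode (f a) (g a) := by
  unfold Ops.elimNode
  fun_prop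

@[fun_prop]
theorem pairs {f : α → ℕ} (hf : Computable f) : Computable fun a => Ops.pairs (f a) := by
  unfold Ops.pairs
  fun_prop

@[fun_prop]
theorem mergeEdges {f : α → ℕ × ℕ} {g : α → List ℕ} (hf : Computable f) (hg : Computable g) :
    Computable fun a => o.mergeEdges (f a) (g a) := by
  unfold Ops.mergeEdges
  fun_prop

@[fun_prop]
theorem simplify {f : α → ℕ} {g : α → List (ℕ × ℕ × ℕ)} (hf : Computable f) (hg : Computable g) :
    Computable fun a => o.simplify (f a) (g a) := by
  unfold Ops.simplify
  fun_prop

@[fun_prop]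
theorem mapEdges {f : α → ℕ → ℕ} {g : α → List (ℕ × ℕ × ℕ)}
    (hf : Computable fun p : α × ℕ => f p.1 p.2) (hg : Computable g) :
    Computable fun a => Q.mapEdges (f a) (g a) := by
  have h1 : Computable fun p : α × ℕ × ℕ × ℕ => f p.1 p.2.1 :=
    hf.comp (g := fun p : α × ℕ × ℕ × ℕ => (p.1, p.2.1)) (by fun_prop)
  have h2 : Computable fun p : α × ℕ × ℕ × ℕ => f p.1 p.2.2.1 :=
    hf.comp (g := fun p : α × ℕ × ℕ × ℕ => (p.1, p.2.2.1)) (by fun_prop)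
  exact map hg (by fun_prop)

@[fun_prop]
theorem normalize {f : α → Net ℕ} (hf : Computable f) : Computable fun a => o.normalize (f a) := by
  have h1 : Computable fun a => (f a).nodes.flatMap fun w =>
      if w ∈ (f a).inputs ++ (f a).outputs then [] else [w] :=
    flatMap (by fun_prop) (ite
      (decide_mem (by fun_prop) (by fun_prop)) (by fun_prop) (by fun_prop))
  unfold Ops.normalize
  fun_prop

@[fun_prop]
theorem fresh {f : α → List ℕ} (hf : Computable f) : Computable fun a => Net.fresh (f a) := by
  unfold Net.fresh
  fun_prop

@[fun_prop]
theorem identify {f g : α → ℕ} {h : α → Net ℕ} (hf : Computable f) (hg : Computable g)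
    (hh : Computable h) : Computable fun a => Net.identify (f a) (g a) (h a) := by
  unfold Net.identify Q.subst
  fun_prop

end ComputableFun

namespace CircuitTerm

/-- The recursion on `k` is written as a fold over a list of length `k` whose members are ignored,
so that computability of folds applies. -/
theorem code_units (k : ℕ) : (units k).code = (List.range k).foldr
    (fun _ c => [(5, 0, 0)] ++ c ++ [(2, 0, 0)]) [(0, 0, 0)] := by
  have h : ∀ (k : ℕ) (l : List ℕ), l.length = k → (units k).code =
      l.foldr (fun _ c => [(5, 0, 0)] ++ c ++ [(2, 0, 0)]) [(0, 0, 0)] := by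
    intro k
    induction k with
    | zero =>
      intro l hl
      rw [List.length_eq_zero_iff.1 hl]
      rfl
    | succ k ih =>
      intro l hl
      cases l with
      | nil => simp at hl
      | cons a l => rw [List.foldr_cons, ← ih l (by simpa using hl)]; rfl
  exact h k _ List.length_range

theorem code_counits (k : ℕ) : (counits k).code = (List.range k).foldr
    (fun _ c => [(7, 0, 0)] ++ c ++ [(2, 0, 0)]) [(0, 0, 0)] := by
  have h : ∀ (k : ℕ) (l : List ℕ), l.length = k → (counits k).code =
      l.foldr (fun _ c => [(7, 0, 0)] ++ c ++ [(2, 0, 0)]) [(0, 0, 0)] := by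
    intro k
    induction k with
    | zero =>
      intro l hl
      rw [List.length_eq_zero_iff.1 hl]
      rfl
    | succ k ih =>
      intro l hl
      cases l with
      | nil => simp at hl
      | cons a l => rw [List.foldr_cons, ← ih l (by simpa using hl)]; rfl
  exact h k _ List.length_range

theorem code_legsIn (k : ℕ) (l : List ℕ) : (legsIn k l).code = l.foldr
    (fun i c => [(0, 1, 0)] ++ c ++ [(2, 0, 0)] ++ (join k i).code ++ [(1, 0, 0)])
    (units k).code := by
  induction l with
  | nil => rfl
  | cons i l ih => rw [List.foldr_cons, ← ih]; rfl

theorem code_legsOut (k : ℕ) (l : List ℕ) : (legsOut k l).code = l.foldr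
    (fun i c => (fork k i).code ++ ([(0, 1, 0)] ++ c ++ [(2, 0, 0)]) ++ [(1, 0, 0)])
    (counits k).code := by
  induction l with
  | nil => rfl
  | cons i l ih => rw [List.foldr_cons, ← ih]; rfl

theorem code_links (k : ℕ) (l : List (ℕ × ℕ × ℕ)) : (links k l).code = l.foldr
    (fun e c => (link k e.1 e.2.1 e.2.2).code ++ c ++ [(1, 0, 0)]) [(0, k, 0)] := by
  induction l with
  | nil => rfl
  | cons i l ih => rw [List.foldr_cons, ← ih]; rfl

end CircuitTerm

namespace ComputableFun
open CircuitTerm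
variable {α : Type*} [Primcodable α]

@[fun_prop]
theorem code_join {f g : α → ℕ} (hf : Computable f) (hg : Computable g) :
    Computable fun a => (join (f a) (g a)).code := by
  unfold join code code code code
  fun_prop

@[fun_prop]
theorem code_fork {f g : α → ℕ} (hf : Computable f) (hg : Computable g) :
    Computable fun a => (fork (f a) (g a)).code := by
  unfold fork code code code code
  fun_prop

@[fun_prop]
theorem code_link {f g h k : α → ℕ} (hf : Computable f) (hg : Computable g) (hh : Computable h)
    (hk : Computable k) : Computable fun a => (link (f a) (g a) (h a) (k a)).code := by
  have : Computable fun a => (fork (f a) (g a)).code ++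
      ([(8, k a, 0)] ++ [(0, f a, 0)] ++ [(2, 0, 0)]) ++ [(1, 0, 0)] ++
      (join (f a) (h a)).code ++ [(1, 0, 0)] := by fun_prop
  exact this.of_eq fun a => rfl

@[fun_prop]
theorem code_units {f : α → ℕ} (hf : Computable f) : Computable fun a => (units (f a)).code := by
  simp only [CircuitTerm.code_units]
  fun_prop

@[fun_prop]
theorem code_counits {f : α → ℕ} (hf : Computable f) :
    Computable fun a => (counits (f a)).code := by
  simp only [CircuitTerm.code_counits]
  fun_prop

@[fun_prop]
theorem code_legsIn {f : α → ℕ} {g : α → List ℕ} (hf : Computable f) (hg : Computable g) :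
    Computable fun a => (legsIn (f a) (g a)).code := by
  simp only [CircuitTerm.code_legsIn]
  fun_prop

@[fun_prop]
theorem code_legsOut {f : α → ℕ} {g : α → List ℕ} (hf : Computable f) (hg : Computable g) :
    Computable fun a => (legsOut (f a) (g a)).code := by
  simp only [CircuitTerm.code_legsOut]
  fun_prop

@[fun_prop]
theorem code_links {f : α → ℕ} {g : α → List (ℕ × ℕ × ℕ)} (hf : Computable f)
    (hg : Computable g) : Computable fun a => (links (f a) (g a)).code := by
  have h1 : Computable fun p : α × (ℕ × ℕ × ℕ) × List (ℕ × ℕ × ℕ) =>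
      (link (f p.1) p.2.1.1 p.2.1.2.1 p.2.1.2.2).code ++ p.2.2 ++ [(1, 0, 0)] :=
    append (append
      (code_link (by fun_prop) (by fun_prop) (by fun_prop) (by fun_prop)) (by fun_prop))
      (by fun_prop)
  simp only [CircuitTerm.code_links]
  exact foldr hg (by fun_prop) h1

@[fun_prop]
theorem code_toTerm {f : α → Network ℕ} (hf : Computable f) :
    Computable fun a => (f a).toTerm.code := by
  have : Computable fun a => (legsIn (f a).nodes (f a).inputs).code ++
      (links (f a).nodes (f a).edges).code ++ [(1, 0, 0)] ++
      (legsOut (f a).nodes (f a).outputs).code ++ [(1, 0, 0)] := by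
    fun_prop
  exact this.of_eq fun a => rfl

end ComputableFun

end ResistorCircuit

namespace ResistorCircuit

/-! ### Reading codes -/

namespace CircuitTerm

/-- The expression without subexpressions given by a token. -/
def leaf (k : ℕ × ℕ × ℕ) : CircuitTerm ℕ :=
  if k.1 = 3 then swap k.2.1 k.2.2
  else if k.1 = 4 then mul
  else if k.1 = 5 then unit
  else if k.1 = 6 then comul
  else if k.1 = 7 then counit
  else if k.1 = 8 then cond k.2.1
  else id k.2.1

/-- A step in reading a code. -/
def readStep (l : List (CircuitTerm ℕ)) (k : ℕ × ℕ × ℕ) : List (CircuitTerm ℕ) :=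
  -- The second argument was pushed last, so it is on top of the stack. The default `id 0` serves
  -- only lists that are not codes.
  if k.1 = 1 then comp (l.tail.headD (id 0)) (l.headD (id 0)) :: l.tail.tail
  else if k.1 = 2 then tensor (l.tail.headD (id 0)) (l.headD (id 0)) :: l.tail.tail
  else leaf k :: l

/-- The expression with a given code. -/
def read (c : List (ℕ × ℕ × ℕ)) : CircuitTerm ℕ := (c.foldl readStep []).headD (id 0)

/-- Reverse Polish notation is read with a stack: a complete code pushes its expression and leaves
what lies below untouched. -/
theorem foldl_readStep_code (t : CircuitTerm ℕ) (l : List (CircuitTerm ℕ)) :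
    t.code.foldl readStep l = t :: l := by
  induction t generalizing l with
  | comp f g hf hg => rw [code, List.foldl_append, List.foldl_append, hf, hg]; rfl
  | tensor f g hf hg => rw [code, List.foldl_append, List.foldl_append, hf, hg]; rfl
  | _ => rfl

theorem read_code (t : CircuitTerm ℕ) : read t.code = t := by
  rw [read, foldl_readStep_code]
  rfl

theorem code_injective : Function.Injective code := fun s t h => by
  rw [← read_code s, h, read_code]

/-- Whether an expression is well-formed, `nz` telling which labels are non-zero. -/
def check (nz : ℕ → Bool) : CircuitTerm ℕ → Bool
  | comp f g => (f.check nz && g.check nz) && decide (f.cod = g.dom)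
  | tensor f g => f.check nz && g.check nz
  | cond y => nz y
  | _ => true

/-- The tokens of the generators in an expression, with the positions at which they act. -/
def instrs : CircuitTerm ℕ → List (ℕ × ℕ × ℕ × ℕ)
  | comp f g => f.instrs ++ g.instrs
  | tensor f g => f.instrs ++ g.instrs.map fun i => (f.cod + i.1, i.2)
  | t => t.code.map fun k => (0, k)

/-- Turns the recursion over an expression into a fold over its list of generators, each with its
position; this is what can be computed from a code. -/
theorem act_eq_foldl (t : CircuitTerm ℕ) (p : ℕ) (N : Net ℕ) :
    Net.act t p N = t.instrs.foldl (fun N i => Net.act (leaf i.2) (p + i.1) N) N := by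
  induction t generalizing p N with
  | comp f g hf hg => rw [instrs, List.foldl_append, ← hf, ← hg]; rfl
  | tensor f g hf hg =>
    rw [instrs, List.foldl_append, ← hf, List.foldl_map]
    simp only [← Nat.add_assoc]
    rw [← hg]
    rfl
  | _ => rfl

theorem check_iff {R : Type*} [CommSemiring R] {nz : ℕ → Bool} {val : ℕ → R}
    (h : ∀ a, nz a = true ↔ val a ≠ 0) (t : CircuitTerm ℕ) :
    t.check nz = true ↔ (t.map val).WellFormed := by
  induction t with
  | comp f g hf hg => simp [check, map, WellFormed, hf, hg, dom_map, cod_map, and_assoc]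
  | tensor f g hf hg => simp [check, map, WellFormed, hf, hg]
  | cond y => exact h y
  | _ => simp [check, map, WellFormed]

/-- What is computed from a code: a code again, the type, well-formedness and the generators. -/
abbrev Value : Type :=
  List (ℕ × ℕ × ℕ) × ℕ × ℕ × Bool × List (ℕ × ℕ × ℕ × ℕ)

/-- The value of an expression. -/
def value (nz : ℕ → Bool) (t : CircuitTerm ℕ) : Value :=
  (t.code, t.dom, t.cod, t.check nz, t.instrs)

/-- The value of a composite. -/
def Value.comp (u v : Value) : Value :=
  (u.1 ++ v.1 ++ [(1, 0, 0)], u.2.1, v.2.2.1,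
    (u.2.2.2.1 && v.2.2.2.1) && decide (u.2.2.1 = v.2.1), u.2.2.2.2 ++ v.2.2.2.2)

/-- The value of a tensor product. -/
def Value.tensor (u v : Value) : Value :=
  (u.1 ++ v.1 ++ [(2, 0, 0)], u.2.1 + v.2.1, u.2.2.1 + v.2.2.1, u.2.2.2.1 && v.2.2.2.1,
    u.2.2.2.2 ++ v.2.2.2.2.map fun i => (u.2.2.1 + i.1, i.2))

/-- A step in reading a code. -/
def valueStep (nz : ℕ → Bool) (l : List Value) (k : ℕ × ℕ × ℕ) : List Value :=
  if k.1 = 1 then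
    Value.comp (l.tail.headD (value nz (id 0))) (l.headD (value nz (id 0))) :: l.tail.tail
  else if k.1 = 2 then
    Value.tensor (l.tail.headD (value nz (id 0))) (l.headD (value nz (id 0))) :: l.tail.tail
  else value nz (leaf k) :: l

theorem headD_map {α β : Type*} (f : α → β) (l : List α) (a : α) :
    (l.map f).headD (f a) = f (l.headD a) := by
  cases l <;> rfl

theorem valueStep_map (nz : ℕ → Bool) (l : List (CircuitTerm ℕ)) (k : ℕ × ℕ × ℕ) :
    valueStep nz (l.map (value nz)) k = (readStep l k).map (value nz) := by
  simp only [valueStep, readStep, ← List.map_tail, headD_map]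
  split
  · rfl
  · split <;> rfl

/-- The value of a composite or tensor product depends only on the values of its parts. So the stack
can hold values, which are built from lists, numbers and truth values, instead of expressions. -/
theorem value_read (nz : ℕ → Bool) (c : List (ℕ × ℕ × ℕ)) :
    value nz (read c) = (c.foldl (valueStep nz) []).headD (value nz (id 0)) := by
  have h : ∀ l : List (CircuitTerm ℕ), c.foldl (valueStep nz) (l.map (value nz)) =
      (c.foldl readStep l).map (value nz) := by
    induction c with
    | nil => exact fun l => rfl
    | cons k c ih =>
      intro l
      rw [List.foldl_cons, List.foldl_cons, valueStep_map, ih]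
  rw [read, ← headD_map (value nz), ← h]
  rfl

end CircuitTerm

namespace ComputableFun
open CircuitTerm
variable {α : Type*} [Primcodable α]

theorem act_swap : Computable fun q : (Net ℕ × ℕ) × ℕ × ℕ =>
    Net.act (.swap q.2.1 q.2.2) q.1.2 q.1.1 := by
  unfold Net.act
  fun_prop

theorem act_mul : Computable fun q : Net ℕ × ℕ => Net.act .mul q.2 q.1 := by
  unfold Net.act
  fun_prop

theorem act_unit : Computable fun q : Net ℕ × ℕ => Net.act .unit q.2 q.1 := by
  unfold Net.act
  fun_prop

theorem act_comul : Computable fun q : Net ℕ × ℕ => Net.act .comul q.2 q.1 := by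
  unfold Net.act
  fun_prop

theorem act_counit : Computable fun q : Net ℕ × ℕ => Net.act .counit q.2 q.1 := by
  unfold Net.act
  fun_prop

theorem act_cond : Computable fun q : (Net ℕ × ℕ) × ℕ => Net.act (.cond q.2) q.1.2 q.1.1 := by
  unfold Net.act
  fun_prop

theorem act_leaf : Computable fun p : Net ℕ × ℕ × ℕ × ℕ × ℕ =>
    Net.act (leaf p.2.2) p.2.1 p.1 := by
  have g : Computable fun p : Net ℕ × ℕ × ℕ × ℕ × ℕ => (p.1, p.2.1) := by fun_prop
  have g3 := act_swap.comp (g := fun p : Net ℕ × ℕ × ℕ × ℕ × ℕ =>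
    ((p.1, p.2.1), p.2.2.2.1, p.2.2.2.2)) (by fun_prop)
  have g8 := act_cond.comp (g := fun p : Net ℕ × ℕ × ℕ × ℕ × ℕ => ((p.1, p.2.1), p.2.2.2.1))
    (by fun_prop)
  have g0 : Computable fun p : Net ℕ × ℕ × ℕ × ℕ × ℕ => p.1 := by fun_prop
  have e : ∀ k : ℕ, Computable fun p : Net ℕ × ℕ × ℕ × ℕ × ℕ => decide (p.2.2.1 = k) :=
    fun k => by fun_prop
  refine (ite (e 3) g3 (ite (e 4) (act_mul.comp g) (ite (e 5) (act_unit.comp g)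
    (ite (e 6) (act_comul.comp g) (ite (e 7) (act_counit.comp g) (ite (e 8) g8 g0)))))).of_eq
      fun p => ?_
  unfold leaf
  split_ifs <;> rfl

theorem ofTerm {f : α → List (ℕ × ℕ × ℕ × ℕ)} {g : α → ℕ} (hf : Computable f)
    (hg : Computable g) {t : α → CircuitTerm ℕ} (ht : ∀ a, f a = (t a).instrs)
    (ht' : ∀ a, g a = (t a).dom) : Computable fun a => Net.ofTerm (t a) := by
  have h1 : Computable fun a => (f a).foldl (fun N i => Net.act (leaf i.2) i.1 N)
      (Net.mk (List.range (g a)) (List.range (g a)) (List.range (g a)) []) :=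
    foldl hf (by fun_prop) (act_leaf.comp
      (g := fun p : α × Net ℕ × ℕ × ℕ × ℕ × ℕ => (p.2.1, p.2.2.1, p.2.2.2)) (by fun_prop))
  refine h1.of_eq fun a => ?_
  rw [ht, ht', Net.ofTerm, act_eq_foldl]
  simp only [Nat.zero_add]
  rfl

theorem value_leaf {nz : ℕ → Bool} (hnz : Computable nz) :
    Computable fun k : ℕ × ℕ × ℕ => value nz (leaf k) := by
  have e : ∀ j : ℕ, Computable fun k : ℕ × ℕ × ℕ => decide (k.1 = j) := fun j => by fun_prop
  have h3 : Computable fun k : ℕ × ℕ × ℕ => value nz (.swap k.2.1 k.2.2) := by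
    unfold value code dom cod check instrs code
    fun_prop
  have h8 : Computable fun k : ℕ × ℕ × ℕ => value nz (.cond k.2.1) := by
    unfold value code dom cod check instrs code
    fun_prop
  have h0 : Computable fun k : ℕ × ℕ × ℕ => value nz (.id k.2.1) := by
    unfold value code dom cod check instrs code
    fun_prop
  refine (ite (e 3) h3 (ite (e 4) (const (value nz .mul)) (ite (e 5) (const (value nz .unit))
    (ite (e 6) (const (value nz .comul)) (ite (e 7) (const (value nz .counit))
      (ite (e 8) h8 h0)))))).of_eq fun p => ?_
  unfold leaf
  split_ifs <;> rfl

theorem value_comp {f g : α → Value} (hf : Computable f) (hg : Computable g) :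
    Computable fun a => Value.comp (f a) (g a) := by
  unfold Value.comp
  fun_prop

theorem value_tensor {f g : α → Value} (hf : Computable f) (hg : Computable g) :
    Computable fun a => Value.tensor (f a) (g a) := by
  unfold Value.tensor
  fun_prop

theorem valueStep {nz : ℕ → Bool} (hnz : Computable nz) :
    Computable fun p : List Value × ℕ × ℕ × ℕ => valueStep nz p.1 p.2 := by
  have e : ∀ j : ℕ, Computable fun p : List Value × ℕ × ℕ × ℕ => decide (p.2.1 = j) :=
    fun j => by fun_prop
  exact ite (e 1) (cons (value_comp (by fun_prop) (by fun_prop)) (by fun_prop))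
    (ite (e 2) (cons (value_tensor (by fun_prop) (by fun_prop)) (by fun_prop))
      (cons ((value_leaf hnz).comp (by fun_prop)) (by fun_prop)))

theorem value_read {nz : ℕ → Bool} (hnz : Computable nz) :
    Computable fun c => value nz (read c) := by
  have h1 : Computable fun c : List (ℕ × ℕ × ℕ) =>
      (c.foldl (CircuitTerm.valueStep nz) []).headD (value nz (.id 0)) :=
    headD (foldl (by fun_prop) (by fun_prop) ((valueStep hnz).comp
      (g := fun p : List (ℕ × ℕ × ℕ) × List Value × ℕ × ℕ × ℕ => p.2) (by fun_prop)))
      (by fun_prop)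
  exact h1.of_eq fun c => (CircuitTerm.value_read nz c).symm

theorem code_nf {o : Ops ℕ} [o.IsComputable] : Computable fun c => (o.nf (read c)).code := by
  -- Only the generators and the number of inputs are needed here, not well-formedness; so any
  -- computable `nz` will do.
  have h1 := value_read (nz := fun _ => true) (by fun_prop)
  have h2 : Computable fun c => Net.ofTerm (read c) :=
    ofTerm (f := fun c => (value (fun _ => true) (read c)).2.2.2.2)
      (g := fun c => (value (fun _ => true) (read c)).2.1) (snd (snd (snd (snd h1)))) (fst (snd h1))
      (fun _ => rfl) (fun _ => rfl)
  unfold Ops.nf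
  fun_prop

end ComputableFun

end ResistorCircuit

namespace ResistorCircuit
variable {R : Type*} [CommSemiring R]

/-! ### Computation with names -/

open CircuitTerm

/-- Inverses and canonical names are found by unbounded search. The condition on an inverse `b` of
`a` is that `a b a` and `a` have the same value: it can be tested on names, and it has a solution
for `a = 0` too, so the search always ends. The canonical name is the least name of the same
element. -/
theorem DecidableNaming.exists_ops (hR : IsPositiveDivisionRig R) (ν : DecidableNaming R) :
    ∃ o : Ops ℕ, o.IsComputable ∧ o.Hom ν.val ∧
      ∀ a b, ν.val a = ν.val b → o.canon a = o.canon b := by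
  obtain ⟨add, ha, hadd⟩ := ν.add
  obtain ⟨mul, hm, hmul⟩ := ν.mul
  obtain ⟨_, heq⟩ := ν.decidable_eq
  have hm' : Computable fun p : ℕ × ℕ => mul p.1 p.2 := hm
  have hinv : ∀ a, ∃ b, ν.val (mul (mul a b) a) = ν.val a := by
    intro a
    by_cases h : ν.val a = 0
    · exact ⟨0, by rw [hmul, h, mul_zero]⟩
    · obtain ⟨b, hb⟩ := ν.inv a h
      exact ⟨b, by rw [hmul, hmul, hb, one_mul]⟩
  have hcanon : ∀ a, ∃ b, ν.val b = ν.val a := fun a => ⟨a, rfl⟩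
  have : ∀ a b, Decidable (ν.val a = ν.val b) := fun a b => Classical.dec _
  have heq' : Computable fun p : ℕ × ℕ => decide (ν.val p.1 = ν.val p.2) :=
    heq.of_eq fun p => by congr
  -- The first component is arbitrary, as `zero` is only the total of the empty list.
  refine ⟨⟨0, add, mul, fun a => Nat.find (hinv a), fun a => Nat.find (hcanon a)⟩,
    ⟨ha, hm, ?_, ?_⟩, ⟨hadd, hmul, ?_, fun a => Nat.find_spec (hcanon a)⟩, ?_⟩
  · refine Computable.find (P := fun a b => ν.val (mul (mul a b) a) = ν.val a)
      (heq'.comp (g := fun q : ℕ × ℕ => (mul (mul q.1 q.2) q.1, q.1)) ?_).computablePred hinv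
    exact .pair (hm'.comp (.pair (hm'.comp .id) .fst)) .fst
  · exact Computable.find (P := fun a b => ν.val b = ν.val a)
      (heq'.comp (g := fun q : ℕ × ℕ => (q.2, q.1)) (.pair .snd .fst)).computablePred hcanon
  · intro a h
    have h1 := Nat.find_spec (hinv a)
    rw [hmul, hmul] at h1
    set b := Nat.find (hinv a)
    obtain ⟨y, hy⟩ := hR.exists_inv _ h
    have h2 : ν.val a * ν.val b = 1 := by
      have := congrArg (· * y) h1
      simpa only [mul_assoc, hy, mul_one] using this
    exact (Ring.inverse_unit ⟨ν.val a, ν.val b, h2, by rw [mul_comm, h2]⟩).symm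
  · intro a b h
    simp only [h]

/-- If `0` has a name, compare with it; otherwise all names denote non-zero elements. It is not
decided which case holds, but only the existence of a computable test is claimed. -/
theorem DecidableNaming.exists_nonzero (ν : DecidableNaming R) :
    ∃ nz : ℕ → Bool, Computable nz ∧ ∀ a, nz a = true ↔ ν.val a ≠ 0 := by
  obtain ⟨_, heq⟩ := ν.decidable_eq
  by_cases h : ∃ z, ν.val z = 0
  · obtain ⟨z, hz⟩ := h
    refine ⟨fun a => !decide (ν.val (a, z).1 = ν.val (a, z).2), ?_, fun a => by simp [hz]⟩
    exact ComputableFun.bool_not (heq.comp (.pair .id (.const z)))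
  · exact ⟨fun _ => true, .const _, fun a => by simpa using fun ha => h ⟨a, ha⟩⟩

/-- Both lists are read; it is checked that they are codes of well-formed circuits of the same type;
then the codes of the normal forms are compared. -/
theorem computablePred_toResist_eq (hR : IsPositiveDivisionRig R) (ν : DecidableNaming R) :
    ComputablePred fun p : List (ℕ × ℕ × ℕ) × List (ℕ × ℕ × ℕ) =>
      ∃ (n m : ℕ) (s t : CircuitTerm ℕ)
        (hs : (s.map ν.val).Typed n m) (ht : (t.map ν.val).Typed n m),
        s.code = p.1 ∧ t.code = p.2 ∧
          Circuit.toResist ⟨_, hs⟩ = Circuit.toResist ⟨_, ht⟩ := by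
  obtain ⟨o, ho, hv, hc⟩ := ν.exists_ops hR
  obtain ⟨nz, hnz, hnz'⟩ := ν.exists_nonzero
  have h1 := ComputableFun.value_read hnz
  have h2 := ComputableFun.code_nf (o := o)
  have k1 : Computable fun p : List (ℕ × ℕ × ℕ) × List (ℕ × ℕ × ℕ) =>
      value nz (read p.1) := h1.comp .fst
  have k2 : Computable fun p : List (ℕ × ℕ × ℕ) × List (ℕ × ℕ × ℕ) =>
      value nz (read p.2) := h1.comp .snd
  -- Reading is defined for every list; a list is a code exactly if it is the code of the expression
  -- read from it.
  have e1 := ComputableFun.decide_eq (ComputableFun.fst k1) Computable.fst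
  have e2 := ComputableFun.decide_eq (ComputableFun.fst k2) Computable.snd
  have e3 := ComputableFun.decide_eq (ComputableFun.fst (ComputableFun.snd k1))
    (ComputableFun.fst (ComputableFun.snd k2))
  have e4 := ComputableFun.decide_eq (ComputableFun.fst (ComputableFun.snd (ComputableFun.snd k1)))
    (ComputableFun.fst (ComputableFun.snd (ComputableFun.snd k2)))
  have e5 := ComputableFun.fst (ComputableFun.snd (ComputableFun.snd (ComputableFun.snd k1)))
  have e6 := ComputableFun.fst (ComputableFun.snd (ComputableFun.snd (ComputableFun.snd k2)))
  have e7 : Computable fun p : List (ℕ × ℕ × ℕ) × List (ℕ × ℕ × ℕ) =>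
      decide ((o.nf (read p.1)).code = (o.nf (read p.2)).code) :=
    ComputableFun.decide_eq (h2.comp .fst) (h2.comp .snd)
  refine ComputablePred.computable_iff.2 ⟨_, ComputableFun.bool_and (ComputableFun.bool_and
    (ComputableFun.bool_and e1 e2) (ComputableFun.bool_and e3 e4)) (ComputableFun.bool_and
    (ComputableFun.bool_and e5 e6) e7), ?_⟩
  funext p
  simp only [Bool.and_eq_true, decide_eq_true_eq, eq_iff_iff]
  simp only [value, check_iff hnz']
  constructor
  · rintro ⟨n, m, s, t, hs, ht, h3, h4, h5⟩
    rw [← h3, ← h4, read_code, read_code]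
    obtain ⟨s1, s2, s3⟩ := hs.wellFormed
    obtain ⟨t1, t2, t3⟩ := ht.wellFormed
    rw [dom_map] at s2 t2
    rw [cod_map] at s3 t3
    exact ⟨⟨⟨rfl, rfl⟩, s2.trans t2.symm, s3.trans t3.symm⟩, ⟨s1, t1⟩,
      congrArg code ((hv.nf_eq_iff hR hc hs ht).1 h5)⟩
  · rintro ⟨⟨⟨h3, h4⟩, h5, h6⟩, ⟨h7, h8⟩, h9⟩
    have hs := h7.typed
    have ht : ((read p.2).map ν.val).Typed ((read p.1).map ν.val).dom
        ((read p.1).map ν.val).cod := typed_iff.2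
      ⟨h8, by rw [dom_map, dom_map, h5], by rw [cod_map, cod_map, h6]⟩
    exact ⟨_, _, _, _, hs, ht, h3, h4, (hv.nf_eq_iff hR hc hs ht).2 (code_injective h9)⟩

end ResistorCircuit

theorem mainTheorem2 (R : Type*) [CommSemiring R] (hR : IsPositiveDivisionRig R) :
    -- every diagram reduces to exactly one normal form
    (∀ (n m : ℕ) (d : Diagram R n m), ∃! e, Reduces d e ∧ IsNormal e) ∧
    -- the normal forms are the families of meshes
    (∀ (n m : ℕ) (d : Diagram R n m), IsNormal d ↔ IsMeshFamily d) ∧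
    -- two circuits are the same map exactly if they have the same normal form
    (∀ (n m : ℕ) (s t : Circuit R n m), s.toResist = t.toResist ↔
      ∃ e, IsNormal e ∧ Reduces s.toDiagram e ∧ Reduces t.toDiagram e) ∧
    -- if equality in `R` is decidable, then
    ∀ ν : DecidableNaming R,
      -- normal forms can be computed, so that equality of maps is identity of the results,
      (∃ nf : CircuitTerm ℕ → CircuitTerm ℕ,
        (∃ F : List (ℕ × ℕ × ℕ) → List (ℕ × ℕ × ℕ),
          Computable F ∧ ∀ t, F t.code = (nf t).code) ∧
        (∀ (n m : ℕ) (s : CircuitTerm ℕ) (hs : (s.map ν.val).Typed n m),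
          ∃ hs' : ((nf s).map ν.val).Typed n m,
            IsNormal (Circuit.toDiagram ⟨_, hs'⟩) ∧
            Reduces (Circuit.toDiagram ⟨_, hs⟩) (Circuit.toDiagram ⟨_, hs'⟩)) ∧
        (∀ (n m : ℕ) (s t : CircuitTerm ℕ)
          (hs : (s.map ν.val).Typed n m) (ht : (t.map ν.val).Typed n m),
          Circuit.toResist ⟨_, hs⟩ = Circuit.toResist ⟨_, ht⟩ ↔ nf s = nf t)) ∧
      -- and equality of maps is decidable
      ComputablePred fun p : List (ℕ × ℕ × ℕ) × List (ℕ × ℕ × ℕ) =>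
        ∃ (n m : ℕ) (s t : CircuitTerm ℕ)
          (hs : (s.map ν.val).Typed n m) (ht : (t.map ν.val).Typed n m),
          s.code = p.1 ∧ t.code = p.2 ∧
            Circuit.toResist ⟨_, hs⟩ = Circuit.toResist ⟨_, ht⟩ := by
  refine ⟨fun n m d => ?_, fun n m d => isNormal_iff hR, fun n m s t => ?_, fun ν => ⟨?_,
    computablePred_toResist_eq hR ν⟩⟩
  · obtain ⟨e, h1, h2⟩ := exists_reduces_isMeshFamily hR d
    refine ⟨e, ⟨h1, h2.isNormal⟩, ?_⟩
    rintro e' ⟨h3, h4⟩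
    exact IsMeshFamily.unique hR h3 h1 ((isNormal_iff hR).1 h4) h2
  · simp only [toResist_eq_iff hR, isNormal_iff hR]
  · obtain ⟨o, ho, hv, hc⟩ := ν.exists_ops hR
    refine ⟨o.nf, ⟨fun c => (o.nf (CircuitTerm.read c)).code, ComputableFun.code_nf,
      fun t => by simp only [CircuitTerm.read_code]⟩, fun n m s hs => ?_,
      fun n m s t hs ht => hv.nf_eq_iff hR hc hs ht⟩
    obtain ⟨hs', h1, h2⟩ := hv.nf_spec hR hs
    exact ⟨hs', h1.isNormal, h2⟩
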